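/- **Conventions.** $i,j,k\in\{1,2,3\}$, $\mu\in\{0,1,2,3\}$, repeated indices are summed where $\epsilon_{ijk}$ occurs, $x\wedge y=x\otimes y-y\otimes x$. The Lie algebra $so(4,2)$ has the basis $J_i,P_\mu,K_i,C_\mu,D$ with non-vanishing brackets $[J_i,X_j]=\epsilon_{ijk}X_k$ ($X=J,K,P,C$), $[K_i,K_j]=-\epsilon_{ijk}J_k$, $[K_i,P_i]=P_0$, $[K_i,P_0]=P_i$, $[K_i,C_0]=C_i$, $[K_i,C_i]=C_0$, $[P_0,C_0]=D$, $[P_0,C_i]=-K_i$, $[P_i,C_0]=K_i$, $[P_i,C_j]=-\delta_{ij}D+\epsilon_{ijk}J_k$, $[P_\mu,D]=-P_\mu$, $[C_\mu,D]=C_\mu$. All algebras are real, $z$ is a formal parameter, and tensor products are $z$-adically completed. For a Lie algebra $\mathfrak g$, a twisting element for $U(\mathfrak g)[[z]]$ is an invertible $F$ with $(\epsilon\otimes\mathrm{id})F=(\mathrm{id}\otimes\epsilon)F=1$ and $F_{12}(\Delta_0\otimes\mathrm{id})F=F_{23}(\mathrm{id}\otimes\Delta_0)F$, where $\Delta_0$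 is the primitive coproduct; it defines $\Delta(x)=F\Delta_0(x)F^{-1}$, $S(x)=vS_0(x)v^{-1}$ with $v=m(\mathrm{id}\otimes S_0)F$, and $\mathcal R=F_{21}F^{-1}$. **The algebra $U_z(so(4,2))$.** Put $H_\pm=\frac12(D\pm K_1)$, $T_\pm=\frac12(P_0\pm P_1)$, $T_2=\frac12(P_2-P_3)$, $T_3=\frac12(P_2+P_3)$, $B_2=\frac12(K_2+J_3-K_3+J_2)$, $B_3=\frac12(K_2+J_3+K_3-J_2)$, $\sigma_-=\ln(1-2zT_-)$, $T=T_++z(T_2^2+T_3^2)e^{-\sigma_-}$, $\sigma_+=\ln(1-2zT)$. Then $U_z(so(4,2))$ is $U(so(4,2))[[z]]$ with the coproduct and antipode defined by $F=\Phi_A\Phi_E\Phi_J$, where $\Phi_J=e^{H_-\otimes\sigma_-}$, $\Phi_E=e^{-2zB_3\otimes T_3e^{-\sigma_- /2}}e^{-2zB_2\otimes T_2e^{-\sigma_- /2}}$, $\Phi_A=e^{H_+\otimes\sigma_+}$. Its classical $r$-matrix is $r=z(D\wedge P_0+\sum_iK_i\wedge P_i)+z(J_3\wedge P_2-J_2\wedge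 P_3)$. Its deformed generators are $P_0^z=-\frac1{2z}(\sigma_++\sigma_-)$, $P_1^z=-\frac1{2z}(\sigma_+-\sigma_-)$, $P_2^z=(T_3+T_2)e^{-\sigma_-}$, $P_3^z=(T_3-T_2)e^{-\sigma_-}$, $C_0^z=C_0+\frac z2\sum_iK_i^2$, $C_i^z=C_i-zK_iD$, while $J_i,K_i,D$ are not changed. **Contractions.** The speed-space contraction is $P_i,K_i,C_i\to\varepsilon P_i,\varepsilon K_i,\varepsilon C_i$, $z\to\varepsilon^{-2}z$; the speed-time contraction is $P_0,K_i,C_0\to\varepsilon P_0,\varepsilon K_i,\varepsilon C_0$, $z\to\varepsilon^{-1}z$ (the other generators are fixed). An $\varepsilon$-dependent element of $U(so(4,2))[[z]]$ (or of its tensor square) has the limit $y$ if, at each order in the new parameter $z$, it is for small $\varepsilon\ne0$ a linear combination, with coefficients convergent as $\varepsilon\to0$, of finitely many fixed noncommutative monomials (or tensor products of monomials) in the rescaled generators, and $y$ is the combination of the same monomials in the generators of the contracted algebra with the limit coefficients. **Theorem.** As $\varepsilon\to0$ the structure constants of $so(4,2)$ in the rescaled basis converge to those of a Lie algebra: the conformal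 Galilean algebra $\mathcal G$ for the speed-space contraction and the conformal Carroll algebra $\mathcal C$ for the speed-time contraction. In both cases: * the rescaled deformed generators, the twisting element $F$ and $\mathcal R$ have limits; the limits of the generators, denoted $J_i,P_\mu,K_i,C_\mu,D$ again, equal the classical generators at $z=0$; every element of $U(\mathcal G)[[z]]$, respectively $U(\mathcal C)[[z]]$, is a limit; * the limit of $F$ is a twisting element, $U(\mathcal G)[[z]]$, respectively $U(\mathcal C)[[z]]$, is with the twisted structure a Hopf algebra, denoted $U_z(\mathcal G)$, respectively $U_z(\mathcal C)$, and the limit of $\mathcal R$ is its (triangular) universal $R$-matrix $\mathcal R=F_{21}F^{-1}$; * the product, coproduct, counit and antipode of $U_z(so(4,2))$ converge to those of the limit algebra: if $x_\varepsilon\to y$ and $x'_\varepsilon\to y'$, then $x_\varepsilon x'_\varepsilon\to yy'$, $\Delta(x_\varepsilon)\to\Delta(y)$, $\epsilon(x_\varepsilon)\to\epsilon(y)$, $S(x_\varepsilon)\to S(y)$. *Galilean case.* The non-vanishing commutators are $[J_i,X_j]=\epsilon_{ijk}X_k$ ($X=J,K,P,C$), $[K_i,P_0]=P_i$, $[K_i,C_0]=C_i$,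 $[P_0,C_0]=D$, $[P_0,C_i]=-K_i$, $[P_i,C_0]=K_i$, $[P_i,D]=-P_i$, $[P_0,D]=-P_0-\frac z2\sum_iP_i^2$, $[C_i,D]=C_i$, $[C_0,D]=C_0-\frac z2\sum_iK_i^2$. The generators $J_i,K_i,P_\mu,C_i$ are primitive, $\Delta(D)=D\otimes1+1\otimes D+z\sum_iK_i\otimes P_i$ and $\Delta(C_0)=C_0\otimes1+1\otimes C_0-z\sum_iC_i\otimes P_i$. The limit of $r$ is $z\sum_iK_i\wedge P_i$; the limits of $\Phi_J$ and $\Phi_A$ are $e^{-\frac z2K_1\otimes P_1}$, that of $\Phi_E$ is $e^{-zK_2\otimes P_2}e^{-zK_3\otimes P_3}$, and $F=e^{-zK_3\otimes P_3}e^{-zK_2\otimes P_2}e^{-zK_1\otimes P_1}$. Moreover $\mathcal R=\exp(z\sum_iK_i\wedge P_i)=e^{zK_1\wedge P_1}e^{zK_2\wedge P_2}e^{zK_3\wedge P_3}$. The $z$-adically closed subalgebras generated by $\{J_i,P_\mu,K_i\}$ and by the Weyl–Galilean generators $\{J_i,P_\mu,K_i,D\}$ are Hopf subalgebras. *Carroll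 case.* The non-vanishing commutators are $[J_i,X_j]=\epsilon_{ijk}X_k$ ($X=J,K,P,C$), $[K_i,P_i]=\frac1z(e^{zP_0}-1)$, $[K_i,C_i]=C_0-\frac z2\sum_lK_l^2$, $[P_0,D]=\frac1z(1-e^{zP_0})$, $[P_i,D]=-e^{zP_0}P_i$, $[P_0,C_i]=-K_i$, $[C_0,D]=C_0-\frac z2\sum_lK_l^2$, $[C_i,D]=C_i+zK_iD$, $[P_i,C_0]=K_i$, $[P_i,C_j]=-\delta_{ij}D+\epsilon_{ijk}e^{zP_0}J_k$, $[C_i,C_j]=z(K_iC_j-K_jC_i)$. The generators $J_i,P_\mu$ are primitive, $\Delta(Y)=Y\otimes e^{zP_0}+1\otimes Y$ for $Y\in\{K_i,C_0\}$, $\Delta(D)=D\otimes e^{zP_0}+1\otimes D+z\sum_iK_i\otimes e^{zP_0}P_i$, $\Delta(C_i)=C_i\otimes e^{zP_0}+1\otimes C_i-zC_0\otimes e^{zP_0}P_i+z\epsilon_{ijk}K_j\otimes e^{zP_0}J_k$. The limit of $r$ is $z(D\wedge P_0+\sum_iK_i\wedge P_i)$, formed with the classical generators of $\mathcal C$, and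 it is the first-order term of $\mathcal R$. Moreover $F=e^{-zK_3\otimes P_3}e^{-zK_2\otimes P_2}e^{-zK_1\otimes P_1}e^{-zD\otimes P_0}$ and $\mathcal R=e^{-zP_3\otimes K_3}e^{-zP_2\otimes K_2}e^{-zP_1\otimes K_1}e^{-zP_0\otimes D}e^{zD\otimes P_0}e^{zK_1\otimes P_1}e^{zK_2\otimes P_2}e^{zK_3\otimes P_3}$. The $z$-adically closed subalgebra generated by the Weyl–Carroll generators $\{J_i,P_\mu,K_i,D\}$ is a Hopf subalgebra. -/

import Mathlib

open Filter Topology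
open scoped TensorProduct PowerSeries

noncomputable section

namespace TwistedConformal

/-! ### The conformal Lie algebras -/

/-- Labels of the fifteen conformal generators: rotations `J i`, boosts `K i`, space translations
`P i`, space conformal transformations `C i`, time translation `P0`, time conformal
transformation `C0`, dilation `D`. The physical index `1, 2, 3` is `0, 1, 2 : Fin 3`. -/
inductive Gen : Type
  | J (i : Fin 3) : Gen
  | K (i : Fin 3) : Gen
  | P (i : Fin 3) : Gen
  | C (i : Fin 3) : Gen
  | P0 : Gen
  | C0 : Gen
  | D : Gen
  deriving DecidableEq

/-- The Levi-Civita symbol on `{0, 1, 2}`. -/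
def eps (i j k : Fin 3) : ℝ :=
  ((i : ℕ) - (j : ℕ) : ℝ) * ((j : ℕ) - (k : ℕ) : ℝ) * ((k : ℕ) - (i : ℕ) : ℝ) / 2

/-- The real vector space with basis `Gen`, to be given the Lie bracket whose nonzero values on
basis vectors are, up to antisymmetry,
`[J_i, Y_j] = ε_ijk Y_k` for `Y = J, K, P, C`,
`[K_i, K_j] = - a b ε_ijk J_k`, `[K_i, P_i] = a P_0`, `[K_i, P_0] = b P_i`,
`[K_i, C_0] = b C_i`, `[K_i, C_i] = a C_0`, `[P_0, C_0] = b D`, `[P_0, C_i] = - K_i`,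
`[P_i, C_0] = K_i`, `[P_i, C_j] = a (- δ_ij D + ε_ijk J_k)`,
`[P_μ, D] = - P_μ`, `[C_μ, D] = C_μ`.
The case `a = b = 1` is `so(4,2)` in its conformal basis; `a = 0, b = 1` is the conformal Galilean
algebra and `a = 1, b = 0` the conformal Carroll algebra. -/
def Conf (_a _b : ℝ) : Type := Gen → ℝ

namespace Conf

instance (a b : ℝ) : AddCommGroup (Conf a b) := inferInstanceAs (AddCommGroup (Gen → ℝ))
instance (a b : ℝ) : Module ℝ (Conf a b) := inferInstanceAs (Module ℝ (Gen → ℝ))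

/-- The coordinates of the bracket of `u` and `v`. -/
def bracket (a b : ℝ) (u v : Gen → ℝ) : Gen → ℝ
  | .J i => cr u .J v .J i - a * b * cr u .K v .K i + a * (cr u .P v .C i + cr u .C v .P i)
  | .K i => cr u .J v .K i + cr u .K v .J i
      - (u .P0 * v (.C i) - u (.C i) * v .P0) + (u (.P i) * v .C0 - u .C0 * v (.P i))
  | .P i => cr u .J v .P i + cr u .P v .J i
      + b * (u (.K i) * v .P0 - u .P0 * v (.K i)) - (u (.P i) * v .D - u .D * v (.P i))
  | .C i => cr u .J v .C i + cr u .C v .J i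
      + b * (u (.K i) * v .C0 - u .C0 * v (.K i)) + (u (.C i) * v .D - u .D * v (.C i))
  | .P0 => a * ∑ i, (u (.K i) * v (.P i) - u (.P i) * v (.K i)) - (u .P0 * v .D - u .D * v .P0)
  | .C0 => a * ∑ i, (u (.K i) * v (.C i) - u (.C i) * v (.K i)) + (u .C0 * v .D - u .D * v .C0)
  | .D => b * (u .P0 * v .C0 - u .C0 * v .P0) - a * ∑ i, (u (.P i) * v (.C i) - u (.C i) * v (.P i))
where
  /-- The cross product of the `s`-part of `u` and the `t`-part of `v`. -/
  cr (u : Gen → ℝ) (s : Fin 3 → Gen) (v : Gen → ℝ) (t : Fin 3 → Gen) (i : Fin 3) : ℝ :=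
    u (s (i + 1)) * v (t (i + 2)) - u (s (i + 2)) * v (t (i + 1))

instance (a b : ℝ) : Bracket (Conf a b) (Conf a b) := ⟨fun u v => bracket a b u v⟩

theorem bracket_apply {a b : ℝ} (u v : Conf a b) (g : Gen) : ⁅u, v⁆ g = bracket a b u v g := rfl
theorem add_apply {a b : ℝ} (u v : Conf a b) (g : Gen) : (u + v) g = u g + v g := rfl
theorem smul_apply {a b : ℝ} (r : ℝ) (v : Conf a b) (g : Gen) : (r • v) g = r * v g := rfl
theorem zero_apply {a b : ℝ} (g : Gen) : (0 : Conf a b) g = 0 := rfl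

instance (a b : ℝ) : LieRing (Conf a b) where
  add_lie u v w := by
    funext g
    rcases g with i | i | i | i | _ | _ | _ <;>
      simp only [bracket_apply, add_apply, bracket, bracket.cr, Fin.sum_univ_three] <;> ring
  lie_add u v w := by
    funext g
    rcases g with i | i | i | i | _ | _ | _ <;>
      simp only [bracket_apply, add_apply, bracket, bracket.cr, Fin.sum_univ_three] <;> ring
  lie_self u := by
    funext g
    rcases g with i | i | i | i | _ | _ | _ <;>
      simp only [bracket_apply, zero_apply, bracket, bracket.cr, Fin.sum_univ_three] <;> ring
  leibniz_lie u v w := by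
    funext g
    rcases g with i | i | i | i | _ | _ | _ <;> (try fin_cases i) <;>
      simp [bracket_apply, add_apply, bracket, bracket.cr, Fin.sum_univ_three] <;> ring

instance (a b : ℝ) : LieAlgebra ℝ (Conf a b) where
  lie_smul r u v := by
    funext g
    rcases g with i | i | i | i | _ | _ | _ <;>
      simp only [bracket_apply, smul_apply, bracket, bracket.cr, Fin.sum_univ_three] <;> ring

/-- The basis vector labelled by `g`. -/
def basisVec (a b : ℝ) (g : Gen) : Conf a b := fun h => if h = g then 1 else 0

end Conf

/-! ### Enveloping algebras as Hopf algebras -/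

section Enveloping

attribute [local instance 100] LieRing.ofAssociativeRing

/-- The universal enveloping algebra of `Conf a b`. -/
abbrev U (a b : ℝ) : Type := UniversalEnvelopingAlgebra ℝ (Conf a b)

/-- The generators of `U a b`. -/
def gen (a b : ℝ) (g : Gen) : U a b := UniversalEnvelopingAlgebra.ι ℝ (Conf.basisVec a b g)

/-- The undeformed coproduct, `x ↦ x ⊗ 1 + 1 ⊗ x` on the Lie algebra. -/
def comul₀ (a b : ℝ) : U a b →ₐ[ℝ] U a b ⊗[ℝ] U a b :=
  UniversalEnvelopingAlgebra.lift ℝ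
    { toLinearMap :=
        Algebra.TensorProduct.includeLeft.toLinearMap ∘ₗ
            (UniversalEnvelopingAlgebra.ι ℝ : Conf a b →ₗ⁅ℝ⁆ U a b).toLinearMap +
          Algebra.TensorProduct.includeRight.toLinearMap ∘ₗ
            (UniversalEnvelopingAlgebra.ι ℝ : Conf a b →ₗ⁅ℝ⁆ U a b).toLinearMap
      map_lie' := by
        intro x y
        simp [LieRing.of_associative_ring_bracket, mul_add, add_mul, TensorProduct.sub_tmul,
          TensorProduct.tmul_sub, -UniversalEnvelopingAlgebra.ι_apply]
        abel }

/-- The undeformed counit, `x ↦ 0` on the Lie algebra. -/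
def counit₀ (a b : ℝ) : U a b →ₐ[ℝ] ℝ := UniversalEnvelopingAlgebra.lift ℝ 0

/-- The undeformed antipode as an algebra homomorphism to the opposite algebra, `x ↦ -x` on the
Lie algebra. -/
def antipodeOp₀ (a b : ℝ) : U a b →ₐ[ℝ] (U a b)ᵐᵒᵖ :=
  UniversalEnvelopingAlgebra.lift ℝ
    { toLinearMap :=
        -((MulOpposite.opLinearEquiv ℝ).toLinearMap ∘ₗ
          (UniversalEnvelopingAlgebra.ι ℝ : Conf a b →ₗ⁅ℝ⁆ U a b).toLinearMap)
      map_lie' := by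
        intro x y
        simp [LieRing.of_associative_ring_bracket, -UniversalEnvelopingAlgebra.ι_apply] }

/-- The undeformed antipode. -/
def antipode₀ (a b : ℝ) : U a b →ₗ[ℝ] U a b :=
  (MulOpposite.opLinearEquiv ℝ).symm.toLinearMap ∘ₗ (antipodeOp₀ a b).toLinearMap

end Enveloping

/-! ### Formal power series in the deformation parameter

For an `ℝ`-algebra `A`, `A⟦X⟧` is the `z`-adic completion of `A ⊗ ℝ[z]`, the central variable
`X` being the deformation parameter `z`. The completed tensor square of `A⟦X⟧` over `ℝ⟦X⟧` is
`(A ⊗[ℝ] A)⟦X⟧`. -/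

section Series

variable {A B D : Type} [Ring A] [Algebra ℝ A] [Ring B] [Algebra ℝ B] [Ring D] [Algebra ℝ D]

/-- The deformation parameter. -/
abbrev z : A⟦X⟧ := PowerSeries.X

/-- The commutator. -/
def br (x y : A) : A := x * y - y * x

/-- `exp f` for `f` divisible by `z`: the `n`-th coefficient only involves `f ^ k` for `k ≤ n`. -/
def pexp (f : A⟦X⟧) : A⟦X⟧ :=
  PowerSeries.mk fun n =>
    PowerSeries.coeff n (∑ k ∈ Finset.range (n + 1), ((k.factorial : ℝ)⁻¹) • f ^ k)

/-- `log (1 - f) = - ∑ f ^ k / k` for `f` divisible by `z`. -/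
def plogOneSub (f : A⟦X⟧) : A⟦X⟧ :=
  PowerSeries.mk fun n =>
    PowerSeries.coeff n (-∑ k ∈ Finset.Icc 1 n, ((k : ℝ)⁻¹) • f ^ k)

/-- `z⁻¹ f` for `f` divisible by `z`. -/
def divZ (f : A⟦X⟧) : A⟦X⟧ := PowerSeries.mk fun n => PowerSeries.coeff (n + 1) f

/-- The `n`-th coefficient, as an `ℝ`-linear map. -/
def coeffₗ (A : Type) [Ring A] [Algebra ℝ A] (n : ℕ) : A⟦X⟧ →ₗ[ℝ] A where
  toFun x := PowerSeries.coeff n x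
  map_add' _ _ := rfl
  map_smul' _ _ := rfl

/-- Constant series, as an `ℝ`-linear map. -/
def constₗ (A : Type) [Ring A] [Algebra ℝ A] : A →ₗ[ℝ] A⟦X⟧ where
  toFun x := PowerSeries.C x
  map_add' := map_add _
  map_smul' r x := by
    ext n
    refine Eq.trans ?_ (map_smul (coeffₗ A n) r (PowerSeries.C x)).symm
    change PowerSeries.coeff n (PowerSeries.C (r • x)) =
      r • PowerSeries.coeff n (PowerSeries.C x)
    rw [PowerSeries.coeff_C, PowerSeries.coeff_C, smul_ite, smul_zero]

/-- The coefficientwise extension of a linear map. -/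
def mapₗ (f : A →ₗ[ℝ] B) : A⟦X⟧ →ₗ[ℝ] B⟦X⟧ where
  toFun x := PowerSeries.mk fun n => f (coeffₗ A n x)
  map_add' x y := by ext n; simp
  map_smul' r x := by
    ext n
    refine Eq.trans ?_ (map_smul (coeffₗ B n) r _).symm
    change PowerSeries.coeff n _ = r • PowerSeries.coeff n _
    rw [PowerSeries.coeff_mk, map_smul, map_smul]
    simp

/-- The coefficientwise extension of an algebra homomorphism. -/
abbrev mapₐ (f : A →ₐ[ℝ] B) : A⟦X⟧ →+* B⟦X⟧ := PowerSeries.map f.toRingHom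

/-- `x ⊗ y` in the completed tensor square. -/
def tens (x y : A⟦X⟧) : (A ⊗[ℝ] A)⟦X⟧ :=
  mapₐ Algebra.TensorProduct.includeLeft x * mapₐ Algebra.TensorProduct.includeRight y

/-- The flip of the tensor factors. -/
def swapZ (x : (A ⊗[ℝ] A)⟦X⟧) : (A ⊗[ℝ] A)⟦X⟧ :=
  mapₐ (Algebra.TensorProduct.comm ℝ A A).toAlgHom x

/-- `x ∧ y = x ⊗ y - y ⊗ x`. -/
def wedge (x y : A⟦X⟧) : (A ⊗[ℝ] A)⟦X⟧ := tens x y - tens y x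

/-- The leg embeddings into the completed tensor cube. -/
def leg12 (x : (A ⊗[ℝ] A)⟦X⟧) : (A ⊗[ℝ] (A ⊗[ℝ] A))⟦X⟧ :=
  mapₐ (Algebra.TensorProduct.map (AlgHom.id ℝ A) Algebra.TensorProduct.includeLeft) x

def leg13 (x : (A ⊗[ℝ] A)⟦X⟧) : (A ⊗[ℝ] (A ⊗[ℝ] A))⟦X⟧ :=
  mapₐ (Algebra.TensorProduct.map (AlgHom.id ℝ A) Algebra.TensorProduct.includeRight) x

def leg23 (x : (A ⊗[ℝ] A)⟦X⟧) : (A ⊗[ℝ] (A ⊗[ℝ] A))⟦X⟧ :=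
  mapₐ Algebra.TensorProduct.includeRight x

/-- `L ⊗ id` on the completed tensor product, for an `ℝ⟦X⟧`-linear map `L`, which is determined
by the maps `A → B` taking `a` to the `i`-th coefficient of `L a`. -/
def tensId (L : A⟦X⟧ →ₗ[ℝ] B⟦X⟧) (x : (A ⊗[ℝ] D)⟦X⟧) : (B ⊗[ℝ] D)⟦X⟧ :=
  PowerSeries.mk fun n => ∑ p ∈ Finset.HasAntidiagonal.antidiagonal n,
    (coeffₗ B p.1 ∘ₗ L ∘ₗ constₗ A).rTensor D (coeffₗ (A ⊗[ℝ] D) p.2 x)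

/-- `id ⊗ L` on the completed tensor product, for an `ℝ⟦X⟧`-linear map `L`. -/
def idTens (L : A⟦X⟧ →ₗ[ℝ] B⟦X⟧) (x : (D ⊗[ℝ] A)⟦X⟧) : (D ⊗[ℝ] B)⟦X⟧ :=
  PowerSeries.mk fun n => ∑ p ∈ Finset.HasAntidiagonal.antidiagonal n,
    (coeffₗ B p.1 ∘ₗ L ∘ₗ constₗ A).lTensor D (coeffₗ (D ⊗[ℝ] A) p.2 x)

/-- The reassociation of the completed tensor cube. -/
def assocZ (x : ((A ⊗[ℝ] A) ⊗[ℝ] A)⟦X⟧) : (A ⊗[ℝ] (A ⊗[ℝ] A))⟦X⟧ :=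
  mapₐ (Algebra.TensorProduct.assoc ℝ ℝ ℝ A A A).toAlgHom x

/-- The multiplication on the completed tensor square. -/
def mulZ (x : (A ⊗[ℝ] A)⟦X⟧) : A⟦X⟧ := mapₗ (LinearMap.mul' ℝ A) x

/-- `ε ⊗ id` for a character `ε` of `A`. -/
def counitLeft (ε : A →ₐ[ℝ] ℝ) (x : (A ⊗[ℝ] A)⟦X⟧) : A⟦X⟧ :=
  mapₐ ((Algebra.TensorProduct.lid ℝ A).toAlgHom.comp
    (Algebra.TensorProduct.map ε (AlgHom.id ℝ A))) x

/-- `id ⊗ ε` for a character `ε` of `A`. -/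
def counitRight (ε : A →ₐ[ℝ] ℝ) (x : (A ⊗[ℝ] A)⟦X⟧) : A⟦X⟧ :=
  mapₐ ((Algebra.TensorProduct.rid ℝ ℝ A).toAlgHom.comp
    (Algebra.TensorProduct.map (AlgHom.id ℝ A) ε)) x

/-- `Δ`, `ε`, `S` make the algebra `A⟦X⟧` a (topological) Hopf algebra over `ℝ⟦X⟧`. -/
structure IsHopf (Δ : A⟦X⟧ →ₗ[ℝ] (A ⊗[ℝ] A)⟦X⟧) (ε : A →ₐ[ℝ] ℝ) (S : A⟦X⟧ →ₗ[ℝ] A⟦X⟧) :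
    Prop where
  comul_z : ∀ x, Δ (z * x) = z * Δ x
  comul_one : Δ 1 = 1
  comul_mul : ∀ x y, Δ (x * y) = Δ x * Δ y
  coassoc : ∀ x, assocZ (tensId Δ (Δ x)) = idTens Δ (Δ x)
  counit_left : ∀ x, counitLeft ε (Δ x) = x
  counit_right : ∀ x, counitRight ε (Δ x) = x
  antipode_z : ∀ x, S (z * x) = z * S x
  antipode_left : ∀ x, mulZ (tensId S (Δ x)) = mapₐ ((Algebra.ofId ℝ A).comp ε) x
  antipode_right : ∀ x, mulZ (idTens S (Δ x)) = mapₐ ((Algebra.ofId ℝ A).comp ε) x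

/-- `R` is a universal `R`-matrix for the coproduct `Δ`, and it is triangular. -/
structure IsTriangularRMatrix (Δ : A⟦X⟧ →ₗ[ℝ] (A ⊗[ℝ] A)⟦X⟧) (R : (A ⊗[ℝ] A)⟦X⟧) : Prop where
  isUnit : IsUnit R
  intertwines : ∀ x, R * Δ x = swapZ (Δ x) * R
  comul_left : assocZ (tensId Δ R) = leg13 R * leg23 R
  comul_right : idTens Δ R = leg13 R * leg12 R
  triangular : swapZ R * R = 1

/-- The `z`-adically closed `ℝ⟦X⟧`-subalgebra generated by `S`. -/
def closedSubalgebra (S : Set A⟦X⟧) : Set A⟦X⟧ :=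
  {x | ∀ n, ∃ y ∈ Algebra.adjoin ℝ (insert z S),
    ∀ m < n, PowerSeries.coeff m x = PowerSeries.coeff m y}

/-- The closed subalgebra generated by `S` is a Hopf subalgebra: `Δ` maps it to its completed
tensor square, and `S` maps it to itself. -/
def IsHopfSubalgebra (Δ : A⟦X⟧ →ₗ[ℝ] (A ⊗[ℝ] A)⟦X⟧) (S : A⟦X⟧ →ₗ[ℝ] A⟦X⟧) (G : Set A⟦X⟧) :
    Prop :=
  ∀ x ∈ closedSubalgebra G,
    Δ x ∈ closedSubalgebra ((fun g => tens g 1) '' G ∪ (fun g => tens 1 g) '' G) ∧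
      S x ∈ closedSubalgebra G

end Series

/-! ### Twisting -/

section Twist

variable {a b : ℝ}

/-- The twisted coproduct `x ↦ F Δ₀(x) F⁻¹`. -/
def twComul (F : (U a b ⊗[ℝ] U a b)⟦X⟧) : (U a b)⟦X⟧ →ₗ[ℝ] (U a b ⊗[ℝ] U a b)⟦X⟧ :=
  LinearMap.mulRight ℝ (Ring.inverse F) ∘ₗ LinearMap.mulLeft ℝ F ∘ₗ
    mapₗ (comul₀ a b).toLinearMap

/-- The element `v = ∑ f₁ S₀(f₂)` for `F = ∑ f₁ ⊗ f₂`. -/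
def twElement (F : (U a b ⊗[ℝ] U a b)⟦X⟧) : (U a b)⟦X⟧ :=
  mulZ (mapₗ ((antipode₀ a b).lTensor (U a b)) F)

/-- The twisted antipode `x ↦ v S₀(x) v⁻¹`. -/
def twAntipode (F : (U a b ⊗[ℝ] U a b)⟦X⟧) : (U a b)⟦X⟧ →ₗ[ℝ] (U a b)⟦X⟧ :=
  LinearMap.mulRight ℝ (Ring.inverse (twElement F)) ∘ₗ LinearMap.mulLeft ℝ (twElement F) ∘ₗ
    mapₗ (antipode₀ a b)

/-- `F` is a twisting element for `U a b`. -/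
structure IsTwist (F : (U a b ⊗[ℝ] U a b)⟦X⟧) : Prop where
  isUnit : IsUnit F
  counit_left : counitLeft (counit₀ a b) F = 1
  counit_right : counitRight (counit₀ a b) F = 1
  cocycle : leg12 F * assocZ (mapₐ (Algebra.TensorProduct.map (comul₀ a b) (AlgHom.id ℝ _)) F) =
    leg23 F * mapₐ (Algebra.TensorProduct.map (AlgHom.id ℝ _) (comul₀ a b)) F

/-- The `R`-matrix `F₂₁ F⁻¹` of a twisting element. -/
def rMatrix (F : (U a b ⊗[ℝ] U a b)⟦X⟧) : (U a b ⊗[ℝ] U a b)⟦X⟧ := swapZ F * Ring.inverse F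

end Twist

/-! ### The twisted conformal algebra of `so(4,2)` -/

namespace SO42

/-- The undeformed generators of `so(4,2)`, as constant series. -/
def e (g : Gen) : (U 1 1)⟦X⟧ := PowerSeries.C (gen 1 1 g)

/-- The conformal null-plane generators. -/
def Hp : (U 1 1)⟦X⟧ := (1 / 2 : ℝ) • (e .D + e (.K 0))
def Hm : (U 1 1)⟦X⟧ := (1 / 2 : ℝ) • (e .D - e (.K 0))
def Tp : (U 1 1)⟦X⟧ := (1 / 2 : ℝ) • (e .P0 + e (.P 0))
def Tm : (U 1 1)⟦X⟧ := (1 / 2 : ℝ) • (e .P0 - e (.P 0))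
def T2 : (U 1 1)⟦X⟧ := (1 / 2 : ℝ) • (e (.P 1) - e (.P 2))
def T3 : (U 1 1)⟦X⟧ := (1 / 2 : ℝ) • (e (.P 1) + e (.P 2))
def B2 : (U 1 1)⟦X⟧ := (1 / 2 : ℝ) • (e (.K 1) + e (.J 2) - e (.K 2) + e (.J 1))
def B3 : (U 1 1)⟦X⟧ := (1 / 2 : ℝ) • (e (.K 1) + e (.J 2) + e (.K 2) - e (.J 1))

/-- `σ₋ = log (1 - 2 z T₋)`. -/
def sigmaM : (U 1 1)⟦X⟧ := plogOneSub ((2 : ℝ) • (z * Tm))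
/-- `T = T₊ + z (T₂² + T₃²) exp (-σ₋)`. -/
def T : (U 1 1)⟦X⟧ := Tp + z * ((T2 ^ 2 + T3 ^ 2) * pexp (-sigmaM))
/-- `σ₊ = log (1 - 2 z T)`. -/
def sigmaP : (U 1 1)⟦X⟧ := plogOneSub ((2 : ℝ) • (z * T))

/-- The three factors of the twisting element. -/
def PhiJ : (U 1 1 ⊗[ℝ] U 1 1)⟦X⟧ := pexp (tens Hm sigmaM)
def PhiE : (U 1 1 ⊗[ℝ] U 1 1)⟦X⟧ :=
  pexp (-(2 : ℝ) • (z * tens B3 (T3 * pexp (-(1 / 2 : ℝ) • sigmaM)))) *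
    pexp (-(2 : ℝ) • (z * tens B2 (T2 * pexp (-(1 / 2 : ℝ) • sigmaM))))
def PhiA : (U 1 1 ⊗[ℝ] U 1 1)⟦X⟧ := pexp (tens Hp sigmaP)

/-- The twisting element of the twisted conformal algebra. -/
def F : (U 1 1 ⊗[ℝ] U 1 1)⟦X⟧ := PhiA * PhiE * PhiJ

/-- The classical `r`-matrix. -/
def r : (U 1 1 ⊗[ℝ] U 1 1)⟦X⟧ :=
  z * (wedge (e .D) (e .P0) + ∑ i, wedge (e (.K i)) (e (.P i))) +
    z * (wedge (e (.J 2)) (e (.P 1)) - wedge (e (.J 1)) (e (.P 2)))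

/-- The generators of the twisted conformal algebra in the deformed conformal basis. The
translations are `P₀ = -(σ₊ + σ₋)/(2z)`, `P₁ = -(σ₊ - σ₋)/(2z)`, `P₂ = (T₃ + T₂) exp (-σ₋)`,
`P₃ = (T₃ - T₂) exp (-σ₋)`; the conformal transformations are
`C₀ + (z/2) (K₁² + K₂² + K₃²)` and `C_i - z K_i D`; the others are undeformed. -/
def qgen : Gen → (U 1 1)⟦X⟧
  | .P0 => -(1 / 2 : ℝ) • divZ (sigmaP + sigmaM)
  | .P 0 => -(1 / 2 : ℝ) • divZ (sigmaP - sigmaM)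
  | .P 1 => (T3 + T2) * pexp (-sigmaM)
  | .P 2 => (T3 - T2) * pexp (-sigmaM)
  | .C0 => e .C0 + (1 / 2 : ℝ) • (z * ∑ i, e (.K i) ^ 2)
  | .C i => e (.C i) - z * (e (.K i) * e .D)
  | .J i => e (.J i)
  | .K i => e (.K i)
  | .D => e .D

end SO42

/-! ### Contractions -/

section Contraction

/-- `x ε` has the limit `y` as `ε → 0`, where `x ε` is expressed through `φ ε : W → V` and `y`
through `φ₀ : W → V₀`: near `0`, `x ε` is a combination of the `φ ε`-images of finitely many
fixed elements of `W` with convergent coefficients, and `y` is the combination of their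
`φ₀`-images with the limit coefficients. -/
def HasLimit {W V V₀ : Type} [AddCommGroup W] [Module ℝ W] [AddCommGroup V] [Module ℝ V]
    [AddCommGroup V₀] [Module ℝ V₀] (φ : ℝ → W →ₗ[ℝ] V) (φ₀ : W →ₗ[ℝ] V₀) (x : ℝ → V) (y : V₀) :
    Prop :=
  ∃ (m : ℕ) (c : Fin m → ℝ → ℝ) (c₀ : Fin m → ℝ) (w : Fin m → W),
    (∀ᶠ ε in 𝓝[≠] 0, x ε = ∑ i, c i ε • φ ε (w i)) ∧
      (∀ i, Tendsto (c i) (𝓝[≠] 0) (𝓝 (c₀ i))) ∧ y = ∑ i, c₀ i • φ₀ (w i)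

/-- Noncommutative polynomials in the generators, evaluated at the rescaled generators
`ε ^ w g • g` of `so(4,2)`. -/
def evalScaled (w : Gen → ℕ) (ε : ℝ) : FreeAlgebra ℝ Gen →ₐ[ℝ] U 1 1 :=
  FreeAlgebra.lift ℝ fun g => ε ^ w g • gen 1 1 g

/-- Noncommutative polynomials in the generators, evaluated at the generators of `Conf a b`. -/
def evalLimit (a b : ℝ) : FreeAlgebra ℝ Gen →ₐ[ℝ] U a b := FreeAlgebra.lift ℝ (gen a b)

/-- The contraction limit of an `ε`-dependent element of `U(so(4,2))⟦z⟧` under the map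
`g ↦ ε ^ w g • g`, `z ↦ ε ^ (-k) z`. In terms of the new parameter `z' = ε ^ (-k) z`, the
coefficient of `z' ^ n` is `ε ^ (k n)` times that of `z ^ n`; it is expressed through the rescaled
generators, and then `ε → 0`. -/
def ContractsTo (w : Gen → ℕ) (k : ℕ) {a b : ℝ} (x : ℝ → (U 1 1)⟦X⟧) (y : (U a b)⟦X⟧) : Prop :=
  ∀ n, HasLimit (fun ε => (evalScaled w ε).toLinearMap) (evalLimit a b).toLinearMap
    (fun ε => ε ^ (k * n) • PowerSeries.coeff n (x ε)) (PowerSeries.coeff n y)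

/-- The contraction limit in the completed tensor square. -/
def ContractsTo₂ (w : Gen → ℕ) (k : ℕ) {a b : ℝ} (x : ℝ → (U 1 1 ⊗[ℝ] U 1 1)⟦X⟧)
    (y : (U a b ⊗[ℝ] U a b)⟦X⟧) : Prop :=
  ∀ n, HasLimit
    (fun ε => TensorProduct.map (evalScaled w ε).toLinearMap (evalScaled w ε).toLinearMap)
    (TensorProduct.map (evalLimit a b).toLinearMap (evalLimit a b).toLinearMap)
    (fun ε => ε ^ (k * n) • PowerSeries.coeff n (x ε)) (PowerSeries.coeff n y)

/-- The Lie algebra `Conf a b` is the Inönü-Wigner contraction of `so(4,2)` with weights `w`: the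
structure constants of `so(4,2)` in the rescaled basis `ε ^ w g • g` converge to those of
`Conf a b` as `ε → 0`. -/
def IsLieContraction (w : Gen → ℕ) (a b : ℝ) : Prop :=
  ∀ g h k : Gen, Tendsto
    (fun ε : ℝ => (ε ^ w k)⁻¹ *
      (⁅ε ^ w g • Conf.basisVec 1 1 g, ε ^ w h • Conf.basisVec 1 1 h⁆ : Conf 1 1) k)
    (𝓝[≠] 0) (𝓝 ((⁅Conf.basisVec a b g, Conf.basisVec a b h⁆ : Conf a b) k))

/-- The twisted Hopf algebra of `U a b` with twisting element `F₀` and generators `Y` is the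
contraction, with weights `w` for the generators and `k` for `z`, of the twisted conformal algebra
of `so(4,2)`. -/
structure IsQuantumContraction (w : Gen → ℕ) (k : ℕ) {a b : ℝ} (Y : Gen → (U a b)⟦X⟧)
    (F₀ : (U a b ⊗[ℝ] U a b)⟦X⟧) : Prop where
  lie : IsLieContraction w a b
  /-- The rescaled deformed generators converge to the `Y g`. -/
  generators : ∀ g, ContractsTo w k (fun ε => ε ^ w g • SO42.qgen g) (Y g)
  /-- The `Y g` are deformations of the generators of `U a b`. -/
  classical : ∀ g, PowerSeries.constantCoeff (Y g) = gen a b g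
  /-- Every element of the limit algebra is a limit. -/
  surj : ∀ y : (U a b)⟦X⟧, ∃ x, ContractsTo w k x y
  mul : ∀ (x x' : ℝ → (U 1 1)⟦X⟧) (y y' : (U a b)⟦X⟧), ContractsTo w k x y →
    ContractsTo w k x' y' → ContractsTo w k (fun ε => x ε * x' ε) (y * y')
  comul : ∀ (x : ℝ → (U 1 1)⟦X⟧) (y : (U a b)⟦X⟧), ContractsTo w k x y →
    ContractsTo₂ w k (fun ε => twComul SO42.F (x ε)) (twComul F₀ y)
  counit : ∀ (x : ℝ → (U 1 1)⟦X⟧) (y : (U a b)⟦X⟧), ContractsTo w k x y →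
    ∀ n, Tendsto (fun ε => ε ^ (k * n) * counit₀ 1 1 (PowerSeries.coeff n (x ε))) (𝓝[≠] 0)
      (𝓝 (counit₀ a b (PowerSeries.coeff n y)))
  antipode : ∀ (x : ℝ → (U 1 1)⟦X⟧) (y : (U a b)⟦X⟧), ContractsTo w k x y →
    ContractsTo w k (fun ε => twAntipode SO42.F (x ε)) (twAntipode F₀ y)
  /-- The twisting element and the universal `R`-matrix converge. -/
  twist : ContractsTo₂ w k (fun _ => SO42.F) F₀
  rMatrix : ContractsTo₂ w k (fun _ => rMatrix SO42.F) (rMatrix F₀)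
  /-- The limit is a triangular twisted Hopf algebra. -/
  isTwist : IsTwist F₀
  isHopf : IsHopf (twComul F₀) (counit₀ a b) (twAntipode F₀)
  isRMatrix : IsTriangularRMatrix (twComul F₀) (TwistedConformal.rMatrix F₀)

/-- The weights of the speed-space contraction: `P_i, K_i, C_i` are multiplied by `ε`. -/
def speedSpace : Gen → ℕ
  | .P _ | .K _ | .C _ => 1
  | _ => 0

/-- The weights of the speed-time contraction: `P_0, K_i, C_0` are multiplied by `ε`. -/
def speedTime : Gen → ℕ
  | .P0 | .K _ | .C0 => 1
  | _ => 0

end Contraction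

/-! ### The explicit Hopf structures -/

section Explicit

variable {A : Type} [Ring A] [Algebra ℝ A]

/-- `exp (c z x ⊗ y)`. -/
def expTens (c : ℝ) (x y : A⟦X⟧) : (A ⊗[ℝ] A)⟦X⟧ := pexp (c • (z * tens x y))

/-- The commutators with the rotations, which are the same in all cases. -/
structure RotationRelations (Y : Gen → A⟦X⟧) : Prop where
  JJ : ∀ i j, br (Y (.J i)) (Y (.J j)) = ∑ k, eps i j k • Y (.J k)
  JK : ∀ i j, br (Y (.J i)) (Y (.K j)) = ∑ k, eps i j k • Y (.K k)
  JP : ∀ i j, br (Y (.J i)) (Y (.P j)) = ∑ k, eps i j k • Y (.P k)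
  JC : ∀ i j, br (Y (.J i)) (Y (.C j)) = ∑ k, eps i j k • Y (.C k)
  JP0 : ∀ i, br (Y (.J i)) (Y .P0) = 0
  JC0 : ∀ i, br (Y (.J i)) (Y .C0) = 0
  JD : ∀ i, br (Y (.J i)) (Y .D) = 0

/-- The commutators of the twisted conformal Galilean algebra. -/
structure GalileanRelations (Y : Gen → A⟦X⟧) : Prop extends RotationRelations Y where
  KK : ∀ i j, br (Y (.K i)) (Y (.K j)) = 0
  KP : ∀ i j, br (Y (.K i)) (Y (.P j)) = 0
  KC : ∀ i j, br (Y (.K i)) (Y (.C j)) = 0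
  KP0 : ∀ i, br (Y (.K i)) (Y .P0) = Y (.P i)
  KC0 : ∀ i, br (Y (.K i)) (Y .C0) = Y (.C i)
  KD : ∀ i, br (Y (.K i)) (Y .D) = 0
  PP : ∀ i j, br (Y (.P i)) (Y (.P j)) = 0
  PC : ∀ i j, br (Y (.P i)) (Y (.C j)) = 0
  PP0 : ∀ i, br (Y (.P i)) (Y .P0) = 0
  PC0 : ∀ i, br (Y (.P i)) (Y .C0) = Y (.K i)
  PD : ∀ i, br (Y (.P i)) (Y .D) = -Y (.P i)
  CC : ∀ i j, br (Y (.C i)) (Y (.C j)) = 0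
  CC0 : ∀ i, br (Y (.C i)) (Y .C0) = 0
  CD : ∀ i, br (Y (.C i)) (Y .D) = Y (.C i)
  P0C : ∀ i, br (Y .P0) (Y (.C i)) = -Y (.K i)
  P0C0 : br (Y .P0) (Y .C0) = Y .D
  P0D : br (Y .P0) (Y .D) = -Y .P0 - (1 / 2 : ℝ) • (z * ∑ i, Y (.P i) ^ 2)
  C0D : br (Y .C0) (Y .D) = Y .C0 - (1 / 2 : ℝ) • (z * ∑ i, Y (.K i) ^ 2)

/-- The coproduct of the twisted conformal Galilean algebra. -/
structure GalileanCoproduct (Δ : A⟦X⟧ →ₗ[ℝ] (A ⊗[ℝ] A)⟦X⟧) (Y : Gen → A⟦X⟧) : Prop where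
  primitive : ∀ g, g ≠ .D → g ≠ .C0 → Δ (Y g) = tens (Y g) 1 + tens 1 (Y g)
  D : Δ (Y .D) = tens (Y .D) 1 + tens 1 (Y .D) + z * ∑ i, tens (Y (.K i)) (Y (.P i))
  C0 : Δ (Y .C0) = tens (Y .C0) 1 + tens 1 (Y .C0) - z * ∑ i, tens (Y (.C i)) (Y (.P i))

/-- The commutators of the twisted conformal Carroll algebra, with `E = exp (z P₀)`. -/
structure CarrollRelations (Y : Gen → A⟦X⟧) (E : A⟦X⟧) : Prop extends RotationRelations Y where
  KK : ∀ i j, br (Y (.K i)) (Y (.K j)) = 0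
  KP : ∀ i j, br (Y (.K i)) (Y (.P j)) = if i = j then divZ (E - 1) else 0
  KC : ∀ i j, br (Y (.K i)) (Y (.C j)) =
    if i = j then Y .C0 - (1 / 2 : ℝ) • (z * ∑ l, Y (.K l) ^ 2) else 0
  KP0 : ∀ i, br (Y (.K i)) (Y .P0) = 0
  KC0 : ∀ i, br (Y (.K i)) (Y .C0) = 0
  KD : ∀ i, br (Y (.K i)) (Y .D) = 0
  PP : ∀ i j, br (Y (.P i)) (Y (.P j)) = 0
  PC : ∀ i j, br (Y (.P i)) (Y (.C j)) =
    (if i = j then -Y .D else 0) + ∑ k, eps i j k • (E * Y (.J k))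
  PP0 : ∀ i, br (Y (.P i)) (Y .P0) = 0
  PC0 : ∀ i, br (Y (.P i)) (Y .C0) = Y (.K i)
  PD : ∀ i, br (Y (.P i)) (Y .D) = -(E * Y (.P i))
  CC : ∀ i j, br (Y (.C i)) (Y (.C j)) = z * (Y (.K i) * Y (.C j) - Y (.K j) * Y (.C i))
  CC0 : ∀ i, br (Y (.C i)) (Y .C0) = 0
  CD : ∀ i, br (Y (.C i)) (Y .D) = Y (.C i) + z * (Y (.K i) * Y .D)
  P0C : ∀ i, br (Y .P0) (Y (.C i)) = -Y (.K i)
  P0C0 : br (Y .P0) (Y .C0) = 0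
  P0D : br (Y .P0) (Y .D) = divZ (1 - E)
  C0D : br (Y .C0) (Y .D) = Y .C0 - (1 / 2 : ℝ) • (z * ∑ i, Y (.K i) ^ 2)

/-- The coproduct of the twisted conformal Carroll algebra, with `E = exp (z P₀)`. -/
structure CarrollCoproduct (Δ : A⟦X⟧ →ₗ[ℝ] (A ⊗[ℝ] A)⟦X⟧) (Y : Gen → A⟦X⟧) (E : A⟦X⟧) :
    Prop where
  J : ∀ i, Δ (Y (.J i)) = tens (Y (.J i)) 1 + tens 1 (Y (.J i))
  P : ∀ i, Δ (Y (.P i)) = tens (Y (.P i)) 1 + tens 1 (Y (.P i))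
  P0 : Δ (Y .P0) = tens (Y .P0) 1 + tens 1 (Y .P0)
  K : ∀ i, Δ (Y (.K i)) = tens (Y (.K i)) E + tens 1 (Y (.K i))
  C0 : Δ (Y .C0) = tens (Y .C0) E + tens 1 (Y .C0)
  D : Δ (Y .D) = tens (Y .D) E + tens 1 (Y .D) + z * ∑ i, tens (Y (.K i)) (E * Y (.P i))
  C : ∀ i, Δ (Y (.C i)) = tens (Y (.C i)) E + tens 1 (Y (.C i)) - z * tens (Y .C0) (E * Y (.P i)) +
    z * ∑ j, ∑ k, eps i j k • tens (Y (.K j)) (E * Y (.J k))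

/-- The generators `J_i, P_μ, K_i` of the kinematical subalgebra. -/
def kinematical : Set Gen := {g | g = .P0 ∨ ∃ i, g = .J i ∨ g = .P i ∨ g = .K i}

/-- The generators `J_i, P_μ, K_i, D` of the Weyl subalgebra. -/
def weyl : Set Gen := insert .D kinematical

end Explicit

end TwistedConformal

end

open Filter Topology
open scoped TensorProduct PowerSeries

set_option linter.unusedSectionVars false
set_option linter.unusedSimpArgs false
set_option linter.unreachableTactic false
set_option linter.unusedTactic false

noncomputable section

namespace TwistedConformal

/-! ### Calculus of formal series in `z`: truncation, exponential, logarithm, geometric series. -/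

section FormalSeries

variable {A B : Type} [Ring A] [Algebra ℝ A] [Ring B] [Algebra ℝ B]

/-! Everything is governed by the twisting element. The coproduct, the antipode and the `R`-matrix
are algebraic expressions in `F`, `F⁻¹`, `v`, `v⁻¹` and the primitive structure maps. The primitive
maps are covered by maps of the free algebra that do not depend on `ε`, so they respect limits.
Since `F` and `v` have constant term 1, each coefficient of an inverse is a polynomial in finitely
many coefficients. Hence convergence of `F` alone gives convergence of the whole Hopf structure
(`IsQuantumContraction.of_twist`), and Drinfeld's theorem (`IsTwist.isHopf`,
`IsTwist.isTriangularRMatrix`) makes the limit a triangular Hopf algebra as soon as the limit of `F`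
is a twist. It remains to identify this limit, to verify its cocycle identity and to compute with
it.

In both cases the limit has the form `exp (∑ X_i ⊗ Q_i)` with commuting primitive `X_i` and
commuting `Q_i` that are primitive for the twisted coproduct. Both sides of the cocycle identity
then equal `F₁₂ F₁₃ F₂₃` (`isTwist_pexp`).

Galilean case: `X_i = K_i` and `Q_i = -z P_i` all commute. For the exponent `f`, the double
commutator with each `Δ₀` that occurs vanishes, so the twisted coproduct is `Δ₀ + [f, Δ₀]`
(`twComul_galilean`). The quadratic corrections to `P₀` and `C₀` have coproducts whose cross terms
cancel against terms of this commutator.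

Carroll case: put `L = -log (1 - z P₀)` and `E = (1 - z P₀)⁻¹ = exp L` for the classical `P₀`. The
pairs are `K_i` with `-z P_i E`, and `D` with `-L`. Conjugation by `exp (-D ⊗ L)` rescales a vector
of dilation weight `r` by `exp (-r L)` in the other leg; conjugation by the boost factor stops at
second order (`pexp_mul_of_ad`). Thus `1 - z P₀` becomes group-like, hence `L` becomes primitive,
and the remaining coproducts follow.

Convergence, Galilean case: `σ₊` and `σ₋` already converge when `z` is rescaled by `ε⁻¹` only. Under
the true rescaling by `ε⁻²` there is an extra power of `ε` per order, so only lowest orders survive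
(`SeriesLimit.weight_two`, `SeriesLimit.weight_two_inv`). The deformed `P₀` is more delicate: it
needs the exact first-order term of `σ₊ + σ₋`, where the `P₁` parts cancel, and the limit of the
second-order term.

Convergence, Carroll case: `σ₊` and `σ₋` both tend to `-L`, while `K₁` is `ε⁻¹` times its rescaled
version, so the exponents of `Φ_A` and `Φ_J` are of order `ε⁻¹`. Only the combination `K₁ ⊗ (σ₊ -
σ₋)` stays finite. `SO42.F_eq` brings the two pieces together by moving one of them across `Φ_E`,
and `SeriesLimit.plogOneSub_sub` computes the limit of the difference quotient of the logarithms. -/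

theorem coeff_real_smul (n : ℕ) (r : ℝ) (f : A⟦X⟧) :
    PowerSeries.coeff n (r • f) = r • PowerSeries.coeff n f := rfl

theorem coeff_z_mul_succ (n : ℕ) (f : A⟦X⟧) :
    PowerSeries.coeff (n + 1) (z * f) = PowerSeries.coeff n f :=
  PowerSeries.coeff_succ_X_mul n f

theorem coeff_z_mul_zero (f : A⟦X⟧) : PowerSeries.coeff 0 (z * f) = 0 := by simp

theorem z_mul_comm (f : A⟦X⟧) : z * f = f * z := PowerSeries.X_mul

theorem z_commute (f : A⟦X⟧) : Commute z f := PowerSeries.X_mul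

/-- The series `f` and `g` agree below order `N`. -/
def AgreeTo (N : ℕ) (f g : A⟦X⟧) : Prop :=
  ∀ m < N, PowerSeries.coeff m f = PowerSeries.coeff m g

namespace AgreeTo

variable {N : ℕ} {f g h f' g' : A⟦X⟧}

theorem refl (N : ℕ) (f : A⟦X⟧) : AgreeTo N f f := fun _ _ => rfl

theorem symm (h : AgreeTo N f g) : AgreeTo N g f := fun m hm => (h m hm).symm

theorem trans (h₁ : AgreeTo N f g) (h₂ : AgreeTo N g h) : AgreeTo N f h :=
  fun m hm => (h₁ m hm).trans (h₂ m hm)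

theorem mono {M : ℕ} (h : AgreeTo N f g) (hM : M ≤ N) : AgreeTo M f g :=
  fun m hm => h m (hm.trans_le hM)

theorem add (h₁ : AgreeTo N f g) (h₂ : AgreeTo N f' g') : AgreeTo N (f + f') (g + g') :=
  fun m hm => by rw [map_add, map_add, h₁ m hm, h₂ m hm]

theorem sub (h₁ : AgreeTo N f g) (h₂ : AgreeTo N f' g') : AgreeTo N (f - f') (g - g') :=
  fun m hm => by rw [map_sub, map_sub, h₁ m hm, h₂ m hm]

theorem neg (h₁ : AgreeTo N f g) : AgreeTo N (-f) (-g) :=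
  fun m hm => by rw [map_neg, map_neg, h₁ m hm]

theorem smul (r : ℝ) (h₁ : AgreeTo N f g) : AgreeTo N (r • f) (r • g) :=
  fun m hm => by rw [coeff_real_smul, coeff_real_smul, h₁ m hm]

theorem mul (h₁ : AgreeTo N f g) (h₂ : AgreeTo N f' g') : AgreeTo N (f * f') (g * g') := by
  intro m hm
  rw [PowerSeries.coeff_mul, PowerSeries.coeff_mul]
  refine Finset.sum_congr rfl fun p hp => ?_
  rw [Finset.HasAntidiagonal.mem_antidiagonal] at hp
  rw [h₁ _ (by omega), h₂ _ (by omega)]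

theorem pow (h : AgreeTo N f g) (k : ℕ) : AgreeTo N (f ^ k) (g ^ k) := by
  induction k with
  | zero => simpa using refl N 1
  | succ k ih => simpa [pow_succ] using ih.mul h

theorem sum {ι : Type*} (s : Finset ι) {f g : ι → A⟦X⟧} (h : ∀ i ∈ s, AgreeTo N (f i) (g i)) :
    AgreeTo N (∑ i ∈ s, f i) (∑ i ∈ s, g i) := fun m hm => by
  rw [map_sum, map_sum]
  exact Finset.sum_congr rfl fun i hi => h i hi m hm

/-- Orders of vanishing add: if `i + j < N + M`, then `i < N` or `j < M`, so one factor of each term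
vanishes. -/
theorem mul_vanish {M : ℕ} (h₁ : AgreeTo N f 0) (h₂ : AgreeTo M g 0) :
    AgreeTo (N + M) (f * g) 0 := by
  intro m hm
  rw [PowerSeries.coeff_mul, map_zero]
  refine Finset.sum_eq_zero fun p hp => ?_
  rw [Finset.HasAntidiagonal.mem_antidiagonal] at hp
  rcases lt_or_ge p.1 N with h | h
  · rw [h₁ _ h, map_zero, zero_mul]
  · rw [h₂ _ (by omega), map_zero, mul_zero]

theorem pow_vanish (h : AgreeTo 1 f 0) (k : ℕ) : AgreeTo k (f ^ k) 0 := by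
  induction k with
  | zero => intro m hm; omega
  | succ k ih => rw [pow_succ]; exact ih.mul_vanish h

end AgreeTo

theorem eq_of_agreeTo {f g : A⟦X⟧} (h : ∀ N, AgreeTo N f g) : f = g :=
  PowerSeries.ext fun n => h (n + 1) n n.lt_succ_self

/-- The series has no constant term. -/
abbrev Small (f : A⟦X⟧) : Prop := AgreeTo 1 f 0

theorem small_iff {f : A⟦X⟧} : Small f ↔ PowerSeries.coeff 0 f = 0 := by
  constructor
  · intro h; simpa using h 0 one_pos
  · intro h m hm
    obtain rfl : m = 0 := by omega
    simpa using h

theorem small_z_mul (f : A⟦X⟧) : Small (z * f) := small_iff.2 (coeff_z_mul_zero f)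

theorem small_zero : Small (0 : A⟦X⟧) := AgreeTo.refl _ _

theorem Small.add {f g : A⟦X⟧} (hf : Small f) (hg : Small g) : Small (f + g) := by
  simpa using AgreeTo.add hf hg

theorem Small.neg {f : A⟦X⟧} (hf : Small f) : Small (-f) := by
  simpa using AgreeTo.neg hf

theorem Small.smul {f : A⟦X⟧} (r : ℝ) (hf : Small f) : Small (r • f) := by
  simpa using AgreeTo.smul r hf

theorem Small.mul_left {f : A⟦X⟧} (g : A⟦X⟧) (hf : Small f) : Small (g * f) := by
  simpa using AgreeTo.mul (AgreeTo.refl 1 g) hf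

theorem Small.mul_right {f : A⟦X⟧} (hf : Small f) (g : A⟦X⟧) : Small (f * g) := by
  simpa using AgreeTo.mul hf (AgreeTo.refl 1 g)

theorem Small.sum {ι : Type*} (s : Finset ι) {f : ι → A⟦X⟧} (h : ∀ i ∈ s, Small (f i)) :
    Small (∑ i ∈ s, f i) := by
  simpa using AgreeTo.sum s h

theorem z_mul_divZ {f : A⟦X⟧} (hf : Small f) : z * divZ f = f := by
  ext n
  cases n with
  | zero => rw [coeff_z_mul_zero, small_iff.1 hf]
  | succ n => rw [coeff_z_mul_succ, divZ, PowerSeries.coeff_mk]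

theorem divZ_z_mul (f : A⟦X⟧) : divZ (z * f) = f := by
  ext n
  rw [divZ, PowerSeries.coeff_mk, coeff_z_mul_succ]

theorem z_mul_injective {f g : A⟦X⟧} (h : z * f = z * g) : f = g := PowerSeries.X_mul_cancel h

theorem coeff_mapₐ (φ : A →ₐ[ℝ] B) (n : ℕ) (f : A⟦X⟧) :
    PowerSeries.coeff n (mapₐ φ f) = φ (PowerSeries.coeff n f) := rfl

theorem mapₐ_smul (φ : A →ₐ[ℝ] B) (r : ℝ) (f : A⟦X⟧) : mapₐ φ (r • f) = r • mapₐ φ f := by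
  ext n
  rw [coeff_mapₐ, coeff_real_smul, coeff_real_smul, map_smul, coeff_mapₐ]

theorem mapₐ_z (φ : A →ₐ[ℝ] B) : mapₐ φ z = z := PowerSeries.map_X _

theorem mapₐ_C (φ : A →ₐ[ℝ] B) (a : A) : mapₐ φ (PowerSeries.C a) = PowerSeries.C (φ a) :=
  PowerSeries.map_C _ _

theorem AgreeTo.mapₐ (φ : A →ₐ[ℝ] B) {N : ℕ} {f g : A⟦X⟧} (h : AgreeTo N f g) :
    AgreeTo N (mapₐ φ f) (mapₐ φ g) := fun m hm => by
  rw [coeff_mapₐ, coeff_mapₐ, h m hm]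

theorem Small.mapₐ (φ : A →ₐ[ℝ] B) {f : A⟦X⟧} (h : Small f) : Small (mapₐ φ f) := by
  simpa using AgreeTo.mapₐ φ h

/-- `∑ c k f ^ k` for `f` without constant term. -/
def pser (c : ℕ → ℝ) (f : A⟦X⟧) : A⟦X⟧ :=
  PowerSeries.mk fun n => PowerSeries.coeff n (∑ k ∈ Finset.range (n + 1), c k • f ^ k)

theorem pexp_eq_pser (f : A⟦X⟧) : pexp f = pser (fun k => (k.factorial : ℝ)⁻¹) f := rfl

/-- The convention `0⁻¹ = 0` makes the `k = 0` term vanish, which lets the logarithm be treated as a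
series indexed from zero. -/
theorem plogOneSub_eq_pser (f : A⟦X⟧) : plogOneSub f = pser (fun k => -(k : ℝ)⁻¹) f := by
  ext n
  rw [plogOneSub, pser, PowerSeries.coeff_mk, PowerSeries.coeff_mk, ← Finset.sum_neg_distrib,
    Finset.sum_range_succ', Finset.range_eq_Ico, Finset.sum_Ico_add' (fun k : ℕ => -(k : ℝ)⁻¹ • f ^ k)]
  simp [neg_smul, Finset.Ico_add_one_right_eq_Icc]

/-- The geometric series `(1 - f)⁻¹`. -/
def pgeom (f : A⟦X⟧) : A⟦X⟧ := pser (fun _ => 1) f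

/-- The truncation in `pser` varies with the coefficient. Since `f ^ k` vanishes below order `k`,
lengthening it changes nothing, so one common partial sum serves all orders below `N`. Identities
between partial sums thereby pass to series. -/
theorem pser_agreeTo {c : ℕ → ℝ} {f : A⟦X⟧} (hf : Small f) (N : ℕ) :
    AgreeTo N (pser c f) (∑ k ∈ Finset.range N, c k • f ^ k) := by
  intro m hm
  rw [pser, PowerSeries.coeff_mk]
  obtain ⟨j, rfl⟩ := Nat.exists_eq_add_of_lt hm
  rw [show m + j + 1 = m + 1 + j by ring, Finset.sum_range_add _ (m + 1), map_add, left_eq_add,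
    map_sum]
  refine Finset.sum_eq_zero fun i _ => ?_
  rw [coeff_real_smul, AgreeTo.pow_vanish hf (m + 1 + i) m (by omega), map_zero, smul_zero]

theorem pexp_agreeTo {f : A⟦X⟧} (hf : Small f) (N : ℕ) :
    AgreeTo N (pexp f) (∑ k ∈ Finset.range N, (k.factorial : ℝ)⁻¹ • f ^ k) :=
  pser_agreeTo hf N

theorem coeff_zero_pser (c : ℕ → ℝ) (f : A⟦X⟧) :
    PowerSeries.coeff 0 (pser c f) = c 0 • 1 := by
  simp [pser]

theorem pser_small {c : ℕ → ℝ} (hc : c 0 = 0) (f : A⟦X⟧) : Small (pser c f) :=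
  small_iff.2 (by rw [coeff_zero_pser, hc, zero_smul])

theorem plogOneSub_small (f : A⟦X⟧) : Small (plogOneSub f) := by
  rw [plogOneSub_eq_pser]
  exact pser_small (by simp) f

theorem mapₐ_pser (φ : A →ₐ[ℝ] B) (c : ℕ → ℝ) (f : A⟦X⟧) :
    mapₐ φ (pser c f) = pser c (mapₐ φ f) := by
  ext n
  rw [coeff_mapₐ, pser, pser, PowerSeries.coeff_mk, PowerSeries.coeff_mk, ← coeff_mapₐ, map_sum]
  simp only [mapₐ_smul, map_pow]

theorem mapₐ_pexp (φ : A →ₐ[ℝ] B) (f : A⟦X⟧) : mapₐ φ (pexp f) = pexp (mapₐ φ f) :=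
  mapₐ_pser φ _ f

theorem pser_semiconj {c : ℕ → ℝ} {x f g : A⟦X⟧} (hf : Small f) (hg : Small g)
    (h : SemiconjBy x f g) : SemiconjBy x (pser c f) (pser c g) := by
  refine eq_of_agreeTo fun N => ?_
  refine ((AgreeTo.refl N x).mul (pser_agreeTo hf N)).trans
    (AgreeTo.trans ?_ ((pser_agreeTo hg N).mul (AgreeTo.refl N x)).symm)
  rw [Finset.mul_sum, Finset.sum_mul]
  refine AgreeTo.sum _ fun k _ => ?_
  rw [mul_smul_comm, smul_mul_assoc, (h.pow_right k).eq]
  exact AgreeTo.refl _ _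

theorem pser_commute {c : ℕ → ℝ} {x f : A⟦X⟧} (hf : Small f) (h : Commute x f) :
    Commute x (pser c f) :=
  pser_semiconj hf hf h

theorem pexp_semiconj {x f g : A⟦X⟧} (hf : Small f) (hg : Small g) (h : SemiconjBy x f g) :
    SemiconjBy x (pexp f) (pexp g) :=
  pser_semiconj hf hg h

theorem pexp_commute {x f : A⟦X⟧} (hf : Small f) (h : Commute x f) : Commute x (pexp f) :=
  pser_commute hf h

theorem plogOneSub_commute {x f : A⟦X⟧} (hf : Small f) (h : Commute x f) :
    Commute x (plogOneSub f) := by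
  rw [plogOneSub_eq_pser]
  exact pser_commute hf h

theorem pexp_zero : pexp (0 : A⟦X⟧) = 1 := by
  refine eq_of_agreeTo fun N => (pexp_agreeTo small_zero N).trans ?_
  cases N with
  | zero => intro m hm; omega
  | succ N =>
    rw [Finset.sum_range_succ', Finset.sum_eq_zero fun k _ => by simp]
    simpa using AgreeTo.refl _ _

theorem coeff_zero_pexp (f : A⟦X⟧) : PowerSeries.coeff 0 (pexp f) = 1 := by
  rw [pexp_eq_pser, coeff_zero_pser]; simp

theorem constantCoeff_pexp (f : A⟦X⟧) : PowerSeries.constantCoeff (pexp f) = 1 := by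
  rw [← PowerSeries.coeff_zero_eq_constantCoeff_apply, coeff_zero_pexp]

theorem coeff_one_pexp (f : A⟦X⟧) : PowerSeries.coeff 1 (pexp f) = PowerSeries.coeff 1 f := by
  rw [pexp, PowerSeries.coeff_mk]
  simp [Finset.sum_range_succ, PowerSeries.coeff_one]

theorem pexp_add {f g : A⟦X⟧} (hf : Small f) (hg : Small g) (h : Commute f g) :
    pexp (f + g) = pexp f * pexp g := by
  refine eq_of_agreeTo fun N => (pexp_agreeTo (hf.add hg) N).trans
    (AgreeTo.trans ?_ ((pexp_agreeTo hf N).mul (pexp_agreeTo hg N)).symm)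
  set a : ℕ → A⟦X⟧ := fun k => (k.factorial : ℝ)⁻¹ • f ^ k
  set b : ℕ → A⟦X⟧ := fun k => (k.factorial : ℝ)⁻¹ • g ^ k
  have hsum : ∀ k, (k.factorial : ℝ)⁻¹ • (f + g) ^ k =
      ∑ p ∈ Finset.HasAntidiagonal.antidiagonal k, a p.1 * b p.2 := by
    intro k
    rw [h.add_pow', Finset.smul_sum]
    refine Finset.sum_congr rfl fun p hp => ?_
    rw [Finset.HasAntidiagonal.mem_antidiagonal] at hp
    simp only [a, b, smul_mul_smul_comm]
    rw [← Nat.cast_smul_eq_nsmul ℝ, smul_smul]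
    congr 1
    have h1 := Nat.choose_mul_factorial_mul_factorial (show p.1 ≤ k by omega)
    rw [show k - p.1 = p.2 by omega] at h1
    have h2 : ((k.choose p.1 : ℝ)) * p.1.factorial * p.2.factorial = k.factorial := by
      exact_mod_cast h1
    rw [← h2]
    have hc : (k.choose p.1 : ℝ) ≠ 0 :=
      Nat.cast_ne_zero.2 (Nat.choose_pos (by omega)).ne'
    have := Nat.factorial_ne_zero p.1
    have := Nat.factorial_ne_zero p.2
    field_simp
  simp only [hsum]
  -- The square of indices splits into the triangle `p.1 + p.2 < N`, which reproduces the binomial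
  -- sum of `exp (f + g)`, and its complement, whose terms vanish below order `N`.
  rw [Finset.sum_mul_sum, ← Finset.sum_product', Finset.sum_sigma',
    ← Finset.sum_filter_add_sum_filter_not (Finset.range N ×ˢ Finset.range N)
      (fun p => p.1 + p.2 < N)]
  have h1 : ∑ x ∈ (Finset.range N).sigma fun k => Finset.HasAntidiagonal.antidiagonal k,
      a x.2.1 * b x.2.2 =
      ∑ p ∈ Finset.range N ×ˢ Finset.range N with p.1 + p.2 < N, a p.1 * b p.2 := by
    refine Finset.sum_bij' (fun x _ => x.2) (fun p _ => ⟨p.1 + p.2, p⟩) ?_ ?_ ?_ ?_ ?_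
    · rintro ⟨k, p⟩ hp
      simp only [Finset.mem_sigma, Finset.mem_range, Finset.HasAntidiagonal.mem_antidiagonal,
        Finset.mem_filter, Finset.mem_product] at hp ⊢
      omega
    · rintro p hp
      simp only [Finset.mem_sigma, Finset.mem_range, Finset.HasAntidiagonal.mem_antidiagonal,
        Finset.mem_filter, Finset.mem_product] at hp ⊢
      exact ⟨hp.2, trivial⟩
    · rintro ⟨k, p⟩ hp
      simp only [Finset.mem_sigma, Finset.HasAntidiagonal.mem_antidiagonal] at hp
      obtain ⟨-, rfl⟩ := hp
      rfl
    · intro p _; rfl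
    · intro x _; rfl
  rw [h1]
  conv_lhs => rw [← add_zero (∑ p ∈ _, _)]
  refine (AgreeTo.refl _ _).add (AgreeTo.symm ?_)
  rw [← Finset.sum_const_zero (s := {p ∈ Finset.range N ×ˢ Finset.range N | ¬p.1 + p.2 < N})]
  refine AgreeTo.sum _ fun p hp => ?_
  rw [Finset.mem_filter] at hp
  refine AgreeTo.mono ?_ (show N ≤ p.1 + p.2 by omega)
  exact AgreeTo.mul_vanish (by simpa using (hf.pow_vanish p.1).smul (p.1.factorial : ℝ)⁻¹)
    (by simpa using (hg.pow_vanish p.2).smul (p.2.factorial : ℝ)⁻¹)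

theorem pexp_mul_pexp_neg {f : A⟦X⟧} (hf : Small f) : pexp f * pexp (-f) = 1 := by
  rw [← pexp_add hf hf.neg ((Commute.refl f).neg_right), add_neg_cancel, pexp_zero]

theorem pexp_neg_mul_pexp {f : A⟦X⟧} (hf : Small f) : pexp (-f) * pexp f = 1 := by
  rw [← pexp_add hf.neg hf ((Commute.refl f).neg_left), neg_add_cancel, pexp_zero]

/-- Conjugation by `exp f` of an element on which `ad f` is nilpotent of order three. -/
theorem pexp_mul_of_ad {f x y w : A⟦X⟧} (hf : Small f) (hy : br f x = y) (hw : br f y = w)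
    (h0 : Commute f w) : pexp f * x = (x + y + (1 / 2 : ℝ) • w) * pexp f := by
  set e : ℕ → A⟦X⟧ := fun k => (k.factorial : ℝ)⁻¹ • f ^ k with he
  have hx : f * x = x * f + y := by rw [← hy, br]; abel
  have hyf : f * y = y * f + w := by rw [← hw, br]; abel
  have h1 : ∀ k, e (k + 2) * x = x * e (k + 2) + y * e (k + 1) + (1 / 2 : ℝ) • (w * e k) := by
    intro k
    -- Leibniz rule `f ^ n x = ∑ C(n, j) (ad f)^j (x) f ^ (n - j)`; only `j ≤ 2` contributes because
    -- `f` commutes with `w`.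
    have key : ∀ k, f ^ (k + 2) * x = x * f ^ (k + 2) + ((k + 2 : ℕ) : ℝ) • (y * f ^ (k + 1)) +
        (((k + 2 : ℕ) : ℝ) * ((k + 1 : ℕ) : ℝ) / 2) • (w * f ^ k) := by
      intro k
      induction k with
      | zero =>
        simp only [zero_add, pow_zero, mul_one, pow_one]
        rw [pow_two, mul_assoc, hx, mul_add, hyf, ← mul_assoc, hx, add_mul, mul_assoc]
        push_cast
        module
      | succ k ih =>
        rw [pow_succ', mul_assoc, ih, mul_add, mul_add, mul_smul_comm, mul_smul_comm,
          ← mul_assoc, ← mul_assoc, ← mul_assoc, hx, hyf, h0.eq, add_mul, add_mul]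
        simp only [mul_assoc, ← pow_succ']
        push_cast
        module
    have hk : ((k + 2).factorial : ℝ) = (k + 2) * ((k + 1) * k.factorial) := by
      rw [Nat.factorial_succ, Nat.factorial_succ]; push_cast; ring
    have hk' : ((k + 1).factorial : ℝ) = (k + 1) * k.factorial := by
      rw [Nat.factorial_succ]; push_cast; ring
    have := Nat.factorial_ne_zero k
    have h3 : (k : ℝ) + 1 ≠ 0 := by positivity
    have h4 : (k : ℝ) + 2 ≠ 0 := by positivity
    simp only [he, smul_mul_assoc, key, mul_smul_comm, smul_add, smul_smul, hk, hk']
    refine congrArg₂ (· + ·) (congrArg₂ (· + ·) rfl (congrArg (· • _) ?_)) (congrArg (· • _) ?_)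
    · push_cast; field_simp
    · push_cast; field_simp
  -- Partial sums of the three lengths `N + 2`, `N + 1`, `N` match the shifts in `h1`, so the
  -- identity is exact, with no remainder.
  have hS : ∀ N, (∑ k ∈ Finset.range (N + 2), e k) * x = x * ∑ k ∈ Finset.range (N + 2), e k +
      y * ∑ k ∈ Finset.range (N + 1), e k + (1 / 2 : ℝ) • (w * ∑ k ∈ Finset.range N, e k) := by
    intro N
    induction N with
    | zero =>
      simp [Finset.sum_range_succ, he, add_mul, hx, mul_add]
      abel
    | succ N ih =>
      rw [Finset.sum_range_succ, add_mul, ih, h1, Finset.sum_range_succ _ (N + 1),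
        Finset.sum_range_succ _ N]
      simp only [mul_add, smul_add]
      abel
  refine eq_of_agreeTo fun N => ?_
  refine (((pexp_agreeTo hf (N + 2)).mono (Nat.le_add_right N 2)).mul (AgreeTo.refl N x)).trans ?_
  change AgreeTo N ((∑ k ∈ Finset.range (N + 2), e k) * x) _
  rw [hS, add_mul, add_mul, smul_mul_assoc]
  refine AgreeTo.add (AgreeTo.add ?_ ?_) (AgreeTo.smul _ ?_)
  · exact (AgreeTo.refl N x).mul ((pexp_agreeTo hf (N + 2)).mono (Nat.le_add_right N 2)).symm
  · exact (AgreeTo.refl N y).mul ((pexp_agreeTo hf (N + 1)).mono (Nat.le_add_right N 1)).symm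
  · exact (AgreeTo.refl N w).mul (pexp_agreeTo hf N).symm

/-- By induction on the order: if `f` and `g` agree below order `m`, their powers with exponent at
least two agree through order `m`, since neither has a constant term. The coefficient of order `m`
in the exponential then determines that of its argument. No commutation of `f` with `g` is needed.
-/
theorem pexp_injective {f g : A⟦X⟧} (hf : Small f) (hg : Small g) (h : pexp f = pexp g) :
    f = g := by
  refine eq_of_agreeTo fun N => ?_
  induction N with
  | zero => intro m hm; omega
  | succ N ih =>
    intro m hm
    rcases Nat.lt_succ_iff_lt_or_eq.1 hm with hm | rfl
    · exact ih m hm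
    rcases Nat.eq_zero_or_pos m with rfl | hpos
    · rw [small_iff.1 hf, small_iff.1 hg]
    have key : ∀ {u : A⟦X⟧}, Small u → PowerSeries.coeff m (pexp u) = PowerSeries.coeff m u +
        PowerSeries.coeff m (∑ k ∈ Finset.range m, ((k + 2).factorial : ℝ)⁻¹ • u ^ (k + 2)) := by
      intro u hu
      rw [pexp_agreeTo hu (m + 2) m (by omega), Finset.sum_range_succ', Finset.sum_range_succ',
        map_add, map_add, add_comm]
      simp [PowerSeries.coeff_one, hpos.ne']
      abel
    have hpow : ∀ k, AgreeTo (m + 1) (f ^ (k + 2)) (g ^ (k + 2)) := by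
      intro k j hj
      rw [pow_succ f, pow_succ g]
      have h1 : AgreeTo (m + 1) ((f ^ (k + 1) - g ^ (k + 1)) * f) 0 :=
        AgreeTo.mul_vanish (by simpa using (ih.pow (k + 1)).sub (AgreeTo.refl m (g ^ (k + 1)))) hf
      have h2 : AgreeTo (1 + m) (g ^ (k + 1) * (f - g)) 0 :=
        AgreeTo.mul_vanish (((hg.pow_vanish (k + 1)).mono (by omega)))
          (by simpa using ih.sub (AgreeTo.refl m g))
      have h3 : f ^ (k + 1) * f - g ^ (k + 1) * g =
          (f ^ (k + 1) - g ^ (k + 1)) * f + g ^ (k + 1) * (f - g) := by noncomm_ring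
      rw [← sub_eq_zero, ← map_sub, h3, map_add, h1 j hj, h2 j (by omega)]
      simp
    have := congrArg (PowerSeries.coeff m) h
    rw [key hf, key hg, AgreeTo.sum (Finset.range m) (fun k _ => (hpow k).smul _) m
      (Nat.lt_succ_self m)] at this
    exact add_right_cancel this

theorem pgeom_mul {f : A⟦X⟧} (hf : Small f) : pgeom f * (1 - f) = 1 := by
  refine eq_of_agreeTo fun N => ?_
  refine ((pser_agreeTo hf N).mul (AgreeTo.refl N (1 - f))).trans ?_
  simp only [one_smul]
  rw [geom_sum_mul_neg]
  simpa using (AgreeTo.refl N 1).sub (hf.pow_vanish N)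

theorem mul_pgeom {f : A⟦X⟧} (hf : Small f) : (1 - f) * pgeom f = 1 := by
  have : Commute (1 - f) (pgeom f) :=
    pser_commute hf ((Commute.one_left f).sub_left (Commute.refl f))
  rw [this.eq, pgeom_mul hf]

theorem isUnit_of_coeff_zero {f : A⟦X⟧} (h : PowerSeries.coeff 0 f = 1) : IsUnit f := by
  rw [PowerSeries.isUnit_iff_constantCoeff, ← PowerSeries.coeff_zero_eq_constantCoeff_apply, h]
  exact isUnit_one

end FormalSeries

/-! ### The enveloping algebra: generation by the fifteen generators, and its primitive Hopf
structure. -/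

section EnvelopingGenerators

attribute [local instance 100] LieRing.ofAssociativeRing

variable {a b : ℝ}

instance : Fintype Gen where
  elems := Finset.univ.map ⟨Gen.J, fun _ _ h => by injection h⟩ ∪
    Finset.univ.map ⟨Gen.K, fun _ _ h => by injection h⟩ ∪
    Finset.univ.map ⟨Gen.P, fun _ _ h => by injection h⟩ ∪
    Finset.univ.map ⟨Gen.C, fun _ _ h => by injection h⟩ ∪ {.P0, .C0, .D}
  complete g := by rcases g with i | i | i | i | _ | _ | _ <;> simp <;> exact ⟨i, rfl⟩

theorem Conf.eq_sum_basisVec (v : Conf a b) : v = ∑ g, v g • Conf.basisVec a b g := by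
  funext h
  have : (∑ g, v g • Conf.basisVec a b g) h = ∑ g, (v g • Conf.basisVec a b g) h :=
    Finset.sum_apply (M := fun _ : Gen => ℝ) h Finset.univ (fun g => v g • Conf.basisVec a b g)
  rw [this]
  simp only [Conf.smul_apply, Conf.basisVec, mul_ite, mul_one, mul_zero]
  exact ((Finset.sum_ite_eq Finset.univ h v).trans (if_pos (Finset.mem_univ h))).symm

theorem ι_eq_sum_gen (v : Conf a b) :
    UniversalEnvelopingAlgebra.ι ℝ v = ∑ g, v g • gen a b g := by
  conv_lhs => rw [Conf.eq_sum_basisVec v]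
  simp only [map_sum, map_smul, gen]

theorem gen_mul_sub (g h : Gen) : gen a b g * gen a b h - gen a b h * gen a b g =
    ∑ k, Conf.bracket a b (Conf.basisVec a b g) (Conf.basisVec a b h) k • gen a b k := by
  rw [← ι_eq_sum_gen (Conf.bracket a b (Conf.basisVec a b g) (Conf.basisVec a b h))]
  exact (LieHom.map_lie (UniversalEnvelopingAlgebra.ι ℝ)
    (Conf.basisVec a b g) (Conf.basisVec a b h)).symm

theorem evalLimit_gen (g : Gen) : evalLimit a b (FreeAlgebra.ι ℝ g) = gen a b g :=
  FreeAlgebra.lift_ι_apply _ _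

/-- The range `S` contains the Lie algebra, so the universal property gives a homomorphism from the
enveloping algebra into `S`. Followed by the inclusion it is the identity, hence `S` is everything.
-/
theorem evalLimit_surjective : Function.Surjective (evalLimit a b) := by
  let S := (evalLimit a b).range
  have hmem : ∀ v : Conf a b, UniversalEnvelopingAlgebra.ι ℝ v ∈ S := by
    intro v
    rw [ι_eq_sum_gen]
    exact S.sum_mem fun g _ => S.smul_mem ⟨FreeAlgebra.ι ℝ g, evalLimit_gen g⟩ _
  let L : Conf a b →ₗ⁅ℝ⁆ S :=
    { toFun := fun v => ⟨UniversalEnvelopingAlgebra.ι ℝ v, hmem v⟩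
      map_add' := fun x y => Subtype.ext (map_add _ x y)
      map_smul' := fun r x => Subtype.ext (map_smul _ r x)
      map_lie' := fun {x y} => Subtype.ext (LieHom.map_lie _ x y) }
  have h : S.val.comp (UniversalEnvelopingAlgebra.lift ℝ L) = AlgHom.id ℝ (U a b) := by
    apply UniversalEnvelopingAlgebra.hom_ext
    ext v
    change ((UniversalEnvelopingAlgebra.lift ℝ L (UniversalEnvelopingAlgebra.ι ℝ v) : S) : U a b) =
      UniversalEnvelopingAlgebra.ι ℝ v
    rw [UniversalEnvelopingAlgebra.lift_ι_apply]
    rfl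
  intro u
  have := congrArg (fun f : U a b →ₐ[ℝ] U a b => f u) h
  obtain ⟨w, hw⟩ := (UniversalEnvelopingAlgebra.lift ℝ L u).2
  exact ⟨w, hw.trans this⟩

theorem U_induction {p : U a b → Prop} (hscalar : ∀ r : ℝ, p (algebraMap ℝ _ r))
    (hgen : ∀ g, p (gen a b g)) (hadd : ∀ x y, p x → p y → p (x + y))
    (hmul : ∀ x y, p x → p y → p (x * y)) (x : U a b) : p x := by
  obtain ⟨w, rfl⟩ := evalLimit_surjective x
  induction w using FreeAlgebra.induction with
  | grade0 r => rw [AlgHom.commutes]; exact hscalar r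
  | grade1 g => rw [evalLimit_gen]; exact hgen g
  | mul x y hx hy => rw [map_mul]; exact hmul _ _ hx hy
  | add x y hx hy => rw [map_add]; exact hadd _ _ hx hy

theorem U_hom_ext {B : Type} [Semiring B] [Algebra ℝ B] {f g : U a b →ₐ[ℝ] B}
    (h : ∀ k, f (gen a b k) = g (gen a b k)) : f = g := by
  ext1 x
  induction x using U_induction with
  | hscalar r => rw [AlgHom.commutes, AlgHom.commutes]
  | hgen k => exact h k
  | hadd x y hx hy => rw [map_add, map_add, hx, hy]
  | hmul x y hx hy => rw [map_mul, map_mul, hx, hy]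

theorem comul₀_gen (g : Gen) :
    comul₀ a b (gen a b g) = gen a b g ⊗ₜ 1 + 1 ⊗ₜ gen a b g := by
  rw [gen, comul₀, UniversalEnvelopingAlgebra.lift_ι_apply]
  rfl

theorem counit₀_gen (g : Gen) : counit₀ a b (gen a b g) = 0 := by
  rw [gen, counit₀, UniversalEnvelopingAlgebra.lift_ι_apply]
  rfl

theorem antipode₀_gen (g : Gen) : antipode₀ a b (gen a b g) = -gen a b g := by
  change MulOpposite.unop (antipodeOp₀ a b (gen a b g)) = _
  rw [gen, antipodeOp₀, UniversalEnvelopingAlgebra.lift_ι_apply]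
  rfl

theorem antipode₀_mul (x y : U a b) :
    antipode₀ a b (x * y) = antipode₀ a b y * antipode₀ a b x := by
  change MulOpposite.unop (antipodeOp₀ a b (x * y)) = _
  rw [map_mul]
  rfl

theorem antipode₀_algebraMap (r : ℝ) :
    antipode₀ a b (algebraMap ℝ _ r) = algebraMap ℝ _ r := by
  change MulOpposite.unop (antipodeOp₀ a b (algebraMap ℝ _ r)) = _
  rw [AlgHom.commutes]
  rfl

theorem antipode₀_one : antipode₀ a b 1 = 1 := by
  simpa using antipode₀_algebraMap (a := a) (b := b) 1

theorem comul₀_cocomm (x : U a b) :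
    Algebra.TensorProduct.comm ℝ _ _ (comul₀ a b x) = comul₀ a b x := by
  have : ((Algebra.TensorProduct.comm ℝ (U a b) (U a b)).toAlgHom.comp (comul₀ a b)) =
      comul₀ a b := by
    refine U_hom_ext fun g => ?_
    simp [comul₀_gen, add_comm]
  exact congrArg (fun f => f x) this

theorem comul₀_coassoc (x : U a b) :
    Algebra.TensorProduct.assoc ℝ ℝ ℝ _ _ _
      (Algebra.TensorProduct.map (comul₀ a b) (AlgHom.id ℝ _) (comul₀ a b x)) =
    Algebra.TensorProduct.map (AlgHom.id ℝ _) (comul₀ a b) (comul₀ a b x) := by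
  have : ((Algebra.TensorProduct.assoc ℝ ℝ ℝ (U a b) (U a b) (U a b)).toAlgHom.comp
      ((Algebra.TensorProduct.map (comul₀ a b) (AlgHom.id ℝ _)).comp (comul₀ a b))) =
      (Algebra.TensorProduct.map (AlgHom.id ℝ _) (comul₀ a b)).comp (comul₀ a b) := by
    refine U_hom_ext fun g => ?_
    simp [comul₀_gen, TensorProduct.add_tmul, TensorProduct.tmul_add,
      Algebra.TensorProduct.one_def, add_assoc]
  exact congrArg (fun f => f x) this

theorem comul₀_counit_left (x : U a b) : Algebra.TensorProduct.lid ℝ _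
    (Algebra.TensorProduct.map (counit₀ a b) (AlgHom.id ℝ _) (comul₀ a b x)) = x := by
  have : ((Algebra.TensorProduct.lid ℝ (U a b)).toAlgHom.comp
      ((Algebra.TensorProduct.map (counit₀ a b) (AlgHom.id ℝ _)).comp (comul₀ a b))) =
      AlgHom.id ℝ _ := by
    refine U_hom_ext fun g => ?_
    simp [comul₀_gen, counit₀_gen]
  exact congrArg (fun f => f x) this

theorem comul₀_counit_right (x : U a b) : Algebra.TensorProduct.rid ℝ ℝ _
    (Algebra.TensorProduct.map (AlgHom.id ℝ _) (counit₀ a b) (comul₀ a b x)) = x := by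
  have : ((Algebra.TensorProduct.rid ℝ ℝ (U a b)).toAlgHom.comp
      ((Algebra.TensorProduct.map (AlgHom.id ℝ _) (counit₀ a b)).comp (comul₀ a b))) =
      AlgHom.id ℝ _ := by
    refine U_hom_ext fun g => ?_
    simp [comul₀_gen, counit₀_gen]
  exact congrArg (fun f => f x) this

/-- `x ⊗ y ↦ x S₀(y)`. -/
def mulAntipodeRight (a b : ℝ) : U a b ⊗[ℝ] U a b →ₗ[ℝ] U a b :=
  LinearMap.mul' ℝ _ ∘ₗ (antipode₀ a b).lTensor _

/-- `x ⊗ y ↦ S₀(x) y`. -/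
def mulAntipodeLeft (a b : ℝ) : U a b ⊗[ℝ] U a b →ₗ[ℝ] U a b :=
  LinearMap.mul' ℝ _ ∘ₗ (antipode₀ a b).rTensor _

@[simp] theorem mulAntipodeRight_tmul (x y : U a b) :
    mulAntipodeRight a b (x ⊗ₜ y) = x * antipode₀ a b y := rfl

@[simp] theorem mulAntipodeLeft_tmul (x y : U a b) :
    mulAntipodeLeft a b (x ⊗ₜ y) = antipode₀ a b x * y := rfl

theorem mulAntipodeRight_mul (x y : U a b) (t : U a b ⊗[ℝ] U a b) :
    mulAntipodeRight a b ((x ⊗ₜ y) * t) = x * mulAntipodeRight a b t * antipode₀ a b y := by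
  induction t using TensorProduct.induction_on with
  | zero => simp
  | tmul c d => simp [antipode₀_mul, mul_assoc]
  | add s t hs ht => rw [mul_add, map_add, hs, ht, map_add, mul_add, add_mul]

theorem mulAntipodeLeft_mul (x y : U a b) (t : U a b ⊗[ℝ] U a b) :
    mulAntipodeLeft a b (t * (x ⊗ₜ y)) = antipode₀ a b x * mulAntipodeLeft a b t * y := by
  induction t using TensorProduct.induction_on with
  | zero => simp
  | tmul c d => simp [antipode₀_mul, mul_assoc]
  | add s t hs ht => rw [add_mul, map_add, hs, ht, map_add, mul_add, add_mul]

/-- The antipode axiom is the case `t = 1`; an arbitrary left factor is what lets the induction on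
`x` pass through products. For a generator `g` the terms `c g S₀(d)` and `c S₀(d g) = -c g S₀(d)`
cancel. -/
theorem mulAntipodeRight_mul_comul₀ (t : U a b ⊗[ℝ] U a b) (x : U a b) :
    mulAntipodeRight a b (t * comul₀ a b x) = counit₀ a b x • mulAntipodeRight a b t := by
  induction x using U_induction generalizing t with
  | hscalar r =>
    rw [AlgHom.commutes, AlgHom.commutes, Algebra.algebraMap_eq_smul_one, mul_smul_comm, mul_one,
      map_smul]
    rfl
  | hgen g =>
    rw [comul₀_gen, counit₀_gen, zero_smul]
    induction t using TensorProduct.induction_on with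
    | zero => simp
    | tmul c d => simp [mul_add, antipode₀_mul, antipode₀_gen, mul_assoc]
    | add s t hs ht => rw [add_mul, map_add, hs, ht, add_zero]
  | hadd x y hx hy => rw [map_add, mul_add, map_add, hx, hy, map_add, add_smul]
  | hmul x y hx hy => rw [map_mul (comul₀ a b), ← mul_assoc, hy, hx, map_mul, smul_smul, mul_comm]

theorem mulAntipodeLeft_comul₀_mul (t : U a b ⊗[ℝ] U a b) (x : U a b) :
    mulAntipodeLeft a b (comul₀ a b x * t) = counit₀ a b x • mulAntipodeLeft a b t := by
  induction x using U_induction generalizing t with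
  | hscalar r =>
    rw [AlgHom.commutes, AlgHom.commutes, Algebra.algebraMap_eq_smul_one, smul_mul_assoc, one_mul,
      map_smul]
    rfl
  | hgen g =>
    rw [comul₀_gen, counit₀_gen, zero_smul]
    induction t using TensorProduct.induction_on with
    | zero => simp
    | tmul c d => simp [add_mul, antipode₀_mul, antipode₀_gen, mul_assoc]
    | add s t hs ht => rw [mul_add, map_add, hs, ht, add_zero]
  | hadd x y hx hy => rw [map_add, add_mul, map_add, hx, hy, map_add, add_smul]
  | hmul x y hx hy => rw [map_mul (comul₀ a b), mul_assoc, hx, hy, map_mul, smul_smul]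

end EnvelopingGenerators

/-! ### Reduction of `z`-linear identities to constants and to pure tensors. -/

section Density

variable {V W : Type} [Ring V] [Algebra ℝ V] [Ring W] [Algebra ℝ W]

/-- An additive map commuting with `z` is determined by its values on constants. -/
theorem zlinear_ext (Φ Ψ : V⟦X⟧ →+ W⟦X⟧) (hΦ : ∀ x, Φ (z * x) = z * Φ x)
    (hΨ : ∀ x, Ψ (z * x) = z * Ψ x) (h : ∀ v, Φ (PowerSeries.C v) = Ψ (PowerSeries.C v)) :
    Φ = Ψ := by
  ext1 x
  refine eq_of_agreeTo fun N => ?_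
  induction N generalizing x with
  | zero => intro m hm; omega
  | succ N ih =>
    -- Split off the constant term. The remainder is divisible by `z`, and the quotient is needed to
    -- one order less.
    have hx : x = PowerSeries.C (PowerSeries.coeff 0 x) + z * divZ x := by
      ext n
      cases n with
      | zero => simp
      | succ n =>
        rw [map_add, coeff_z_mul_succ, divZ, PowerSeries.coeff_mk, PowerSeries.coeff_C,
          if_neg n.succ_ne_zero, zero_add]
    rw [hx, map_add, map_add, hΦ, hΨ, h]
    refine (AgreeTo.refl _ _).add fun m hm => ?_
    cases m with
    | zero => simp
    | succ m => rw [coeff_z_mul_succ, coeff_z_mul_succ, ih _ m (by omega)]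

/-- An additive map on the completed tensor square commuting with `z` is determined by its values
on pure tensors. -/
theorem zlinear_tensor_ext {V₁ V₂ : Type} [Ring V₁] [Algebra ℝ V₁] [Ring V₂] [Algebra ℝ V₂]
    (Φ Ψ : (V₁ ⊗[ℝ] V₂)⟦X⟧ →+ W⟦X⟧) (hΦ : ∀ x, Φ (z * x) = z * Φ x)
    (hΨ : ∀ x, Ψ (z * x) = z * Ψ x)
    (h : ∀ v w, Φ (PowerSeries.C (v ⊗ₜ w)) = Ψ (PowerSeries.C (v ⊗ₜ w))) : Φ = Ψ := by
  refine zlinear_ext Φ Ψ hΦ hΨ fun t => ?_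
  induction t using TensorProduct.induction_on with
  | zero => simp
  | tmul v w => exact h v w
  | add s t hs ht => simp only [map_add, hs, ht]

end Density


/-! ### The completed tensor square: pure tensors, the flip, and maps applied to one leg. -/

section TensorSquare

variable {A B D : Type} [Ring A] [Algebra ℝ A] [Ring B] [Algebra ℝ B] [Ring D] [Algebra ℝ D]

theorem tens_mul_tens (a b c d : A⟦X⟧) : tens a b * tens c d = tens (a * c) (b * d) := by
  have h : Commute (mapₐ (Algebra.TensorProduct.includeRight : A →ₐ[ℝ] A ⊗[ℝ] A) b)
      (mapₐ Algebra.TensorProduct.includeLeft c) := by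
    ext n
    rw [PowerSeries.coeff_mul, PowerSeries.coeff_mul, ← Finset.Nat.sum_antidiagonal_swap]
    refine Finset.sum_congr rfl fun p _ => ?_
    simp
  rw [tens, tens, tens, map_mul, map_mul, mul_assoc, ← mul_assoc _ _ (mapₐ _ d), h.eq]
  simp only [mul_assoc]

theorem tens_one_one : tens (1 : A⟦X⟧) 1 = 1 := by simp [tens]

theorem tens_C (x y : A) : tens (PowerSeries.C x) (PowerSeries.C y) = PowerSeries.C (x ⊗ₜ y) := by
  rw [tens, mapₐ_C, mapₐ_C, ← map_mul]; simp

theorem add_tens (a b c : A⟦X⟧) : tens (a + b) c = tens a c + tens b c := by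
  simp only [tens, map_add, add_mul]

theorem tens_add (a b c : A⟦X⟧) : tens a (b + c) = tens a b + tens a c := by
  simp only [tens, map_add, mul_add]

theorem sub_tens (a b c : A⟦X⟧) : tens (a - b) c = tens a c - tens b c := by
  simp only [tens, map_sub, sub_mul]

theorem tens_sub (a b c : A⟦X⟧) : tens a (b - c) = tens a b - tens a c := by
  simp only [tens, map_sub, mul_sub]

theorem neg_tens (a c : A⟦X⟧) : tens (-a) c = -tens a c := by
  simp only [tens, map_neg, neg_mul]

theorem tens_neg (a b : A⟦X⟧) : tens a (-b) = -tens a b := by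
  simp only [tens, map_neg, mul_neg]

theorem zero_tens (a : A⟦X⟧) : tens 0 a = 0 := by simp [tens]

theorem tens_zero (a : A⟦X⟧) : tens a 0 = 0 := by simp [tens]

theorem smul_tens (r : ℝ) (a b : A⟦X⟧) : tens (r • a) b = r • tens a b := by
  rw [tens, mapₐ_smul, smul_mul_assoc, tens]

theorem tens_smul (r : ℝ) (a b : A⟦X⟧) : tens a (r • b) = r • tens a b := by
  rw [tens, mapₐ_smul, mul_smul_comm, tens]

theorem z_mul_tens (a b : A⟦X⟧) : tens (z * a) b = z * tens a b := by
  rw [tens, map_mul, mapₐ_z, mul_assoc, tens]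

theorem tens_z_mul (a b : A⟦X⟧) : tens a (z * b) = z * tens a b := by
  rw [tens, map_mul, mapₐ_z, ← mul_assoc, ← z_mul_comm, mul_assoc, tens]

theorem sum_tens {ι : Type*} (s : Finset ι) (f : ι → A⟦X⟧) (b : A⟦X⟧) :
    tens (∑ i ∈ s, f i) b = ∑ i ∈ s, tens (f i) b := by
  simp only [tens, map_sum, Finset.sum_mul]

theorem tens_sum {ι : Type*} (s : Finset ι) (f : ι → A⟦X⟧) (b : A⟦X⟧) :
    tens b (∑ i ∈ s, f i) = ∑ i ∈ s, tens b (f i) := by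
  simp only [tens, map_sum, Finset.mul_sum]

theorem tens_commute {a b c d : A⟦X⟧} (h₁ : Commute a c) (h₂ : Commute b d) :
    Commute (tens a b) (tens c d) := by
  rw [Commute, SemiconjBy, tens_mul_tens, tens_mul_tens, h₁.eq, h₂.eq]

theorem tens_small_left {a : A⟦X⟧} (h : Small a) (b : A⟦X⟧) : Small (tens a b) :=
  (h.mapₐ _).mul_right _

theorem tens_small_right {b : A⟦X⟧} (a : A⟦X⟧) (h : Small b) : Small (tens a b) :=
  (h.mapₐ _).mul_left _

theorem pexp_tens_one (a : A⟦X⟧) : pexp (tens a 1) = tens (pexp a) 1 := by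
  simp only [tens, map_one, mul_one, mapₐ_pexp]

theorem pexp_one_tens (a : A⟦X⟧) : pexp (tens 1 a) = tens 1 (pexp a) := by
  simp only [tens, map_one, one_mul, mapₐ_pexp]

theorem swapZ_tens (a b : A⟦X⟧) : swapZ (tens a b) = tens b a := by
  have h1 : swapZ (mapₐ (Algebra.TensorProduct.includeLeft : A →ₐ[ℝ] A ⊗[ℝ] A) a) =
      mapₐ Algebra.TensorProduct.includeRight a := by
    ext n; simp [swapZ]
  have h2 : swapZ (mapₐ (Algebra.TensorProduct.includeRight : A →ₐ[ℝ] A ⊗[ℝ] A) b) =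
      mapₐ Algebra.TensorProduct.includeLeft b := by
    ext n; simp [swapZ]
  have h3 : swapZ (tens a b) = tens 1 a * tens b 1 := by
    rw [tens, swapZ, map_mul]
    change swapZ _ * swapZ _ = _
    rw [h1, h2]
    simp [tens]
  rw [h3, tens_mul_tens, mul_one, one_mul]

theorem swapZ_mul (x y : (A ⊗[ℝ] A)⟦X⟧) : swapZ (x * y) = swapZ x * swapZ y := map_mul _ _ _

theorem swapZ_one : swapZ (1 : (A ⊗[ℝ] A)⟦X⟧) = 1 := map_one _

theorem swapZ_swapZ (x : (A ⊗[ℝ] A)⟦X⟧) : swapZ (swapZ x) = x := by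
  ext n
  simp only [swapZ, coeff_mapₐ]
  exact (Algebra.TensorProduct.comm ℝ A A).symm_apply_apply _

theorem swapZ_pexp (x : (A ⊗[ℝ] A)⟦X⟧) : swapZ (pexp x) = pexp (swapZ x) := mapₐ_pexp _ x

theorem coeffₗ_apply (n : ℕ) (x : A⟦X⟧) : coeffₗ A n x = PowerSeries.coeff n x := rfl

theorem constₗ_apply (x : A) : constₗ A x = PowerSeries.C x := rfl

theorem coeff_mapₗ (f : A →ₗ[ℝ] B) (n : ℕ) (x : A⟦X⟧) :
    PowerSeries.coeff n (mapₗ f x) = f (PowerSeries.coeff n x) := by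
  simp [mapₗ, coeffₗ_apply]

theorem mapₗ_z_mul (f : A →ₗ[ℝ] B) (x : A⟦X⟧) : mapₗ f (z * x) = z * mapₗ f x := by
  ext n
  cases n with
  | zero => rw [coeff_mapₗ, coeff_z_mul_zero, coeff_z_mul_zero, map_zero]
  | succ n => rw [coeff_mapₗ, coeff_z_mul_succ, coeff_z_mul_succ, coeff_mapₗ]

theorem mapₗ_C (f : A →ₗ[ℝ] B) (a : A) : mapₗ f (PowerSeries.C a) = PowerSeries.C (f a) := by
  ext n
  rw [coeff_mapₗ, PowerSeries.coeff_C, PowerSeries.coeff_C]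
  split_ifs <;> simp

theorem mapₗ_algHom (f : A →ₐ[ℝ] B) (x : A⟦X⟧) : mapₗ f.toLinearMap x = mapₐ f x := by
  ext n
  rw [coeff_mapₗ, coeff_mapₐ]; rfl

theorem mapₐ_z_mul (f : A →ₐ[ℝ] B) (x : A⟦X⟧) : mapₐ f (z * x) = z * mapₐ f x := by
  rw [map_mul, mapₐ_z]

theorem mulZ_z_mul (x : (A ⊗[ℝ] A)⟦X⟧) : mulZ (z * x) = z * mulZ x := mapₗ_z_mul _ x

theorem mulZ_add (x y : (A ⊗[ℝ] A)⟦X⟧) : mulZ (x + y) = mulZ x + mulZ y := map_add _ x y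

theorem tensId_add (L : A⟦X⟧ →ₗ[ℝ] B⟦X⟧) (x y : (A ⊗[ℝ] D)⟦X⟧) :
    tensId L (x + y) = tensId L x + tensId L y := by
  ext n
  simp only [tensId, PowerSeries.coeff_mk, map_add, Finset.sum_add_distrib]

theorem idTens_add (L : A⟦X⟧ →ₗ[ℝ] B⟦X⟧) (x y : (D ⊗[ℝ] A)⟦X⟧) :
    idTens L (x + y) = idTens L x + idTens L y := by
  ext n
  simp only [idTens, PowerSeries.coeff_mk, map_add, Finset.sum_add_distrib]

theorem tensId_z_mul (L : A⟦X⟧ →ₗ[ℝ] B⟦X⟧) (x : (A ⊗[ℝ] D)⟦X⟧) :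
    tensId L (z * x) = z * tensId L x := by
  ext n
  cases n with
  | zero => simp [tensId, coeffₗ_apply]
  | succ n =>
    rw [coeff_z_mul_succ]
    simp only [tensId, PowerSeries.coeff_mk]
    rw [Finset.Nat.sum_antidiagonal_succ']
    simp [coeffₗ_apply]

theorem idTens_z_mul (L : A⟦X⟧ →ₗ[ℝ] B⟦X⟧) (x : (D ⊗[ℝ] A)⟦X⟧) :
    idTens L (z * x) = z * idTens L x := by
  ext n
  cases n with
  | zero => simp [idTens, coeffₗ_apply]
  | succ n =>
    rw [coeff_z_mul_succ]
    simp only [idTens, PowerSeries.coeff_mk]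
    rw [Finset.Nat.sum_antidiagonal_succ']
    simp [coeffₗ_apply]

/-- A constant series has only a zeroth coefficient, so the convolution defining `tensId` reduces to
the single pair `(n, 0)`. -/
theorem tensId_C_tmul (L : A⟦X⟧ →ₗ[ℝ] B⟦X⟧) (x : A) (d : D) :
    tensId L (PowerSeries.C (x ⊗ₜ d)) =
      mapₐ Algebra.TensorProduct.includeLeft (L (PowerSeries.C x)) * PowerSeries.C (1 ⊗ₜ d) := by
  ext n
  rw [PowerSeries.coeff_mul_C, coeff_mapₐ]
  simp only [tensId, PowerSeries.coeff_mk]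
  rw [Finset.sum_eq_single (n, 0)]
  · simp [coeffₗ_apply, constₗ_apply]
  · rintro ⟨i, j⟩ hp hne
    rw [Finset.HasAntidiagonal.mem_antidiagonal] at hp
    have : j ≠ 0 := by rintro rfl; exact hne (by simpa using hp)
    simp [coeffₗ_apply, PowerSeries.coeff_C, this]
  · intro h; simp at h

theorem idTens_C_tmul (L : A⟦X⟧ →ₗ[ℝ] B⟦X⟧) (x : A) (d : D) :
    idTens L (PowerSeries.C (d ⊗ₜ x)) =
      PowerSeries.C (d ⊗ₜ 1) * mapₐ Algebra.TensorProduct.includeRight (L (PowerSeries.C x)) := by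
  ext n
  rw [PowerSeries.coeff_C_mul, coeff_mapₐ]
  simp only [idTens, PowerSeries.coeff_mk]
  rw [Finset.sum_eq_single (n, 0)]
  · simp [coeffₗ_apply, constₗ_apply]
  · rintro ⟨i, j⟩ hp hne
    rw [Finset.HasAntidiagonal.mem_antidiagonal] at hp
    have : j ≠ 0 := by rintro rfl; exact hne (by simpa using hp)
    simp [coeffₗ_apply, PowerSeries.coeff_C, this]
  · intro h; simp at h

theorem mulZ_mapₐ_left (x : A⟦X⟧) (y : A) :
    mulZ (mapₐ Algebra.TensorProduct.includeLeft x * PowerSeries.C (1 ⊗ₜ[ℝ] y)) =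
      x * PowerSeries.C y := by
  ext n
  rw [mulZ, coeff_mapₗ, PowerSeries.coeff_mul_C, PowerSeries.coeff_mul_C, coeff_mapₐ]
  simp

theorem mulZ_mapₐ_right (x : A⟦X⟧) (y : A) :
    mulZ (PowerSeries.C (y ⊗ₜ[ℝ] 1) * mapₐ Algebra.TensorProduct.includeRight x) =
      PowerSeries.C y * x := by
  ext n
  rw [mulZ, coeff_mapₗ, PowerSeries.coeff_C_mul, PowerSeries.coeff_C_mul, coeff_mapₐ]
  simp

end TensorSquare

/-! ### Drinfeld twists: the Hopf algebra and the triangular `R`-matrix defined by a cocycle. -/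

section TwistTheory

variable {a b : ℝ}

/-- The coefficientwise undeformed coproduct. -/
abbrev comulZ (a b : ℝ) : (U a b)⟦X⟧ →+* (U a b ⊗[ℝ] U a b)⟦X⟧ := mapₐ (comul₀ a b)

/-- `Δ₀ ⊗ id` on the completed tensor square. -/
def comulLeftZ (a b : ℝ) : (U a b ⊗[ℝ] U a b)⟦X⟧ →+* (U a b ⊗[ℝ] (U a b ⊗[ℝ] U a b))⟦X⟧ :=
  (mapₐ (Algebra.TensorProduct.assoc ℝ ℝ ℝ (U a b) (U a b) (U a b)).toAlgHom).comp
    (mapₐ (Algebra.TensorProduct.map (comul₀ a b) (AlgHom.id ℝ _)))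

/-- `id ⊗ Δ₀` on the completed tensor square. -/
def comulRightZ (a b : ℝ) : (U a b ⊗[ℝ] U a b)⟦X⟧ →+* (U a b ⊗[ℝ] (U a b ⊗[ℝ] U a b))⟦X⟧ :=
  mapₐ (Algebra.TensorProduct.map (AlgHom.id ℝ _) (comul₀ a b))

theorem leg12_mul (x y : (U a b ⊗[ℝ] U a b)⟦X⟧) : leg12 (x * y) = leg12 x * leg12 y :=
  map_mul _ _ _

theorem leg13_mul (x y : (U a b ⊗[ℝ] U a b)⟦X⟧) : leg13 (x * y) = leg13 x * leg13 y :=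
  map_mul _ _ _

theorem leg23_mul (x y : (U a b ⊗[ℝ] U a b)⟦X⟧) : leg23 (x * y) = leg23 x * leg23 y :=
  map_mul _ _ _

theorem leg12_one : leg12 (1 : (U a b ⊗[ℝ] U a b)⟦X⟧) = 1 := map_one _

theorem leg13_one : leg13 (1 : (U a b ⊗[ℝ] U a b)⟦X⟧) = 1 := map_one _

theorem leg23_one : leg23 (1 : (U a b ⊗[ℝ] U a b)⟦X⟧) = 1 := map_one _

theorem twComul_apply (F : (U a b ⊗[ℝ] U a b)⟦X⟧) (x : (U a b)⟦X⟧) :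
    twComul F x = F * comulZ a b x * Ring.inverse F := by
  change F * mapₗ _ x * Ring.inverse F = _
  rw [mapₗ_algHom]

theorem twAntipode_apply (F : (U a b ⊗[ℝ] U a b)⟦X⟧) (x : (U a b)⟦X⟧) :
    twAntipode F x = twElement F * mapₗ (antipode₀ a b) x * Ring.inverse (twElement F) := rfl

theorem mul_z_mul (x y : (U a b ⊗[ℝ] (U a b ⊗[ℝ] U a b))⟦X⟧) : x * (z * y) = z * (x * y) := by
  rw [← mul_assoc, ← z_mul_comm, mul_assoc]

theorem UU_hom_ext {B : Type} [Ring B] [Algebra ℝ B] {f g : U a b ⊗[ℝ] U a b →ₐ[ℝ] B}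
    (h₁ : ∀ k, f (gen a b k ⊗ₜ 1) = g (gen a b k ⊗ₜ 1))
    (h₂ : ∀ k, f (1 ⊗ₜ gen a b k) = g (1 ⊗ₜ gen a b k)) : f = g := by
  have hl : f.comp Algebra.TensorProduct.includeLeft = g.comp Algebra.TensorProduct.includeLeft :=
    U_hom_ext h₁
  have hr : f.comp Algebra.TensorProduct.includeRight = g.comp Algebra.TensorProduct.includeRight :=
    U_hom_ext h₂
  refine Algebra.TensorProduct.ext' fun x y => ?_
  have hx : f (x ⊗ₜ 1) = g (x ⊗ₜ 1) := congrArg (fun φ => φ x) hl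
  have hy : f (1 ⊗ₜ y) = g (1 ⊗ₜ y) := congrArg (fun φ => φ y) hr
  rw [show x ⊗ₜ[ℝ] y = (x ⊗ₜ 1) * (1 ⊗ₜ y) by simp, map_mul, map_mul, hx, hy]

theorem mapₐ_congr {A B : Type} [Ring A] [Algebra ℝ A] [Ring B] [Algebra ℝ B]
    {f g : A →ₐ[ℝ] B} (h : f = g) (x : A⟦X⟧) : mapₐ f x = mapₐ g x := by rw [h]

theorem leg12_eq (x : (U a b ⊗[ℝ] U a b)⟦X⟧) :
    assocZ (mapₐ Algebra.TensorProduct.includeLeft x) = leg12 x := by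
  refine mapₐ_congr (f := (Algebra.TensorProduct.assoc ℝ ℝ ℝ (U a b) (U a b) (U a b)).toAlgHom.comp
    Algebra.TensorProduct.includeLeft)
    (g := Algebra.TensorProduct.map (AlgHom.id ℝ _) Algebra.TensorProduct.includeLeft)
    (UU_hom_ext ?_ ?_) x <;> intro k <;> simp

theorem leg12_commute_C (x : (U a b ⊗[ℝ] U a b)⟦X⟧) (w : U a b) :
    Commute (leg12 x) (PowerSeries.C (1 ⊗ₜ (1 ⊗ₜ w))) := by
  ext n
  rw [PowerSeries.coeff_mul_C, PowerSeries.coeff_C_mul, leg12, coeff_mapₐ]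
  induction PowerSeries.coeff n x using TensorProduct.induction_on with
  | zero => simp
  | tmul u v => simp
  | add s t hs ht => rw [map_add, add_mul, mul_add, hs, ht]

theorem leg23_commute_C (x : (U a b ⊗[ℝ] U a b)⟦X⟧) (w : U a b) :
    Commute (leg23 x) (PowerSeries.C (w ⊗ₜ 1)) := by
  ext n
  rw [PowerSeries.coeff_mul_C, PowerSeries.coeff_C_mul, leg23, coeff_mapₐ]
  simp

/-- Both sides are additive and `z`-linear in `x`, so constants `v ⊗ w` suffice. There the factor
`w` sits in the third leg and commutes with the inverse of `F₁₂`. -/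
theorem assocZ_tensId_twComul (F x : (U a b ⊗[ℝ] U a b)⟦X⟧) :
    assocZ (tensId (twComul F) x) = leg12 F * comulLeftZ a b x * leg12 (Ring.inverse F) := by
  let Φ : (U a b ⊗[ℝ] U a b)⟦X⟧ →+ (U a b ⊗[ℝ] (U a b ⊗[ℝ] U a b))⟦X⟧ :=
    AddMonoidHom.mk' (fun x => assocZ (tensId (twComul F) x)) fun x y => by
      rw [tensId_add, assocZ, map_add]; rfl
  let Ψ : (U a b ⊗[ℝ] U a b)⟦X⟧ →+ (U a b ⊗[ℝ] (U a b ⊗[ℝ] U a b))⟦X⟧ :=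
    AddMonoidHom.mk' (fun x => leg12 F * comulLeftZ a b x * leg12 (Ring.inverse F)) fun x y => by
      rw [map_add, mul_add, add_mul]
  refine DFunLike.congr_fun (zlinear_tensor_ext Φ Ψ ?_ ?_ ?_) x
  · intro x
    change assocZ (tensId _ _) = z * assocZ (tensId _ _)
    rw [tensId_z_mul, assocZ, mapₐ_z_mul, assocZ]
  · intro x
    change _ * comulLeftZ a b (z * x) * _ = z * (_ * comulLeftZ a b x * _)
    rw [comulLeftZ, RingHom.comp_apply, mapₐ_z_mul, mapₐ_z_mul, mul_z_mul, mul_assoc]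
    rfl
  · intro v w
    change assocZ (tensId _ _) = _ * comulLeftZ a b _ * _
    rw [tensId_C_tmul, twComul_apply, assocZ, map_mul, map_mul, map_mul, map_mul, map_mul,
      mapₐ_C _ (1 ⊗ₜ[ℝ] w)]
    change assocZ (mapₐ _ F) * assocZ (mapₐ _ _) * assocZ (mapₐ _ _) * _ = _
    rw [leg12_eq, leg12_eq, leg12_eq, mul_assoc]
    have := (leg12_commute_C (Ring.inverse F) w).eq
    rw [show (Algebra.TensorProduct.assoc ℝ ℝ ℝ (U a b) (U a b) (U a b)).toAlgHom
      ((1 : U a b ⊗[ℝ] U a b) ⊗ₜ[ℝ] w) = 1 ⊗ₜ (1 ⊗ₜ w) from rfl, this, ← mul_assoc,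
      mul_assoc (leg12 F)]
    congr 2
    rw [comulLeftZ, RingHom.comp_apply, mapₐ_C, mapₐ_C, leg12, mapₐ_C, mapₐ_C, ← map_mul]
    congr 1
    simp only [Algebra.TensorProduct.map_tmul,
      AlgHom.coe_id, id_eq]
    induction comul₀ a b v using TensorProduct.induction_on with
    | zero => simp
    | tmul u v => simp
    | add s t hs ht => rw [map_add, add_mul, hs, ht, TensorProduct.add_tmul, map_add]

theorem idTens_twComul (F x : (U a b ⊗[ℝ] U a b)⟦X⟧) :
    idTens (twComul F) x = leg23 F * comulRightZ a b x * leg23 (Ring.inverse F) := by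
  let Φ : (U a b ⊗[ℝ] U a b)⟦X⟧ →+ (U a b ⊗[ℝ] (U a b ⊗[ℝ] U a b))⟦X⟧ :=
    AddMonoidHom.mk' (fun x => idTens (twComul F) x) fun x y => idTens_add _ x y
  let Ψ : (U a b ⊗[ℝ] U a b)⟦X⟧ →+ (U a b ⊗[ℝ] (U a b ⊗[ℝ] U a b))⟦X⟧ :=
    AddMonoidHom.mk' (fun x => leg23 F * comulRightZ a b x * leg23 (Ring.inverse F)) fun x y => by
      rw [map_add, mul_add, add_mul]
  refine DFunLike.congr_fun (zlinear_tensor_ext Φ Ψ ?_ ?_ ?_) x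
  · intro x; exact idTens_z_mul _ x
  · intro x
    change _ * comulRightZ a b (z * x) * _ = z * (_ * comulRightZ a b x * _)
    rw [comulRightZ, mapₐ_z_mul, mul_z_mul, mul_assoc]
  · intro v w
    change idTens _ _ = _ * comulRightZ a b _ * _
    rw [idTens_C_tmul, twComul_apply, map_mul, map_mul]
    change _ * (leg23 F * leg23 _ * leg23 _) = _
    rw [← mul_assoc, ← mul_assoc, ← (leg23_commute_C F v).eq, mul_assoc (leg23 F)]
    congr 2
    rw [comulRightZ, leg23, mapₐ_C, mapₐ_C, mapₐ_C, ← map_mul]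
    simp

/-- The cyclic permutation `x ⊗ y ⊗ w ↦ y ⊗ w ⊗ x`. -/
def rotate (a b : ℝ) : U a b ⊗[ℝ] (U a b ⊗[ℝ] U a b) →ₐ[ℝ] U a b ⊗[ℝ] (U a b ⊗[ℝ] U a b) :=
  (Algebra.TensorProduct.assoc ℝ ℝ ℝ (U a b) (U a b) (U a b)).toAlgHom.comp
    (Algebra.TensorProduct.comm ℝ (U a b) (U a b ⊗[ℝ] U a b)).toAlgHom

/-- The transposition `x ⊗ y ⊗ w ↦ x ⊗ w ⊗ y`. -/
def swapLast (a b : ℝ) : U a b ⊗[ℝ] (U a b ⊗[ℝ] U a b) →ₐ[ℝ] U a b ⊗[ℝ] (U a b ⊗[ℝ] U a b) :=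
  Algebra.TensorProduct.map (AlgHom.id ℝ _)
    (Algebra.TensorProduct.comm ℝ (U a b) (U a b)).toAlgHom

@[simp] theorem rotate_tmul (x y w : U a b) :
    rotate a b (x ⊗ₜ (y ⊗ₜ w)) = y ⊗ₜ (w ⊗ₜ x) := rfl

@[simp] theorem swapLast_tmul (x y w : U a b) :
    swapLast a b (x ⊗ₜ (y ⊗ₜ w)) = x ⊗ₜ (w ⊗ₜ y) := rfl

/-! ### Permutations of three legs, acting on the leg embeddings and on the iterated coproducts. -/

section Permutations

variable (x : (U a b ⊗[ℝ] U a b)⟦X⟧)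

theorem rotate_leg12 : mapₐ (rotate a b) (leg12 x) = leg13 (swapZ x) := by
  refine mapₐ_congr (f := (rotate a b).comp (Algebra.TensorProduct.map (AlgHom.id ℝ _)
    Algebra.TensorProduct.includeLeft)) (g := (Algebra.TensorProduct.map (AlgHom.id ℝ _)
    Algebra.TensorProduct.includeRight).comp (Algebra.TensorProduct.comm ℝ _ _).toAlgHom)
    (UU_hom_ext ?_ ?_) x <;> intro k <;> simp

theorem rotate_leg23 : mapₐ (rotate a b) (leg23 x) = leg12 x := by
  refine mapₐ_congr (f := (rotate a b).comp Algebra.TensorProduct.includeRight)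
    (g := Algebra.TensorProduct.map (AlgHom.id ℝ _) Algebra.TensorProduct.includeLeft)
    (UU_hom_ext ?_ ?_) x <;> intro k <;> simp

theorem rotate_leg13 : mapₐ (rotate a b) (leg13 x) = leg23 (swapZ x) := by
  refine mapₐ_congr (f := (rotate a b).comp (Algebra.TensorProduct.map (AlgHom.id ℝ _)
    Algebra.TensorProduct.includeRight)) (g := AlgHom.comp
    Algebra.TensorProduct.includeRight (Algebra.TensorProduct.comm ℝ _ _).toAlgHom)
    (UU_hom_ext ?_ ?_) x <;> intro k <;> simp

theorem swapLast_leg12 : mapₐ (swapLast a b) (leg12 x) = leg13 x := by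
  refine mapₐ_congr (f := (swapLast a b).comp (Algebra.TensorProduct.map (AlgHom.id ℝ _)
    Algebra.TensorProduct.includeLeft)) (g := Algebra.TensorProduct.map (AlgHom.id ℝ _)
    Algebra.TensorProduct.includeRight) (UU_hom_ext ?_ ?_) x <;> intro k <;> simp

theorem swapLast_leg13 : mapₐ (swapLast a b) (leg13 x) = leg12 x := by
  refine mapₐ_congr (f := (swapLast a b).comp (Algebra.TensorProduct.map (AlgHom.id ℝ _)
    Algebra.TensorProduct.includeRight)) (g := Algebra.TensorProduct.map (AlgHom.id ℝ _)
    Algebra.TensorProduct.includeLeft) (UU_hom_ext ?_ ?_) x <;> intro k <;> simp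

theorem swapLast_leg23 : mapₐ (swapLast a b) (leg23 x) = leg23 (swapZ x) := by
  refine mapₐ_congr (f := (swapLast a b).comp Algebra.TensorProduct.includeRight)
    (g := AlgHom.comp Algebra.TensorProduct.includeRight
      (Algebra.TensorProduct.comm ℝ _ _).toAlgHom)
    (UU_hom_ext ?_ ?_) x <;> intro k <;> simp

/-- The homomorphism inducing `comulLeftZ`. -/
def comulLeft (a b : ℝ) : U a b ⊗[ℝ] U a b →ₐ[ℝ] U a b ⊗[ℝ] (U a b ⊗[ℝ] U a b) :=
  (Algebra.TensorProduct.assoc ℝ ℝ ℝ (U a b) (U a b) (U a b)).toAlgHom.comp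
    (Algebra.TensorProduct.map (comul₀ a b) (AlgHom.id ℝ _))

@[simp] theorem comulLeft_gen_left (k : Gen) : comulLeft a b (gen a b k ⊗ₜ 1) =
    gen a b k ⊗ₜ (1 ⊗ₜ 1) + 1 ⊗ₜ (gen a b k ⊗ₜ 1) := by
  simp [comulLeft, comul₀_gen, TensorProduct.add_tmul]

@[simp] theorem comulLeft_gen_right (k : Gen) : comulLeft a b (1 ⊗ₜ gen a b k) =
    1 ⊗ₜ (1 ⊗ₜ gen a b k) := by
  simp [comulLeft, Algebra.TensorProduct.one_def]

theorem rotate_comulRightZ : mapₐ (rotate a b) (comulRightZ a b x) = comulLeftZ a b (swapZ x) := by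
  refine mapₐ_congr (f := (rotate a b).comp (Algebra.TensorProduct.map (AlgHom.id ℝ _)
    (comul₀ a b))) (g := (comulLeft a b).comp (Algebra.TensorProduct.comm ℝ _ _).toAlgHom)
    (UU_hom_ext ?_ ?_) x <;> intro k <;>
    simp [comul₀_gen, TensorProduct.tmul_add, Algebra.TensorProduct.one_def]

/-- The two permutations send `x₁ ⊗ x₂ ⊗ y` to `x₂ ⊗ y ⊗ x₁` and to `x₁ ⊗ y ⊗ x₂`. These agree on
the image of `Δ₀ ⊗ id` because `Δ₀` is cocommutative. -/
theorem rotate_comulLeftZ :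
    mapₐ (rotate a b) (comulLeftZ a b x) = mapₐ (swapLast a b) (comulLeftZ a b x) := by
  refine mapₐ_congr (f := (rotate a b).comp (comulLeft a b))
    (g := (swapLast a b).comp (comulLeft a b))
    (UU_hom_ext ?_ ?_) x <;> intro k <;> simp [add_comm]

theorem swapLast_comulRightZ : mapₐ (swapLast a b) (comulRightZ a b x) = comulRightZ a b x := by
  refine mapₐ_congr (f := (swapLast a b).comp (Algebra.TensorProduct.map (AlgHom.id ℝ _)
    (comul₀ a b))) (g := Algebra.TensorProduct.map (AlgHom.id ℝ _) (comul₀ a b))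
    (UU_hom_ext ?_ ?_) x <;> intro k <;>
    simp [comul₀_gen, TensorProduct.tmul_add, Algebra.TensorProduct.one_def, add_comm]

theorem rotate_comulLeftZ_swapZ :
    mapₐ (rotate a b) (comulLeftZ a b (swapZ x)) =
      mapₐ (swapLast a b) (mapₐ (rotate a b) (comulRightZ a b x)) := by
  rw [rotate_comulLeftZ, rotate_comulRightZ]

theorem rotate_rotate_comulLeftZ :
    mapₐ (rotate a b) (mapₐ (rotate a b) (comulLeftZ a b x)) = comulRightZ a b (swapZ x) := by
  refine mapₐ_congr (f := (rotate a b).comp ((rotate a b).comp (comulLeft a b)))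
    (g := (Algebra.TensorProduct.map (AlgHom.id ℝ _) (comul₀ a b)).comp
      (Algebra.TensorProduct.comm ℝ _ _).toAlgHom)
    (UU_hom_ext ?_ ?_) x <;> intro k <;>
    simp [comul₀_gen, TensorProduct.tmul_add, Algebra.TensorProduct.one_def, add_comm]

theorem swapLast_rotate_comulLeftZ :
    mapₐ (swapLast a b) (mapₐ (rotate a b) (comulLeftZ a b x)) = comulLeftZ a b x := by
  refine mapₐ_congr (f := (swapLast a b).comp ((rotate a b).comp (comulLeft a b)))
    (g := comulLeft a b) (UU_hom_ext ?_ ?_) x <;> intro k <;> simp [add_comm]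

end Permutations

/-- `f₁ ⊗ f₂ ↦ f₁ S₀(f₂)` coefficientwise is `twElement`; this is `f₁ ⊗ f₂ ↦ S₀(f₁) f₂`. -/
def twElement' (F : (U a b ⊗[ℝ] U a b)⟦X⟧) : (U a b)⟦X⟧ := mapₗ (mulAntipodeLeft a b) F

theorem twElement_eq (F : (U a b ⊗[ℝ] U a b)⟦X⟧) :
    twElement F = mapₗ (mulAntipodeRight a b) F := by
  ext n
  rw [twElement, mulZ, coeff_mapₗ, coeff_mapₗ, coeff_mapₗ]
  rfl

theorem mul_z_mul' {A : Type} [Ring A] (x y : A⟦X⟧) : x * (z * y) = z * (x * y) := by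
  rw [← mul_assoc, ← PowerSeries.X_mul, mul_assoc]

/-- On a pure tensor the left side is `x v S₀(y) v⁻¹`, and `x v S₀(y)` is `m (id ⊗ S₀)` of `(x ⊗ y)
F` because `S₀` reverses products. -/
theorem mulZ_idTens_twAntipode (F G : (U a b ⊗[ℝ] U a b)⟦X⟧) :
    mulZ (idTens (twAntipode F) G) = twElement (G * F) * Ring.inverse (twElement F) := by
  set w := Ring.inverse (twElement F)
  refine DFunLike.congr_fun (zlinear_tensor_ext
    (AddMonoidHom.mk' (fun G => mulZ (idTens (twAntipode F) G)) fun x y => by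
      rw [idTens_add, mulZ_add])
    (AddMonoidHom.mk' (fun G => twElement (G * F) * w) fun x y => by
      rw [add_mul, twElement_eq, map_add, ← twElement_eq, ← twElement_eq, add_mul])
    ?_ ?_ ?_) G
  · intro x
    change mulZ (idTens _ _) = z * mulZ (idTens _ _)
    rw [idTens_z_mul, mulZ_z_mul]
  · intro x
    change twElement (_ * F) * w = z * (twElement (_ * F) * w)
    rw [mul_assoc, twElement_eq, mapₗ_z_mul, mul_assoc, ← twElement_eq]
  · intro x y
    change mulZ (idTens _ _) = twElement (_ * F) * w
    rw [idTens_C_tmul, mulZ_mapₐ_right, twAntipode_apply, mapₗ_C, ← mul_assoc, ← mul_assoc]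
    congr 1
    ext n
    rw [twElement_eq, twElement_eq, coeff_mapₗ, PowerSeries.coeff_C_mul, mulAntipodeRight_mul,
      PowerSeries.coeff_mul_C, PowerSeries.coeff_C_mul, coeff_mapₗ]

theorem mulZ_tensId_twAntipode (F G : (U a b ⊗[ℝ] U a b)⟦X⟧) {E : (U a b ⊗[ℝ] U a b)⟦X⟧}
    (hE : Ring.inverse (twElement F) = twElement' E) :
    mulZ (tensId (twAntipode F) G) = twElement F * twElement' (E * G) := by
  refine DFunLike.congr_fun (zlinear_tensor_ext
    (AddMonoidHom.mk' (fun G => mulZ (tensId (twAntipode F) G)) fun x y => by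
      rw [tensId_add, mulZ_add])
    (AddMonoidHom.mk' (fun G => twElement F * twElement' (E * G)) fun x y => by
      rw [mul_add, twElement', map_add, mul_add]; rfl)
    ?_ ?_ ?_) G
  · intro x
    change mulZ (tensId _ _) = z * mulZ (tensId _ _)
    rw [tensId_z_mul, mulZ_z_mul]
  · intro x
    change _ * twElement' (E * _) = z * (_ * twElement' (E * _))
    rw [mul_z_mul', twElement', mapₗ_z_mul, mul_z_mul']
    rfl
  · intro x y
    change mulZ (tensId _ _) = twElement F * twElement' (E * _)
    rw [tensId_C_tmul, mulZ_mapₐ_left, twAntipode_apply, mapₗ_C, hE, mul_assoc, mul_assoc]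
    congr 1
    ext n
    rw [twElement', twElement', coeff_mapₗ, PowerSeries.coeff_mul_C, mulAntipodeLeft_mul,
      ← mul_assoc, PowerSeries.coeff_mul_C, PowerSeries.coeff_C_mul, coeff_mapₗ]

theorem twElement_mul_comulZ (F : (U a b ⊗[ℝ] U a b)⟦X⟧) (x : (U a b)⟦X⟧) :
    twElement (F * comulZ a b x) =
      twElement F * mapₐ ((Algebra.ofId ℝ (U a b)).comp (counit₀ a b)) x := by
  ext n
  rw [twElement_eq, twElement_eq, coeff_mapₗ, PowerSeries.coeff_mul, PowerSeries.coeff_mul, map_sum]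
  refine Finset.sum_congr rfl fun p _ => ?_
  rw [coeff_mapₐ, coeff_mapₐ, mulAntipodeRight_mul_comul₀, coeff_mapₗ, AlgHom.comp_apply,
    Algebra.ofId_apply, ← Algebra.commutes, Algebra.smul_def]

theorem twElement'_comulZ_mul (F : (U a b ⊗[ℝ] U a b)⟦X⟧) (x : (U a b)⟦X⟧) :
    twElement' (comulZ a b x * F) =
      twElement' F * mapₐ ((Algebra.ofId ℝ (U a b)).comp (counit₀ a b)) x := by
  ext n
  rw [twElement', twElement', coeff_mapₗ, PowerSeries.coeff_mul, PowerSeries.coeff_mul, map_sum,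
    ← Finset.Nat.sum_antidiagonal_swap]
  refine Finset.sum_congr rfl fun p _ => ?_
  rw [coeff_mapₐ, coeff_mapₐ, mulAntipodeLeft_comul₀_mul, coeff_mapₗ, AlgHom.comp_apply,
    Algebra.ofId_apply, ← Algebra.commutes, Algebra.smul_def]
  rfl

/-- `x ⊗ y ⊗ w ↦ S₀(x) y S₀(w)`. -/
def mulAntipodeTriple (a b : ℝ) : U a b ⊗[ℝ] (U a b ⊗[ℝ] U a b) →ₗ[ℝ] U a b :=
  LinearMap.mul' ℝ _ ∘ₗ TensorProduct.map (antipode₀ a b) (mulAntipodeRight a b)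

@[simp] theorem mulAntipodeTriple_tmul (x y w : U a b) :
    mulAntipodeTriple a b (x ⊗ₜ (y ⊗ₜ w)) = antipode₀ a b x * (y * antipode₀ a b w) := rfl

theorem mulAntipodeTriple_legs (s t : U a b ⊗[ℝ] U a b) :
    mulAntipodeTriple a b
      (Algebra.TensorProduct.map (AlgHom.id ℝ _) Algebra.TensorProduct.includeLeft s *
        Algebra.TensorProduct.includeRight t) =
      mulAntipodeLeft a b s * mulAntipodeRight a b t := by
  induction s using TensorProduct.induction_on with
  | zero => simp
  | add s s' hs hs' => simp only [map_add, add_mul, hs, hs']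
  | tmul x y =>
    induction t using TensorProduct.induction_on with
    | zero => simp
    | add t t' ht ht' => simp only [map_add, mul_add, ht, ht']
    | tmul u v => simp [mul_assoc]

/-- On `s = x ⊗ y`, `t = u ⊗ v` the value is `S₀(u) S₀(x₁) x₂ v₁ S₀(v₂) S₀(y)`, where `x₁ ⊗ x₂` and
`v₁ ⊗ v₂` stand for the coproducts of `x` and `v`; the two inner pairs collapse to counits by the
antipode axioms. -/
theorem mulAntipodeTriple_comuls (s t : U a b ⊗[ℝ] U a b) :
    mulAntipodeTriple a b (comulLeft a b s *
        Algebra.TensorProduct.map (AlgHom.id ℝ _) (comul₀ a b) t) =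
      antipode₀ a b (Algebra.TensorProduct.rid ℝ ℝ _
        (Algebra.TensorProduct.map (AlgHom.id ℝ _) (counit₀ a b) t)) *
      antipode₀ a b (Algebra.TensorProduct.lid ℝ _
        (Algebra.TensorProduct.map (counit₀ a b) (AlgHom.id ℝ _) s)) := by
  have key : ∀ (X Y : U a b ⊗[ℝ] U a b) (y u : U a b), mulAntipodeTriple a b
      (Algebra.TensorProduct.assoc ℝ ℝ ℝ _ _ _ (X ⊗ₜ y) * (u ⊗ₜ Y)) =
      antipode₀ a b u * (mulAntipodeLeft a b X * mulAntipodeRight a b Y) * antipode₀ a b y := by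
    intro X Y y u
    induction X using TensorProduct.induction_on with
    | zero => simp
    | add s s' hs hs' => simp only [map_add, TensorProduct.add_tmul, add_mul, mul_add, hs, hs']
    | tmul x₁ x₂ =>
      induction Y using TensorProduct.induction_on with
      | zero => simp
      | add s s' hs hs' => simp only [map_add, TensorProduct.tmul_add, add_mul, mul_add, hs, hs']
      | tmul y₁ y₂ => simp [mul_assoc, antipode₀_mul]
  have h1 : ∀ x, mulAntipodeLeft a b (comul₀ a b x) = counit₀ a b x • 1 := by
    intro x
    rw [← mul_one (comul₀ a b x), mulAntipodeLeft_comul₀_mul, Algebra.TensorProduct.one_def,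
      mulAntipodeLeft_tmul, antipode₀_one, mul_one]
  have h2 : ∀ x, mulAntipodeRight a b (comul₀ a b x) = counit₀ a b x • 1 := by
    intro x
    rw [← one_mul (comul₀ a b x), mulAntipodeRight_mul_comul₀, Algebra.TensorProduct.one_def,
      mulAntipodeRight_tmul, antipode₀_one, mul_one]
  induction s using TensorProduct.induction_on with
  | zero => simp
  | add s s' hs hs' => simp only [map_add, add_mul, mul_add, hs, hs']
  | tmul x y =>
    induction t using TensorProduct.induction_on with
    | zero => simp
    | add t t' ht ht' => simp only [map_add, mul_add, add_mul, ht, ht']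
    | tmul u v =>
      have : comulLeft a b (x ⊗ₜ y) *
          Algebra.TensorProduct.map (AlgHom.id ℝ _) (comul₀ a b) (u ⊗ₜ v) =
          Algebra.TensorProduct.assoc ℝ ℝ ℝ _ _ _ (comul₀ a b x ⊗ₜ y) * (u ⊗ₜ comul₀ a b v) := rfl
      rw [this, key, h1, h2]
      simp [smul_smul, mul_comm]

section Hopf

variable {F : (U a b ⊗[ℝ] U a b)⟦X⟧} (hF : IsTwist F) (h0 : PowerSeries.coeff 0 F = 1)

include h0

theorem coeff_zero_twElement : PowerSeries.coeff 0 (twElement F) = 1 := by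
  rw [twElement_eq, coeff_mapₗ, h0, Algebra.TensorProduct.one_def, mulAntipodeRight_tmul,
    antipode₀_one, mul_one]

theorem isUnit_twElement : IsUnit (twElement F) := isUnit_of_coeff_zero (coeff_zero_twElement h0)

include hF

/-- The cocycle identity rearranges to `F₁₂⁻¹ F₂₃ = (Δ₀ ⊗ id)F · (id ⊗ Δ₀)F⁻¹`. Applying `m (S₀ ⊗ id
⊗ S₀)` turns the left side into `twElement' F⁻¹ * twElement F`, while the right side collapses to 1
by counit normalisation. So a left inverse of the unit `v` is found explicitly. -/
theorem inverse_twElement : Ring.inverse (twElement F) = twElement' (Ring.inverse F) := by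
  have hcoc : leg12 F * comulLeftZ a b F = leg23 F * comulRightZ a b F := hF.cocycle
  set G := Ring.inverse F with hG
  have hFG : F * G = 1 := Ring.mul_inverse_cancel _ hF.isUnit
  have hGF : G * F = 1 := Ring.inverse_mul_cancel _ hF.isUnit
  have h1 : leg12 G * leg23 F = comulLeftZ a b F * comulRightZ a b G := by
    calc leg12 G * leg23 F
        = leg12 G * (leg23 F * comulRightZ a b F) * comulRightZ a b G := by
          rw [mul_assoc, mul_assoc, ← map_mul, hFG, map_one, mul_one]
      _ = leg12 (G * F) * comulLeftZ a b F * comulRightZ a b G := by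
          rw [← hcoc, leg12_mul]; simp only [mul_assoc]
      _ = _ := by rw [hGF, leg12_one, one_mul]
  have h2 : twElement' G * twElement F = 1 := by
    have : mapₗ (mulAntipodeTriple a b) (leg12 G * leg23 F) = twElement' G * twElement F := by
      ext n
      rw [twElement_eq, twElement', coeff_mapₗ, PowerSeries.coeff_mul, PowerSeries.coeff_mul,
        map_sum]
      refine Finset.sum_congr rfl fun p _ => ?_
      rw [leg12, leg23, coeff_mapₐ, coeff_mapₐ, mulAntipodeTriple_legs, coeff_mapₗ, coeff_mapₗ]
    rw [← this, h1]
    have : mapₗ (mulAntipodeTriple a b) (comulLeftZ a b F * comulRightZ a b G) =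
        mapₗ (antipode₀ a b) (counitRight (counit₀ a b) G) *
          mapₗ (antipode₀ a b) (counitLeft (counit₀ a b) F) := by
      ext n
      rw [coeff_mapₗ, PowerSeries.coeff_mul, PowerSeries.coeff_mul, map_sum,
        ← Finset.Nat.sum_antidiagonal_swap]
      refine Finset.sum_congr rfl fun p _ => ?_
      rw [comulLeftZ, RingHom.comp_apply, comulRightZ, coeff_mapₐ, coeff_mapₐ, coeff_mapₐ]
      refine (mulAntipodeTriple_comuls _ _).trans ?_
      rw [coeff_mapₗ, coeff_mapₗ, counitLeft, counitRight, coeff_mapₐ, coeff_mapₐ]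
      rfl
    have hone : mapₗ (antipode₀ a b) (1 : (U a b)⟦X⟧) = 1 := by
      rw [← map_one (PowerSeries.C (R := U a b)), mapₗ_C, antipode₀_one]
    have hR : counitRight (counit₀ a b) G = 1 := by
      have h3 : counitRight (counit₀ a b) (G * F) = counitRight (counit₀ a b) G := by
        rw [counitRight, map_mul]
        change _ * counitRight (counit₀ a b) F = _
        rw [hF.counit_right, mul_one]; rfl
      rw [← h3, hGF]
      exact map_one _
    rw [this, hR, hF.counit_left, hone, mul_one]
  have hv := isUnit_twElement h0
  calc Ring.inverse (twElement F) = twElement' G * twElement F * Ring.inverse (twElement F) := by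
        rw [h2, one_mul]
    _ = _ := by rw [mul_assoc, Ring.mul_inverse_cancel _ hv, mul_one]

/-- A twisting element congruent to `1` modulo `z` makes the enveloping algebra a Hopf algebra. -/
theorem IsTwist.isHopf : IsHopf (twComul F) (counit₀ a b) (twAntipode F) := by
  have hcoc : leg12 F * comulLeftZ a b F = leg23 F * comulRightZ a b F := hF.cocycle
  have hinv := inverse_twElement hF h0
  have hv := isUnit_twElement h0
  have hGF : Ring.inverse F * F = 1 := Ring.inverse_mul_cancel _ hF.isUnit
  have hFG : F * Ring.inverse F = 1 := Ring.mul_inverse_cancel _ hF.isUnit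
  have hcl : ∀ x : (U a b)⟦X⟧, counitLeft (counit₀ a b) (comulZ a b x) = x := by
    intro x; ext n
    exact comul₀_counit_left _
  have hcr : ∀ x : (U a b)⟦X⟧, counitRight (counit₀ a b) (comulZ a b x) = x := by
    intro x; ext n
    exact comul₀_counit_right _
  have hclm : ∀ x y, counitLeft (counit₀ a b) (x * y) =
      counitLeft (counit₀ a b) x * counitLeft (counit₀ a b) y := fun x y => map_mul _ _ _
  have hcrm : ∀ x y, counitRight (counit₀ a b) (x * y) =
      counitRight (counit₀ a b) x * counitRight (counit₀ a b) y := fun x y => map_mul _ _ _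
  have hcl1 : counitLeft (counit₀ a b) (1 : (U a b ⊗[ℝ] U a b)⟦X⟧) = 1 := map_one _
  have hcr1 : counitRight (counit₀ a b) (1 : (U a b ⊗[ℝ] U a b)⟦X⟧) = 1 := map_one _
  have hclG : counitLeft (counit₀ a b) (Ring.inverse F) = 1 := by
    have := congrArg (counitLeft (counit₀ a b)) hGF
    rwa [hclm, hF.counit_left, mul_one, hcl1] at this
  have hcrG : counitRight (counit₀ a b) (Ring.inverse F) = 1 := by
    have := congrArg (counitRight (counit₀ a b)) hGF
    rwa [hcrm, hF.counit_right, mul_one, hcr1] at this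
  constructor
  · intro x
    rw [twComul_apply, twComul_apply, mapₐ_z_mul, mul_z_mul', mul_assoc]
  · rw [twComul_apply, map_one, mul_one, hFG]
  · intro x y
    simp only [twComul_apply, map_mul, mul_assoc]
    rw [← mul_assoc (Ring.inverse F) F, hGF, one_mul]
  · intro x
    rw [assocZ_tensId_twComul, idTens_twComul, twComul_apply, map_mul, map_mul, map_mul, map_mul]
    have hco : comulLeftZ a b (comulZ a b x) = comulRightZ a b (comulZ a b x) := by
      ext n
      exact comul₀_coassoc _
    -- The cocycle identity inverted: the two products are a left and a right inverse of the same
    -- element.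
    have hGG : comulLeftZ a b (Ring.inverse F) * leg12 (Ring.inverse F) =
        comulRightZ a b (Ring.inverse F) * leg23 (Ring.inverse F) := by
      have e1 : comulLeftZ a b (Ring.inverse F) * leg12 (Ring.inverse F) *
          (leg12 F * comulLeftZ a b F) = 1 := by
        rw [mul_assoc, ← mul_assoc _ (leg12 F), ← leg12_mul, hGF, leg12_one, one_mul, ← map_mul,
          hGF, map_one]
      have e2 : (leg12 F * comulLeftZ a b F) *
          (comulRightZ a b (Ring.inverse F) * leg23 (Ring.inverse F)) = 1 := by
        rw [hcoc, mul_assoc, ← mul_assoc _ _ (leg23 (Ring.inverse F)), ← map_mul, hFG, map_one,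
          one_mul, ← leg23_mul, hFG, leg23_one]
      exact left_inv_eq_right_inv e1 e2
    calc _ = (leg12 F * comulLeftZ a b F) * comulLeftZ a b (comulZ a b x) *
          (comulLeftZ a b (Ring.inverse F) * leg12 (Ring.inverse F)) := by
          simp only [mul_assoc]
      _ = _ := by
          rw [hcoc, hGG, hco]
          simp only [mul_assoc]
  · intro x
    rw [twComul_apply, hclm, hclm, hF.counit_left, hclG, hcl, one_mul, mul_one]
  · intro x
    rw [twComul_apply, hcrm, hcrm, hF.counit_right, hcrG, hcr, one_mul, mul_one]
  · intro x
    rw [twAntipode_apply, twAntipode_apply, mapₗ_z_mul, mul_z_mul', mul_assoc]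
  · intro x
    -- Here `F⁻¹ Δ(x) = Δ₀(x) F⁻¹`, so the counit of `x` comes out and `v · twElement' F⁻¹ = v v⁻¹`
    -- remains.
    rw [mulZ_tensId_twAntipode F _ hinv, twComul_apply, ← mul_assoc, ← mul_assoc, hGF, one_mul,
      twElement'_comulZ_mul, ← hinv, ← mul_assoc, Ring.mul_inverse_cancel _ hv, one_mul]
  · intro x
    rw [mulZ_idTens_twAntipode, twComul_apply, mul_assoc, hGF, mul_one, twElement_mul_comulZ]
    have hcomm : Commute (mapₐ ((Algebra.ofId ℝ (U a b)).comp (counit₀ a b)) x)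
        (Ring.inverse (twElement F)) := by
      ext n
      rw [PowerSeries.coeff_mul, PowerSeries.coeff_mul, ← Finset.Nat.sum_antidiagonal_swap]
      refine Finset.sum_congr rfl fun p _ => ?_
      exact Algebra.commutes (A := U a b) (counit₀ a b (PowerSeries.coeff p.2 x)) _
    rw [mul_assoc, hcomm.eq, ← mul_assoc, Ring.mul_inverse_cancel _ hv, one_mul]

omit h0 in
/-- The `R`-matrix of a twisting element is a triangular universal `R`-matrix. -/
theorem IsTwist.isTriangularRMatrix : IsTriangularRMatrix (twComul F) (rMatrix F) := by
  have hcoc : leg12 F * comulLeftZ a b F = leg23 F * comulRightZ a b F := hF.cocycle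
  have hGF : Ring.inverse F * F = 1 := Ring.inverse_mul_cancel _ hF.isUnit
  have hFG : F * Ring.inverse F = 1 := Ring.mul_inverse_cancel _ hF.isUnit
  have hsw : swapZ (Ring.inverse F) * swapZ F = 1 := by rw [← swapZ_mul, hGF, swapZ_one]
  have hsw' : swapZ F * swapZ (Ring.inverse F) = 1 := by rw [← swapZ_mul, hFG, swapZ_one]
  have htri : swapZ (rMatrix F) * rMatrix F = 1 := by
    rw [rMatrix, swapZ_mul, swapZ_swapZ, mul_assoc, ← mul_assoc _ (swapZ F), hsw, one_mul, hFG]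
  have htri' : rMatrix F * swapZ (rMatrix F) = 1 := by
    rw [rMatrix, swapZ_mul, swapZ_swapZ, mul_assoc, ← mul_assoc _ F, hGF, one_mul, hsw']
  have hcocG : comulLeftZ a b (Ring.inverse F) * leg12 (Ring.inverse F) =
      comulRightZ a b (Ring.inverse F) * leg23 (Ring.inverse F) := by
    have e1 : comulLeftZ a b (Ring.inverse F) * leg12 (Ring.inverse F) *
        (leg12 F * comulLeftZ a b F) = 1 := by
      rw [mul_assoc, ← mul_assoc _ (leg12 F), ← leg12_mul, hGF, leg12_one, one_mul, ← map_mul,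
        hGF, map_one]
    have e2 : (leg12 F * comulLeftZ a b F) *
        (comulRightZ a b (Ring.inverse F) * leg23 (Ring.inverse F)) = 1 := by
      rw [hcoc, mul_assoc, ← mul_assoc _ _ (leg23 (Ring.inverse F)), ← map_mul, hFG, map_one,
        one_mul, ← leg23_mul, hFG, leg23_one]
    exact left_inv_eq_right_inv e1 e2
  have c13 : leg13 (Ring.inverse F) * leg13 F = 1 := by rw [← leg13_mul, hGF, leg13_one]
  have hcR : comulRightZ a b F * comulRightZ a b (Ring.inverse F) = 1 := by
    rw [← map_mul, hFG, map_one]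
  have hcL : comulLeftZ a b F * comulLeftZ a b (Ring.inverse F) = 1 := by
    rw [← map_mul, hFG, map_one]
  refine ⟨⟨⟨_, _, htri', htri⟩, rfl⟩, ?_, ?_, ?_, htri⟩
  · intro x
    have : swapZ (comulZ a b x) = comulZ a b x := by
      ext n
      exact comul₀_cocomm _
    rw [rMatrix, twComul_apply, swapZ_mul, swapZ_mul, this]
    simp only [mul_assoc]
    rw [← mul_assoc (Ring.inverse F) F, hGF, one_mul, ← mul_assoc (swapZ (Ring.inverse F)), hsw,
      one_mul]
  -- Two permuted copies of the cocycle identity both contain `M`, the element `(Δ₀ ⊗ id) F` with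
  -- its last two legs exchanged. Eliminating `M` expresses `F₁₂ (Δ₀ ⊗ id) F₂₁` through legs 13 and
  -- 23.
  · have h2 := congrArg (mapₐ (rotate a b)) hcoc
    rw [map_mul, map_mul, rotate_leg12, rotate_comulLeftZ, rotate_leg23, rotate_comulRightZ] at h2
    have h3 := congrArg (mapₐ (swapLast a b)) hcoc
    rw [map_mul, map_mul, swapLast_leg12, swapLast_leg23, swapLast_comulRightZ] at h3
    set M := mapₐ (swapLast a b) (comulLeftZ a b F)
    have hM : M = leg13 (Ring.inverse F) * (leg23 (swapZ F) * comulRightZ a b F) := by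
      rw [← h3, ← mul_assoc, c13, one_mul]
    rw [assocZ_tensId_twComul]
    simp only [rMatrix, map_mul, leg13_mul, leg23_mul]
    rw [← mul_assoc (leg12 F), ← h2, hM, mul_assoc _ _ (leg12 _), hcocG]
    simp only [mul_assoc]
    rw [← mul_assoc (comulRightZ a b F), hcR, one_mul]
  -- The mirror argument: `N`, the double rotation of `(id ⊗ Δ₀) F`, is eliminated between two other
  -- permutations of the cocycle identity.
  · have h2 := congrArg (mapₐ (rotate a b)) (congrArg (mapₐ (rotate a b)) hcoc)
    rw [map_mul, map_mul, map_mul, map_mul, rotate_leg12, rotate_leg13, rotate_leg23, rotate_leg12,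
      swapZ_swapZ, rotate_rotate_comulLeftZ] at h2
    have h3 := congrArg (mapₐ (swapLast a b)) (congrArg (mapₐ (rotate a b)) hcoc)
    rw [map_mul, map_mul, map_mul, map_mul, rotate_leg12, swapLast_leg13, rotate_leg23,
      swapLast_leg12, swapLast_rotate_comulLeftZ, ← rotate_comulLeftZ_swapZ,
      ← rotate_comulRightZ] at h3
    set N := mapₐ (rotate a b) (mapₐ (rotate a b) (comulRightZ a b F))
    have hN : N = leg13 (Ring.inverse F) * (leg12 (swapZ F) * comulLeftZ a b F) := by
      rw [h3, ← mul_assoc, c13, one_mul]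
    rw [idTens_twComul]
    simp only [rMatrix, map_mul, leg13_mul, leg12_mul]
    rw [← mul_assoc (leg23 F), h2, hN, mul_assoc _ _ (leg23 _), ← hcocG]
    simp only [mul_assoc]
    rw [← mul_assoc (comulLeftZ a b F), hcL, one_mul]

end Hopf

end TwistTheory

/-! ### Contraction limits of series and their stability under algebraic operations. -/

section Limits

namespace HasLimit

variable {W V V₀ : Type} [AddCommGroup W] [Module ℝ W] [AddCommGroup V] [Module ℝ V]
  [AddCommGroup V₀] [Module ℝ V₀] {φ : ℝ → W →ₗ[ℝ] V} {φ₀ : W →ₗ[ℝ] V₀}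
  {x x' : ℝ → V} {y y' : V₀}

theorem of_fintype {ι : Type} [Fintype ι] (c : ι → ℝ → ℝ) (c₀ : ι → ℝ) (w : ι → W)
    (hx : ∀ᶠ ε in 𝓝[≠] 0, x ε = ∑ i, c i ε • φ ε (w i))
    (hc : ∀ i, Tendsto (c i) (𝓝[≠] 0) (𝓝 (c₀ i))) (hy : y = ∑ i, c₀ i • φ₀ (w i)) :
    HasLimit φ φ₀ x y := by
  let e := (Fintype.equivFin ι).symm
  refine ⟨Fintype.card ι, fun i => c (e i), fun i => c₀ (e i), fun i => w (e i), ?_,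
    fun i => hc _, ?_⟩
  · filter_upwards [hx] with ε h
    rw [h]
    exact (Equiv.sum_comp e fun i => c i ε • φ ε (w i)).symm
  · rw [hy]
    exact (Equiv.sum_comp e fun i => c₀ i • φ₀ (w i)).symm

theorem congr (h : HasLimit φ φ₀ x y) (hx : ∀ᶠ ε in 𝓝[≠] 0, x' ε = x ε) :
    HasLimit φ φ₀ x' y := by
  obtain ⟨m, c, c₀, w, h1, h2, h3⟩ := h
  refine ⟨m, c, c₀, w, ?_, h2, h3⟩
  filter_upwards [h1, hx] with ε h h' using h'.trans h

theorem congr_ne (h : HasLimit φ φ₀ x y) (hx : ∀ ε, ε ≠ 0 → x' ε = x ε) :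
    HasLimit φ φ₀ x' y :=
  h.congr (by filter_upwards [self_mem_nhdsWithin] with ε hε using hx ε hε)

theorem map_const (w : W) : HasLimit φ φ₀ (fun ε => φ ε w) (φ₀ w) :=
  of_fintype (ι := Unit) (fun _ _ => 1) (fun _ => 1) (fun _ => w) (by simp)
    (fun _ => tendsto_const_nhds) (by simp)

theorem zero : HasLimit φ φ₀ (fun _ => 0) 0 := by
  simpa using map_const (φ := φ) (φ₀ := φ₀) 0

theorem add (h : HasLimit φ φ₀ x y) (h' : HasLimit φ φ₀ x' y') :
    HasLimit φ φ₀ (fun ε => x ε + x' ε) (y + y') := by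
  obtain ⟨m, c, c₀, w, h1, h2, rfl⟩ := h
  obtain ⟨m', c', c₀', w', h1', h2', rfl⟩ := h'
  refine of_fintype (ι := Fin m ⊕ Fin m') (Sum.elim c c') (Sum.elim c₀ c₀') (Sum.elim w w')
    ?_ ?_ ?_
  · filter_upwards [h1, h1'] with ε h h'
    simp [h, h']
  · rintro (i | i)
    exacts [h2 i, h2' i]
  · simp

theorem smul {c : ℝ → ℝ} {c₀ : ℝ} (hc : Tendsto c (𝓝[≠] 0) (𝓝 c₀)) (h : HasLimit φ φ₀ x y) :
    HasLimit φ φ₀ (fun ε => c ε • x ε) (c₀ • y) := by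
  obtain ⟨m, d, d₀, w, h1, h2, rfl⟩ := h
  refine ⟨m, fun i ε => c ε * d i ε, fun i => c₀ * d₀ i, w, ?_, fun i => hc.mul (h2 i), ?_⟩
  · filter_upwards [h1] with ε h
    simp [h, Finset.smul_sum, smul_smul]
  · simp [Finset.smul_sum, smul_smul]

theorem sum {ι : Type*} (s : Finset ι) {x : ι → ℝ → V} {y : ι → V₀}
    (h : ∀ i ∈ s, HasLimit φ φ₀ (x i) (y i)) :
    HasLimit φ φ₀ (fun ε => ∑ i ∈ s, x i ε) (∑ i ∈ s, y i) := by
  classical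
  induction s using Finset.induction_on with
  | empty => simpa using zero
  | insert i s hi ih =>
    simp only [Finset.sum_insert hi]
    exact (h i (Finset.mem_insert_self _ _)).add
      (ih fun j hj => h j (Finset.mem_insert_of_mem hj))

theorem map {W' V' V₀' : Type} [AddCommGroup W'] [Module ℝ W'] [AddCommGroup V'] [Module ℝ V']
    [AddCommGroup V₀'] [Module ℝ V₀'] {φ' : ℝ → W' →ₗ[ℝ] V'} {φ₀' : W' →ₗ[ℝ] V₀'}
    (g : V →ₗ[ℝ] V') (g₀ : V₀ →ₗ[ℝ] V₀') (gW : W →ₗ[ℝ] W')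
    (hg : ∀ ε w, g (φ ε w) = φ' ε (gW w)) (hg₀ : ∀ w, g₀ (φ₀ w) = φ₀' (gW w))
    (h : HasLimit φ φ₀ x y) : HasLimit φ' φ₀' (fun ε => g (x ε)) (g₀ y) := by
  obtain ⟨m, c, c₀, w, h1, h2, rfl⟩ := h
  refine ⟨m, c, c₀, fun i => gW (w i), ?_, h2, ?_⟩
  · filter_upwards [h1] with ε h
    simp [h, hg]
  · simp [hg₀]

end HasLimit

/-- The evaluation maps are algebra homomorphisms on one fixed algebra `W`, so products of the fixed
elements are again fixed elements, indexed by pairs, and the coefficients multiply. -/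
theorem HasLimit.mul {W V V₀ : Type} [Ring W] [Algebra ℝ W] [Ring V] [Algebra ℝ V]
    [Ring V₀] [Algebra ℝ V₀] {φ : ℝ → W →ₐ[ℝ] V} {φ₀ : W →ₐ[ℝ] V₀}
    {x x' : ℝ → V} {y y' : V₀}
    (h : HasLimit (fun ε => (φ ε).toLinearMap) φ₀.toLinearMap x y)
    (h' : HasLimit (fun ε => (φ ε).toLinearMap) φ₀.toLinearMap x' y') :
    HasLimit (fun ε => (φ ε).toLinearMap) φ₀.toLinearMap (fun ε => x ε * x' ε) (y * y') := by
  obtain ⟨m, c, c₀, w, h1, h2, rfl⟩ := h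
  obtain ⟨m', c', c₀', w', h1', h2', rfl⟩ := h'
  refine HasLimit.of_fintype (ι := Fin m × Fin m') (fun p ε => c p.1 ε * c' p.2 ε)
    (fun p => c₀ p.1 * c₀' p.2) (fun p => w p.1 * w' p.2) ?_ (fun p => (h2 _).mul (h2' _)) ?_
  · filter_upwards [h1, h1'] with ε h h'
    rw [h, h', Finset.sum_mul_sum, Fintype.sum_prod_type]
    simp only [smul_mul_smul_comm, AlgHom.toLinearMap_apply, map_mul]
  · rw [Finset.sum_mul_sum, Fintype.sum_prod_type]
    simp only [smul_mul_smul_comm, AlgHom.toLinearMap_apply, map_mul]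

/-- Coefficientwise contraction limits of series, `z ^ n` being rescaled by `ε ^ (k n)`. -/
def SeriesLimit {W V V₀ : Type} [Ring W] [Algebra ℝ W] [Ring V] [Algebra ℝ V]
    [Ring V₀] [Algebra ℝ V₀] (φ : ℝ → W →ₐ[ℝ] V) (φ₀ : W →ₐ[ℝ] V₀) (k : ℕ)
    (x : ℝ → V⟦X⟧) (y : V₀⟦X⟧) : Prop :=
  ∀ n, HasLimit (fun ε => (φ ε).toLinearMap) φ₀.toLinearMap
    (fun ε => ε ^ (k * n) • PowerSeries.coeff n (x ε)) (PowerSeries.coeff n y)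

theorem contractsTo_iff {w : Gen → ℕ} {k : ℕ} {a b : ℝ} {x : ℝ → (U 1 1)⟦X⟧} {y : (U a b)⟦X⟧} :
    ContractsTo w k x y ↔ SeriesLimit (evalScaled w) (evalLimit a b) k x y := Iff.rfl

/-- The tensor product of linear maps in `ContractsTo₂` is definitionally the linear map under an
algebra homomorphism; this gives tensor-square limits their multiplicativity. -/
theorem contractsTo₂_iff {w : Gen → ℕ} {k : ℕ} {a b : ℝ} {x : ℝ → (U 1 1 ⊗[ℝ] U 1 1)⟦X⟧}
    {y : (U a b ⊗[ℝ] U a b)⟦X⟧} : ContractsTo₂ w k x y ↔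
      SeriesLimit (fun ε => Algebra.TensorProduct.map (evalScaled w ε) (evalScaled w ε))
        (Algebra.TensorProduct.map (evalLimit a b) (evalLimit a b)) k x y := Iff.rfl

namespace SeriesLimit

variable {W V V₀ : Type} [Ring W] [Algebra ℝ W] [Ring V] [Algebra ℝ V] [Ring V₀] [Algebra ℝ V₀]
  {φ : ℝ → W →ₐ[ℝ] V} {φ₀ : W →ₐ[ℝ] V₀} {k : ℕ} {x x' : ℝ → V⟦X⟧} {y y' : V₀⟦X⟧}

theorem congr (h : SeriesLimit φ φ₀ k x y) (hx : ∀ ε, ε ≠ 0 → x' ε = x ε) :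
    SeriesLimit φ φ₀ k x' y :=
  fun n => (h n).congr_ne fun ε hε => by rw [hx ε hε]

theorem add (h : SeriesLimit φ φ₀ k x y) (h' : SeriesLimit φ φ₀ k x' y') :
    SeriesLimit φ φ₀ k (fun ε => x ε + x' ε) (y + y') := fun n => by
  simpa only [map_add, smul_add] using (h n).add (h' n)

theorem smul {c : ℝ → ℝ} {c₀ : ℝ} (hc : Tendsto c (𝓝[≠] 0) (𝓝 c₀))
    (h : SeriesLimit φ φ₀ k x y) : SeriesLimit φ φ₀ k (fun ε => c ε • x ε) (c₀ • y) := fun n => by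
  refine ((h n).smul hc).congr_ne fun ε _ => ?_
  rw [coeff_real_smul, smul_comm]

theorem const_smul (c : ℝ) (h : SeriesLimit φ φ₀ k x y) :
    SeriesLimit φ φ₀ k (fun ε => c • x ε) (c • y) := h.smul tendsto_const_nhds

theorem neg (h : SeriesLimit φ φ₀ k x y) : SeriesLimit φ φ₀ k (fun ε => -x ε) (-y) := by
  simpa using h.const_smul (-1)

theorem sub (h : SeriesLimit φ φ₀ k x y) (h' : SeriesLimit φ φ₀ k x' y') :
    SeriesLimit φ φ₀ k (fun ε => x ε - x' ε) (y - y') := by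
  simpa only [sub_eq_add_neg] using h.add h'.neg

theorem sum {ι : Type*} (s : Finset ι) {x : ι → ℝ → V⟦X⟧} {y : ι → V₀⟦X⟧}
    (h : ∀ i ∈ s, SeriesLimit φ φ₀ k (x i) (y i)) :
    SeriesLimit φ φ₀ k (fun ε => ∑ i ∈ s, x i ε) (∑ i ∈ s, y i) := fun n => by
  simpa only [map_sum, Finset.smul_sum] using HasLimit.sum s fun i hi => h i hi n

theorem mul (h : SeriesLimit φ φ₀ k x y) (h' : SeriesLimit φ φ₀ k x' y') :
    SeriesLimit φ φ₀ k (fun ε => x ε * x' ε) (y * y') := fun n => by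
  rw [PowerSeries.coeff_mul]
  refine (HasLimit.sum _ fun p _ => (h p.1).mul (h' p.2)).congr_ne fun ε _ => ?_
  rw [PowerSeries.coeff_mul, Finset.smul_sum]
  refine Finset.sum_congr rfl fun p hp => ?_
  rw [Finset.HasAntidiagonal.mem_antidiagonal] at hp
  rw [smul_mul_smul_comm, ← hp, mul_add, pow_add]

theorem C {x : ℝ → V} {y : V₀}
    (h : HasLimit (fun ε => (φ ε).toLinearMap) φ₀.toLinearMap x y) :
    SeriesLimit φ φ₀ k (fun ε => PowerSeries.C (x ε)) (PowerSeries.C y) := fun n => by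
  cases n with
  | zero => simpa using h
  | succ n => simpa [PowerSeries.coeff_C] using HasLimit.zero

theorem one : SeriesLimit φ φ₀ k (fun _ => 1) 1 := by
  have : HasLimit (fun ε => (φ ε).toLinearMap) φ₀.toLinearMap (fun _ => (1 : V)) 1 := by
    simpa using HasLimit.map_const (φ := fun ε => (φ ε).toLinearMap) (φ₀ := φ₀.toLinearMap) 1
  simpa using SeriesLimit.C (k := k) this

theorem pow (h : SeriesLimit φ φ₀ k x y) (n : ℕ) :
    SeriesLimit φ φ₀ k (fun ε => x ε ^ n) (y ^ n) := by
  induction n with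
  | zero => simpa using one
  | succ n ih => simpa only [pow_succ] using ih.mul h

theorem pser (c : ℕ → ℝ) (h : SeriesLimit φ φ₀ k x y) :
    SeriesLimit φ φ₀ k (fun ε => TwistedConformal.pser c (x ε)) (TwistedConformal.pser c y) :=
  fun n => by
    simp only [TwistedConformal.pser, PowerSeries.coeff_mk]
    exact sum (Finset.range (n + 1)) (fun i _ => (h.pow i).const_smul (c i)) n

theorem pexp (h : SeriesLimit φ φ₀ k x y) :
    SeriesLimit φ φ₀ k (fun ε => pexp (x ε)) (pexp y) := h.pser _

theorem plogOneSub (h : SeriesLimit φ φ₀ k x y) :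
    SeriesLimit φ φ₀ k (fun ε => plogOneSub (x ε)) (plogOneSub y) := by
  simpa only [plogOneSub_eq_pser] using h.pser _

/-- With constant term 1 the inverse is the geometric series in `1 - x`, each of whose coefficients
is a noncommutative polynomial in coefficients of `x`. -/
theorem inverse (h : SeriesLimit φ φ₀ k x y) (hx : ∀ ε, PowerSeries.coeff 0 (x ε) = 1)
    (hy : PowerSeries.coeff 0 y = 1) :
    SeriesLimit φ φ₀ k (fun ε => Ring.inverse (x ε)) (Ring.inverse y) := by
  have key : ∀ {A : Type} [Ring A] [Algebra ℝ A] (f : A⟦X⟧), PowerSeries.coeff 0 f = 1 →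
      Ring.inverse f = pgeom (1 - f) := by
    intro A _ _ f hf
    have hs : Small (1 - f) := small_iff.2 (by rw [map_sub, hf]; simp)
    have h1 := pgeom_mul hs
    rw [sub_sub_cancel] at h1
    calc Ring.inverse f = pgeom (1 - f) * f * Ring.inverse f := by rw [h1, one_mul]
      _ = _ := by rw [mul_assoc, Ring.mul_inverse_cancel _ (isUnit_of_coeff_zero hf), mul_one]
  simp only [key _ (hx _), key _ hy]
  exact (one.sub h).pser _

/-- A factor `z` shifts the order by one and so supplies the rescaling factor `ε ^ k` required of
`x`. -/
theorem z_mul (h : SeriesLimit φ φ₀ k (fun ε => ε ^ k • x ε) y) :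
    SeriesLimit φ φ₀ k (fun ε => z * x ε) (z * y) := fun n => by
  cases n with
  | zero => simpa using HasLimit.zero
  | succ n =>
    rw [coeff_z_mul_succ]
    refine (h n).congr_ne fun ε _ => ?_
    rw [coeff_z_mul_succ, coeff_real_smul, smul_smul, ← pow_add, mul_add, mul_one]

theorem divZ (h : SeriesLimit φ φ₀ k x y) :
    SeriesLimit φ φ₀ k (fun ε => ε ^ k • divZ (x ε)) (divZ y) := fun n => by
  rw [TwistedConformal.divZ, PowerSeries.coeff_mk]
  refine (h (n + 1)).congr_ne fun ε _ => ?_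
  rw [coeff_real_smul, TwistedConformal.divZ, PowerSeries.coeff_mk, smul_smul, ← pow_add, mul_add,
    mul_one]

theorem map {W' V' V₀' : Type} [Ring W'] [Algebra ℝ W'] [Ring V'] [Algebra ℝ V']
    [Ring V₀'] [Algebra ℝ V₀'] {φ' : ℝ → W' →ₐ[ℝ] V'} {φ₀' : W' →ₐ[ℝ] V₀'}
    (g : V →ₗ[ℝ] V') (g₀ : V₀ →ₗ[ℝ] V₀') (gW : W →ₗ[ℝ] W')
    (hg : ∀ ε w, g (φ ε w) = φ' ε (gW w)) (hg₀ : ∀ w, g₀ (φ₀ w) = φ₀' (gW w))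
    (h : SeriesLimit φ φ₀ k x y) :
    SeriesLimit φ' φ₀' k (fun ε => mapₗ g (x ε)) (mapₗ g₀ y) := fun n => by
  rw [coeff_mapₗ]
  refine (HasLimit.map (φ' := fun ε => (φ' ε).toLinearMap) (φ₀' := φ₀'.toLinearMap)
    g g₀ gW hg hg₀ (h n)).congr_ne fun ε _ => ?_
  rw [coeff_mapₗ, map_smul]

theorem map_algHom {W' V' V₀' : Type} [Ring W'] [Algebra ℝ W'] [Ring V'] [Algebra ℝ V']
    [Ring V₀'] [Algebra ℝ V₀'] {φ' : ℝ → W' →ₐ[ℝ] V'} {φ₀' : W' →ₐ[ℝ] V₀'}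
    (g : V →ₐ[ℝ] V') (g₀ : V₀ →ₐ[ℝ] V₀') (gW : W →ₐ[ℝ] W')
    (hg : ∀ ε, g.comp (φ ε) = (φ' ε).comp gW) (hg₀ : g₀.comp φ₀ = φ₀'.comp gW)
    (h : SeriesLimit φ φ₀ k x y) :
    SeriesLimit φ' φ₀' k (fun ε => mapₐ g (x ε)) (mapₐ g₀ y) := by
  have := h.map (φ' := φ') (φ₀' := φ₀') g.toLinearMap g₀.toLinearMap gW.toLinearMap
    (fun ε w => congrArg (fun f => f w) (hg ε)) (fun w => congrArg (fun f => f w) hg₀)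
  simpa only [mapₗ_algHom] using this

/-- Limits with weight `1` for `z` give limits with weight `2`, with the trivial dependence on
`z`. -/
theorem weight_two (h : SeriesLimit φ φ₀ 1 x y) :
    SeriesLimit φ φ₀ 2 x (PowerSeries.C (PowerSeries.coeff 0 y)) := fun n => by
  -- The surplus factor is `ε ^ (2 n) / ε ^ n = ε ^ n`. It kills every positive order, and `0 ^ 0 =
  -- 1` keeps order zero.
  have h1 : Tendsto (fun ε : ℝ => ε ^ n) (𝓝[≠] 0) (𝓝 (0 ^ n)) :=
    ((continuous_pow n).tendsto 0).mono_left nhdsWithin_le_nhds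
  have h2 := (h n).smul h1
  have h3 : (0 : ℝ) ^ n • PowerSeries.coeff n y =
      PowerSeries.coeff n (PowerSeries.C (PowerSeries.coeff 0 y)) := by
    cases n with
    | zero => simp
    | succ n => simp
  rw [← h3]
  refine h2.congr_ne fun ε _ => ?_
  rw [smul_smul, ← pow_add]
  congr 2
  ring

/-- Limits with weight `1` for `z` of series without constant term give limits with weight `2` of
the series divided by `ε`. -/
theorem weight_two_inv (h : SeriesLimit φ φ₀ 1 x y) (hx : ∀ ε, Small (x ε)) :
    SeriesLimit φ φ₀ 2 (fun ε => ε⁻¹ • x ε) (z * PowerSeries.C (PowerSeries.coeff 1 y)) :=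
  fun n => by
  cases n with
  | zero =>
    rw [coeff_z_mul_zero]
    refine HasLimit.zero.congr_ne fun ε _ => ?_
    rw [coeff_real_smul, small_iff.1 (hx ε), smul_zero, smul_zero]
  | succ n =>
    -- At order `n + 1` one has `ε⁻¹ ε ^ (2 (n + 1)) = ε ^ n · ε ^ (n + 1)`, so only the first order
    -- survives.
    have h1 : Tendsto (fun ε : ℝ => ε ^ n) (𝓝[≠] 0) (𝓝 (0 ^ n)) :=
      ((continuous_pow n).tendsto 0).mono_left nhdsWithin_le_nhds
    have h2 := (h (n + 1)).smul h1
    have h3 : (0 : ℝ) ^ n • PowerSeries.coeff (n + 1) y =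
        PowerSeries.coeff (n + 1) (z * PowerSeries.C (PowerSeries.coeff 1 y)) := by
      rw [coeff_z_mul_succ]
      cases n with
      | zero => simp
      | succ n => simp
    rw [← h3]
    refine h2.congr_ne fun ε hε => ?_
    rw [coeff_real_smul, smul_smul, smul_smul, ← pow_add]
    congr 1
    field_simp
    ring

/-- The first-order behaviour of `log (1 - x) - log (1 - x')` when `x` and `x'` have the same
limit. -/
theorem plogOneSub_sub {d : V₀⟦X⟧} (h : SeriesLimit φ φ₀ k x y) (h' : SeriesLimit φ φ₀ k x' y)
    (hd : SeriesLimit φ φ₀ k (fun ε => ε⁻¹ • (x ε - x' ε)) d) (hyd : Commute y d) (hds : Small d)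
    (hys : Small y) :
    SeriesLimit φ φ₀ k (fun ε => ε⁻¹ • (TwistedConformal.plogOneSub (x ε) -
      TwistedConformal.plogOneSub (x' ε))) (-(d * pgeom y)) := by
  -- Difference quotient of a power, from `x ^ (m + 2) - x' ^ (m + 2) = x (x ^ (m + 1) - x' ^ (m +
  -- 1)) + (x - x') x' ^ (m + 1)`. Here `x` and `x'` need not commute; commutation of `y` with `d`
  -- collects the limit.
  have hpow : ∀ m : ℕ, SeriesLimit φ φ₀ k (fun ε => ε⁻¹ • (x ε ^ (m + 1) - x' ε ^ (m + 1)))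
      (((m + 1 : ℕ) : ℝ) • (d * y ^ m)) := by
    intro m
    induction m with
    | zero => simpa using hd
    | succ m ih =>
      have h1 := (h.mul ih).add (hd.mul (h'.pow (m + 1)))
      have h2 : y * (((m + 1 : ℕ) : ℝ) • (d * y ^ m)) + d * y ^ (m + 1) =
          ((m + 1 + 1 : ℕ) : ℝ) • (d * y ^ (m + 1)) := by
        rw [mul_smul_comm, ← mul_assoc, hyd.eq, mul_assoc, ← pow_succ']
        push_cast
        module
      rw [← h2]
      refine h1.congr fun ε _ => ?_
      rw [mul_smul_comm, smul_mul_assoc, ← smul_add, pow_succ' _ (m + 1), pow_succ' _ (m + 1)]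
      congr 1
      noncomm_ring
  intro n
  have h1 := sum (Finset.range n) (fun m _ => (hpow m).const_smul (-((m + 1 : ℕ) : ℝ)⁻¹)) n
  -- Cutting `pgeom y` after `n` terms leaves an error of order `n`. The factor `d` has no constant
  -- term and raises this to `n + 1`, out of reach of the coefficient of order `n`.
  have h2 : PowerSeries.coeff n (-(d * pgeom y)) = PowerSeries.coeff n
      (∑ m ∈ Finset.range n, (-((m + 1 : ℕ) : ℝ)⁻¹) • (((m + 1 : ℕ) : ℝ) • (d * y ^ m))) := by
    have h3 : ∀ m : ℕ, (-((m + 1 : ℕ) : ℝ)⁻¹) • (((m + 1 : ℕ) : ℝ) • (d * y ^ m)) =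
        -(d * ((1 : ℝ) • y ^ m)) := by
      intro m
      have : ((m + 1 : ℕ) : ℝ) ≠ 0 := by positivity
      rw [smul_smul, neg_mul, inv_mul_cancel₀ this, neg_smul, one_smul, one_smul]
    simp only [h3, Finset.sum_neg_distrib, ← Finset.mul_sum]
    rw [map_neg, map_neg, neg_inj]
    have h5 := (pser_agreeTo (c := fun _ => 1) hys n).sub
      (AgreeTo.refl n (∑ m ∈ Finset.range n, (1 : ℝ) • y ^ m))
    rw [sub_self] at h5
    have h4 : AgreeTo (1 + n) (d * (pgeom y - ∑ m ∈ Finset.range n, (1 : ℝ) • y ^ m)) 0 :=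
      hds.mul_vanish h5
    have := h4 n (by omega)
    rw [mul_sub, map_sub, map_zero, sub_eq_zero] at this
    exact this
  rw [h2]
  refine h1.congr_ne fun ε _ => ?_
  congr 1
  rw [coeff_real_smul, map_sub, TwistedConformal.plogOneSub, TwistedConformal.plogOneSub,
    PowerSeries.coeff_mk, PowerSeries.coeff_mk, ← map_sub, ← coeff_real_smul]
  congr 1
  rw [neg_sub_neg, ← Finset.sum_sub_distrib, Finset.smul_sum, ← Finset.Ico_add_one_right_eq_Icc]
  beta_reduce
  rw [Finset.range_eq_Ico, Finset.sum_Ico_add' (fun m : ℕ => -(m : ℝ)⁻¹ •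
      (ε⁻¹ • (x ε ^ m - x' ε ^ m)))]
  refine Finset.sum_congr rfl fun m _ => ?_
  module

end SeriesLimit

end Limits


theorem SeriesLimit.tens {W V V₀ : Type} [Ring W] [Algebra ℝ W] [Ring V] [Algebra ℝ V] [Ring V₀]
    [Algebra ℝ V₀] {φ : ℝ → W →ₐ[ℝ] V} {φ₀ : W →ₐ[ℝ] V₀} {k : ℕ} {x x' : ℝ → V⟦X⟧}
    {y y' : V₀⟦X⟧} (h : SeriesLimit φ φ₀ k x y) (h' : SeriesLimit φ φ₀ k x' y') :
    SeriesLimit (fun ε => Algebra.TensorProduct.map (φ ε) (φ ε)) (Algebra.TensorProduct.map φ₀ φ₀) k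
      (fun ε => tens (x ε) (x' ε)) (tens y y') := by
  refine SeriesLimit.mul (φ := fun ε => Algebra.TensorProduct.map (φ ε) (φ ε))
    (φ₀ := Algebra.TensorProduct.map φ₀ φ₀) ?_ ?_
  · refine SeriesLimit.map_algHom (φ := φ) (φ₀ := φ₀)
      (φ' := fun ε => Algebra.TensorProduct.map (φ ε) (φ ε))
      (φ₀' := Algebra.TensorProduct.map φ₀ φ₀) Algebra.TensorProduct.includeLeft
      Algebra.TensorProduct.includeLeft Algebra.TensorProduct.includeLeft ?_ ?_ h
    · intro ε; exact AlgHom.ext fun x => by simp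
    · exact AlgHom.ext fun x => by simp
  · refine SeriesLimit.map_algHom (φ := φ) (φ₀ := φ₀)
      (φ' := fun ε => Algebra.TensorProduct.map (φ ε) (φ ε))
      (φ₀' := Algebra.TensorProduct.map φ₀ φ₀) Algebra.TensorProduct.includeRight
      Algebra.TensorProduct.includeRight Algebra.TensorProduct.includeRight ?_ ?_ h'
    · intro ε; exact AlgHom.ext fun x => by simp
    · exact AlgHom.ext fun x => by simp

/-! ### Limits of the Hopf structure maps, and the Lie algebra contractions. -/

section StructureLimits

variable {a b : ℝ} {w : Gen → ℕ} {k : ℕ}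

/-- The primitive coproduct on noncommutative polynomials in the generators. -/
def freeComul : FreeAlgebra ℝ Gen →ₐ[ℝ] FreeAlgebra ℝ Gen ⊗[ℝ] FreeAlgebra ℝ Gen :=
  FreeAlgebra.lift ℝ fun g => FreeAlgebra.ι ℝ g ⊗ₜ 1 + 1 ⊗ₜ FreeAlgebra.ι ℝ g

/-- The antipode on noncommutative polynomials in the generators. -/
def freeAntipodeOp : FreeAlgebra ℝ Gen →ₐ[ℝ] (FreeAlgebra ℝ Gen)ᵐᵒᵖ :=
  FreeAlgebra.lift ℝ fun g => -MulOpposite.op (FreeAlgebra.ι ℝ g)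

/-- The antipode on noncommutative polynomials as a linear map. -/
def freeAntipode : FreeAlgebra ℝ Gen →ₗ[ℝ] FreeAlgebra ℝ Gen :=
  (MulOpposite.opLinearEquiv ℝ).symm.toLinearMap ∘ₗ freeAntipodeOp.toLinearMap

theorem evalScaled_ι (w : Gen → ℕ) (ε : ℝ) (g : Gen) :
    evalScaled w ε (FreeAlgebra.ι ℝ g) = ε ^ w g • gen 1 1 g :=
  FreeAlgebra.lift_ι_apply _ _

/-- A homomorphism from noncommutative polynomials sending each generator to a multiple of the
same generator of `U a b`. -/
def evalWith (a b : ℝ) (c : Gen → ℝ) : FreeAlgebra ℝ Gen →ₐ[ℝ] U a b :=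
  FreeAlgebra.lift ℝ fun g => c g • gen a b g

theorem evalWith_ι (c : Gen → ℝ) (g : Gen) :
    evalWith a b c (FreeAlgebra.ι ℝ g) = c g • gen a b g :=
  FreeAlgebra.lift_ι_apply _ _

theorem evalScaled_eq (w : Gen → ℕ) (ε : ℝ) : evalScaled w ε = evalWith 1 1 fun g => ε ^ w g := rfl

theorem evalLimit_eq : evalLimit a b = evalWith a b fun _ => 1 := by
  apply FreeAlgebra.hom_ext
  funext g
  simp [evalLimit_gen, evalWith_ι]

/-- The primitive coproduct is linear in each generator, hence indifferent to its scale. A single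
coproduct on noncommutative polynomials therefore covers all `ε` and the limit at once. -/
theorem comul₀_comp_evalWith (c : Gen → ℝ) : (comul₀ a b).comp (evalWith a b c) =
    (Algebra.TensorProduct.map (evalWith a b c) (evalWith a b c)).comp freeComul := by
  apply FreeAlgebra.hom_ext
  funext g
  simp [evalWith_ι, freeComul, comul₀_gen, TensorProduct.smul_tmul']

theorem counit₀_comp_evalWith (c : Gen → ℝ) :
    (counit₀ a b).comp (evalWith a b c) = FreeAlgebra.lift ℝ fun _ => 0 := by
  apply FreeAlgebra.hom_ext
  funext g
  simp [evalWith_ι, counit₀_gen]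

theorem antipode₀_evalWith (c : Gen → ℝ) (x : FreeAlgebra ℝ Gen) :
    antipode₀ a b (evalWith a b c x) = evalWith a b c (freeAntipode x) := by
  have : (antipodeOp₀ a b).comp (evalWith a b c) =
      (AlgHom.op (evalWith a b c)).comp freeAntipodeOp := by
    apply FreeAlgebra.hom_ext
    funext g
    apply MulOpposite.unop_injective
    have := antipode₀_gen (a := a) (b := b) g
    change MulOpposite.unop (antipodeOp₀ a b (gen a b g)) = _ at this
    simp [evalWith_ι, freeAntipodeOp, this]
  exact congrArg (fun f => MulOpposite.unop (f x)) this

theorem ContractsTo.comulZ {x : ℝ → (U 1 1)⟦X⟧} {y : (U a b)⟦X⟧} (h : ContractsTo w k x y) :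
    ContractsTo₂ w k (fun ε => comulZ 1 1 (x ε)) (comulZ a b y) :=
  SeriesLimit.map_algHom (W := FreeAlgebra ℝ Gen) (φ := evalScaled w) (φ₀ := evalLimit a b)
    (φ' := fun ε => Algebra.TensorProduct.map (evalScaled w ε) (evalScaled w ε))
    (φ₀' := Algebra.TensorProduct.map (evalLimit a b) (evalLimit a b))
    (comul₀ 1 1) (comul₀ a b) freeComul
    (fun _ => comul₀_comp_evalWith _) (by rw [evalLimit_eq, comul₀_comp_evalWith]) h

theorem ContractsTo.antipodeZ {x : ℝ → (U 1 1)⟦X⟧} {y : (U a b)⟦X⟧} (h : ContractsTo w k x y) :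
    ContractsTo w k (fun ε => mapₗ (antipode₀ 1 1) (x ε)) (mapₗ (antipode₀ a b) y) :=
  SeriesLimit.map (W := FreeAlgebra ℝ Gen) (φ := evalScaled w) (φ₀ := evalLimit a b)
    (φ' := evalScaled w) (φ₀' := evalLimit a b)
    (antipode₀ 1 1) (antipode₀ a b) freeAntipode
    (fun _ => antipode₀_evalWith _) (by rw [evalLimit_eq]; exact antipode₀_evalWith _) h

theorem ContractsTo₂.twElement {x : ℝ → (U 1 1 ⊗[ℝ] U 1 1)⟦X⟧} {y : (U a b ⊗[ℝ] U a b)⟦X⟧}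
    (h : ContractsTo₂ w k x y) :
    ContractsTo w k (fun ε => twElement (x ε)) (twElement y) := by
  simp only [twElement_eq]
  refine SeriesLimit.map (φ := fun ε => Algebra.TensorProduct.map (evalScaled w ε) (evalScaled w ε))
    (φ₀ := Algebra.TensorProduct.map (evalLimit a b) (evalLimit a b))
    (φ' := evalScaled w) (φ₀' := evalLimit a b) (mulAntipodeRight 1 1) (mulAntipodeRight a b)
    (LinearMap.mul' ℝ _ ∘ₗ freeAntipode.lTensor _) ?_ ?_ h
  · intro ε t
    induction t using TensorProduct.induction_on with
    | zero => simp
    | add s t hs ht => simp only [map_add, hs, ht]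
    | tmul x y => simp [evalScaled_eq, antipode₀_evalWith]
  · intro t
    induction t using TensorProduct.induction_on with
    | zero => simp
    | add s t hs ht => simp only [map_add, hs, ht]
    | tmul x y => simp [evalLimit_eq, antipode₀_evalWith]

theorem ContractsTo₂.swapZ {x : ℝ → (U 1 1 ⊗[ℝ] U 1 1)⟦X⟧} {y : (U a b ⊗[ℝ] U a b)⟦X⟧}
    (h : ContractsTo₂ w k x y) : ContractsTo₂ w k (fun ε => swapZ (x ε)) (swapZ y) := by
  refine SeriesLimit.map_algHom
    (φ := fun ε => Algebra.TensorProduct.map (evalScaled w ε) (evalScaled w ε))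
    (φ₀ := Algebra.TensorProduct.map (evalLimit a b) (evalLimit a b))
    (φ' := fun ε => Algebra.TensorProduct.map (evalScaled w ε) (evalScaled w ε))
    (φ₀' := Algebra.TensorProduct.map (evalLimit a b) (evalLimit a b))
    (Algebra.TensorProduct.comm ℝ _ _).toAlgHom (Algebra.TensorProduct.comm ℝ _ _).toAlgHom
    (Algebra.TensorProduct.comm ℝ _ _).toAlgHom ?_ ?_ h
  · intro ε
    exact Algebra.TensorProduct.ext' fun x y => by simp
  · exact Algebra.TensorProduct.ext' fun x y => by simp

theorem ContractsTo.mul {x x' : ℝ → (U 1 1)⟦X⟧} {y y' : (U a b)⟦X⟧} (h : ContractsTo w k x y)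
    (h' : ContractsTo w k x' y') : ContractsTo w k (fun ε => x ε * x' ε) (y * y') :=
  contractsTo_iff.2 ((contractsTo_iff.1 h).mul (contractsTo_iff.1 h'))

theorem ContractsTo₂.mul {x x' : ℝ → (U 1 1 ⊗[ℝ] U 1 1)⟦X⟧} {y y' : (U a b ⊗[ℝ] U a b)⟦X⟧}
    (h : ContractsTo₂ w k x y) (h' : ContractsTo₂ w k x' y') :
    ContractsTo₂ w k (fun ε => x ε * x' ε) (y * y') :=
  contractsTo₂_iff.2 ((contractsTo₂_iff.1 h).mul (contractsTo₂_iff.1 h'))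

/-- Lift each coefficient to a noncommutative polynomial, evaluate it at the rescaled generators and
undo the rescaling of `z`; the resulting family is constant in rescaled terms for `ε ≠ 0`. -/
theorem contractsTo_surjective (y : (U a b)⟦X⟧) : ∃ x, ContractsTo w k x y := by
  choose f hf using evalLimit_surjective (a := a) (b := b)
  refine ⟨fun ε => PowerSeries.mk fun n =>
    (ε ^ (k * n))⁻¹ • evalScaled w ε (f (PowerSeries.coeff n y)), fun n => ?_⟩
  have h := HasLimit.map_const (φ := fun ε => (evalScaled w ε).toLinearMap)
    (φ₀ := (evalLimit a b).toLinearMap) (f (PowerSeries.coeff n y))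
  rw [AlgHom.toLinearMap_apply, hf] at h
  refine h.congr_ne fun ε hε => ?_
  rw [PowerSeries.coeff_mk, smul_smul, mul_inv_cancel₀ (pow_ne_zero _ hε), one_smul]
  rfl

theorem ContractsTo.counit {x : ℝ → (U 1 1)⟦X⟧} {y : (U a b)⟦X⟧} (h : ContractsTo w k x y)
    (n : ℕ) : Tendsto (fun ε => ε ^ (k * n) * counit₀ 1 1 (PowerSeries.coeff n (x ε))) (𝓝[≠] 0)
      (𝓝 (counit₀ a b (PowerSeries.coeff n y))) := by
  obtain ⟨m, c, c₀, u, h1, h2, h3⟩ := h n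
  have e1 : ∀ ε v, counit₀ 1 1 (evalScaled w ε v) = FreeAlgebra.lift ℝ (fun _ : Gen => (0 : ℝ)) v :=
    fun ε v => congrArg (fun f => f v) (counit₀_comp_evalWith (a := 1) (b := 1) fun g => ε ^ w g)
  have e2 : ∀ v, counit₀ a b (evalLimit a b v) = FreeAlgebra.lift ℝ (fun _ : Gen => (0 : ℝ)) v := by
    intro v
    rw [evalLimit_eq]
    exact congrArg (fun f => f v) (counit₀_comp_evalWith (a := a) (b := b) fun _ => 1)
  have h4 : Tendsto (fun ε => ∑ i, c i ε * FreeAlgebra.lift ℝ (fun _ : Gen => (0 : ℝ)) (u i))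
      (𝓝[≠] 0) (𝓝 (∑ i, c₀ i * FreeAlgebra.lift ℝ (fun _ : Gen => (0 : ℝ)) (u i))) :=
    tendsto_finsetSum _ fun i _ => (h2 i).mul_const _
  rw [h3]
  simp only [map_sum, map_smul, AlgHom.toLinearMap_apply, e2, smul_eq_mul]
  refine h4.congr' ?_
  filter_upwards [h1] with ε h
  rw [← smul_eq_mul, ← map_smul, h]
  simp only [map_sum, map_smul, AlgHom.toLinearMap_apply, e1, smul_eq_mul]

/-- A contraction limit `F₀` of the twisting element which is itself a twisting element makes the
whole twisted Hopf algebra structure converge. -/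
theorem IsQuantumContraction.of_twist {Y : Gen → (U a b)⟦X⟧} {F₀ : (U a b ⊗[ℝ] U a b)⟦X⟧}
    (hlie : IsLieContraction w a b)
    (hgen : ∀ g, ContractsTo w k (fun ε => ε ^ w g • SO42.qgen g) (Y g))
    (hcl : ∀ g, PowerSeries.constantCoeff (Y g) = gen a b g)
    (hF : ContractsTo₂ w k (fun _ => SO42.F) F₀) (hF₀ : IsTwist F₀)
    (h0 : PowerSeries.coeff 0 F₀ = 1) (h1 : PowerSeries.coeff 0 SO42.F = 1) :
    IsQuantumContraction w k Y F₀ := by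
  -- Both constant terms are 1, so the inverses of the twist, and below those of `v`, converge as
  -- well. The structure maps are then products of convergent factors.
  have hinv : ContractsTo₂ w k (fun _ => Ring.inverse SO42.F) (Ring.inverse F₀) :=
    SeriesLimit.inverse (contractsTo₂_iff.1 hF) (fun _ => h1) h0
  have hv := hF.twElement
  have hvinv : ContractsTo w k (fun _ => Ring.inverse (twElement SO42.F))
      (Ring.inverse (twElement F₀)) :=
    SeriesLimit.inverse (contractsTo_iff.1 hv) (fun _ => coeff_zero_twElement h1)
      (coeff_zero_twElement h0)
  refine ⟨hlie, hgen, hcl, contractsTo_surjective, ?_, ?_, fun x y h n => h.counit n, ?_, hF, ?_,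
    hF₀, hF₀.isHopf h0, hF₀.isTriangularRMatrix⟩
  · intro x x' y y' h h'
    exact h.mul h'
  · intro x y h
    simp only [twComul_apply]
    exact (hF.mul h.comulZ).mul hinv
  · intro x y h
    simp only [twAntipode_apply]
    exact (hv.mul h.antipodeZ).mul hvinv
  · exact hF.swapZ.mul hinv

/-- The rescaled brackets of `so(4,2)` are again brackets of the family `Conf`, with parameters `α
ε` and `β ε`. Coordinates of the bracket are polynomial in the two parameters, so they converge with
them. -/
theorem isLieContraction_of_scaling (α β : ℝ → ℝ) (hα : Tendsto α (𝓝[≠] 0) (𝓝 a))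
    (hβ : Tendsto β (𝓝[≠] 0) (𝓝 b))
    (h : ∀ ε, ε ≠ 0 → ∀ (u v : Gen → ℝ) (l : Gen),
      Conf.bracket 1 1 (fun g => ε ^ w g * u g) (fun g => ε ^ w g * v g) l =
        ε ^ w l * Conf.bracket (α ε) (β ε) u v l) : IsLieContraction w a b := by
  intro g h' l
  have hcont : ∀ u v : Gen → ℝ, Tendsto (fun ε => Conf.bracket (α ε) (β ε) u v l) (𝓝[≠] 0)
      (𝓝 (Conf.bracket a b u v l)) := by
    intro u v
    rcases l with i | i | i | i | _ | _ | _ <;> simp only [Conf.bracket]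
    · exact (tendsto_const_nhds.sub ((hα.mul hβ).mul_const _)).add (hα.mul_const _)
    · exact tendsto_const_nhds
    · exact (tendsto_const_nhds.add (hβ.mul_const _)).sub tendsto_const_nhds
    · exact (tendsto_const_nhds.add (hβ.mul_const _)).add tendsto_const_nhds
    · exact (hα.mul_const _).sub tendsto_const_nhds
    · exact (hα.mul_const _).add tendsto_const_nhds
    · exact (hβ.mul_const _).sub (hα.mul_const _)
  refine (hcont (Conf.basisVec a b g) (Conf.basisVec a b h')).congr' ?_
  filter_upwards [self_mem_nhdsWithin] with ε hε
  have key : ∀ g₁ : Gen, (ε ^ w g₁ • Conf.basisVec 1 1 g₁ : Conf 1 1) =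
      fun g => ε ^ w g * Conf.basisVec a b g₁ g := by
    intro g₁
    funext g
    rw [Conf.smul_apply, Conf.basisVec, Conf.basisVec]
    split_ifs with hg
    · rw [hg]
    · simp
  rw [key, key]
  refine Eq.trans ?_ (congrArg ((ε ^ w l)⁻¹ * ·)
    (h ε hε (Conf.basisVec a b g) (Conf.basisVec a b h') l)).symm
  exact (inv_mul_cancel_left₀ (pow_ne_zero _ hε) _).symm

/-- Brackets carrying the factor `a`, such as `[K_i, P_i] = a P₀`, take two generators of weight one
to weight zero, which costs `ε ^ 2`. Brackets with only the factor `b` preserve the weight. -/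
theorem isLieContraction_speedSpace : IsLieContraction speedSpace 0 1 := by
  refine isLieContraction_of_scaling (fun ε => ε ^ 2) (fun _ => 1) ?_ tendsto_const_nhds ?_
  · exact (by simpa using (continuous_pow (M := ℝ) 2).tendsto 0 :
      Tendsto (fun ε : ℝ => ε ^ 2) (𝓝 0) (𝓝 0)).mono_left nhdsWithin_le_nhds
  · intro ε hε u v l
    rcases l with i | i | i | i | _ | _ | _ <;>
      simp only [Conf.bracket, Conf.bracket.cr, speedSpace, Fin.sum_univ_three] <;> ring

/-- The roles are exchanged: now brackets with the factor `b`, such as `[K_i, P₀] = b P_i`, drop the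
weight by two. -/
theorem isLieContraction_speedTime : IsLieContraction speedTime 1 0 := by
  refine isLieContraction_of_scaling (fun _ => 1) (fun ε => ε ^ 2) tendsto_const_nhds ?_ ?_
  · exact (by simpa using (continuous_pow (M := ℝ) 2).tendsto 0 :
      Tendsto (fun ε : ℝ => ε ^ 2) (𝓝 0) (𝓝 0)).mono_left nhdsWithin_le_nhds
  · intro ε hε u v l
    rcases l with i | i | i | i | _ | _ | _ <;>
      simp only [Conf.bracket, Conf.bracket.cr, speedTime, Fin.sum_univ_three] <;> ring

end StructureLimits


/-! ### Twisting elements that are exponentials of commuting pure tensors. -/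

section ExponentialTwist

variable {a b : ℝ}

/-- The embeddings of the tensor factors into the completed tensor cube. -/
def fst3 (a b : ℝ) : (U a b)⟦X⟧ →+* (U a b ⊗[ℝ] (U a b ⊗[ℝ] U a b))⟦X⟧ :=
  mapₐ Algebra.TensorProduct.includeLeft

/-- The second embedding into the completed tensor cube. -/
def snd3 (a b : ℝ) : (U a b)⟦X⟧ →+* (U a b ⊗[ℝ] (U a b ⊗[ℝ] U a b))⟦X⟧ :=
  mapₐ (Algebra.TensorProduct.includeRight.comp Algebra.TensorProduct.includeLeft)

/-- The third embedding into the completed tensor cube. -/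
def thd3 (a b : ℝ) : (U a b)⟦X⟧ →+* (U a b ⊗[ℝ] (U a b ⊗[ℝ] U a b))⟦X⟧ :=
  mapₐ (Algebra.TensorProduct.includeRight.comp Algebra.TensorProduct.includeRight)

theorem mapₐ_commute_mapₐ {A B D : Type} [Ring A] [Algebra ℝ A] [Ring B] [Algebra ℝ B] [Ring D]
    [Algebra ℝ D] (f : A →ₐ[ℝ] D) (g : B →ₐ[ℝ] D) (h : ∀ x y, Commute (f x) (g y)) (x : A⟦X⟧)
    (y : B⟦X⟧) : Commute (mapₐ f x) (mapₐ g y) := by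
  ext n
  rw [PowerSeries.coeff_mul, PowerSeries.coeff_mul, ← Finset.Nat.sum_antidiagonal_swap]
  exact Finset.sum_congr rfl fun p _ => h _ _

theorem fst3_commute_leg23 (x : (U a b)⟦X⟧) (y : (U a b ⊗[ℝ] U a b)⟦X⟧) :
    Commute (fst3 a b x) (leg23 y) :=
  mapₐ_commute_mapₐ _ _ (fun x y => by simp [Commute, SemiconjBy]) x y

theorem fst3_commute_snd3 (x y : (U a b)⟦X⟧) : Commute (fst3 a b x) (snd3 a b y) :=
  mapₐ_commute_mapₐ _ _ (fun x y => by simp [Commute, SemiconjBy]) x y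

theorem fst3_commute_thd3 (x y : (U a b)⟦X⟧) : Commute (fst3 a b x) (thd3 a b y) :=
  mapₐ_commute_mapₐ _ _ (fun x y => by simp [Commute, SemiconjBy]) x y

theorem snd3_commute_thd3 (x y : (U a b)⟦X⟧) : Commute (snd3 a b x) (thd3 a b y) :=
  mapₐ_commute_mapₐ _ _ (fun x y => by simp [Commute, SemiconjBy]) x y

theorem leg12_tens (x y : (U a b)⟦X⟧) : leg12 (tens x y) = fst3 a b x * snd3 a b y := by
  rw [tens, leg12_mul]
  congr 1

theorem leg13_tens (x y : (U a b)⟦X⟧) : leg13 (tens x y) = fst3 a b x * thd3 a b y := by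
  rw [tens, leg13_mul]
  congr 1

theorem leg23_tens (x y : (U a b)⟦X⟧) : leg23 (tens x y) = snd3 a b x * thd3 a b y := by
  rw [tens, leg23_mul]
  rfl

theorem leg12_add (x y : (U a b ⊗[ℝ] U a b)⟦X⟧) : leg12 (x + y) = leg12 x + leg12 y :=
  map_add _ _ _

theorem leg23_add (x y : (U a b ⊗[ℝ] U a b)⟦X⟧) : leg23 (x + y) = leg23 x + leg23 y :=
  map_add _ _ _

theorem comulRightZ_tens (x y : (U a b)⟦X⟧) :
    comulRightZ a b (tens x y) = fst3 a b x * leg23 (comulZ a b y) := by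
  rw [tens, map_mul]
  congr 1
  refine mapₐ_congr (f := (Algebra.TensorProduct.map (AlgHom.id ℝ (U a b)) (comul₀ a b)).comp
      Algebra.TensorProduct.includeLeft) (g := Algebra.TensorProduct.includeLeft)
      (U_hom_ext fun k => ?_) x
  simp

theorem comulLeftZ_tens (x y : (U a b)⟦X⟧) :
    comulLeftZ a b (tens x y) = leg12 (comulZ a b x) * thd3 a b y := by
  rw [tens, map_mul]
  congr 1
  · refine mapₐ_congr (f := (comulLeft a b).comp Algebra.TensorProduct.includeLeft)
      (g := (Algebra.TensorProduct.map (AlgHom.id ℝ (U a b))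
      (Algebra.TensorProduct.includeLeft : U a b →ₐ[ℝ] U a b ⊗[ℝ] U a b)).comp (comul₀ a b))
      (U_hom_ext fun k => ?_) x
    simp [comul₀_gen]
  · refine mapₐ_congr (f := (comulLeft a b).comp Algebra.TensorProduct.includeRight)
      (g := Algebra.TensorProduct.includeRight.comp
      Algebra.TensorProduct.includeRight) (U_hom_ext fun k => ?_) y
    simp

theorem counitLeft_tens (x y : (U a b)⟦X⟧) : counitLeft (counit₀ a b) (tens x y) =
    mapₐ ((Algebra.ofId ℝ (U a b)).comp (counit₀ a b)) x * y := by
  rw [tens, counitLeft, map_mul]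
  congr 1
  · refine mapₐ_congr (f := ((Algebra.TensorProduct.lid ℝ (U a b)).toAlgHom.comp
      (Algebra.TensorProduct.map (counit₀ a b) (AlgHom.id ℝ _))).comp
      Algebra.TensorProduct.includeLeft) (U_hom_ext fun k => ?_) x
    simp [counit₀_gen]
  · ext n
    simp

theorem counitRight_tens (x y : (U a b)⟦X⟧) : counitRight (counit₀ a b) (tens x y) =
    x * mapₐ ((Algebra.ofId ℝ (U a b)).comp (counit₀ a b)) y := by
  rw [tens, counitRight, map_mul]
  congr 1
  · ext n
    simp
  · refine mapₐ_congr (f := ((Algebra.TensorProduct.rid ℝ ℝ (U a b)).toAlgHom.comp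
      (Algebra.TensorProduct.map (AlgHom.id ℝ _) (counit₀ a b))).comp
      Algebra.TensorProduct.includeRight) (U_hom_ext fun k => ?_) y
    simp [counit₀_gen]

/-- A twisting element `exp (∑ X_i ⊗ Q_i)` built from commuting primitive elements `X_i` and
commuting elements `Q_i` which are primitive for the twisted coproduct. -/
theorem isTwist_pexp {ι : Type} [Fintype ι] (X Q : ι → (U a b)⟦X⟧)
    (hX : ∀ i j, Commute (X i) (X j)) (hQ : ∀ i j, Commute (Q i) (Q j)) (hs : ∀ i, Small (Q i))
    (hεX : ∀ i, mapₐ ((Algebra.ofId ℝ (U a b)).comp (counit₀ a b)) (X i) = 0)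
    (hεQ : ∀ i, mapₐ ((Algebra.ofId ℝ (U a b)).comp (counit₀ a b)) (Q i) = 0)
    (hΔX : ∀ i, comulZ a b (X i) = tens (X i) 1 + tens 1 (X i))
    (hΔQ : ∀ i, pexp (∑ j, tens (X j) (Q j)) * comulZ a b (Q i) =
      (tens (Q i) 1 + tens 1 (Q i)) * pexp (∑ j, tens (X j) (Q j))) :
    IsTwist (pexp (∑ j, tens (X j) (Q j))) := by
  set f := ∑ j, tens (X j) (Q j) with hf
  have hfs : Small f := Small.sum _ fun i _ => tens_small_right _ (hs i)
  have h12 : leg12 f = ∑ j, fst3 a b (X j) * snd3 a b (Q j) := by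
    rw [hf, leg12, map_sum]; exact Finset.sum_congr rfl fun j _ => leg12_tens _ _
  have h13 : leg13 f = ∑ j, fst3 a b (X j) * thd3 a b (Q j) := by
    rw [hf, leg13, map_sum]; exact Finset.sum_congr rfl fun j _ => leg13_tens _ _
  have h23 : leg23 f = ∑ j, snd3 a b (X j) * thd3 a b (Q j) := by
    rw [hf, leg23, map_sum]; exact Finset.sum_congr rfl fun j _ => leg23_tens _ _
  have hs12 : Small (leg12 f) := hfs.mapₐ _
  have hs13 : Small (leg13 f) := hfs.mapₐ _
  have hs23 : Small (leg23 f) := hfs.mapₐ _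
  have e12 : leg12 (pexp f) = pexp (leg12 f) := mapₐ_pexp _ _
  have e13 : leg13 (pexp f) = pexp (leg13 f) := mapₐ_pexp _ _
  have e23 : leg23 (pexp f) = pexp (leg23 f) := mapₐ_pexp _ _
  have c1 : Commute (leg13 f) (leg23 f) := by
    rw [h13, h23]
    refine Commute.sum_left _ _ _ fun i _ => Commute.sum_right _ _ _ fun j _ => ?_
    exact Commute.mul_left ((fst3_commute_snd3 _ _).mul_right (fst3_commute_thd3 _ _))
      ((snd3_commute_thd3 _ _).symm.mul_right ((hQ i j).map (thd3 a b)))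
  have c2 : Commute (leg12 f) (leg13 f) := by
    rw [h12, h13]
    refine Commute.sum_left _ _ _ fun i _ => Commute.sum_right _ _ _ fun j _ => ?_
    exact Commute.mul_left (((hX i j).map (fst3 a b)).mul_right (fst3_commute_thd3 _ _))
      ((fst3_commute_snd3 _ _).symm.mul_right (snd3_commute_thd3 _ _))
  -- Primitivity of the `X_i` gives `(Δ₀ ⊗ id) f = f₁₃ + f₂₃`, and these commute because the `Q_i`
  -- do.
  have hL : comulLeftZ a b (pexp f) = leg13 (pexp f) * leg23 (pexp f) := by
    have : comulLeftZ a b f = leg13 f + leg23 f := by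
      rw [h13, h23, ← Finset.sum_add_distrib, hf, map_sum]
      refine Finset.sum_congr rfl fun j _ => ?_
      rw [comulLeftZ_tens, hΔX, leg12_add, leg12_tens, leg12_tens, map_one, map_one, mul_one,
        one_mul, add_mul]
    rw [e13, e23, ← pexp_add hs13 hs23 c1, ← this, comulLeftZ, RingHom.comp_apply, mapₐ_pexp,
      mapₐ_pexp]
    rfl
  -- Conjugation by `F₂₃` replaces `Δ₀(Q_i)` by the twisted coproduct of `Q_i`, which is primitive.
  -- The conjugated exponent is thus `f₁₂ + f₁₃`, and these commute because the `X_i` do.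
  have hR : leg23 (pexp f) * comulRightZ a b (pexp f) =
      leg12 (pexp f) * leg13 (pexp f) * leg23 (pexp f) := by
    have h1 : SemiconjBy (leg23 (pexp f)) (comulRightZ a b f) (leg12 f + leg13 f) := by
      rw [h12, h13, ← Finset.sum_add_distrib, hf, map_sum]
      rw [SemiconjBy, Finset.mul_sum, Finset.sum_mul]
      refine Finset.sum_congr rfl fun j _ => ?_
      rw [comulRightZ_tens, ← mul_assoc, ← (fst3_commute_leg23 _ _).eq, mul_assoc, ← leg23_mul,
        hΔQ, leg23_mul, leg23_add, leg23_tens, leg23_tens, map_one, map_one, mul_one, one_mul,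
        ← mul_add, mul_assoc]
    have h2 : comulRightZ a b (pexp f) = pexp (comulRightZ a b f) := mapₐ_pexp _ _
    rw [h2, (pexp_semiconj (show Small (comulRightZ a b f) from hfs.mapₐ _) (hs12.add hs13) h1).eq, pexp_add hs12 hs13 c2, e12, e13]
  refine ⟨isUnit_of_coeff_zero (coeff_zero_pexp f), ?_, ?_, ?_⟩
  · have : counitLeft (counit₀ a b) f = 0 := by
      rw [hf, counitLeft, map_sum]
      refine Finset.sum_eq_zero fun j _ => ?_
      have := counitLeft_tens (X j) (Q j)
      rw [hεX, zero_mul] at this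
      exact this
    rw [counitLeft, mapₐ_pexp]
    change pexp (counitLeft (counit₀ a b) f) = 1
    rw [this, pexp_zero]
  · have : counitRight (counit₀ a b) f = 0 := by
      rw [hf, counitRight, map_sum]
      refine Finset.sum_eq_zero fun j _ => ?_
      have := counitRight_tens (X j) (Q j)
      rw [hεQ, mul_zero] at this
      exact this
    rw [counitRight, mapₐ_pexp]
    change pexp (counitRight (counit₀ a b) f) = 1
    rw [this, pexp_zero]
  · change leg12 (pexp f) * comulLeftZ a b (pexp f) = leg23 (pexp f) * comulRightZ a b (pexp f)
    rw [hL, hR, mul_assoc]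

end ExponentialTwist

/-! ### Closed subalgebras, and a criterion on generators for Hopf subalgebras. -/

section HopfSubalgebra

variable {A : Type} [Ring A] [Algebra ℝ A]

theorem adjoin_subset_closedSubalgebra {S : Set A⟦X⟧} {x : A⟦X⟧}
    (h : x ∈ Algebra.adjoin ℝ (insert z S)) : x ∈ closedSubalgebra S :=
  fun N => ⟨x, h, AgreeTo.refl N x⟩

theorem closedSubalgebra_closed {S : Set A⟦X⟧} {x : A⟦X⟧}
    (h : ∀ N, ∃ y ∈ closedSubalgebra S, AgreeTo N x y) : x ∈ closedSubalgebra S := fun N => by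
  obtain ⟨y, hy, hxy⟩ := h N
  obtain ⟨y', hy', hyy'⟩ := hy N
  exact ⟨y', hy', hxy.trans hyy'⟩

/-- The closed subalgebra generated by a set, as a subalgebra. -/
def closure (S : Set A⟦X⟧) : Subalgebra ℝ A⟦X⟧ where
  carrier := closedSubalgebra S
  mul_mem' := by
    intro x y hx hy N
    obtain ⟨x', hx', h1⟩ := hx N
    obtain ⟨y', hy', h2⟩ := hy N
    exact ⟨x' * y', mul_mem hx' hy', AgreeTo.mul h1 h2⟩
  add_mem' := by
    intro x y hx hy N
    obtain ⟨x', hx', h1⟩ := hx N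
    obtain ⟨y', hy', h2⟩ := hy N
    exact ⟨x' + y', add_mem hx' hy', AgreeTo.add h1 h2⟩
  algebraMap_mem' r := adjoin_subset_closedSubalgebra (Subalgebra.algebraMap_mem _ r)

theorem mem_closure_of_mem {S : Set A⟦X⟧} {x : A⟦X⟧} (h : x ∈ S) : x ∈ closure S :=
  adjoin_subset_closedSubalgebra (Algebra.subset_adjoin (Set.mem_insert_of_mem _ h))

theorem z_mem_closure (S : Set A⟦X⟧) : z ∈ closure S :=
  adjoin_subset_closedSubalgebra (Algebra.subset_adjoin (Set.mem_insert _ _))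

theorem pser_mem_closure {S : Set A⟦X⟧} (c : ℕ → ℝ) {f : A⟦X⟧} (hf : Small f)
    (h : f ∈ closure S) : pser c f ∈ closure S :=
  closedSubalgebra_closed fun N => ⟨_, (closure S).sum_mem fun k _ =>
    (closure S).smul_mem (pow_mem h k) (c k), pser_agreeTo hf N⟩

/-- The series of counits lies in `ℝ⟦z⟧` and is the limit of its polynomial truncations in `z`. -/
theorem scalar_mem_closure (S : Set A⟦X⟧) (ε : A →ₐ[ℝ] ℝ) (x : A⟦X⟧) :
    mapₐ ((Algebra.ofId ℝ A).comp ε) x ∈ closure S := by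
  refine closedSubalgebra_closed fun N =>
    ⟨∑ n ∈ Finset.range N, ε (PowerSeries.coeff n x) • z ^ n, (closure S).sum_mem fun n _ =>
      (closure S).smul_mem (pow_mem (z_mem_closure S) n) _, fun m hm => ?_⟩
  rw [coeff_mapₐ, map_sum, Finset.sum_eq_single m]
  · rw [coeff_real_smul, PowerSeries.coeff_X_pow_self, AlgHom.comp_apply, Algebra.ofId_apply,
      Algebra.algebraMap_eq_smul_one]
  · intro n _ hn
    rw [coeff_real_smul, PowerSeries.coeff_X_pow, if_neg hn.symm, smul_zero]
  · intro h
    exact absurd (Finset.mem_range.2 hm) h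

theorem tens_one_mem_closure {G : Set A⟦X⟧} {x : A⟦X⟧} (h : x ∈ closure G) :
    tens x 1 ∈ closure ((fun g => tens g 1) '' G ∪ (fun g => tens 1 g) '' G) := by
  set T := (fun g => tens g 1) '' G ∪ (fun g => tens 1 g) '' G
  refine closedSubalgebra_closed fun N => ?_
  obtain ⟨y, hy, hxy⟩ := h N
  refine ⟨tens y 1, ?_, AgreeTo.mul (AgreeTo.mapₐ _ hxy) (AgreeTo.refl _ _)⟩
  clear hxy
  change tens y 1 ∈ closure T
  induction hy using Algebra.adjoin_induction with
  | mem y hy =>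
    rcases hy with rfl | hy
    · rw [← mul_one z, z_mul_tens, tens_one_one, mul_one]
      exact z_mem_closure T
    · exact mem_closure_of_mem (Or.inl ⟨y, hy, rfl⟩)
  | algebraMap r =>
    rw [Algebra.algebraMap_eq_smul_one, smul_tens, tens_one_one]
    exact (closure T).smul_mem (one_mem _) r
  | add x y _ _ hx hy => rw [add_tens]; exact add_mem hx hy
  | mul x y _ _ hx hy =>
    rw [← mul_one (1 : A⟦X⟧), ← tens_mul_tens]; exact mul_mem hx hy

theorem one_tens_mem_closure {G : Set A⟦X⟧} {x : A⟦X⟧} (h : x ∈ closure G) :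
    tens 1 x ∈ closure ((fun g => tens g 1) '' G ∪ (fun g => tens 1 g) '' G) := by
  set T := (fun g => tens g 1) '' G ∪ (fun g => tens 1 g) '' G
  refine closedSubalgebra_closed fun N => ?_
  obtain ⟨y, hy, hxy⟩ := h N
  refine ⟨tens 1 y, ?_, AgreeTo.mul (AgreeTo.refl _ _) (AgreeTo.mapₐ _ hxy)⟩
  clear hxy
  change tens 1 y ∈ closure T
  induction hy using Algebra.adjoin_induction with
  | mem y hy =>
    rcases hy with rfl | hy
    · rw [← mul_one z, tens_z_mul, tens_one_one, mul_one]
      exact z_mem_closure T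
    · exact mem_closure_of_mem (Or.inr ⟨y, hy, rfl⟩)
  | algebraMap r =>
    rw [Algebra.algebraMap_eq_smul_one, tens_smul, tens_one_one]
    exact (closure T).smul_mem (one_mem _) r
  | add x y _ _ hx hy => rw [tens_add]; exact add_mem hx hy
  | mul x y _ _ hx hy =>
    rw [← mul_one (1 : A⟦X⟧), ← tens_mul_tens]; exact mul_mem hx hy

theorem tens_mem_closure {G : Set A⟦X⟧} {x y : A⟦X⟧} (hx : x ∈ closure G) (hy : y ∈ closure G) :
    tens x y ∈ closure ((fun g => tens g 1) '' G ∪ (fun g => tens 1 g) '' G) := by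
  have : tens x y = tens x 1 * tens 1 y := by rw [tens_mul_tens, mul_one, one_mul]
  rw [this]
  exact mul_mem (tens_one_mem_closure hx) (one_tens_mem_closure hy)

/-- `m (L ⊗ id) (x ⊗ y) = L(x) y`. -/
theorem mulZ_tensId_tens (L : A⟦X⟧ →ₗ[ℝ] A⟦X⟧) (hL : ∀ x, L (z * x) = z * L x) (x y : A⟦X⟧) :
    mulZ (tensId L (tens x y)) = L x * y := by
  have key : ∀ u : A, mulZ (tensId L (tens (PowerSeries.C u) y)) = L (PowerSeries.C u) * y := by
    intro u
    refine DFunLike.congr_fun (zlinear_ext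
      (AddMonoidHom.mk' (fun y => mulZ (tensId L (tens (PowerSeries.C u) y))) fun x y => by
        rw [tens_add, tensId_add, mulZ_add])
      (AddMonoidHom.mk' (fun y => L (PowerSeries.C u) * y) fun x y => mul_add _ _ _)
      (fun y => ?_) (fun y => ?_) fun v => ?_) y
    · change mulZ (tensId L (tens _ _)) = z * mulZ (tensId L (tens _ _))
      rw [tens_z_mul, tensId_z_mul, mulZ_z_mul]
    · exact mul_z_mul' _ _
    · change mulZ (tensId L (tens _ _)) = _ * _
      rw [tens_C, tensId_C_tmul, mulZ_mapₐ_left]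
  refine DFunLike.congr_fun (zlinear_ext
    (AddMonoidHom.mk' (fun x => mulZ (tensId L (tens x y))) fun x x' => by
      rw [add_tens, tensId_add, mulZ_add])
    (AddMonoidHom.mk' (fun x => L x * y) fun x x' => by rw [map_add, add_mul])
    (fun x => ?_) (fun x => ?_) key) x
  · change mulZ (tensId L (tens _ _)) = z * mulZ (tensId L (tens _ _))
    rw [z_mul_tens, tensId_z_mul, mulZ_z_mul]
  · change L (z * x) * y = z * (L x * y)
    rw [hL, mul_assoc]

/-- `m (L ⊗ id)` as an additive map. -/
def antipodeConv (L : A⟦X⟧ →ₗ[ℝ] A⟦X⟧) : (A ⊗[ℝ] A)⟦X⟧ →+ A⟦X⟧ :=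
  AddMonoidHom.mk' (fun t => mulZ (tensId L t)) fun x y => by rw [tensId_add, mulZ_add]

theorem antipodeConv_z_mul (L : A⟦X⟧ →ₗ[ℝ] A⟦X⟧) (t : (A ⊗[ℝ] A)⟦X⟧) :
    antipodeConv L (z * t) = z * antipodeConv L t := by
  change mulZ (tensId L (z * t)) = z * mulZ (tensId L t)
  rw [tensId_z_mul, mulZ_z_mul]

variable {a b : ℝ} {F : (U a b ⊗[ℝ] U a b)⟦X⟧}

theorem twAntipode_mul (hv : IsUnit (twElement F)) (x y : (U a b)⟦X⟧) :
    twAntipode F (x * y) = twAntipode F y * twAntipode F x := by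
  have h : mapₗ (antipode₀ a b) (x * y) = mapₗ (antipode₀ a b) y * mapₗ (antipode₀ a b) x := by
    ext n
    rw [coeff_mapₗ, PowerSeries.coeff_mul, PowerSeries.coeff_mul, map_sum,
      ← Finset.Nat.sum_antidiagonal_swap]
    refine Finset.sum_congr rfl fun p _ => ?_
    rw [antipode₀_mul, coeff_mapₗ, coeff_mapₗ]; rfl
  simp only [twAntipode_apply, h, mul_assoc]
  rw [← mul_assoc (Ring.inverse _) (twElement F), Ring.inverse_mul_cancel _ hv, one_mul]

/-- The coproduct is multiplicative, the antipode antimultiplicative, and both commute with `z` and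
preserve agreement below any order. A check on generators therefore extends to polynomials and then
to their `z`-adic limits. -/
theorem isHopfSubalgebra_of_generators (hopf : IsHopf (twComul F) (counit₀ a b) (twAntipode F))
    (hv : IsUnit (twElement F)) {G : Set (U a b)⟦X⟧}
    (hΔ : ∀ g ∈ G, twComul F g ∈ closure ((fun g => tens g 1) '' G ∪ (fun g => tens 1 g) '' G))
    (hS : ∀ g ∈ G, twAntipode F g ∈ closure G) :
    IsHopfSubalgebra (twComul F) (twAntipode F) G := by
  have hS1 : twAntipode F 1 = 1 := by
    have := hopf.antipode_left 1
    rw [hopf.comul_one, ← tens_one_one, mulZ_tensId_tens _ hopf.antipode_z, mul_one, map_one (mapₐ _)] at this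
    exact this
  intro x hx
  constructor
  · refine closedSubalgebra_closed fun N => ?_
    obtain ⟨y, hy, hxy⟩ := hx N
    refine ⟨twComul F y, ?_, ?_⟩
    · clear hxy
      set T := (fun g => tens g 1) '' G ∪ (fun g => tens 1 g) '' G
      change twComul F y ∈ closure T
      induction hy using Algebra.adjoin_induction with
      | mem y hy =>
        rcases hy with rfl | hy
        · rw [← mul_one z, hopf.comul_z, hopf.comul_one, mul_one]
          exact z_mem_closure T
        · exact hΔ y hy
      | algebraMap r =>
        rw [Algebra.algebraMap_eq_smul_one, map_smul, hopf.comul_one]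
        exact (closure T).smul_mem (one_mem _) r
      | add x y _ _ hx hy => rw [map_add]; exact add_mem hx hy
      | mul x y _ _ hx hy => rw [hopf.comul_mul]; exact mul_mem hx hy
    · rw [twComul_apply, twComul_apply]
      exact ((AgreeTo.refl _ _).mul (AgreeTo.mapₐ _ hxy)).mul (AgreeTo.refl _ _)
  · refine closedSubalgebra_closed fun N => ?_
    obtain ⟨y, hy, hxy⟩ := hx N
    refine ⟨twAntipode F y, ?_, ?_⟩
    · clear hxy
      change twAntipode F y ∈ closure G
      induction hy using Algebra.adjoin_induction with
      | mem y hy =>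
        rcases hy with rfl | hy
        · rw [← mul_one z, hopf.antipode_z, hS1, mul_one]
          exact z_mem_closure G
        · exact hS y hy
      | algebraMap r =>
        rw [Algebra.algebraMap_eq_smul_one, map_smul, hS1]
        exact (closure G).smul_mem (one_mem _) r
      | add x y _ _ hx hy => rw [map_add]; exact add_mem hx hy
      | mul x y _ _ hx hy => rw [twAntipode_mul hv]; exact mul_mem hy hx
    · rw [twAntipode_apply, twAntipode_apply]
      refine ((AgreeTo.refl _ _).mul fun m hm => ?_).mul (AgreeTo.refl _ _)
      rw [coeff_mapₗ, coeff_mapₗ, hxy m hm]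

end HopfSubalgebra


/-! ### Commutator calculus, and the bracket table of the classical generators. -/

section Commutators

section General

variable {A : Type} [Ring A] [Algebra ℝ A] (x y w : A)

theorem br_add : br x (y + w) = br x y + br x w := by simp only [br, mul_add, add_mul]; abel
theorem add_br : br (x + y) w = br x w + br y w := by simp only [br, mul_add, add_mul]; abel
theorem br_sub : br x (y - w) = br x y - br x w := by simp only [br, mul_sub, sub_mul]; abel
theorem sub_br : br (x - y) w = br x w - br y w := by simp only [br, mul_sub, sub_mul]; abel
theorem br_neg : br x (-y) = -br x y := by simp only [br, mul_neg, neg_mul]; abel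
theorem neg_br : br (-x) y = -br x y := by simp only [br, mul_neg, neg_mul]; abel
theorem br_zero : br x 0 = 0 := by simp [br]
theorem zero_br : br 0 x = 0 := by simp [br]
theorem br_smul (r : ℝ) : br x (r • y) = r • br x y := by
  simp only [br, mul_smul_comm, smul_mul_assoc, smul_sub]
theorem smul_br (r : ℝ) : br (r • x) y = r • br x y := by
  simp only [br, mul_smul_comm, smul_mul_assoc, smul_sub]
theorem br_mul : br x (y * w) = br x y * w + y * br x w := by simp only [br]; noncomm_ring
theorem mul_br : br (x * y) w = x * br y w + br x w * y := by simp only [br]; noncomm_ring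
theorem br_pow_two : br x (y ^ 2) = br x y * y + y * br x y := by rw [pow_two, br_mul]
theorem pow_two_br : br (x ^ 2) y = x * br x y + br x y * x := by rw [pow_two, mul_br]
theorem br_sum {ι : Type*} (s : Finset ι) (f : ι → A) :
    br x (∑ i ∈ s, f i) = ∑ i ∈ s, br x (f i) := by
  simp only [br, Finset.mul_sum, Finset.sum_mul, Finset.sum_sub_distrib]
theorem sum_br {ι : Type*} (s : Finset ι) (f : ι → A) :
    br (∑ i ∈ s, f i) x = ∑ i ∈ s, br (f i) x := by
  simp only [br, Finset.mul_sum, Finset.sum_mul, Finset.sum_sub_distrib]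
theorem br_swap : br x y = -br y x := by simp only [br]; abel
theorem br_self : br x x = 0 := sub_self _

variable {x y w}

theorem br_eq_zero_iff : br x y = 0 ↔ Commute x y := sub_eq_zero

theorem br_z_mul (x y : A⟦X⟧) : br x (z * y) = z * br x y := by
  rw [br, br, mul_z_mul', mul_sub, mul_assoc]

theorem z_mul_br (x y : A⟦X⟧) : br (z * x) y = z * br x y := by
  rw [br, br, mul_z_mul', mul_sub, mul_assoc]

theorem br_mul_eq (h : br x y = w) : x * y = y * x + w := by
  rw [← h, br]; abel

/-- Commutators of pure tensors whose left legs commute. -/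
theorem br_tens_left {x y u v : A⟦X⟧} (h : Commute x u) :
    br (tens x y) (tens u v) = tens (x * u) (br y v) := by
  rw [br, tens_mul_tens, tens_mul_tens, ← h.eq, br, tens_sub]

/-- Commutators of pure tensors whose right legs commute. -/
theorem br_tens_right {x y u v : A⟦X⟧} (h : Commute y v) :
    br (tens x y) (tens u v) = tens (br x u) (y * v) := by
  rw [br, tens_mul_tens, tens_mul_tens, ← h.eq, br, sub_tens]

end General

variable (a b : ℝ)

/-- The generators of `U a b` as constant series. -/
def cl (g : Gen) : (U a b)⟦X⟧ := PowerSeries.C (gen a b g)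

/-- The generators as a sum of five index sets. -/
def genEquiv : Fin 3 ⊕ Fin 3 ⊕ Fin 3 ⊕ Fin 3 ⊕ Fin 3 ≃ Gen where
  toFun
    | .inl i => .J i
    | .inr (.inl i) => .K i
    | .inr (.inr (.inl i)) => .P i
    | .inr (.inr (.inr (.inl i))) => .C i
    | .inr (.inr (.inr (.inr 0))) => .P0
    | .inr (.inr (.inr (.inr 1))) => .C0
    | .inr (.inr (.inr (.inr 2))) => .D
  invFun
    | .J i => .inl i
    | .K i => .inr (.inl i)
    | .P i => .inr (.inr (.inl i))
    | .C i => .inr (.inr (.inr (.inl i)))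
    | .P0 => .inr (.inr (.inr (.inr 0)))
    | .C0 => .inr (.inr (.inr (.inr 1)))
    | .D => .inr (.inr (.inr (.inr 2)))
  left_inv := by
    rintro (i | i | i | i | i) <;> try rfl
    fin_cases i <;> rfl
  right_inv := by rintro (i | i | i | i | _ | _ | _) <;> rfl

theorem sum_gen {M : Type*} [AddCommMonoid M] (f : Gen → M) :
    ∑ g, f g = ∑ i, f (.J i) + (∑ i, f (.K i) + (∑ i, f (.P i) + (∑ i, f (.C i) +
      (f .P0 + f .C0 + f .D)))) := by
  rw [← genEquiv.sum_comp f]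
  simp only [Fintype.sum_sum_type]
  congr 4
  exact Fin.sum_univ_three _

theorem cl_br (g h : Gen) : br (cl a b g) (cl a b h) =
    ∑ k, Conf.bracket a b (Conf.basisVec a b g) (Conf.basisVec a b h) k • cl a b k := by
  have : ∀ (r : ℝ) k, r • cl a b k = PowerSeries.C (r • gen a b k) := fun r k =>
    ((constₗ (U a b)).map_smul r (gen a b k)).symm
  simp only [this]
  rw [br, cl, cl, ← map_mul, ← map_mul, ← map_sub, gen_mul_sub, map_sum]

theorem cl_JJ (i j : Fin 3) :
    br (cl a b (.J i)) (cl a b (.J j)) = ∑ k, eps i j k • cl a b (.J k) := by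
  rw [cl_br, sum_gen]
  fin_cases i <;> fin_cases j <;>
    simp [Conf.bracket, Conf.bracket.cr, Conf.basisVec, eps, Fin.sum_univ_three] <;> try module

theorem cl_JK (i j : Fin 3) :
    br (cl a b (.J i)) (cl a b (.K j)) = ∑ k, eps i j k • cl a b (.K k) := by
  rw [cl_br, sum_gen]
  fin_cases i <;> fin_cases j <;>
    simp [Conf.bracket, Conf.bracket.cr, Conf.basisVec, eps, Fin.sum_univ_three] <;> try module

theorem cl_JP (i j : Fin 3) :
    br (cl a b (.J i)) (cl a b (.P j)) = ∑ k, eps i j k • cl a b (.P k) := by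
  rw [cl_br, sum_gen]
  fin_cases i <;> fin_cases j <;>
    simp [Conf.bracket, Conf.bracket.cr, Conf.basisVec, eps, Fin.sum_univ_three] <;> try module

theorem cl_JC (i j : Fin 3) :
    br (cl a b (.J i)) (cl a b (.C j)) = ∑ k, eps i j k • cl a b (.C k) := by
  rw [cl_br, sum_gen]
  fin_cases i <;> fin_cases j <;>
    simp [Conf.bracket, Conf.bracket.cr, Conf.basisVec, eps, Fin.sum_univ_three] <;> try module

theorem cl_JP0 (i : Fin 3) :
    br (cl a b (.J i)) (cl a b .P0) = 0 := by
  rw [cl_br, sum_gen]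
  fin_cases i <;>
    simp [Conf.bracket, Conf.bracket.cr, Conf.basisVec, eps, Fin.sum_univ_three] <;> try module

theorem cl_JC0 (i : Fin 3) :
    br (cl a b (.J i)) (cl a b .C0) = 0 := by
  rw [cl_br, sum_gen]
  fin_cases i <;>
    simp [Conf.bracket, Conf.bracket.cr, Conf.basisVec, eps, Fin.sum_univ_three] <;> try module

theorem cl_JD (i : Fin 3) :
    br (cl a b (.J i)) (cl a b .D) = 0 := by
  rw [cl_br, sum_gen]
  fin_cases i <;>
    simp [Conf.bracket, Conf.bracket.cr, Conf.basisVec, eps, Fin.sum_univ_three] <;> try module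

theorem cl_KK (i j : Fin 3) :
    br (cl a b (.K i)) (cl a b (.K j)) = -(a * b) • ∑ k, eps i j k • cl a b (.J k) := by
  rw [cl_br, sum_gen]
  fin_cases i <;> fin_cases j <;>
    simp [Conf.bracket, Conf.bracket.cr, Conf.basisVec, eps, Fin.sum_univ_three] <;> try module

theorem cl_KP (i j : Fin 3) :
    br (cl a b (.K i)) (cl a b (.P j)) = if i = j then a • cl a b .P0 else 0 := by
  rw [cl_br, sum_gen]
  fin_cases i <;> fin_cases j <;>
    simp [Conf.bracket, Conf.bracket.cr, Conf.basisVec, eps, Fin.sum_univ_three] <;> try module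

theorem cl_KC (i j : Fin 3) :
    br (cl a b (.K i)) (cl a b (.C j)) = if i = j then a • cl a b .C0 else 0 := by
  rw [cl_br, sum_gen]
  fin_cases i <;> fin_cases j <;>
    simp [Conf.bracket, Conf.bracket.cr, Conf.basisVec, eps, Fin.sum_univ_three] <;> try module

theorem cl_KP0 (i : Fin 3) :
    br (cl a b (.K i)) (cl a b .P0) = b • cl a b (.P i) := by
  rw [cl_br, sum_gen]
  fin_cases i <;>
    simp [Conf.bracket, Conf.bracket.cr, Conf.basisVec, eps, Fin.sum_univ_three] <;> try module

theorem cl_KC0 (i : Fin 3) :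
    br (cl a b (.K i)) (cl a b .C0) = b • cl a b (.C i) := by
  rw [cl_br, sum_gen]
  fin_cases i <;>
    simp [Conf.bracket, Conf.bracket.cr, Conf.basisVec, eps, Fin.sum_univ_three] <;> try module

theorem cl_KD (i : Fin 3) :
    br (cl a b (.K i)) (cl a b .D) = 0 := by
  rw [cl_br, sum_gen]
  fin_cases i <;>
    simp [Conf.bracket, Conf.bracket.cr, Conf.basisVec, eps, Fin.sum_univ_three] <;> try module

theorem cl_PP (i j : Fin 3) :
    br (cl a b (.P i)) (cl a b (.P j)) = 0 := by
  rw [cl_br, sum_gen]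
  fin_cases i <;> fin_cases j <;>
    simp [Conf.bracket, Conf.bracket.cr, Conf.basisVec, eps, Fin.sum_univ_three] <;> try module

theorem cl_PC (i j : Fin 3) :
    br (cl a b (.P i)) (cl a b (.C j)) = a • ((if i = j then -cl a b .D else 0) + ∑ k, eps i j k • cl a b (.J k)) := by
  rw [cl_br, sum_gen]
  fin_cases i <;> fin_cases j <;>
    simp [Conf.bracket, Conf.bracket.cr, Conf.basisVec, eps, Fin.sum_univ_three] <;> try module

theorem cl_PP0 (i : Fin 3) :
    br (cl a b (.P i)) (cl a b .P0) = 0 := by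
  rw [cl_br, sum_gen]
  fin_cases i <;>
    simp [Conf.bracket, Conf.bracket.cr, Conf.basisVec, eps, Fin.sum_univ_three] <;> try module

theorem cl_PC0 (i : Fin 3) :
    br (cl a b (.P i)) (cl a b .C0) = cl a b (.K i) := by
  rw [cl_br, sum_gen]
  fin_cases i <;>
    simp [Conf.bracket, Conf.bracket.cr, Conf.basisVec, eps, Fin.sum_univ_three] <;> try module

theorem cl_PD (i : Fin 3) :
    br (cl a b (.P i)) (cl a b .D) = -cl a b (.P i) := by
  rw [cl_br, sum_gen]
  fin_cases i <;>
    simp [Conf.bracket, Conf.bracket.cr, Conf.basisVec, eps, Fin.sum_univ_three] <;> try module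

theorem cl_CC (i j : Fin 3) :
    br (cl a b (.C i)) (cl a b (.C j)) = 0 := by
  rw [cl_br, sum_gen]
  fin_cases i <;> fin_cases j <;>
    simp [Conf.bracket, Conf.bracket.cr, Conf.basisVec, eps, Fin.sum_univ_three] <;> try module

theorem cl_CC0 (i : Fin 3) :
    br (cl a b (.C i)) (cl a b .C0) = 0 := by
  rw [cl_br, sum_gen]
  fin_cases i <;>
    simp [Conf.bracket, Conf.bracket.cr, Conf.basisVec, eps, Fin.sum_univ_three] <;> try module

theorem cl_CD (i : Fin 3) :
    br (cl a b (.C i)) (cl a b .D) = cl a b (.C i) := by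
  rw [cl_br, sum_gen]
  fin_cases i <;>
    simp [Conf.bracket, Conf.bracket.cr, Conf.basisVec, eps, Fin.sum_univ_three] <;> try module

theorem cl_P0C (i : Fin 3) :
    br (cl a b .P0) (cl a b (.C i)) = -cl a b (.K i) := by
  rw [cl_br, sum_gen]
  fin_cases i <;>
    simp [Conf.bracket, Conf.bracket.cr, Conf.basisVec, eps, Fin.sum_univ_three] <;> try module

theorem cl_P0C0 :
    br (cl a b .P0) (cl a b .C0) = b • cl a b .D := by
  rw [cl_br, sum_gen]
  simp [Conf.bracket, Conf.bracket.cr, Conf.basisVec, eps, Fin.sum_univ_three]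

theorem cl_P0D :
    br (cl a b .P0) (cl a b .D) = -cl a b .P0 := by
  rw [cl_br, sum_gen]
  simp [Conf.bracket, Conf.bracket.cr, Conf.basisVec, eps, Fin.sum_univ_three]

theorem cl_C0D :
    br (cl a b .C0) (cl a b .D) = cl a b .C0 := by
  rw [cl_br, sum_gen]
  simp [Conf.bracket, Conf.bracket.cr, Conf.basisVec, eps, Fin.sum_univ_three]

end Commutators

/-! ### Coproducts of quadratic elements, rotation invariants, and antipodes from coproducts. -/

section Structure

variable {a b : ℝ}

theorem constantCoeff_cl (g : Gen) : PowerSeries.constantCoeff (cl a b g) = gen a b g :=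
  PowerSeries.constantCoeff_C _

theorem comulZ_cl (g : Gen) : comulZ a b (cl a b g) = tens (cl a b g) 1 + tens 1 (cl a b g) := by
  rw [cl, comulZ, mapₐ_C, comul₀_gen, map_add, ← tens_C, ← tens_C, map_one]

/-- The cross term `2 ∑ x ⊗ x` is the source of the quadratic corrections to the deformed `P₀` and
`C₀`: it is cancelled by commutators with the twist exponent. -/
theorem comulZ_sum_sq (G : Fin 3 → Gen) : comulZ a b (∑ i, cl a b (G i) ^ 2) =
    tens (∑ i, cl a b (G i) ^ 2) 1 + tens 1 (∑ i, cl a b (G i) ^ 2) +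
      (2 : ℝ) • ∑ i, tens (cl a b (G i)) (cl a b (G i)) := by
  have h : ∀ x : (U a b)⟦X⟧, (tens x 1 + tens 1 x) ^ 2 =
      tens (x ^ 2) 1 + tens 1 (x ^ 2) + (2 : ℝ) • tens x x := by
    intro x
    simp only [pow_two, mul_add, add_mul, tens_mul_tens, mul_one, one_mul]
    module
  simp only [map_sum, map_pow, comulZ_cl, h, Finset.sum_add_distrib, sum_tens, tens_sum,
    Finset.smul_sum]

theorem counit_cl (g : Gen) :
    mapₐ ((Algebra.ofId ℝ (U a b)).comp (counit₀ a b)) (cl a b g) = 0 := by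
  rw [cl, mapₐ_C, AlgHom.comp_apply, counit₀_gen, map_zero, map_zero]

theorem twComul_eq {F : (U a b ⊗[ℝ] U a b)⟦X⟧} (hF : IsUnit F) {x : (U a b)⟦X⟧}
    {y : (U a b ⊗[ℝ] U a b)⟦X⟧} (h : F * comulZ a b x = y * F) : twComul F x = y := by
  rw [twComul_apply, h, mul_assoc, Ring.mul_inverse_cancel _ hF, mul_one]

/-- An expression symmetric in `j, k` is contracted with the antisymmetric symbol. -/
theorem eps_contract {M : Type} [AddCommGroup M] [Module ℝ M] (f : Fin 3 → Fin 3 → M) (i : Fin 3) :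
    ∑ j, ∑ k, eps i j k • (f k j + f j k) = 0 := by
  fin_cases i <;> simp [Fin.sum_univ_three, eps] <;> module

section Invariants

variable {A : Type} [Ring A] [Algebra ℝ A]

/-- A rotation acts on the vector `V` antisymmetrically, so it preserves the squared length, even
when the components do not commute. -/
theorem br_sum_sq_eq_zero {x : A⟦X⟧} {V : Fin 3 → A⟦X⟧} {i : Fin 3}
    (h : ∀ j, br x (V j) = ∑ k, eps i j k • V k) : br x (∑ j, V j ^ 2) = 0 := by
  rw [br_sum, ← eps_contract (fun j k => V j * V k) i]
  simp only [br_pow_two, h, Finset.sum_mul, Finset.mul_sum, smul_mul_assoc, mul_smul_comm,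
    smul_add, Finset.sum_add_distrib]

theorem br_tens_one_left (x u v : A⟦X⟧) : br (tens x 1) (tens u v) = tens (br x u) v := by
  rw [br_tens_right (Commute.one_left v), one_mul]

theorem br_one_tens_left (x u v : A⟦X⟧) : br (tens 1 x) (tens u v) = tens u (br x v) := by
  rw [br_tens_left (Commute.one_left u), one_mul]

theorem br_tens_one_right (x u v : A⟦X⟧) : br (tens u v) (tens x 1) = tens (br u x) v := by
  rw [br_tens_right (Commute.one_right v), mul_one]

theorem br_one_tens_right (x u v : A⟦X⟧) : br (tens u v) (tens 1 x) = tens u (br v x) := by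
  rw [br_tens_left (Commute.one_right u), mul_one]

theorem br_sum_tens_eq_zero {x : A⟦X⟧} {V W : Fin 3 → A⟦X⟧} {i : Fin 3}
    (hV : ∀ j, br x (V j) = ∑ k, eps i j k • V k) (hW : ∀ j, br x (W j) = ∑ k, eps i j k • W k) :
    br (tens x 1 + tens 1 x) (∑ j, tens (V j) (W j)) = 0 := by
  rw [br_sum, ← eps_contract (fun j k => tens (V j) (W k)) i]
  simp only [add_br, br_tens_one_left, br_one_tens_left, hV, hW, sum_tens, tens_sum, smul_tens,
    tens_smul, smul_add, Finset.sum_add_distrib]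

end Invariants

/-- The antipode of an element which is skew-primitive up to terms with known antipodes. -/
theorem antipode_mem_closure {F : (U a b ⊗[ℝ] U a b)⟦X⟧}
    (hopf : IsHopf (twComul F) (counit₀ a b) (twAntipode F)) {G : Set (U a b)⟦X⟧}
    {x u u' : (U a b)⟦X⟧} {V W : Fin 3 → (U a b)⟦X⟧}
    (hΔ : twComul F x = tens x u + tens 1 x + z * ∑ i, tens (V i) (W i)) (hu : u * u' = 1)
    (hu' : u' ∈ closure G) (hx : x ∈ closure G) (hV : ∀ i, twAntipode F (V i) ∈ closure G)
    (hW : ∀ i, W i ∈ closure G) : twAntipode F x ∈ closure G := by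
  have h1 : twAntipode F 1 = 1 := by
    have := hopf.antipode_left 1
    rwa [hopf.comul_one, ← tens_one_one, mulZ_tensId_tens _ hopf.antipode_z, mul_one,
      map_one (mapₐ _)] at this
  have h := hopf.antipode_left x
  have h2 : antipodeConv (twAntipode F) (twComul F x) =
      twAntipode F x * u + x + z * ∑ i, twAntipode F (V i) * W i := by
    rw [hΔ, map_add, map_add, antipodeConv_z_mul, map_sum]
    congr 1
    · congr 1
      · exact mulZ_tensId_tens _ hopf.antipode_z _ _
      · exact (mulZ_tensId_tens _ hopf.antipode_z _ _).trans (by rw [h1, one_mul])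
    · congr 1
      exact Finset.sum_congr rfl fun i _ => mulZ_tensId_tens _ hopf.antipode_z _ _
  -- The axiom `m (S ⊗ id) Δ(x) = ε(x)` solved for `S(x)`, the invertible `u` being moved to the
  -- other side.
  have h3 : twAntipode F x = (mapₐ ((Algebra.ofId ℝ (U a b)).comp (counit₀ a b)) x - x -
      z * ∑ i, twAntipode F (V i) * W i) * u' := by
    rw [← h, show mulZ (tensId (twAntipode F) (twComul F x)) = _ from h2]
    rw [show ∀ p q r : (U a b)⟦X⟧, p + q + r - q - r = p by intros; abel, mul_assoc, hu, mul_one]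
  rw [h3]
  exact mul_mem (sub_mem (sub_mem (scalar_mem_closure _ _ _) hx) (mul_mem (z_mem_closure _)
    (sum_mem fun i _ => mul_mem (hV i) (hW i)))) hu'

end Structure

/-! ### The Galilean Hopf algebra: relations, coproduct, `R`-matrix and subalgebras. -/

section Galilean

local notation "c" => cl 0 1

/-- The limits of the deformed generators in the Galilean case. -/
def galileanGen : Gen → (U 0 1)⟦X⟧
  | .P0 => c .P0 + (1 / 2 : ℝ) • (z * ∑ i, c (.P i) ^ 2)
  | .C0 => c .C0 + (1 / 2 : ℝ) • (z * ∑ i, c (.K i) ^ 2)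
  | .J i => c (.J i)
  | .K i => c (.K i)
  | .P i => c (.P i)
  | .C i => c (.C i)
  | .D => c .D

/-- The exponent of the Galilean twisting element. -/
def galileanExponent : (U 0 1 ⊗[ℝ] U 0 1)⟦X⟧ := ∑ i, tens (c (.K i)) (-(z * c (.P i)))

/-- The Galilean twisting element. -/
def galileanTwist : (U 0 1 ⊗[ℝ] U 0 1)⟦X⟧ := pexp galileanExponent

theorem galileanExponent_eq : galileanExponent = -(z * ∑ i, tens (c (.K i)) (c (.P i))) := by
  simp only [galileanExponent, tens_neg, tens_z_mul, Finset.sum_neg_distrib, Finset.mul_sum]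

/-- The quadratic corrections have twice the dilation weight of `P₀`, respectively weight zero in
the case of `C₀`; this mismatch produces the terms in `z` of `[P₀, D]` and `[C₀, D]`. In `[P₀, C₀]`
the two corrections contribute opposite sums of `P_i K_i + K_i P_i` and cancel. -/
theorem galileanGen_relations : GalileanRelations galileanGen := by
  have sq : ∀ x : (U 0 1)⟦X⟧, x * x = x ^ 2 := fun x => (pow_two x).symm
  have h1 := fun i => br_swap (c .P0) (c (.K i))
  have h2 := fun i j => br_swap (c (.P i)) (c (.K j))
  have h3 := fun i => br_swap (c .C0) (c (.K i))
  have h4 := fun i j => br_swap (c (.C i)) (c (.K j))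
  constructor
  · constructor <;> intros
    · exact cl_JJ ..
    · exact cl_JK ..
    · exact cl_JP ..
    · exact cl_JC ..
    · simp only [galileanGen, br_add, br_smul, br_z_mul, br_sum_sq_eq_zero (cl_JP 0 1 _), cl_JP0,
        mul_zero, smul_zero, add_zero]
    · simp only [galileanGen, br_add, br_smul, br_z_mul, br_sum_sq_eq_zero (cl_JK 0 1 _), cl_JC0,
        mul_zero, smul_zero, add_zero]
    · exact cl_JD ..
  all_goals intros
  all_goals simp only [galileanGen, br_add, add_br, br_smul, smul_br, br_z_mul, z_mul_br, br_sum,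
    sum_br, br_pow_two, pow_two_br, cl_KK, cl_KP, cl_KC, cl_KP0, cl_KC0, cl_KD, cl_PP, cl_PC,
    cl_PP0, cl_PC0, cl_PD, cl_CC, cl_CC0, cl_CD, cl_P0C, cl_P0C0, cl_P0D, cl_C0D, h1, h2, h3, h4,
    zero_mul, mul_zero, neg_zero, zero_smul, one_smul, smul_zero, add_zero, zero_add, ite_self,
    Finset.sum_const_zero, neg_mul, mul_neg, smul_neg, Finset.sum_add_distrib, mul_add, smul_add,
    Finset.sum_neg_distrib, sq]
  all_goals module

theorem galileanGen_commute_KP (i j : Fin 3) : Commute (c (.K i)) (c (.P j)) :=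
  br_eq_zero_iff.1 (by rw [cl_KP, zero_smul, ite_self])

theorem small_galileanExponent : Small galileanExponent := by
  rw [galileanExponent_eq]; exact (small_z_mul _).neg

theorem isUnit_galileanTwist : IsUnit galileanTwist :=
  isUnit_of_coeff_zero (coeff_zero_pexp _)

theorem br_galileanExponent (x : (U 0 1 ⊗[ℝ] U 0 1)⟦X⟧) :
    br galileanExponent x = -(z * ∑ i, br (tens (c (.K i)) (c (.P i))) x) := by
  rw [galileanExponent_eq, neg_br, z_mul_br, sum_br]

/-- Boosts and space translations commute when `a = 0`, so the elements `-z P_i` commute with the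
exponent in both legs and keep their primitive coproduct under the twist. -/
theorem isTwist_galileanTwist : IsTwist galileanTwist := by
  have hPP : ∀ i j, Commute (c (.P i)) (c (.P j)) := fun i j => br_eq_zero_iff.1 (cl_PP ..)
  refine isTwist_pexp (fun i => c (.K i)) (fun i => -(z * c (.P i)))
    (fun i j => br_eq_zero_iff.1 ?_) (fun i j => ?_) (fun i => (small_z_mul _).neg)
    (fun i => counit_cl _) (fun i => ?_) (fun i => comulZ_cl _) (fun i => ?_)
  · simp only [cl_KK, mul_one, neg_zero, zero_smul]
  · exact (((z_commute _).mul_left ((z_commute _).symm.mul_right (hPP i j))).neg_left).neg_right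
  · rw [map_neg, mapₐ_z_mul, counit_cl, mul_zero, neg_zero]
  · have h : comulZ 0 1 (-(z * c (.P i))) = tens (-(z * c (.P i))) 1 + tens 1 (-(z * c (.P i))) := by
      rw [map_neg, comulZ, mapₐ_z_mul, comulZ_cl, neg_tens, tens_neg, z_mul_tens, tens_z_mul,
        mul_add, neg_add]
    rw [← h]
    refine (pexp_commute small_galileanExponent (br_eq_zero_iff.1 ?_)).symm
    rw [br_swap, br_galileanExponent, map_neg, comulZ, mapₐ_z_mul, comulZ_cl]
    simp only [br_neg, br_z_mul, br_add, br_tens_one_right, br_one_tens_right, cl_KP, cl_PP,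
      zero_smul, ite_self, zero_tens, tens_zero, add_zero, mul_zero, neg_zero,
      Finset.sum_const_zero]

/-- Conjugation by the exponential stops after the first commutator when the exponent commutes with
that commutator, which happens for every generator. -/
theorem twComul_galilean {x : (U 0 1)⟦X⟧} {y : (U 0 1 ⊗[ℝ] U 0 1)⟦X⟧}
    (hy : br galileanExponent (comulZ 0 1 x) = y) (h0 : br galileanExponent y = 0) :
    twComul galileanTwist x = comulZ 0 1 x + y := by
  refine twComul_eq isUnit_galileanTwist ?_
  rw [galileanTwist, pexp_mul_of_ad small_galileanExponent hy h0 (Commute.zero_right _), smul_zero,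
    add_zero]

theorem galileanGen_coproduct : GalileanCoproduct (twComul galileanTwist) galileanGen := by
  have hKK : ∀ i j, br (c (.K i)) (c (.K j)) = 0 := fun i j => by
    simp only [cl_KK, mul_one, neg_zero, zero_smul]
  have hKP : ∀ i j, br (c (.K i)) (c (.P j)) = 0 := fun i j => by
    simp only [cl_KP, zero_smul, ite_self]
  have hPK := fun i j => (br_swap (c (.P i)) (c (.K j))).trans (by rw [hKP, neg_zero])
  have hPC : ∀ i j, br (c (.P i)) (c (.C j)) = 0 := fun i j => by simp only [cl_PC, zero_smul]
  have hKC : ∀ i j, br (c (.K i)) (c (.C j)) = 0 := fun i j => by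
    simp only [cl_KC, zero_smul, ite_self]
  have hPP := cl_PP 0 1
  have tt : ∀ {x y u v : (U 0 1)⟦X⟧}, br x u = 0 → br y v = 0 → br (tens x y) (tens u v) = 0 :=
    fun h1 h2 => br_eq_zero_iff.2 (tens_commute (br_eq_zero_iff.1 h1) (br_eq_zero_iff.1 h2))
  refine ⟨fun g hD hC0 => ?_, ?_, ?_⟩
  · rcases g with i | i | i | i | _ | _ | _
    · rw [galileanGen, twComul_galilean (y := 0), add_zero, comulZ_cl]
      · rw [galileanExponent_eq, comulZ_cl, br_swap, br_neg, br_z_mul,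
          br_sum_tens_eq_zero (cl_JK 0 1 i) (cl_JP 0 1 i), mul_zero, neg_zero, neg_zero]
      · exact br_zero _
    · rw [galileanGen, twComul_galilean (y := 0), add_zero, comulZ_cl]
      · simp only [br_galileanExponent, comulZ_cl, br_add, br_tens_one_right, br_one_tens_right,
          hKK, hPK, zero_tens, tens_zero, add_zero, Finset.sum_const_zero, mul_zero, neg_zero]
      · exact br_zero _
    · rw [galileanGen, twComul_galilean (y := 0), add_zero, comulZ_cl]
      · simp only [br_galileanExponent, comulZ_cl, br_add, br_tens_one_right, br_one_tens_right,
          hKP, hPP, zero_tens, tens_zero, add_zero, Finset.sum_const_zero, mul_zero, neg_zero]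
      · exact br_zero _
    · rw [galileanGen, twComul_galilean (y := 0), add_zero, comulZ_cl]
      · simp only [br_galileanExponent, comulZ_cl, br_add, br_tens_one_right, br_one_tens_right,
          hKC, hPC, zero_tens, tens_zero, add_zero, Finset.sum_const_zero, mul_zero, neg_zero]
      · exact br_zero _
    · have hx : comulZ 0 1 (galileanGen .P0) = tens (galileanGen .P0) 1 + tens 1 (galileanGen .P0) +
          z * ∑ i, tens (c (.P i)) (c (.P i)) := by
        rw [galileanGen, map_add, mapₐ_smul, comulZ, mapₐ_z_mul, comulZ_sum_sq, comulZ_cl]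
        simp only [mul_add, mul_smul_comm, add_tens, tens_add, smul_tens, tens_smul, z_mul_tens,
          tens_z_mul]
        module
      -- Since `[K_i, P₀] = P_i`, the commutator with the exponent is `-z ∑ P_i ⊗ P_i`, exactly
      -- opposite to the cross term of the quadratic correction; the deformed `P₀` becomes
      -- primitive.
      rw [twComul_galilean (y := -(z * ∑ i, tens (c (.P i)) (c (.P i)))), hx]
      · abel
      · rw [hx]
        simp only [galileanGen, br_galileanExponent, br_add, br_tens_one_right, br_one_tens_right,
          br_smul, br_z_mul, br_sum, br_pow_two, hKP, hPP, cl_KP0, cl_PP0, one_smul,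
          tt (hKP _ _) (hPP _ _), zero_mul, mul_zero, add_zero, Finset.sum_const_zero, smul_zero,
          tens_zero, neg_zero]
      · simp only [br_galileanExponent, br_neg, br_z_mul, br_sum, tt (hKP _ _) (hPP _ _),
          Finset.sum_const_zero, mul_zero, neg_zero]
    · exact absurd rfl hC0
    · exact absurd rfl hD
  · rw [galileanGen, twComul_galilean, comulZ_cl]
    · simp only [br_galileanExponent, comulZ_cl, br_add, br_tens_one_right, br_one_tens_right,
        cl_KD, cl_PD, zero_tens, tens_neg, zero_add, Finset.sum_neg_distrib, mul_neg, neg_neg,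
        Finset.sum_const_zero, mul_zero, neg_zero]
      rfl
    · simp only [br_galileanExponent, galileanGen, br_z_mul, br_sum, tt (hKK _ _) (hPP _ _),
        Finset.sum_const_zero, mul_zero, neg_zero]
  · have hx : comulZ 0 1 (galileanGen .C0) = tens (galileanGen .C0) 1 + tens 1 (galileanGen .C0) +
        z * ∑ i, tens (c (.K i)) (c (.K i)) := by
      rw [galileanGen, map_add, mapₐ_smul, comulZ, mapₐ_z_mul, comulZ_sum_sq, comulZ_cl]
      simp only [mul_add, mul_smul_comm, add_tens, tens_add, smul_tens, tens_smul, z_mul_tens,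
        tens_z_mul]
      module
    -- The commutator has two parts, from `[K_i, C₀] = C_i` and from `[P_i, C₀] = K_i`. The second
    -- cancels the cross term `z ∑ K_i ⊗ K_i`; the first remains.
    rw [twComul_galilean (y := -(z * ∑ i, tens (c (.C i)) (c (.P i))) -
      z * ∑ i, tens (c (.K i)) (c (.K i))), hx]
    · simp only [galileanGen]; abel
    · rw [hx]
      simp only [galileanGen, br_galileanExponent, br_add, br_tens_one_right, br_one_tens_right,
        br_smul, br_z_mul, br_sum, br_pow_two, hKK, hPK, cl_KC0, cl_PC0, one_smul,
        tt (hKK _ _) (hPK _ _), zero_mul, mul_zero, add_zero, Finset.sum_const_zero, smul_zero,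
        tens_zero, zero_tens, Finset.sum_add_distrib, mul_add]
      simp only [neg_zero, Finset.sum_const_zero, mul_zero]
      abel
    · simp only [br_galileanExponent, br_neg, br_sub, br_z_mul, br_sum, tt (hKC _ _) (hPP _ _),
        tt (hKK _ _) (hPK _ _), Finset.sum_const_zero, mul_zero, neg_zero, sub_zero]

theorem galilean_commute (i j : Fin 3) : Commute (z * tens (c (.K i)) (c (.P i)))
    (z * tens (c (.K j)) (c (.P j))) :=
  (z_commute _).mul_left ((z_commute _).symm.mul_right (tens_commute
    (br_eq_zero_iff.1 (by simp only [cl_KK, mul_one, neg_zero, zero_smul]))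
    (br_eq_zero_iff.1 (cl_PP ..))))

theorem galileanTwist_eq : galileanTwist = expTens (-1) (galileanGen (.K 2)) (galileanGen (.P 2)) *
    expTens (-1) (galileanGen (.K 1)) (galileanGen (.P 1)) *
    expTens (-1) (galileanGen (.K 0)) (galileanGen (.P 0)) := by
  have hs : ∀ i, Small ((-1 : ℝ) • (z * tens (c (.K i)) (c (.P i)))) := fun i =>
    (small_z_mul _).smul _
  have hc : ∀ i j, Commute ((-1 : ℝ) • (z * tens (c (.K i)) (c (.P i))))
      ((-1 : ℝ) • (z * tens (c (.K j)) (c (.P j)))) := fun i j =>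
    ((galilean_commute i j).smul_left _).smul_right _
  rw [expTens, expTens, expTens, galileanTwist, galileanExponent_eq, Fin.sum_univ_three]
  change _ = pexp ((-1 : ℝ) • (z * tens (c (.K 2)) (c (.P 2)))) *
    pexp ((-1 : ℝ) • (z * tens (c (.K 1)) (c (.P 1)))) *
    pexp ((-1 : ℝ) • (z * tens (c (.K 0)) (c (.P 0))))
  rw [← pexp_add (hs _) (hs _) (hc _ _), ← pexp_add ((hs _).add (hs _)) (hs _)
    ((hc _ _).add_left (hc _ _)), mul_add, mul_add]
  congr 1
  module

theorem inverse_pexp {A : Type} [Ring A] [Algebra ℝ A] {f : A⟦X⟧} (hf : Small f) :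
    Ring.inverse (pexp f) = pexp (-f) := by
  rw [← mul_one (Ring.inverse _), ← pexp_mul_pexp_neg hf, ← mul_assoc,
    Ring.inverse_mul_cancel _ (isUnit_of_coeff_zero (coeff_zero_pexp _)), one_mul]

theorem swapZ_galileanExponent :
    swapZ galileanExponent = -(z * ∑ i, tens (c (.P i)) (c (.K i))) := by
  rw [galileanExponent_eq, swapZ, map_neg, mapₐ_z_mul, map_sum]
  exact congrArg (fun t => -(z * t)) (Finset.sum_congr rfl fun i _ => swapZ_tens _ _)

theorem galilean_wedge_commute (i j : Fin 3) : Commute (z * wedge (c (.K i)) (c (.P i)))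
    (z * wedge (c (.K j)) (c (.P j))) := by
  have hKK : Commute (c (.K i)) (c (.K j)) :=
    br_eq_zero_iff.1 (by simp only [cl_KK, mul_one, neg_zero, zero_smul])
  have hPP : Commute (c (.P i)) (c (.P j)) := br_eq_zero_iff.1 (cl_PP ..)
  refine (z_commute _).mul_left ((z_commute _).symm.mul_right (Commute.sub_left ?_ ?_))
  · exact (tens_commute hKK hPP).sub_right
      (tens_commute (galileanGen_commute_KP i j) (galileanGen_commute_KP j i).symm)
  · exact (tens_commute (galileanGen_commute_KP j i).symm (galileanGen_commute_KP i j)).sub_right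
      (tens_commute hPP hKK)

/-- The exponent and its flip commute, because all `K_i` and `P_j` do, so the product of the two
exponentials is the exponential of the flip minus the exponent. -/
theorem rMatrix_galileanTwist : rMatrix galileanTwist =
    pexp (z * ∑ i, wedge (galileanGen (.K i)) (galileanGen (.P i))) := by
  rw [rMatrix, galileanTwist, inverse_pexp small_galileanExponent, swapZ_pexp, ← pexp_add]
  · congr 1
    rw [swapZ_galileanExponent, galileanExponent_eq, neg_neg, neg_add_eq_sub, ← mul_sub,
      ← Finset.sum_sub_distrib]
    rfl
  · exact small_galileanExponent.mapₐ _
  · exact small_galileanExponent.neg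
  · rw [swapZ_galileanExponent, galileanExponent_eq]
    refine (((z_commute _).mul_left ((z_commute _).symm.mul_right ?_)).neg_left).neg_right.neg_right
    exact Commute.sum_left _ _ _ fun i _ => Commute.sum_right _ _ _ fun j _ =>
      tens_commute (galileanGen_commute_KP j i).symm (galileanGen_commute_KP i j)

theorem rMatrix_galileanTwist_eq_mul : rMatrix galileanTwist =
    pexp (z * wedge (galileanGen (.K 0)) (galileanGen (.P 0))) *
      pexp (z * wedge (galileanGen (.K 1)) (galileanGen (.P 1))) *
      pexp (z * wedge (galileanGen (.K 2)) (galileanGen (.P 2))) := by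
  have hc := galilean_wedge_commute
  rw [rMatrix_galileanTwist, Fin.sum_univ_three, mul_add, mul_add]
  simp only [galileanGen]
  rw [pexp_add ((small_z_mul _).add (small_z_mul _)) (small_z_mul _)
    ((hc _ _).add_left (hc _ _)), pexp_add (small_z_mul _) (small_z_mul _) (hc _ _)]

theorem isHopf_galileanTwist :
    IsHopf (twComul galileanTwist) (counit₀ 0 1) (twAntipode galileanTwist) :=
  isTwist_galileanTwist.isHopf (coeff_zero_pexp _)

/-- The kinematical and the Weyl subalgebra are treated together. Among these generators only `D` is
not primitive, and its coproduct involves only `K_i` and `P_i`, which every admissible `G` contains.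
-/
theorem galilean_isHopfSubalgebra {G : Set Gen} (hG : kinematical ⊆ G) (hG' : G ⊆ weyl) :
    IsHopfSubalgebra (twComul galileanTwist) (twAntipode galileanTwist) (galileanGen '' G) := by
  have hmem : ∀ {g}, g ∈ G → galileanGen g ∈ closure (galileanGen '' G) := fun hg =>
    mem_closure_of_mem ⟨_, hg, rfl⟩
  have hK : ∀ i, Gen.K i ∈ G := fun i => hG (Or.inr ⟨i, Or.inr (Or.inr rfl)⟩)
  have hP : ∀ i, Gen.P i ∈ G := fun i => hG (Or.inr ⟨i, Or.inr (Or.inl rfl)⟩)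
  have hC0 : Gen.C0 ∉ G := fun h => by
    have := hG' h
    simp [weyl, kinematical] at this
  have cop := galileanGen_coproduct
  have hprim : ∀ g ∈ G, g ≠ .D → twAntipode galileanTwist (galileanGen g) ∈
      closure (galileanGen '' G) := fun g hg hD =>
    antipode_mem_closure isHopf_galileanTwist (u := 1) (u' := 1) (V := 0) (W := 0)
      (by rw [cop.primitive g hD (fun h => hC0 (h ▸ hg))]; simp [tens_zero]) (one_mul 1)
      (one_mem _) (hmem hg) (fun i => by rw [Pi.zero_apply, map_zero]; exact zero_mem _)
      fun i => zero_mem _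
  refine isHopfSubalgebra_of_generators isHopf_galileanTwist
    (isUnit_twElement (coeff_zero_pexp _)) ?_ ?_
  · rintro _ ⟨g, hg, rfl⟩
    have h1 : ∀ {x}, x ∈ closure (galileanGen '' G) → tens x 1 + tens 1 x ∈ _ := fun hx =>
      add_mem (tens_mem_closure hx (one_mem _)) (tens_mem_closure (one_mem _) hx)
    by_cases hD : g = .D
    · rw [hD, cop.D]
      exact add_mem (h1 (hmem (hD ▸ hg))) (mul_mem (z_mem_closure _) (sum_mem fun i _ =>
        tens_mem_closure (hmem (hK i)) (hmem (hP i))))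
    · rw [cop.primitive g hD (fun h => hC0 (h ▸ hg))]
      exact h1 (hmem hg)
  · rintro _ ⟨g, hg, rfl⟩
    by_cases hD : g = .D
    · rw [hD]
      exact antipode_mem_closure isHopf_galileanTwist (u := 1) (u' := 1) cop.D (one_mul 1)
        (one_mem _) (hmem (hD ▸ hg)) (fun i => hprim _ (hK i) (by simp)) fun i => hmem (hP i)
    · exact hprim g hg hD

end Galilean

/-! ### The deformed Carroll time translation: `E = (1 - z P₀)⁻¹` and its logarithm. -/

section DeformedTime

theorem br_z {A : Type} [Ring A] [Algebra ℝ A] (x : A⟦X⟧) : br x z = 0 :=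
  br_eq_zero_iff.2 (z_commute x).symm

theorem z_br {A : Type} [Ring A] [Algebra ℝ A] (x : A⟦X⟧) : br z x = 0 :=
  br_eq_zero_iff.2 (z_commute x)

theorem br_mul_pow {A : Type} [Ring A] [Algebra ℝ A] {u x y : A} (h : br u x = y)
    (hc : Commute u y) (k : ℕ) : br (u ^ (k + 1)) x = ((k + 1 : ℕ) : ℝ) • (y * u ^ k) := by
  induction k with
  | zero => simp [h]
  | succ k ih =>
    rw [pow_succ u (k + 1), mul_br, ih, h, (hc.pow_left (k + 1)).eq, smul_mul_assoc, mul_assoc,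
      ← pow_succ]
    push_cast
    module

/-- The commutator of a power series in `z u` with an element `x` such that `[u, x]` commutes
with `u`. -/
theorem br_pser {A : Type} [Ring A] [Algebra ℝ A] (d : ℕ → ℝ) {u x y : A⟦X⟧} (h : br u x = y)
    (hc : Commute u y) :
    br (pser d (z * u)) x = z * (y * pser (fun k => ((k + 1 : ℕ) : ℝ) * d (k + 1)) (z * u)) := by
  have hb : br (z * u) x = z * y := by rw [z_mul_br, h]
  have hcz : Commute (z * u) (z * y) :=
    (z_commute _).mul_left ((z_commute _).symm.mul_right hc)
  refine eq_of_agreeTo fun N => ?_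
  have h1 := (pser_agreeTo (c := d) (small_z_mul u) (N + 1)).mono N.le_succ
  have h2 := pser_agreeTo (c := fun k => ((k + 1 : ℕ) : ℝ) * d (k + 1)) (small_z_mul u) N
  have key : br (∑ k ∈ Finset.range (N + 1), d k • (z * u) ^ k) x =
      z * (y * ∑ k ∈ Finset.range N, (((k + 1 : ℕ) : ℝ) * d (k + 1)) • (z * u) ^ k) := by
    rw [sum_br, Finset.sum_range_succ', Finset.mul_sum, Finset.mul_sum, smul_br, pow_zero]
    rw [show br (1 : A⟦X⟧) x = 0 by simp [br], smul_zero, add_zero]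
    refine Finset.sum_congr rfl fun k _ => ?_
    rw [smul_br, br_mul_pow hb hcz, mul_smul_comm, mul_smul_comm, smul_smul, mul_comm (d _),
      mul_assoc z]
  refine AgreeTo.trans ?_ ((AgreeTo.refl N z).mul ((AgreeTo.refl N y).mul h2.symm))
  rw [← key]
  exact (h1.mul (AgreeTo.refl N x)).sub ((AgreeTo.refl N x).mul h1)

theorem br_inverse {A : Type} [Ring A] [Algebra ℝ A] {x q E : A} (h1 : E * q = 1)
    (h2 : q * E = 1) : br E x = -(E * br q x * E) := by
  rw [br, br, mul_sub, sub_mul, mul_assoc E (q * x), mul_assoc q x, ← mul_assoc E q, h1, one_mul,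
    mul_assoc E (x * q), mul_assoc x q, h2, mul_one, neg_sub]

local notation "c" => cl 1 0

/-- `(1 - z P₀)⁻¹` for the classical generator `P₀`. -/
def carrollE : (U 1 0)⟦X⟧ := pgeom (z * c .P0)

/-- `-log (1 - z P₀)` for the classical generator `P₀`. -/
def carrollLog : (U 1 0)⟦X⟧ := -plogOneSub (z * c .P0)

theorem carrollE_mul : carrollE * (1 - z * c .P0) = 1 := pgeom_mul (small_z_mul _)

theorem mul_carrollE : (1 - z * c .P0) * carrollE = 1 := mul_pgeom (small_z_mul _)

theorem z_mul_mul_carrollE : z * (c .P0 * carrollE) = carrollE - 1 := by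
  have := mul_carrollE
  rw [sub_mul, one_mul, sub_eq_iff_eq_add, mul_assoc] at this
  rw [eq_sub_iff_add_eq', ← this]

theorem carrollLog_eq : carrollLog = pser (fun k => (k : ℝ)⁻¹) (z * c .P0) := by
  rw [carrollLog, plogOneSub_eq_pser]
  ext n
  simp only [pser, map_neg, PowerSeries.coeff_mk, map_sum, coeff_real_smul, neg_smul,
    Finset.sum_neg_distrib, neg_neg]

theorem small_carrollLog : Small carrollLog := (plogOneSub_small _).neg

/-- A bracket commuting with `P₀` makes the commutator act as a derivation on functions of `P₀`, and
the derivative of `-log (1 - u)` is `(1 - u)⁻¹`. -/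
theorem br_carrollLog {x y : (U 1 0)⟦X⟧} (h : br (c .P0) x = y) (hc : Commute (c .P0) y) :
    br carrollLog x = z * (y * carrollE) := by
  rw [carrollLog_eq, br_pser _ h hc]
  have : (fun k : ℕ => ((k + 1 : ℕ) : ℝ) * ((k + 1 : ℕ) : ℝ)⁻¹) = fun _ => 1 := by
    funext k
    exact mul_inv_cancel₀ (Nat.cast_ne_zero.2 k.succ_ne_zero)
  rw [this, carrollE, pgeom]

/-- The series whose `n`-th coefficient has degree `n` with respect to the dilation. -/
def dilationHomogeneous : Subalgebra ℝ (U 1 0)⟦X⟧ where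
  carrier := {x | ∀ n, br (PowerSeries.coeff n x) (gen 1 0 .D) = -(n : ℝ) • PowerSeries.coeff n x}
  add_mem' := fun hx hy n => by rw [map_add, add_br, hx n, hy n, smul_add]
  mul_mem' := fun {x y} hx hy n => by
    rw [PowerSeries.coeff_mul, sum_br, Finset.smul_sum]
    refine Finset.sum_congr rfl fun p hp => ?_
    rw [mul_br, hx, hy, mul_smul_comm, smul_mul_assoc, ← Finset.HasAntidiagonal.mem_antidiagonal.1 hp]
    push_cast
    module
  algebraMap_mem' r n := by
    rw [Algebra.algebraMap_eq_smul_one, coeff_real_smul, PowerSeries.coeff_one]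
    rcases n with _ | n
    · simp [br]
    · simp [zero_br]

theorem pser_mem_dilationHomogeneous (d : ℕ → ℝ) {f : (U 1 0)⟦X⟧}
    (h : f ∈ dilationHomogeneous) : pser d f ∈ dilationHomogeneous := fun n => by
  rw [pser, PowerSeries.coeff_mk]
  exact dilationHomogeneous.sum_mem
    (fun k _ => dilationHomogeneous.smul_mem (pow_mem h k) (d k)) n

theorem z_mul_mem_dilationHomogeneous : z * c .P0 ∈ dilationHomogeneous := by
  intro n
  have h := congrArg (PowerSeries.coeff 0) (cl_P0D 1 0)
  rcases n with _ | _ | n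
  · rw [coeff_z_mul_zero, zero_br, smul_zero]
  · rw [coeff_z_mul_succ]
    simpa [br, cl] using h
  · rw [coeff_z_mul_succ, cl, PowerSeries.coeff_C, if_neg n.succ_ne_zero, zero_br, smul_zero]

/-- The dilation multiplies the coefficient of order `n` by `-n`. A series commuting with `D`
therefore has no coefficient of positive order. -/
theorem eq_one_of_dilationHomogeneous {x : (U 1 0)⟦X⟧} (hx : x ∈ dilationHomogeneous)
    (h : br x (c .D) = 0) (h0 : PowerSeries.coeff 0 x = 1) : x = 1 := by
  ext n
  rcases n with _ | n
  · rw [h0]; simp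
  · have h1 := congrArg (PowerSeries.coeff (n + 1)) h
    rw [br, cl, map_sub, PowerSeries.coeff_mul_C, PowerSeries.coeff_C_mul, map_zero] at h1
    have h2 := hx (n + 1)
    rw [br, h1, eq_comm, smul_eq_zero] at h2
    rw [h2.resolve_left (neg_ne_zero.2 (Nat.cast_ne_zero.2 n.succ_ne_zero)), PowerSeries.coeff_one,
      if_neg n.succ_ne_zero]

theorem carroll_commute_P0_self : Commute (c .P0) (-c .P0) := (Commute.refl _).neg_right

theorem br_carrollLog_D : br carrollLog (c .D) = 1 - carrollE := by
  rw [br_carrollLog (cl_P0D 1 0) carroll_commute_P0_self, neg_mul, mul_neg, z_mul_mul_carrollE,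
    neg_sub]

theorem carrollE_commute {x : (U 1 0)⟦X⟧} (h : br (c .P0) x = 0) : Commute carrollE x :=
  (pser_commute (small_z_mul _) ((z_commute x).symm.mul_right (br_eq_zero_iff.1 h).symm)).symm

theorem carrollLog_commute {x : (U 1 0)⟦X⟧} (h : br (c .P0) x = 0) : Commute carrollLog x :=
  (plogOneSub_commute (small_z_mul _)
    ((z_commute x).symm.mul_right (br_eq_zero_iff.1 h).symm)).symm.neg_left

theorem carrollE_commute_carrollLog : Commute carrollE carrollLog :=
  carrollE_commute (br_eq_zero_iff.2 (carrollLog_commute (br_self _)).symm)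

/-- The dilation serves as the Euler derivation in `P₀`, so the identity `exp (-log (1 - u)) = (1 -
u)⁻¹` is proved as a differential equation. With `L` for `carrollLog`, `[L, D] = 1 - E` implies that
`exp L · (1 - z P₀)` commutes with `D`; being homogeneous with constant term 1, it equals 1. -/
theorem pexp_carrollLog : pexp carrollLog = carrollE := by
  have h1 : pexp carrollLog * (1 - z * c .P0) = 1 := by
    refine eq_one_of_dilationHomogeneous (mul_mem (pser_mem_dilationHomogeneous _ ?_)
      (sub_mem (one_mem _) z_mul_mem_dilationHomogeneous)) ?_ ?_
    · rw [carrollLog_eq]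
      exact pser_mem_dilationHomogeneous _ z_mul_mem_dilationHomogeneous
    · have h2 : br (pexp carrollLog) (c .D) = (1 - carrollE) * pexp carrollLog := by
        rw [br, pexp_mul_of_ad small_carrollLog br_carrollLog_D
          (br_eq_zero_iff.2 ((Commute.one_right _).sub_right carrollE_commute_carrollLog.symm))
          (Commute.zero_right _), smul_zero, add_zero, add_mul, add_sub_cancel_left]
      have h3 : Commute (pexp carrollLog) (1 - carrollE) :=
        (pexp_commute small_carrollLog
          ((Commute.one_left _).sub_left carrollE_commute_carrollLog)).symm
      have h4 : br (1 - z * c .P0) (c .D) = z * c .P0 := by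
        rw [sub_br, z_mul_br, cl_P0D, show br (1 : (U 1 0)⟦X⟧) (c .D) = 0 by simp [br], mul_neg,
          zero_sub, neg_neg]
      rw [mul_br, h2, h4, ← h3.eq, mul_assoc, ← mul_add, sub_mul, carrollE_mul]
      simp
    · simp [constantCoeff_pexp]
  rw [← mul_one (pexp _), ← mul_carrollE, ← mul_assoc, h1, one_mul]

end DeformedTime

/-! ### Relations of the deformed Carroll generators. -/

section Carroll

local notation "c" => cl 1 0
local notation "E" => carrollE

/-- The limits of the deformed generators in the Carroll case. -/
def carrollGen : Gen → (U 1 0)⟦X⟧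
  | .P0 => divZ carrollLog
  | .C0 => c .C0 + (1 / 2 : ℝ) • (z * ∑ i, c (.K i) ^ 2)
  | .J i => c (.J i)
  | .K i => c (.K i)
  | .P i => c (.P i) * E
  | .C i => c (.C i) - z * (c (.K i) * c .D)
  | .D => c .D

theorem z_mul_carrollGen_P0 : z * carrollGen .P0 = carrollLog := z_mul_divZ small_carrollLog

theorem pexp_z_mul_carrollGen_P0 : pexp (z * carrollGen .P0) = E := by
  rw [z_mul_carrollGen_P0, pexp_carrollLog]

/-- Multiplication by `z` is injective, so brackets with the deformed time translation are read off
from brackets with `z P₀`, the logarithm. -/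
theorem carrollGen_P0_commute {x : (U 1 0)⟦X⟧} (h : br (c .P0) x = 0) :
    br (carrollGen .P0) x = 0 :=
  z_mul_injective (by rw [← z_mul_br, z_mul_carrollGen_P0, mul_zero,
    br_eq_zero_iff.2 (carrollLog_commute h)])

theorem br_carrollE {x y : (U 1 0)⟦X⟧} (h : br (c .P0) x = y) (hc : Commute (c .P0) y) :
    br E x = z * (y * E ^ 2) := by
  rw [br_inverse carrollE_mul mul_carrollE, sub_br, z_mul_br, h,
    show br (1 : (U 1 0)⟦X⟧) x = 0 by simp [br], zero_sub, mul_neg, neg_mul, neg_neg, mul_z_mul',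
    mul_assoc, (carrollE_commute (br_eq_zero_iff.2 hc)).eq, pow_two, mul_assoc]

theorem carroll_P0_K (i : Fin 3) : br (c .P0) (c (.K i)) = 0 := by
  rw [br_swap, cl_KP0, zero_smul, neg_zero]
theorem carroll_P0_P (i : Fin 3) : br (c .P0) (c (.P i)) = 0 := by
  rw [br_swap, cl_PP0, neg_zero]
theorem carroll_P0_J (i : Fin 3) : br (c .P0) (c (.J i)) = 0 := by
  rw [br_swap, cl_JP0, neg_zero]
theorem carroll_P0_C0 : br (c .P0) (c .C0) = 0 := by rw [cl_P0C0, zero_smul]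

theorem carroll_E_K (i : Fin 3) : br E (c (.K i)) = 0 :=
  br_eq_zero_iff.2 (carrollE_commute (carroll_P0_K i))
theorem carroll_E_P (i : Fin 3) : br E (c (.P i)) = 0 :=
  br_eq_zero_iff.2 (carrollE_commute (carroll_P0_P i))
theorem carroll_E_J (i : Fin 3) : br E (c (.J i)) = 0 :=
  br_eq_zero_iff.2 (carrollE_commute (carroll_P0_J i))
theorem carroll_E_C0 : br E (c .C0) = 0 := br_eq_zero_iff.2 (carrollE_commute carroll_P0_C0)
theorem carroll_E_C (i : Fin 3) : br E (c (.C i)) = -(z * (c (.K i) * E ^ 2)) := by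
  rw [br_carrollE (cl_P0C 1 0 i) (br_eq_zero_iff.1 (carroll_P0_K i)).neg_right, neg_mul, mul_neg]
theorem carroll_E_D : br E (c .D) = E - E ^ 2 := by
  rw [br_carrollE (cl_P0D 1 0) carroll_commute_P0_self, neg_mul, mul_neg, pow_two, ← mul_assoc,
    ← mul_assoc, mul_assoc z, z_mul_mul_carrollE, sub_mul, one_mul, neg_sub]
theorem carroll_L_D : br (carrollGen .P0) (c .D) = divZ (1 - E) := by
  rw [← divZ_z_mul (br _ _), ← z_mul_br, z_mul_carrollGen_P0, br_carrollLog_D]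
theorem carroll_L_C (i : Fin 3) : br (carrollGen .P0) (c (.C i)) = -(c (.K i) * E) :=
  z_mul_injective (by rw [← z_mul_br, z_mul_carrollGen_P0, br_carrollLog (cl_P0C 1 0 i)
    (br_eq_zero_iff.1 (carroll_P0_K i)).neg_right, neg_mul])

theorem z_mul_divZ_E : z * divZ (E - 1) = E - 1 := by
  rw [← z_mul_mul_carrollE, divZ_z_mul]

theorem z_mul_divZ_E' : z * divZ (1 - E) = 1 - E := by
  rw [← neg_sub, ← z_mul_mul_carrollE, ← mul_neg, divZ_z_mul]

theorem divZ_E : divZ (E - 1) = c .P0 * E := by rw [← z_mul_mul_carrollE, divZ_z_mul]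

/-- Each relation follows from the classical table and the brackets of `E` and its logarithm with
the classical generators. The recurrent simplification is `z P₀ E = E - 1` for the classical `P₀`.
-/
theorem carrollGen_relations : CarrollRelations carrollGen E := by
  have hKK : ∀ i j, br (c (.K i)) (c (.K j)) = 0 := fun i j => by
    simp only [cl_KK, mul_zero, neg_zero, zero_smul]
  have hKP : ∀ i j, br (c (.K i)) (c (.P j)) = if i = j then c .P0 else 0 := fun i j => by
    simp only [cl_KP, one_smul]
  have hKE : ∀ i, br (c (.K i)) E = 0 := fun i => by rw [br_swap, carroll_E_K, neg_zero]
  have hPE : ∀ i, br (c (.P i)) E = 0 := fun i => by rw [br_swap, carroll_E_P, neg_zero]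
  have hJE : ∀ i, br (c (.J i)) E = 0 := fun i => by rw [br_swap, carroll_E_J, neg_zero]
  have hPK : ∀ i j, br (c (.P i)) (c (.K j)) = if i = j then -c .P0 else 0 := fun i j => by
    rw [br_swap, hKP]
    split_ifs with h1 h2 h2
    · rfl
    · exact absurd h1.symm h2
    · exact absurd h2.symm h1
    · exact neg_zero
  have hKC : ∀ i j, br (c (.K i)) (c (.C j)) = if i = j then c .C0 else 0 := fun i j => by
    simp only [cl_KC, one_smul]
  constructor
  · constructor <;> intro i <;> try intro j
    · exact cl_JJ ..
    · exact cl_JK ..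
    · simp only [carrollGen, br_mul, cl_JP, hJE, mul_zero, add_zero, Finset.sum_mul,
        smul_mul_assoc]
    · simp only [carrollGen, br_sub, br_mul, br_z, cl_JC, cl_JK, cl_JD, mul_zero, zero_mul, zero_add, add_zero,
        Finset.sum_mul, Finset.mul_sum, smul_mul_assoc, smul_sub, mul_smul_comm,
        Finset.sum_sub_distrib]
    · rw [br_swap]; exact (congrArg _ (carrollGen_P0_commute (carroll_P0_J i))).trans neg_zero
    · simp only [carrollGen, br_add, br_smul, br_z_mul, br_sum_sq_eq_zero (cl_JK 1 0 _), cl_JC0,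
        mul_zero, smul_zero, add_zero]
    · exact cl_JD ..
  · exact hKK
  · intro i j
    simp only [carrollGen, br_mul, hKP, hKE, mul_zero, add_zero, divZ_E]
    split_ifs <;> simp
  · intro i j
    simp only [carrollGen, br_sub, br_mul, br_z, hKK, cl_KD, mul_zero, zero_mul, add_zero,
      sub_zero, hKC]
    split_ifs <;> simp
  · intro i
    rw [br_swap]; exact (congrArg _ (carrollGen_P0_commute (carroll_P0_K i))).trans neg_zero
  · intro i
    simp only [carrollGen, br_add, br_smul, br_z_mul, br_sum, br_pow_two, hKK, mul_zero, zero_mul,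
      add_zero, Finset.sum_const_zero, smul_zero, cl_KC0, zero_smul]
  · exact cl_KD 1 0
  · intro i j
    simp only [carrollGen, br_mul, mul_br, cl_PP, hPE, carroll_E_P, br_self, mul_zero, zero_mul,
      add_zero]
  · intro i j
    have h1 : ∀ x, c (.P i) * (c (.K j) * x) = c (.K j) * (c (.P i) * x) +
        (if i = j then -c .P0 else 0) * x := fun x => by
      rw [← mul_assoc, br_mul_eq (hPK i j), add_mul, mul_assoc]
    have h2 := br_mul_eq carroll_E_D
    have h3 : ∀ k, c (.J k) * E = E * c (.J k) := fun k => br_eq_zero_iff.1 (hJE k)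
    have h4 : ∀ x : (U 1 0)⟦X⟧, z * (c .P0 * (E * x)) = (E - 1) * x := fun x => by
      rw [← z_mul_mul_carrollE, mul_assoc, mul_assoc]
    -- Reordering `D` past `E` yields `E ^ 2 - E`. On the diagonal this cancels the terms that `h4`
    -- produces from moving `P_i` past `K_i`, leaving `-D`.
    have h5 : c .D * E = E * c .D - E + E * E := by rw [h2, pow_two]; abel
    simp only [carrollGen, br_sub, br_mul, br_z, mul_br, hPK, carroll_E_C, carroll_E_K, carroll_E_D,
      cl_PC, cl_PD, one_smul, zero_mul, mul_zero, zero_add, add_mul, Finset.sum_mul,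
      smul_mul_assoc, h3]
    simp only [mul_neg, mul_z_mul', h1]
    split_ifs
    · simp only [mul_add, add_mul, neg_mul, mul_neg, mul_assoc, pow_two, h4, h5, mul_sub, sub_mul,
        one_mul]
      abel
    · simp only [add_mul, zero_mul, mul_assoc, pow_two, mul_sub, mul_neg, neg_mul, mul_add, mul_zero]
      abel
  · intro i
    rw [br_swap, carrollGen_P0_commute, neg_zero]
    simp only [carrollGen, br_mul, carroll_P0_P, zero_mul, zero_add]
    rw [br_eq_zero_iff.2 (carrollE_commute (br_self _)).symm, mul_zero]
  · intro i
    have h1 : Commute (c (.K i)) (divZ (E - 1)) := by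
      rw [divZ_E]
      exact (br_eq_zero_iff.1 (carroll_P0_K i)).symm.mul_right (br_eq_zero_iff.1 (hKE i))
    have h2 : ∀ l, br (c (.P i) * E) (c (.K l)) = if i = l then -divZ (E - 1) else 0 := fun l => by
      rw [mul_br, carroll_E_K, mul_zero, zero_add, hPK, divZ_E]
      split_ifs <;> simp
    have h3 : br (c (.P i) * E) (c .C0) = c (.K i) * E := by
      rw [mul_br, carroll_E_C0, mul_zero, zero_add, cl_PC0]
    simp only [carrollGen, br_add, br_smul, br_z_mul, br_sum, br_pow_two, h2, h3, ite_mul, mul_zero, mul_ite, zero_mul,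
      Finset.sum_add_distrib, Finset.sum_ite_eq, Finset.mem_univ, if_true, neg_mul, mul_neg,
      ← h1.eq]
    -- The two halves of the commutator with `K_i ^ 2` agree, and `z · (E - 1) / z = E - 1`. So the
    -- correction contributes `-K_i (E - 1)`, and adding `K_i E` leaves `K_i`.
    rw [← neg_add, mul_neg, ← two_smul ℝ, mul_smul_comm, ← mul_z_mul', z_mul_divZ_E, smul_neg,
      smul_smul, mul_sub]
    norm_num
  · intro i
    simp only [carrollGen, mul_br, cl_PD, carroll_E_D]
    rw [← mul_assoc, (br_eq_zero_iff.1 (carroll_E_P i)).eq, mul_assoc, ← pow_two, mul_sub]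
    noncomm_ring
  · intro i j
    have h1 := br_eq_zero_iff.1 (hKK i j)
    have hDC : br (c .D) (c (.C j)) = -c (.C j) := by rw [br_swap, cl_CD]
    have hDK : br (c .D) (c (.K j)) = 0 := by rw [br_swap, cl_KD, neg_zero]
    have hCK : br (c (.C i)) (c (.K j)) = if i = j then -c .C0 else 0 := by
      rw [br_swap, hKC]
      split_ifs with h1 h2 h2
      · rfl
      · exact absurd h1.symm h2
      · exact absurd h2.symm h1
      · exact neg_zero
    simp only [carrollGen, br_sub, sub_br, br_mul, mul_br, br_z, z_br, cl_CC, cl_CD, hCK, hDC, hDK,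
      hKC, hKK, cl_KD, br_self, zero_mul, mul_zero, add_zero, zero_add, mul_sub, mul_z_mul',
      sub_zero, zero_sub]
    rw [← mul_assoc (c (.K i)) (c (.K j)), h1.eq, ← mul_assoc (c (.K j)) (c (.K i))]
    split_ifs <;> noncomm_ring
  · intro i
    have hDC : br (c .D) (c .C0) = -c .C0 := by rw [br_swap, cl_C0D]
    have hDK : ∀ l, br (c .D) (c (.K l)) = 0 := fun l => by rw [br_swap, cl_KD, neg_zero]
    have hCK : ∀ l, br (c (.C i)) (c (.K l)) = if l = i then -c .C0 else 0 := fun l => by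
      rw [br_swap, hKC]
      split_ifs <;> simp
    have h1 : c (.K i) * c .C0 = c .C0 * c (.K i) := br_eq_zero_iff.1 (by rw [cl_KC0, zero_smul])
    simp only [carrollGen, br_add, sub_br, z_mul_br, br_smul, br_z_mul, br_sum, br_pow_two, mul_br,
      cl_CC0, hCK, hDC, hDK, hKK, cl_KC0, zero_smul, mul_zero, zero_mul, add_zero,
      Finset.sum_const_zero, ite_mul, mul_ite, Finset.sum_add_distrib, Finset.sum_ite_eq',
      Finset.mem_univ, if_true, zero_sub, sub_zero, smul_zero, h1, mul_neg, neg_mul, mul_add, z_br, br_z]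
    module
  · intro i
    simp only [carrollGen, sub_br, mul_br, z_br, cl_CD, cl_KD, br_self, mul_zero, zero_mul,
      add_zero, sub_zero, sub_add_cancel]
  · intro i
    change br (carrollGen .P0) (c (.C i) - z * (c (.K i) * c .D)) = -c (.K i)
    rw [br_sub, br_z_mul, br_mul, carroll_L_C, carroll_L_D,
      carrollGen_P0_commute (carroll_P0_K i), zero_mul, zero_add, ← mul_z_mul', z_mul_divZ_E']
    rw [mul_sub, mul_one]; abel
  · refine carrollGen_P0_commute ?_
    simp only [carrollGen, br_add, carroll_P0_C0, br_smul, br_z_mul, br_sum, br_pow_two,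
      carroll_P0_K, zero_mul, mul_zero, add_zero, Finset.sum_const_zero, smul_zero]
  · exact carroll_L_D
  · simp only [carrollGen, add_br, smul_br, z_mul_br, sum_br, pow_two_br, cl_C0D, cl_KD, zero_mul,
      mul_zero, add_zero, Finset.sum_const_zero, smul_zero, add_sub_cancel_right]

end Carroll

/-! ### The Carroll twist: cocycle identity, coproducts, `R`-matrix and Weyl subalgebra. -/

section CarrollTwist

local notation "c" => cl 1 0
local notation "E" => carrollE
local notation "Y" => carrollGen

/-- The exponent of the first factor of the Carroll twisting element. -/
def carrollExponentK : (U 1 0 ⊗[ℝ] U 1 0)⟦X⟧ := -(z * ∑ i, tens (c (.K i)) (Y (.P i)))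

/-- The exponent of the second factor of the Carroll twisting element. -/
def carrollExponentD : (U 1 0 ⊗[ℝ] U 1 0)⟦X⟧ := -tens (c .D) carrollLog

/-- The Carroll twisting element. -/
def carrollTwist : (U 1 0 ⊗[ℝ] U 1 0)⟦X⟧ := pexp carrollExponentK * pexp carrollExponentD

theorem small_carrollExponentK : Small carrollExponentK := (small_z_mul _).neg

theorem small_carrollExponentD : Small carrollExponentD :=
  (tens_small_right _ small_carrollLog).neg

theorem coeff_zero_carrollTwist : PowerSeries.coeff 0 carrollTwist = 1 := by
  simp [carrollTwist, constantCoeff_pexp]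

theorem isUnit_carrollTwist : IsUnit carrollTwist := isUnit_of_coeff_zero coeff_zero_carrollTwist

theorem br_carrollExponentK (x : (U 1 0 ⊗[ℝ] U 1 0)⟦X⟧) :
    br carrollExponentK x = -(z * ∑ i, br (tens (c (.K i)) (Y (.P i))) x) := by
  rw [carrollExponentK, neg_br, z_mul_br, sum_br]

theorem br_carrollExponentD (x : (U 1 0 ⊗[ℝ] U 1 0)⟦X⟧) :
    br carrollExponentD x = -br (tens (c .D) carrollLog) x := by
  rw [carrollExponentD, neg_br]

theorem br_log (x : (U 1 0)⟦X⟧) : br carrollLog x = z * br (Y .P0) x := by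
  rw [← z_mul_br, z_mul_carrollGen_P0]

theorem br_tens_eq_zero {A : Type} [Ring A] [Algebra ℝ A] {x y u v : A⟦X⟧} (h1 : br x u = 0)
    (h2 : br y v = 0) : br (tens x y) (tens u v) = 0 :=
  br_eq_zero_iff.2 (tens_commute (br_eq_zero_iff.1 h1) (br_eq_zero_iff.1 h2))

theorem semiconj_of_br {A : Type} [Ring A] [Algebra ℝ A] {f x y w : A⟦X⟧} (hf : Small f)
    (hy : br f x = y) (hw : br f y = w) (h0 : br f w = 0) :
    SemiconjBy (pexp f) x (x + y + (1 / 2 : ℝ) • w) :=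
  pexp_mul_of_ad hf hy hw (br_eq_zero_iff.1 h0)

theorem semiconj_of_br_one {A : Type} [Ring A] [Algebra ℝ A] {f x y : A⟦X⟧} (hf : Small f)
    (hy : br f x = y) (hw : br f y = 0) : SemiconjBy (pexp f) x (x + y) := by
  simpa using semiconj_of_br hf hy hw (br_zero f)

theorem semiconj_of_br_zero {A : Type} [Ring A] [Algebra ℝ A] {f x : A⟦X⟧} (hf : Small f)
    (hy : br f x = 0) : SemiconjBy (pexp f) x x := by
  simpa using semiconj_of_br_one hf hy (br_zero f)

/-- Conjugation by `exp (-D ⊗ log)` of elements of weight `r` in the left factor. -/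
theorem semiconj_D_left {x : (U 1 0)⟦X⟧} {r : ℝ} (h : br (c .D) x = r • x) :
    SemiconjBy (pexp carrollExponentD) (tens x 1) (tens x (pexp (-r • carrollLog))) := by
  -- From `D x = x (D + r)`: carrying `x ⊗ 1` past the exponent shifts it by `-r (1 ⊗ carrollLog)`,
  -- and the shift commutes with the exponent.
  have h1 : SemiconjBy (tens x 1) (tens 1 (-r • carrollLog) + carrollExponentD)
      carrollExponentD := by
    rw [SemiconjBy, carrollExponentD, mul_add, mul_neg, neg_mul, tens_mul_tens, tens_mul_tens,
      tens_mul_tens, br_mul_eq h, add_tens, one_mul, mul_one, one_mul, mul_one, tens_smul, smul_tens]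
    module
  have hs : Small (-r • carrollLog) := small_carrollLog.smul _
  have h2 := pexp_semiconj ((tens_small_right 1 hs).add small_carrollExponentD)
    small_carrollExponentD h1
  rw [pexp_add (tens_small_right 1 hs) small_carrollExponentD, pexp_one_tens] at h2
  · rw [SemiconjBy, ← h2.eq, ← mul_assoc, tens_mul_tens, mul_one, one_mul]
  · exact (tens_commute (Commute.one_left _) ((Commute.refl _).smul_left _)).neg_right

theorem pexp_neg_carrollLog : pexp (-carrollLog) = 1 - z * c .P0 := by
  have h : pexp (-carrollLog) * (E * (1 - z * c .P0)) = 1 - z * c .P0 := by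
    rw [← mul_assoc, ← pexp_carrollLog, pexp_neg_mul_pexp small_carrollLog, one_mul]
  rwa [carrollE_mul, mul_one] at h

theorem semiconj_D_P (i : Fin 3) :
    SemiconjBy (pexp carrollExponentD) (tens (c (.P i)) 1) (tens (c (.P i)) (1 - z * c .P0)) := by
  have := semiconj_D_left (x := c (.P i)) (r := 1) (by rw [br_swap, cl_PD, neg_neg, one_smul])
  rwa [neg_one_smul, pexp_neg_carrollLog] at this

theorem semiconj_D_P0 :
    SemiconjBy (pexp carrollExponentD) (tens (c .P0) 1) (tens (c .P0) (1 - z * c .P0)) := by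
  have := semiconj_D_left (x := c .P0) (r := 1) (by rw [br_swap, cl_P0D, neg_neg, one_smul])
  rwa [neg_one_smul, pexp_neg_carrollLog] at this

theorem semiconj_D_C (i : Fin 3) :
    SemiconjBy (pexp carrollExponentD) (tens (c (.C i)) 1) (tens (c (.C i)) E) := by
  have := semiconj_D_left (x := c (.C i)) (r := -1) (by rw [br_swap, cl_CD, neg_one_smul])
  rwa [neg_neg, one_smul, pexp_carrollLog] at this

theorem semiconj_D_C0 :
    SemiconjBy (pexp carrollExponentD) (tens (c .C0) 1) (tens (c .C0) E) := by
  have := semiconj_D_left (x := c .C0) (r := -1) (by rw [br_swap, cl_C0D, neg_one_smul])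
  rwa [neg_neg, one_smul, pexp_carrollLog] at this

theorem semiconj_D_of_commute {x y : (U 1 0)⟦X⟧} (hx : br (c .D) x = 0) (hy : br (Y .P0) y = 0) :
    SemiconjBy (pexp carrollExponentD) (tens x y) (tens x y) := by
  refine semiconj_of_br_zero small_carrollExponentD ?_
  rw [br_carrollExponentD, br_tens_eq_zero hx (by rw [br_log, hy, mul_zero]), neg_zero]

theorem semiconj_z {f x y : (U 1 0 ⊗[ℝ] U 1 0)⟦X⟧} (h : SemiconjBy f x y) :
    SemiconjBy f (z * x) (z * y) := SemiconjBy.mul_right (z_commute f).symm h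

theorem carroll_br_D_K (i : Fin 3) : br (c .D) (c (.K i)) = 0 := by
  rw [br_swap, cl_KD, neg_zero]

theorem semiconj_K_of_commute {x y : (U 1 0)⟦X⟧} (hx : ∀ i, br (c (.K i)) x = 0)
    (hy : ∀ i, br (Y (.P i)) y = 0) : SemiconjBy (pexp carrollExponentK) (tens x y) (tens x y) := by
  refine semiconj_of_br_zero small_carrollExponentK ?_
  rw [br_carrollExponentK, Finset.sum_eq_zero fun i _ => br_tens_eq_zero (hx i) (hy i), mul_zero,
    neg_zero]

theorem br_one_right {A : Type} [Ring A] [Algebra ℝ A] (x : A) : br x 1 = 0 := by simp [br]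

theorem carroll_YP_p0 (i : Fin 3) : br (Y (.P i)) (c .P0) = 0 := by
  rw [carrollGen, mul_br, br_eq_zero_iff.2 (carrollE_commute (br_self _)), cl_PP0, mul_zero,
    zero_mul, add_zero]

theorem carroll_YP_q (i : Fin 3) : br (Y (.P i)) (1 - z * c .P0) = 0 := by
  rw [br_sub, br_one_right, br_z_mul, carroll_YP_p0, mul_zero, sub_zero]

theorem carroll_YP_E (i : Fin 3) : br (Y (.P i)) E = 0 := by
  rw [br_swap, br_eq_zero_iff.2 (carrollE_commute _), neg_zero]
  rw [br_swap, carroll_YP_p0, neg_zero]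

theorem carroll_KK (i j : Fin 3) : br (c (.K i)) (c (.K j)) = 0 := by
  rw [cl_KK, mul_zero, neg_zero, zero_smul]

theorem carroll_KP0 (i : Fin 3) : br (c (.K i)) (c .P0) = 0 := by rw [cl_KP0, zero_smul]

/-- Conjugation of `Δ₀ P₀` for the classical generator `P₀`. -/
theorem semiconj_P0 : SemiconjBy carrollTwist (comulZ 1 0 (c .P0))
    (tens (c .P0) (1 - z * c .P0) + tens 1 (c .P0)) := by
  rw [comulZ_cl]
  refine SemiconjBy.mul_left (y := tens (c .P0) (1 - z * c .P0) + tens 1 (c .P0))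
    (SemiconjBy.add_right ?_ ?_) (SemiconjBy.add_right semiconj_D_P0 ?_)
  · exact semiconj_K_of_commute carroll_KP0 carroll_YP_q
  · exact semiconj_K_of_commute (fun i => br_one_right _) carroll_YP_p0
  · exact semiconj_D_of_commute (br_one_right _) (carrollGen_P0_commute (br_self _))

/-- Thus `q = 1 - z P₀` is group-like for the twisted coproduct: `q ⊗ q` is one minus `z` times the
twisted coproduct of the classical `P₀`. -/
theorem semiconj_q : SemiconjBy carrollTwist (comulZ 1 0 (1 - z * c .P0))
    (tens (1 - z * c .P0) (1 - z * c .P0)) := by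
  have h : tens (1 - z * c .P0) (1 - z * c .P0) =
      1 - z * (tens (c .P0) (1 - z * c .P0) + tens 1 (c .P0)) := by
    rw [sub_tens, z_mul_tens, tens_sub 1, tens_one_one, tens_z_mul, mul_add]
    abel
  rw [map_sub, map_one, comulZ, mapₐ_z_mul, h]
  exact SemiconjBy.sub_right (SemiconjBy.one_right _) (semiconj_z semiconj_P0)

theorem semiconj_E : SemiconjBy carrollTwist (comulZ 1 0 E) (tens E E) := by
  have h1 : tens E E * tens (1 - z * c .P0) (1 - z * c .P0) = 1 := by
    rw [tens_mul_tens, carrollE_mul, tens_one_one]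
  have h2 : comulZ 1 0 (1 - z * c .P0) * comulZ 1 0 E = 1 := by
    rw [← map_mul, mul_carrollE, map_one]
  rw [SemiconjBy, ← one_mul (carrollTwist * _), ← h1, mul_assoc, ← mul_assoc _ carrollTwist,
    ← semiconj_q.eq, mul_assoc carrollTwist, h2, mul_one]

theorem inverse_conj {F x : (U 1 0 ⊗[ℝ] U 1 0)⟦X⟧} (hF : IsUnit F) :
    SemiconjBy F x (F * x * Ring.inverse F) := by
  rw [SemiconjBy, mul_assoc _ _ F, Ring.inverse_mul_cancel _ hF, mul_one]

/-- The logarithm of a group-like element is primitive: the conjugate of its undeformed coproduct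
and the primitive expression have the same exponential `E ⊗ E`, and the exponential is injective on
series without constant term. -/
theorem semiconj_log : SemiconjBy carrollTwist (comulZ 1 0 carrollLog)
    (tens carrollLog 1 + tens 1 carrollLog) := by
  have h1 := inverse_conj isUnit_carrollTwist (x := comulZ 1 0 carrollLog)
  have hs : Small (comulZ 1 0 carrollLog) := small_carrollLog.mapₐ _
  have hs' : Small (carrollTwist * comulZ 1 0 carrollLog * Ring.inverse carrollTwist) :=
    (hs.mul_left _).mul_right _
  have hsl := tens_small_left small_carrollLog 1
  have hsr := tens_small_right 1 small_carrollLog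
  have h2 := pexp_semiconj hs hs' h1
  rw [comulZ, ← mapₐ_pexp, pexp_carrollLog] at h2
  have h3 : pexp (carrollTwist * comulZ 1 0 carrollLog * Ring.inverse carrollTwist) =
      pexp (tens carrollLog 1 + tens 1 carrollLog) := by
    rw [pexp_add hsl hsr (tens_commute (Commute.one_right _) (Commute.one_left _)), pexp_tens_one,
      pexp_one_tens, tens_mul_tens, pexp_carrollLog, one_mul, mul_one]
    exact isUnit_carrollTwist.mul_right_cancel (h2.eq.symm.trans semiconj_E.eq)
  rwa [pexp_injective hs' (hsl.add hsr) h3] at h1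

theorem carroll_YP_K (i j : Fin 3) :
    br (Y (.P i)) (c (.K j)) = if i = j then -divZ (E - 1) else 0 := by
  rw [br_swap]
  refine (congrArg _ (carrollGen_relations.KP j i)).trans ?_
  split_ifs with h1 h2 h2
  · rfl
  · exact absurd h1.symm h2
  · exact absurd h2.symm h1
  · exact neg_zero

/-- Conjugation of `Δ₀ P_i` for the classical generators `P_i`. -/
theorem semiconj_P (i : Fin 3) : SemiconjBy carrollTwist (comulZ 1 0 (c (.P i)))
    (tens (c (.P i)) (1 - z * c .P0) + tens (1 - z * c .P0) (c (.P i))) := by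
  have hqP : Y (.P i) * (1 - z * c .P0) = c (.P i) := by
    rw [carrollGen, mul_assoc, carrollE_mul, mul_one]
  have hPp : ∀ l, br (Y (.P l)) (c (.P i)) = 0 := fun l => by
    rw [carrollGen, mul_br, carroll_E_P, cl_PP, mul_zero, zero_mul, add_zero]
  rw [comulZ_cl]
  have h : tens (c (.P i)) (1 - z * c .P0) + tens (1 - z * c .P0) (c (.P i)) =
      tens (c (.P i)) (1 - z * c .P0) + -(z * tens (c .P0) (c (.P i))) + tens 1 (c (.P i)) := by
    rw [sub_tens 1, z_mul_tens]; abel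
  rw [h]
  refine SemiconjBy.mul_left (y := tens (c (.P i)) (1 - z * c .P0) + tens 1 (c (.P i)))
    (SemiconjBy.add_right (semiconj_of_br_one small_carrollExponentK ?_ ?_) ?_)
    (SemiconjBy.add_right (semiconj_D_P i) ?_)
  · rw [br_carrollExponentK, Finset.sum_eq_single i]
    · rw [br_tens_right (br_eq_zero_iff.1 (carroll_YP_q i)), hqP]
      rw [cl_KP, if_pos rfl, one_smul]
    · intro l _ hl
      rw [br_tens_right (br_eq_zero_iff.1 (carroll_YP_q l))]
      rw [cl_KP, if_neg hl, zero_tens]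
    · simp
  · rw [br_neg, br_z_mul, br_carrollExponentK, Finset.sum_eq_zero, mul_zero, neg_zero, mul_zero,
      neg_zero]
    exact fun l _ => br_tens_eq_zero (carroll_KP0 l) (hPp l)
  · exact semiconj_K_of_commute (fun _ => br_one_right _) hPp
  · exact semiconj_D_of_commute (br_one_right _) (carrollGen_P0_commute (carroll_P0_P i))

/-- The classical `P_i` is skew-primitive with respect to `1 - z P₀`. Multiplication by its
group-like inverse `E` makes it primitive, which explains the deformed generator `P_i E`. -/
theorem semiconj_YP (i : Fin 3) : SemiconjBy carrollTwist (comulZ 1 0 (Y (.P i)))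
    (tens (Y (.P i)) 1 + tens 1 (Y (.P i))) := by
  have h := (semiconj_P i).mul_right semiconj_E
  rwa [← map_mul, add_mul, tens_mul_tens, tens_mul_tens, mul_carrollE] at h

theorem carroll_K_sum {x : (U 1 0)⟦X⟧} {y : (U 1 0)⟦X⟧} (u : (U 1 0)⟦X⟧) {i : Fin 3}
    (hx : ∀ l, Commute (c (.K l)) u) (h : ∀ l, br (Y (.P l)) x = if l = i then y else 0) :
    br carrollExponentK (tens u x) = -(z * tens (c (.K i) * u) y) := by
  rw [br_carrollExponentK, Finset.sum_eq_single i]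
  · rw [br_tens_left (hx i), h, if_pos rfl]
  · intro l _ hl
    rw [br_tens_left (hx l), h, if_neg hl, tens_zero]
  · simp

/-- Only the boost exponent acts, on `1 ⊗ K_i`. The denominator in `[P_i E, K_i] = -(E - 1) / z`
cancels the `z` of the exponent, giving the finite term `K_i ⊗ (E - 1)`. -/
theorem semiconj_K (i : Fin 3) : SemiconjBy carrollTwist (comulZ 1 0 (Y (.K i)))
    (tens (Y (.K i)) E + tens 1 (Y (.K i))) := by
  have h1 := carroll_K_sum 1 (fun l => Commute.one_right _) fun l => carroll_YP_K l i
  rw [mul_one, tens_neg, mul_neg, neg_neg, ← tens_z_mul, z_mul_divZ_E] at h1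
  have h : tens (Y (.K i)) E + tens 1 (Y (.K i)) =
      tens (c (.K i)) 1 + (tens 1 (c (.K i)) + tens (c (.K i)) (E - 1)) := by
    rw [tens_sub]; simp only [carrollGen]; abel
  rw [h, carrollGen, comulZ_cl]
  refine SemiconjBy.mul_left (y := tens (c (.K i)) 1 + tens 1 (c (.K i))) (SemiconjBy.add_right ?_
    (semiconj_of_br_one small_carrollExponentK h1 ?_)) (SemiconjBy.add_right ?_ ?_)
  · exact semiconj_K_of_commute (fun l => carroll_KK l i) fun l => br_one_right _
  · rw [br_carrollExponentK, Finset.sum_eq_zero, mul_zero, neg_zero]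
    refine fun l _ => br_tens_eq_zero (carroll_KK l i) ?_
    rw [br_sub, br_one_right, carroll_YP_E, sub_zero]
  · exact semiconj_D_of_commute (carroll_br_D_K i) (br_one_right _)
  · exact semiconj_D_of_commute (br_one_right _) (carrollGen_P0_commute (carroll_P0_K i))

theorem semiconj_J (i : Fin 3) : SemiconjBy carrollTwist (comulZ 1 0 (Y (.J i)))
    (tens (Y (.J i)) 1 + tens 1 (Y (.J i))) := by
  rw [carrollGen, comulZ_cl]
  refine SemiconjBy.mul_left (y := tens (c (.J i)) 1 + tens 1 (c (.J i)))
    (semiconj_of_br_zero small_carrollExponentK ?_) (SemiconjBy.add_right ?_ ?_)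
  · rw [br_swap, carrollExponentK, br_neg, br_z_mul]
    have := br_sum_tens_eq_zero (carrollGen_relations.JK i) (carrollGen_relations.JP i)
    exact (congrArg (fun t => -(-(z * t))) this).trans (by rw [mul_zero, neg_zero, neg_zero])
  · exact semiconj_D_of_commute (by rw [br_swap, cl_JD, neg_zero]) (br_one_right _)
  · exact semiconj_D_of_commute (br_one_right _) (carrollGen_P0_commute (carroll_P0_J i))

theorem carroll_YP_D (i : Fin 3) : br (Y (.P i)) (c .D) = -(E * Y (.P i)) :=
  carrollGen_relations.PD i

theorem carroll_YP_YP (i j : Fin 3) : br (Y (.P i)) (Y (.P j)) = 0 := carrollGen_relations.PP i j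

theorem carroll_YP_EYP (i j : Fin 3) : br (Y (.P i)) (E * Y (.P j)) = 0 := by
  rw [br_mul, carroll_YP_E, carroll_YP_YP, zero_mul, mul_zero, add_zero]

theorem br_exponentK_one_D : br carrollExponentK (tens 1 (c .D)) =
    z * ∑ i, tens (c (.K i)) (E * Y (.P i)) := by
  rw [br_carrollExponentK, ← mul_neg, ← Finset.sum_neg_distrib]
  congr 1
  refine Finset.sum_congr rfl fun i _ => ?_
  rw [br_one_tens_right, carroll_YP_D, tens_neg, neg_neg]

theorem semiconj_D_D : SemiconjBy (pexp carrollExponentD) (tens 1 (c .D))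
    (tens 1 (c .D) + tens (c .D) (E - 1)) := by
  refine semiconj_of_br_one small_carrollExponentD ?_ ?_
  · rw [br_carrollExponentD, br_one_tens_right, br_carrollLog_D, ← tens_neg, neg_sub]
  · rw [br_carrollExponentD, br_tens_eq_zero (br_self _), neg_zero]
    rw [br_sub, br_one_right, br_eq_zero_iff.2 carrollE_commute_carrollLog.symm, sub_zero]

/-- The dilation factor turns `D ⊗ 1 + 1 ⊗ D` into `D ⊗ E + 1 ⊗ D`, since `[carrollLog, D] = 1 - E`.
The boost factor then adds the sum over `K_i`, from `[P_i E, D] = -E P_i E`. -/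
theorem semiconj_D : SemiconjBy carrollTwist (comulZ 1 0 (Y .D))
    (tens (Y .D) E + tens 1 (Y .D) + z * ∑ i, tens (Y (.K i)) (E * Y (.P i))) := by
  rw [show comulZ 1 0 (Y .D) = tens (c .D) 1 + tens 1 (c .D) from comulZ_cl _, add_assoc]
  have h : tens (Y .D) E + tens 1 (c .D) =
      tens (c .D) 1 + (tens 1 (c .D) + tens (c .D) (E - 1)) := by
    rw [tens_sub]; simp only [carrollGen]; abel
  refine SemiconjBy.mul_left (y := tens (Y .D) E + tens 1 (c .D)) (SemiconjBy.add_right ?_ ?_) ?_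
  · exact semiconj_K_of_commute (fun l => cl_KD 1 0 l) carroll_YP_E
  · refine semiconj_of_br_one small_carrollExponentK br_exponentK_one_D ?_
    rw [br_z_mul, br_sum, Finset.sum_eq_zero, mul_zero]
    intro i _
    rw [br_carrollExponentK, Finset.sum_eq_zero, mul_zero, neg_zero]
    exact fun l _ => br_tens_eq_zero (carroll_KK l i) (carroll_YP_EYP l i)
  · rw [h]
    exact SemiconjBy.add_right (semiconj_D_of_commute (br_self _) (br_one_right _)) semiconj_D_D

theorem carroll_K_left {x y u : (U 1 0)⟦X⟧} {i : Fin 3} (hu : ∀ l, br (Y (.P l)) u = 0)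
    (h : ∀ l, br (c (.K l)) x = if l = i then y else 0) :
    br carrollExponentK (tens x u) = -(z * tens y (u * Y (.P i))) := by
  rw [br_carrollExponentK, Finset.sum_eq_single i]
  · rw [br_tens_right (br_eq_zero_iff.1 (hu i)), h, if_pos rfl, (br_eq_zero_iff.1 (hu i)).eq]
  · intro l _ hl
    rw [br_tens_right (br_eq_zero_iff.1 (hu l)), h, if_neg hl, zero_tens]
  · simp

theorem br_exponentK_eq_zero {x y : (U 1 0)⟦X⟧} (hx : ∀ i, br (c (.K i)) x = 0)
    (hy : ∀ i, br (Y (.P i)) y = 0) : br carrollExponentK (tens x y) = 0 := by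
  rw [br_carrollExponentK, Finset.sum_eq_zero fun i _ => br_tens_eq_zero (hx i) (hy i), mul_zero,
    neg_zero]

theorem br_exponentD_eq_zero {x y : (U 1 0)⟦X⟧} (hx : br (c .D) x = 0) (hy : br (Y .P0) y = 0) :
    br carrollExponentD (tens x y) = 0 := by
  rw [br_carrollExponentD, br_tens_eq_zero hx (by rw [br_log, hy, mul_zero]), neg_zero]

theorem carroll_KKK (i j k : Fin 3) : br (c (.K i)) (c (.K j) * c (.K k)) = 0 := by
  rw [br_mul, carroll_KK, carroll_KK, zero_mul, mul_zero, add_zero]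

/-- A second-order computation. The first commutator removes the cross term `z ∑ K_i ⊗ K_i` of the
quadratic correction and produces `z S ⊗ (E - 1)`. The second commutator halves this, which
completes `(z / 2) S ⊗ 1` to `(z / 2) S ⊗ E`. -/
theorem semiconj_C0 : SemiconjBy carrollTwist (comulZ 1 0 (Y .C0))
    (tens (Y .C0) E + tens 1 (Y .C0)) := by
  have hsq : ∀ l, br (c (.K l)) (∑ i, c (.K i) ^ 2) = 0 := fun l => by
    rw [br_sum]; exact Finset.sum_eq_zero fun i _ => by rw [pow_two]; exact carroll_KKK l i i
  set S : (U 1 0)⟦X⟧ := ∑ i, c (.K i) ^ 2 with hS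
  set W : (U 1 0 ⊗[ℝ] U 1 0)⟦X⟧ := ∑ i, tens (c (.K i)) (c (.K i)) with hW
  have hY : Y .C0 = c .C0 + (1 / 2 : ℝ) • (z * S) := rfl
  have h0 : comulZ 1 0 (Y .C0) = tens (c .C0) 1 +
      ((1 / 2 : ℝ) • (z * tens S 1) + tens 1 (Y .C0) + z * W) := by
    rw [hY, map_add, mapₐ_smul, comulZ, mapₐ_z_mul, hS, comulZ_sum_sq, comulZ_cl]
    simp only [mul_add, mul_smul_comm, tens_add, tens_smul, tens_z_mul, hW]
    module
  have hE1 : ∀ i, br (Y (.P i)) (E - 1) = 0 := fun i => by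
    rw [br_sub, br_one_right, carroll_YP_E, sub_zero]
  have b1 : br carrollExponentK (tens (c .C0) E) = 0 :=
    br_exponentK_eq_zero (fun i => by rw [cl_KC0, zero_smul]) carroll_YP_E
  have b2 : br carrollExponentK (tens S 1) = 0 :=
    br_exponentK_eq_zero hsq fun _ => br_one_right _
  have b3 : br carrollExponentK (tens 1 (Y .C0)) = -(z * W) := by
    rw [br_carrollExponentK]
    exact congrArg (fun t => -(z * t)) (Finset.sum_congr rfl fun i _ => by
      rw [br_one_tens_right, carrollGen_relations.PC0]; rfl)
  have b4 : br carrollExponentK W = tens S (E - 1) := by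
    rw [hW, br_sum, hS, sum_tens]
    refine Finset.sum_congr rfl fun i _ => ?_
    rw [carroll_K_sum _ (fun l => br_eq_zero_iff.1 (carroll_KK l i)) fun l => carroll_YP_K l i,
      tens_neg, mul_neg, neg_neg, ← tens_z_mul, z_mul_divZ_E, pow_two]
  have b5 : br carrollExponentK (tens S (E - 1)) = 0 := br_exponentK_eq_zero hsq hE1
  rw [h0]
  refine SemiconjBy.mul_left (y := tens (c .C0) E +
    ((1 / 2 : ℝ) • (z * tens S 1) + tens 1 (Y .C0) + z * W)) ?_
    (SemiconjBy.add_right semiconj_D_C0 (semiconj_of_br_zero small_carrollExponentD ?_))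
  · have hfin : tens (Y .C0) E + tens 1 (Y .C0) = tens (c .C0) E +
        ((1 / 2 : ℝ) • (z * tens S 1) + tens 1 (Y .C0) + z * W) +
        (-(z * W) + z * tens S (E - 1)) + (1 / 2 : ℝ) • (-(z * tens S (E - 1))) := by
      rw [hY, add_tens, smul_tens, z_mul_tens, tens_sub, mul_sub]
      module
    rw [hfin]
    refine semiconj_of_br small_carrollExponentK ?_ ?_ ?_
    · simp only [br_add, br_smul, br_z_mul, b1, b2, b3, b4, mul_zero, smul_zero, zero_add]
    · simp only [br_add, br_neg, br_z_mul, b4, b5, mul_zero, add_zero]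
    · simp only [br_neg, br_z_mul, b5, mul_zero, neg_zero]
  · have hDS : br (c .D) S = 0 := by
      rw [hS, br_sum]
      exact Finset.sum_eq_zero fun i _ => by
        rw [br_pow_two, carroll_br_D_K, zero_mul, mul_zero, add_zero]
    have d1 : br carrollExponentD W = 0 := by
      rw [hW, br_sum]
      exact Finset.sum_eq_zero fun i _ => br_exponentD_eq_zero (carroll_br_D_K i)
        (carrollGen_P0_commute (carroll_P0_K i))
    rw [br_add, br_add, br_smul, br_z_mul, br_z_mul, d1,
      br_exponentD_eq_zero hDS (br_one_right _),
      br_exponentD_eq_zero (br_one_right _) carrollGen_relations.P0C0]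
    simp only [mul_zero, smul_zero, add_zero]

theorem eps_swap (i j k : Fin 3) : eps i j k = -eps j i k := by simp only [eps]; ring

/-- The contraction `∑_k ε_ilk ε_kmn = δ_im δ_ln - δ_in δ_lm`. -/
theorem eps_mul_eps {M : Type} [AddCommGroup M] [Module ℝ M] (f : Fin 3 → Fin 3 → Fin 3 → M)
    (i : Fin 3) : ∑ l, ∑ k, eps i l k • ∑ m, ∑ n, eps k m n • f m l n =
      ∑ l, f i l l - ∑ l, f l l i := by
  fin_cases i <;> simp [Fin.sum_univ_three, eps] <;> module

/-- The dilation factor leaves an unwanted `-z K_i ⊗ D`, which the first boost commutator with `1 ⊗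
C_i` cancels while creating the rotation term `T₃`. At order `z ^ 2`, half of the second commutator
contributes `T₁ - T₂ / 2`: the `T₁` cancels the one from first order, and the `T₂` supplies the
quadratic part of the deformed `C₀`. -/
theorem semiconj_C (i : Fin 3) : SemiconjBy carrollTwist (comulZ 1 0 (Y (.C i)))
    (tens (Y (.C i)) E + tens 1 (Y (.C i)) - z * tens (Y .C0) (E * Y (.P i)) +
      z * ∑ j, ∑ k, eps i j k • tens (Y (.K j)) (E * Y (.J k))) := by
  set S : (U 1 0)⟦X⟧ := ∑ i, c (.K i) ^ 2 with hS
  set T₁ : (U 1 0 ⊗[ℝ] U 1 0)⟦X⟧ := ∑ l, tens (c (.K i) * c (.K l)) (E * Y (.P l)) with hT₁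
  set T₂ : (U 1 0 ⊗[ℝ] U 1 0)⟦X⟧ := ∑ l, tens (c (.K l) * c (.K l)) (E * Y (.P i)) with hT₂
  set T₃ : (U 1 0 ⊗[ℝ] U 1 0)⟦X⟧ := ∑ j, ∑ k, eps i j k • tens (c (.K j)) (E * c (.J k)) with hT₃
  have hY : Y (.C i) = c (.C i) - z * (c (.K i) * c .D) := rfl
  have hY0 : Y .C0 = c .C0 + (1 / 2 : ℝ) • (z * S) := rfl
  have hT : z * ∑ j, ∑ k, eps i j k • tens (Y (.K j)) (E * Y (.J k)) = z * T₃ := rfl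
  have hS2 : tens S (E * Y (.P i)) = T₂ := by
    rw [hS, sum_tens]; exact Finset.sum_congr rfl fun l _ => by rw [pow_two]
  have b1 : br carrollExponentK (tens (Y (.C i)) E) = -(z * tens (c .C0) (E * Y (.P i))) := by
    refine carroll_K_left carroll_YP_E fun l => ?_
    refine (carrollGen_relations.KC l i).trans ?_
    rw [hY0]
    exact if_congr Iff.rfl (add_sub_cancel_right _ _) rfl
  have b2 : br carrollExponentK (tens 1 (Y (.C i))) = z * tens (c (.K i)) (c .D) + z * T₃ := by
    rw [br_carrollExponentK, ← mul_neg, ← mul_add]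
    congr 1
    simp only [br_one_tens_right, carrollGen_relations.PC, tens_add, Finset.sum_add_distrib,
      neg_add, hT₃, tens_sum, tens_smul]
    congr 1
    · rw [Finset.sum_eq_single i]
      · rw [if_pos rfl, tens_neg, neg_neg]; rfl
      · intro l _ hl; rw [if_neg hl, tens_zero]
      · simp
    · rw [← Finset.sum_neg_distrib]
      refine Finset.sum_congr rfl fun l _ => ?_
      rw [← Finset.sum_neg_distrib]
      refine Finset.sum_congr rfl fun k _ => ?_
      rw [eps_swap l i k, neg_smul, neg_neg]; rfl
  have b3 : br carrollExponentK (tens (c (.K i)) (c .D)) = z * T₁ := by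
    rw [br_carrollExponentK, ← mul_neg, hT₁, ← Finset.sum_neg_distrib]
    congr 1
    refine Finset.sum_congr rfl fun l _ => ?_
    have := br_eq_zero_iff.1 (carroll_KK l i)
    rw [br_tens_left this, carroll_YP_D, tens_neg, neg_neg, this.eq]
  -- Translating a rotation gives a translation contracted with the Levi-Civita symbol; together
  -- with the symbol already in `T₃` this is the double contraction of `eps_mul_eps`.
  have b4 : br carrollExponentK T₃ = z * (T₁ - T₂) := by
    have hJ : ∀ m k, br (Y (.P m)) (E * c (.J k)) = -∑ n, eps k m n • (E * Y (.P n)) := by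
      intro m k
      rw [br_mul, carroll_YP_E, zero_mul, zero_add, br_swap,
        show br (c (.J k)) (Y (.P m)) = _ from carrollGen_relations.JP k m, mul_neg, Finset.mul_sum]
      simp only [mul_smul_comm]
    have h := eps_mul_eps (fun m l n => tens (c (.K m) * c (.K l)) (E * Y (.P n))) i
    rw [← hT₁, ← hT₂] at h
    rw [← h, hT₃]
    simp only [br_sum, br_smul, Finset.mul_sum, br_carrollExponentK, Finset.smul_sum,
      ← Finset.sum_neg_distrib, mul_smul_comm]
    refine Finset.sum_congr rfl fun l _ => Finset.sum_congr rfl fun k _ =>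
      Finset.sum_congr rfl fun m _ => ?_
    rw [br_tens_left (br_eq_zero_iff.1 (carroll_KK m l)), hJ, tens_neg, mul_neg, neg_neg, tens_sum,
      Finset.mul_sum, Finset.smul_sum]
    simp only [tens_smul, mul_smul_comm]
  have b5 : br carrollExponentK (tens (c .C0) (E * Y (.P i))) = 0 :=
    br_exponentK_eq_zero (fun l => by rw [cl_KC0, zero_smul]) fun l => carroll_YP_EYP l i
  have b6 : br carrollExponentK T₁ = 0 := by
    rw [hT₁, br_sum]
    exact Finset.sum_eq_zero fun l _ => br_exponentK_eq_zero (fun m => carroll_KKK m i l)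
      fun m => carroll_YP_EYP m l
  have b7 : br carrollExponentK T₂ = 0 := by
    rw [hT₂, br_sum]
    exact Finset.sum_eq_zero fun l _ => br_exponentK_eq_zero (fun m => carroll_KKK m l l)
      fun m => carroll_YP_EYP m i
  have h0 : comulZ 1 0 (Y (.C i)) = tens (c (.C i)) 1 - z * tens (c (.K i) * c .D) 1 +
      tens 1 (Y (.C i)) - z * (tens (c (.K i)) 1 * tens 1 (c .D)) - z * tens (c .D) (c (.K i)) := by
    rw [hY, map_sub, comulZ, mapₐ_z_mul, map_mul, comulZ_cl, comulZ_cl, comulZ_cl]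
    simp only [mul_add, add_mul, tens_mul_tens, mul_one, one_mul, tens_sub, tens_z_mul]
    abel
  have h1 : SemiconjBy (pexp carrollExponentD) (comulZ 1 0 (Y (.C i)))
      (tens (Y (.C i)) E + tens 1 (Y (.C i)) - z * tens (c (.K i)) (c .D)) := by
    have hL : br carrollExponentD (tens 1 (Y (.C i))) = z * tens (c .D) (c (.K i)) := by
      rw [br_carrollExponentD, br_one_tens_right, br_log, carrollGen_relations.P0C, tens_z_mul,
        tens_neg, mul_neg, neg_neg]
      rfl
    have hDK := semiconj_D_of_commute (carroll_br_D_K i) (br_one_right (Y .P0))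
    have hfin : tens (Y (.C i)) E + tens 1 (Y (.C i)) - z * tens (c (.K i)) (c .D) =
        tens (c (.C i)) E - z * tens (c (.K i) * c .D) 1 +
        (tens 1 (Y (.C i)) + z * tens (c .D) (c (.K i))) -
        z * (tens (c (.K i)) 1 * (tens 1 (c .D) + tens (c .D) (E - 1))) -
        z * tens (c .D) (c (.K i)) := by
      rw [hY]
      simp only [mul_add, tens_mul_tens, mul_one, one_mul, tens_sub, sub_tens, z_mul_tens, mul_sub]
      abel
    rw [h0, hfin]
    refine ((((semiconj_D_C i).sub_right (semiconj_z (semiconj_D_of_commute ?_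
      (br_one_right _)))).add_right (semiconj_of_br_one small_carrollExponentD hL ?_)).sub_right
      (semiconj_z (hDK.mul_right semiconj_D_D))).sub_right (semiconj_z (semiconj_D_of_commute
        (br_self _) (carrollGen_P0_commute (carroll_P0_K i))))
    · rw [br_mul, carroll_br_D_K, br_self, zero_mul, mul_zero, add_zero]
    · rw [br_z_mul, br_exponentD_eq_zero (br_self _) (carrollGen_P0_commute (carroll_P0_K i)),
        mul_zero]
  refine SemiconjBy.mul_left ?_ h1
  have hfin : tens (Y (.C i)) E + tens 1 (Y (.C i)) - z * tens (Y .C0) (E * Y (.P i)) + z * T₃ =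
      tens (Y (.C i)) E + tens 1 (Y (.C i)) - z * tens (c (.K i)) (c .D) +
      (-(z * tens (c .C0) (E * Y (.P i))) + (z * tens (c (.K i)) (c .D) + z * T₃) -
        z * (z * T₁)) + (1 / 2 : ℝ) • (z * (z * T₁) + z * (z * (T₁ - T₂))) := by
    rw [hY0, add_tens, smul_tens, z_mul_tens, hS2]
    simp only [mul_sub, mul_add, mul_smul_comm]
    module
  rw [hT, hfin]
  refine semiconj_of_br small_carrollExponentK ?_ ?_ ?_
  · rw [br_sub, br_add, br_z_mul, b1, b2, b3]
  · simp only [br_sub, br_add, br_neg, br_z_mul, b3, b4, b5, b6, mul_zero, neg_zero, sub_zero,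
      zero_add]
  · simp only [br_add, br_sub, br_z_mul, b6, b7, mul_zero, sub_zero, add_zero]

theorem carrollGen_coproduct : CarrollCoproduct (twComul carrollTwist) carrollGen E where
  J i := twComul_eq isUnit_carrollTwist (semiconj_J i)
  P i := twComul_eq isUnit_carrollTwist (semiconj_YP i)
  P0 := by
    refine twComul_eq isUnit_carrollTwist (z_mul_injective ?_)
    rw [← mul_z_mul', ← mapₐ_z_mul, z_mul_carrollGen_P0, ← mul_assoc, mul_add, ← z_mul_tens,
      ← tens_z_mul, z_mul_carrollGen_P0]
    exact semiconj_log
  K i := twComul_eq isUnit_carrollTwist (semiconj_K i)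
  C0 := twComul_eq isUnit_carrollTwist semiconj_C0
  D := twComul_eq isUnit_carrollTwist semiconj_D
  C i := twComul_eq isUnit_carrollTwist (semiconj_C i)

theorem carroll_P0_YP (i : Fin 3) : br (Y .P0) (Y (.P i)) = 0 := by
  rw [br_swap, carrollGen_relations.PP0, neg_zero]

/-- `D` commutes with the boosts and the logarithm commutes with the deformed translations, so the
twist is a single exponential over four pairs and `isTwist_pexp` applies. -/
theorem carrollExponent_commute : Commute carrollExponentK carrollExponentD := by
  rw [← br_eq_zero_iff, carrollExponentD, br_neg,
    br_exponentK_eq_zero (cl_KD 1 0) fun i => ?_, neg_zero]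
  rw [br_swap, br_log, carroll_P0_YP, mul_zero, neg_zero]

/-- The left factors of the exponent of the Carroll twisting element. -/
def carrollX : Option (Fin 3) → (U 1 0)⟦X⟧
  | none => c .D
  | some i => c (.K i)

/-- The right factors of the exponent of the Carroll twisting element. -/
def carrollQ : Option (Fin 3) → (U 1 0)⟦X⟧
  | none => -carrollLog
  | some i => -(z * Y (.P i))

theorem carrollTwist_eq_pexp : carrollTwist = pexp (∑ o, tens (carrollX o) (carrollQ o)) := by
  rw [carrollTwist, ← pexp_add small_carrollExponentK small_carrollExponentD
    carrollExponent_commute, Fintype.sum_option, add_comm]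
  simp only [carrollX, carrollQ, tens_neg, tens_z_mul, Finset.sum_neg_distrib, ← Finset.mul_sum]
  rfl

theorem counit_carrollE :
    mapₐ ((Algebra.ofId ℝ (U 1 0)).comp (counit₀ 1 0)) carrollLog = 0 := by
  have : (0 : (U 1 0)⟦X⟧) = plogOneSub 0 := by
    ext n
    rw [plogOneSub, PowerSeries.coeff_mk, Finset.sum_eq_zero, neg_zero, map_zero]
    intro k hk
    rw [zero_pow (by rw [Finset.mem_Icc] at hk; omega), smul_zero]
  rw [carrollLog, map_neg, plogOneSub_eq_pser, mapₐ_pser, mapₐ_z_mul, counit_cl, mul_zero,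
    ← plogOneSub_eq_pser, ← this, neg_zero]

/-- The hypothesis with content is that the right legs are primitive for the twisted coproduct. This
is `semiconj_log` for the leg paired with `D` and `semiconj_YP` for those paired with the boosts. -/
theorem isTwist_carrollTwist : IsTwist carrollTwist := by
  rw [carrollTwist_eq_pexp]
  have hz : ∀ x y : (U 1 0)⟦X⟧, br x y = 0 → Commute (-(z * x)) (-(z * y)) := fun x y h =>
    (((z_commute _).mul_left ((z_commute _).symm.mul_right (br_eq_zero_iff.1 h))).neg_left).neg_right
  have hlP : ∀ i, Commute (-carrollLog) (-(z * Y (.P i))) := fun i => by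
    rw [← z_mul_carrollGen_P0]; exact hz _ _ (carroll_P0_YP i)
  refine isTwist_pexp carrollX carrollQ ?_ ?_ ?_ ?_ ?_ ?_ ?_
  · rintro (_ | i) (_ | j)
    · exact Commute.refl _
    · exact br_eq_zero_iff.1 (carroll_br_D_K j)
    · exact (br_eq_zero_iff.1 (carroll_br_D_K i)).symm
    · exact br_eq_zero_iff.1 (carroll_KK i j)
  · rintro (_ | i) (_ | j)
    · exact Commute.refl _
    · exact hlP j
    · exact (hlP i).symm
    · exact hz _ _ (carroll_YP_YP i j)
  · rintro (_ | i)
    · exact small_carrollLog.neg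
    · exact (small_z_mul _).neg
  · rintro (_ | i) <;> exact counit_cl _
  · rintro (_ | i)
    · rw [carrollQ, map_neg, counit_carrollE, neg_zero]
    · rw [carrollQ, carrollGen, map_neg, mapₐ_z_mul, map_mul, counit_cl, zero_mul, mul_zero,
        neg_zero]
  · rintro (_ | i) <;> exact comulZ_cl _
  · rw [← carrollTwist_eq_pexp]
    rintro (_ | i)
    · have h := semiconj_log.neg_right
      rwa [neg_add, ← neg_tens, ← tens_neg, ← map_neg] at h
    · have h := (semiconj_z (semiconj_YP i)).neg_right
      rwa [mul_add, neg_add, ← z_mul_tens, ← tens_z_mul, ← neg_tens, ← tens_neg, ← mapₐ_z_mul,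
        ← map_neg] at h

theorem carrollTwist_eq : carrollTwist = expTens (-1) (Y (.K 2)) (Y (.P 2)) *
    expTens (-1) (Y (.K 1)) (Y (.P 1)) * expTens (-1) (Y (.K 0)) (Y (.P 0)) *
    expTens (-1) (Y .D) (Y .P0) := by
  have hs : ∀ i, Small ((-1 : ℝ) • (z * tens (c (.K i)) (Y (.P i)))) := fun i =>
    (small_z_mul _).smul _
  have hc : ∀ i j, Commute ((-1 : ℝ) • (z * tens (c (.K i)) (Y (.P i))))
      ((-1 : ℝ) • (z * tens (c (.K j)) (Y (.P j)))) := fun i j =>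
    (((z_commute _).mul_left ((z_commute _).symm.mul_right (tens_commute
      (br_eq_zero_iff.1 (carroll_KK i j))
      (br_eq_zero_iff.1 (carroll_YP_YP i j))))).smul_left _).smul_right _
  rw [carrollTwist]
  congr 1
  · change _ = pexp ((-1 : ℝ) • (z * tens (c (.K 2)) (Y (.P 2)))) *
      pexp ((-1 : ℝ) • (z * tens (c (.K 1)) (Y (.P 1)))) *
      pexp ((-1 : ℝ) • (z * tens (c (.K 0)) (Y (.P 0))))
    rw [← pexp_add (hs _) (hs _) (hc _ _), ← pexp_add ((hs _).add (hs _)) (hs _)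
      ((hc _ _).add_left (hc _ _)), carrollExponentK, Fin.sum_univ_three, mul_add, mul_add]
    congr 1
    module
  · rw [expTens, ← tens_z_mul, z_mul_carrollGen_P0, neg_one_smul]
    rfl

theorem inverse_eq_of_mul_eq_one {R : Type} [Ring R] {x y : R} (hx : IsUnit x) (h : x * y = 1) :
    Ring.inverse x = y := by
  rw [← mul_one (Ring.inverse x), ← h, ← mul_assoc, Ring.inverse_mul_cancel _ hx, one_mul]

theorem expTens_neg_mul {A : Type} [Ring A] [Algebra ℝ A] (x y : A⟦X⟧) :
    expTens (-1) x y * expTens 1 x y = 1 := by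
  rw [expTens, expTens, neg_one_smul, one_smul, pexp_neg_mul_pexp (small_z_mul _)]

theorem swapZ_expTens {A : Type} [Ring A] [Algebra ℝ A] (r : ℝ) (x y : A⟦X⟧) :
    swapZ (expTens r x y) = expTens r y x := by
  rw [expTens, expTens, swapZ_pexp, swapZ, mapₐ_smul, mapₐ_z_mul]
  exact congrArg (fun t => pexp (r • (z * t))) (swapZ_tens x y)

theorem rMatrix_carrollTwist : rMatrix carrollTwist =
    expTens (-1) (Y (.P 2)) (Y (.K 2)) * expTens (-1) (Y (.P 1)) (Y (.K 1)) *
      expTens (-1) (Y (.P 0)) (Y (.K 0)) * expTens (-1) (Y .P0) (Y .D) *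
      expTens 1 (Y .D) (Y .P0) * expTens 1 (Y (.K 0)) (Y (.P 0)) *
      expTens 1 (Y (.K 1)) (Y (.P 1)) * expTens 1 (Y (.K 2)) (Y (.P 2)) := by
  have hinv : Ring.inverse carrollTwist = expTens 1 (Y .D) (Y .P0) *
      expTens 1 (Y (.K 0)) (Y (.P 0)) * expTens 1 (Y (.K 1)) (Y (.P 1)) *
      expTens 1 (Y (.K 2)) (Y (.P 2)) := by
    refine inverse_eq_of_mul_eq_one isUnit_carrollTwist ?_
    have cancel : ∀ (x y : (U 1 0)⟦X⟧) t, expTens (-1) x y * (expTens 1 x y * t) = t :=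
      fun x y t => by rw [← mul_assoc, expTens_neg_mul, one_mul]
    rw [carrollTwist_eq]
    simp only [mul_assoc, cancel, expTens_neg_mul]
  rw [rMatrix, hinv, carrollTwist_eq]
  simp only [swapZ_mul, swapZ_expTens, mul_assoc]

theorem coeff_one_mul {A : Type} [Ring A] {x y : A⟦X⟧} (hx : PowerSeries.coeff 0 x = 1)
    (hy : PowerSeries.coeff 0 y = 1) : PowerSeries.coeff 0 (x * y) = 1 ∧
      PowerSeries.coeff 1 (x * y) = PowerSeries.coeff 1 x + PowerSeries.coeff 1 y := by
  constructor
  · rw [PowerSeries.coeff_mul]; simp [hx, hy]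
  · rw [PowerSeries.coeff_mul, Finset.Nat.antidiagonal_succ]
    simp only [Finset.Nat.antidiagonal_zero]
    simp [-PowerSeries.coeff_zero_eq_constantCoeff, hx, hy, add_comm]

theorem coeff_zero_tens {A : Type} [Ring A] [Algebra ℝ A] (x y : A⟦X⟧) :
    PowerSeries.coeff 0 (tens x y) = PowerSeries.coeff 0 x ⊗ₜ[ℝ] PowerSeries.coeff 0 y := by
  rw [tens, PowerSeries.coeff_mul]
  simp

theorem coeff_zero_carrollLog_succ : PowerSeries.coeff 1 carrollLog = gen 1 0 .P0 := by
  rw [carrollLog_eq, pser, PowerSeries.coeff_mk]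
  simp [Finset.sum_range_succ, coeff_z_mul_succ 0, cl]

theorem coeff_zero_cl {a b : ℝ} (g : Gen) : PowerSeries.coeff 0 (cl a b g) = gen a b g := by
  rw [PowerSeries.coeff_zero_eq_constantCoeff_apply, constantCoeff_cl]

theorem carrollGen_classical (g : Gen) : PowerSeries.constantCoeff (Y g) = gen 1 0 g := by
  rw [← PowerSeries.coeff_zero_eq_constantCoeff_apply]
  rcases g with i | i | i | i | _ | _ | _
  · exact coeff_zero_cl _
  · exact coeff_zero_cl _
  · rw [carrollGen, ← pexp_carrollLog, PowerSeries.coeff_zero_eq_constantCoeff_apply, map_mul,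
      constantCoeff_pexp, mul_one, constantCoeff_cl]
  · rw [carrollGen, map_sub, coeff_z_mul_zero, sub_zero]
    exact coeff_zero_cl _
  · rw [carrollGen, divZ, PowerSeries.coeff_mk, coeff_zero_carrollLog_succ]
  · rw [carrollGen, map_add, coeff_real_smul, coeff_z_mul_zero, smul_zero, add_zero]
    exact coeff_zero_cl _
  · exact coeff_zero_cl _

/-- All eight factors have constant term 1, so their first-order coefficients add; at this order
each deformed generator counts through its classical part. -/
theorem coeff_one_rMatrix_carrollTwist : PowerSeries.coeff 1 (rMatrix carrollTwist) =
    PowerSeries.coeff 1 (z * (wedge (c .D) (c .P0) + ∑ i, wedge (c (.K i)) (c (.P i))) :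
      (U 1 0 ⊗[ℝ] U 1 0)⟦X⟧) := by
  have h0 : ∀ (r : ℝ) (x y : (U 1 0)⟦X⟧), PowerSeries.coeff 0 (expTens r x y) = 1 :=
    fun _ _ _ => coeff_zero_pexp _
  have h1 : ∀ (r : ℝ) (g h : Gen), PowerSeries.coeff 1 (expTens r (Y g) (Y h)) =
      r • gen 1 0 g ⊗ₜ[ℝ] gen 1 0 h := fun r g h => by
    rw [expTens, coeff_one_pexp, coeff_real_smul, coeff_z_mul_succ 0, coeff_zero_tens,
      PowerSeries.coeff_zero_eq_constantCoeff_apply, PowerSeries.coeff_zero_eq_constantCoeff_apply,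
      carrollGen_classical, carrollGen_classical]
  have a2 := coeff_one_mul (h0 (-1) (Y (.P 2)) (Y (.K 2))) (h0 (-1) (Y (.P 1)) (Y (.K 1)))
  have a3 := coeff_one_mul a2.1 (h0 (-1) (Y (.P 0)) (Y (.K 0)))
  have a4 := coeff_one_mul a3.1 (h0 (-1) (Y .P0) (Y .D))
  have a5 := coeff_one_mul a4.1 (h0 1 (Y .D) (Y .P0))
  have a6 := coeff_one_mul a5.1 (h0 1 (Y (.K 0)) (Y (.P 0)))
  have a7 := coeff_one_mul a6.1 (h0 1 (Y (.K 1)) (Y (.P 1)))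
  have a8 := coeff_one_mul a7.1 (h0 1 (Y (.K 2)) (Y (.P 2)))
  rw [rMatrix_carrollTwist, a8.2, a7.2, a6.2, a5.2, a4.2, a3.2, a2.2, coeff_z_mul_succ 0]
  simp only [h1, wedge, cl, tens_C, map_add, map_sub, map_sum,
    PowerSeries.coeff_zero_C, Fin.sum_univ_three]
  module

theorem isHopf_carrollTwist :
    IsHopf (twComul carrollTwist) (counit₀ 1 0) (twAntipode carrollTwist) :=
  isTwist_carrollTwist.isHopf coeff_zero_carrollTwist

theorem carroll_isHopfSubalgebra :
    IsHopfSubalgebra (twComul carrollTwist) (twAntipode carrollTwist) (Y '' weyl) := by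
  have hD : Gen.D ∈ weyl := Or.inl rfl
  have hP0 : Gen.P0 ∈ weyl := Or.inr (Or.inl rfl)
  have hJ : ∀ i, Gen.J i ∈ weyl := fun i => Or.inr (Or.inr ⟨i, Or.inl rfl⟩)
  have hP : ∀ i, Gen.P i ∈ weyl := fun i => Or.inr (Or.inr ⟨i, Or.inr (Or.inl rfl)⟩)
  have hK : ∀ i, Gen.K i ∈ weyl := fun i => Or.inr (Or.inr ⟨i, Or.inr (Or.inr rfl)⟩)
  set G := closure (Y '' weyl) with hG
  have hmem : ∀ {g}, g ∈ weyl → Y g ∈ G := fun hg => mem_closure_of_mem ⟨_, hg, rfl⟩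
  have hlog : carrollLog ∈ G := by
    rw [← z_mul_carrollGen_P0]; exact mul_mem (z_mem_closure _) (hmem hP0)
  -- `E` and its inverse are exponentials of `±z P₀` for the deformed `P₀`, hence limits of
  -- polynomials in Weyl generators. The skew-primitive antipodes need both.
  have hE : E ∈ G := by
    rw [← pexp_carrollLog]; exact pser_mem_closure _ small_carrollLog hlog
  have hE' : pexp (-carrollLog) ∈ G := pser_mem_closure _ small_carrollLog.neg (neg_mem hlog)
  have hEE : E * pexp (-carrollLog) = 1 := by
    rw [← pexp_carrollLog, pexp_mul_pexp_neg small_carrollLog]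
  have hEP : ∀ i, E * Y (.P i) ∈ G := fun i => mul_mem hE (hmem (hP i))
  have cop := carrollGen_coproduct
  have skew : ∀ {x u u' : (U 1 0)⟦X⟧}, twComul carrollTwist x = tens x u + tens 1 x →
      u * u' = 1 → u' ∈ G → x ∈ G → twAntipode carrollTwist x ∈ G := fun h hu hu' hx =>
    antipode_mem_closure isHopf_carrollTwist (V := 0) (W := 0) (by rw [h]; simp [tens_zero]) hu hu'
      hx (fun i => by rw [Pi.zero_apply, map_zero]; exact zero_mem _) fun i => zero_mem _
  have hSK : ∀ i, twAntipode carrollTwist (Y (.K i)) ∈ G := fun i =>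
    skew (cop.K i) hEE hE' (hmem (hK i))
  have hΔ : ∀ {x u : (U 1 0)⟦X⟧}, u ∈ G → x ∈ G → tens x u + tens 1 x ∈ _ := fun hu hx =>
    add_mem (tens_mem_closure hx hu) (tens_mem_closure (one_mem _) hx)
  refine isHopfSubalgebra_of_generators isHopf_carrollTwist
    (isUnit_twElement coeff_zero_carrollTwist) ?_ ?_
  · rintro _ ⟨g, rfl | rfl | ⟨i, rfl | rfl | rfl⟩, rfl⟩
    · rw [cop.D]
      exact add_mem (hΔ hE (hmem hD)) (mul_mem (z_mem_closure _) (sum_mem fun i _ =>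
        tens_mem_closure (hmem (hK i)) (hEP i)))
    · rw [cop.P0]; exact hΔ (one_mem _) (hmem hP0)
    · rw [cop.J]; exact hΔ (one_mem _) (hmem (hJ i))
    · rw [cop.P]; exact hΔ (one_mem _) (hmem (hP i))
    · rw [cop.K]; exact hΔ hE (hmem (hK i))
  · rintro _ ⟨g, rfl | rfl | ⟨i, rfl | rfl | rfl⟩, rfl⟩
    · exact antipode_mem_closure isHopf_carrollTwist cop.D hEE hE' (hmem hD) hSK hEP
    · exact skew cop.P0 (one_mul 1) (one_mem _) (hmem hP0)
    · exact skew (cop.J i) (one_mul 1) (one_mem _) (hmem (hJ i))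
    · exact skew (cop.P i) (one_mul 1) (one_mem _) (hmem (hP i))
    · exact hSK i

end CarrollTwist

/-! ### Limits of classical generators, and exponentials with exponents in a commuting span. -/

section GeneratorLimits

variable {a b : ℝ} {w : Gen → ℕ} {k : ℕ}

theorem gen_limit (g : Gen) : SeriesLimit (evalScaled w) (evalLimit a b) k
    (fun ε => ε ^ w g • SO42.e g) (cl a b g) := by
  have h := HasLimit.map_const (φ := fun ε => (evalScaled w ε).toLinearMap)
    (φ₀ := (evalLimit a b).toLinearMap) (FreeAlgebra.ι ℝ g)
  rw [AlgHom.toLinearMap_apply, evalLimit_gen] at h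
  have h2 := SeriesLimit.C (k := k) h
  refine h2.congr fun ε _ => ?_
  rw [AlgHom.toLinearMap_apply, evalScaled_ι]
  exact ((constₗ (U 1 1)).map_smul _ _).symm

theorem gen_limit_zero {g : Gen} (h : w g = 0) : SeriesLimit (evalScaled w) (evalLimit a b) k
    (fun _ => SO42.e g) (cl a b g) := by
  have := gen_limit (a := a) (b := b) (w := w) (k := k) g
  simpa only [h, pow_zero, one_smul] using this

theorem gen_limit_one {g : Gen} (h : w g = 1) : SeriesLimit (evalScaled w) (evalLimit a b) k
    (fun ε => ε • SO42.e g) (cl a b g) := by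
  have := gen_limit (a := a) (b := b) (w := w) (k := k) g
  simpa only [h, pow_one] using this

theorem tendsto_punctured_zero : Tendsto (fun ε : ℝ => ε) (𝓝[≠] 0) (𝓝 0) :=
  tendsto_id.mono_left nhdsWithin_le_nhds

theorem SeriesLimit.vanish {W V V₀ : Type} [Ring W] [Algebra ℝ W] [Ring V] [Algebra ℝ V] [Ring V₀]
    [Algebra ℝ V₀] {φ : ℝ → W →ₐ[ℝ] V} {φ₀ : W →ₐ[ℝ] V₀} {k : ℕ} {x : ℝ → V⟦X⟧} {y : V₀⟦X⟧}
    (h : SeriesLimit φ φ₀ k x y) : SeriesLimit φ φ₀ k (fun ε => ε • x ε) 0 := by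
  simpa only [zero_smul] using h.smul tendsto_punctured_zero

theorem SeriesLimit.wedge {W V V₀ : Type} [Ring W] [Algebra ℝ W] [Ring V] [Algebra ℝ V] [Ring V₀]
    [Algebra ℝ V₀] {φ : ℝ → W →ₐ[ℝ] V} {φ₀ : W →ₐ[ℝ] V₀} {k : ℕ} {x x' : ℝ → V⟦X⟧}
    {y y' : V₀⟦X⟧} (h : SeriesLimit φ φ₀ k x y) (h' : SeriesLimit φ φ₀ k x' y') :
    SeriesLimit (fun ε => Algebra.TensorProduct.map (φ ε) (φ ε)) (Algebra.TensorProduct.map φ₀ φ₀) k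
      (fun ε => TwistedConformal.wedge (x ε) (x' ε)) (TwistedConformal.wedge y y') :=
  (h.tens h').sub (h'.tens h)

theorem smul_wedge {A : Type} [Ring A] [Algebra ℝ A] (r : ℝ) (x y : A⟦X⟧) :
    wedge (r • x) y = r • wedge x y := by
  rw [wedge, wedge, smul_tens, tens_smul, smul_sub]

theorem wedge_smul {A : Type} [Ring A] [Algebra ℝ A] (r : ℝ) (x y : A⟦X⟧) :
    wedge x (r • y) = r • wedge x y := by
  rw [wedge, wedge, smul_tens, tens_smul, smul_sub]

theorem commute_of_mem_span {A : Type} [Ring A] [Algebra ℝ A] {S : Set A}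
    (hc : ∀ s ∈ S, ∀ t ∈ S, Commute s t) {x y : A} (hx : x ∈ Submodule.span ℝ S)
    (hy : y ∈ Submodule.span ℝ S) : Commute x y := by
  induction hx using Submodule.span_induction with
  | mem u h =>
    induction hy using Submodule.span_induction with
    | mem v h' => exact hc u h v h'
    | zero => exact Commute.zero_right _
    | add u v _ _ h h' => exact h.add_right h'
    | smul r u _ h => exact h.smul_right r
  | zero => exact Commute.zero_left _
  | add u v _ _ h h' => exact h.add_left h'
  | smul r u _ h => exact h.smul_left r

/-- The span of `z u ⊗ v` for `u` in the span of the `X i` and `v` in the span of the `P i`. -/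
def tensSpan {A ι : Type} [Ring A] [Algebra ℝ A] (X P : ι → A⟦X⟧) : Submodule ℝ (A ⊗[ℝ] A)⟦X⟧ :=
  Submodule.span ℝ {t | ∃ u ∈ Submodule.span ℝ (Set.range X),
    ∃ v ∈ Submodule.span ℝ (Set.range P), t = z * tens u v}

theorem mem_tensSpan {A ι : Type} [Ring A] [Algebra ℝ A] {X P : ι → A⟦X⟧} {u v : A⟦X⟧}
    (hu : u ∈ Submodule.span ℝ (Set.range X)) (hv : v ∈ Submodule.span ℝ (Set.range P)) :
    z * tens u v ∈ tensSpan X P := Submodule.subset_span ⟨u, hu, v, hv, rfl⟩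

/-- Exponents that are combinations of `z X_i ⊗ P_j` commute, so products of exponentials only
depend on the sum of the exponents. This permits the passage from the null-plane basis, with sums
and differences of generators, to the conformal basis. -/
theorem pexp_mul_pexp_of_tensSpan {A ι : Type} [Ring A] [Algebra ℝ A] {X P : ι → A⟦X⟧}
    (hX : ∀ i j, Commute (X i) (X j)) (hP : ∀ i j, Commute (P i) (P j)) {x y : (A ⊗[ℝ] A)⟦X⟧}
    (hx : x ∈ tensSpan X P) (hy : y ∈ tensSpan X P) : pexp x * pexp y = pexp (x + y) := by
  have small : ∀ u ∈ tensSpan X P, Small u := fun u hu => by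
    induction hu using Submodule.span_induction with
    | mem u h => obtain ⟨u, _, v, _, rfl⟩ := h; exact small_z_mul _
    | zero => exact small_zero
    | add u v _ _ h h' => exact h.add h'
    | smul r u _ h => exact h.smul r
  refine (pexp_add (small x hx) (small y hy) (commute_of_mem_span ?_ hx hy)).symm
  rintro _ ⟨u, hu, v, hv, rfl⟩ _ ⟨u', hu', v', hv', rfl⟩
  refine (z_commute _).mul_left ((z_commute _).symm.mul_right (tens_commute
    (commute_of_mem_span ?_ hu hu') (commute_of_mem_span ?_ hv hv')))
  · rintro _ ⟨i, rfl⟩ _ ⟨j, rfl⟩; exact hX i j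
  · rintro _ ⟨i, rfl⟩ _ ⟨j, rfl⟩; exact hP i j

theorem coeff_zero_SO42_F : PowerSeries.coeff 0 SO42.F = 1 := by
  simp [SO42.F, SO42.PhiA, SO42.PhiE, SO42.PhiJ, constantCoeff_pexp]

theorem coeff_one_plogOneSub {A : Type} [Ring A] [Algebra ℝ A] (f : A⟦X⟧) :
    PowerSeries.coeff 1 (plogOneSub f) = -PowerSeries.coeff 1 f := by
  simp [plogOneSub]

theorem coeff_two_plogOneSub {A : Type} [Ring A] [Algebra ℝ A] (f : A⟦X⟧) :
    PowerSeries.coeff 2 (plogOneSub f) =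
      -(PowerSeries.coeff 2 f + (1 / 2 : ℝ) • PowerSeries.coeff 2 (f ^ 2)) := by
  rw [plogOneSub, PowerSeries.coeff_mk, map_neg, map_sum,
    show Finset.Icc 1 2 = ({1, 2} : Finset ℕ) from rfl, Finset.sum_pair (by norm_num)]
  simp [coeff_real_smul]

end GeneratorLimits

/-! ### The speed-space contraction: generators, twist factors and classical `r`-matrix. -/

section GalileanLimit

local notation "c" => cl 0 1
local notation "Lim" => SeriesLimit (evalScaled speedSpace) (evalLimit 0 1)
local notation "Lim₂" => SeriesLimit
  (fun ε => Algebra.TensorProduct.map (evalScaled speedSpace ε) (evalScaled speedSpace ε))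
  (Algebra.TensorProduct.map (evalLimit 0 1) (evalLimit 0 1))

open SO42

variable {k : ℕ}

theorem galilean_limit_P (i : Fin 3) : Lim k (fun ε => ε • e (.P i)) (c (.P i)) := gen_limit_one rfl
theorem galilean_limit_K (i : Fin 3) : Lim k (fun ε => ε • e (.K i)) (c (.K i)) := gen_limit_one rfl
theorem galilean_limit_C (i : Fin 3) : Lim k (fun ε => ε • e (.C i)) (c (.C i)) := gen_limit_one rfl
theorem galilean_limit_J (i : Fin 3) : Lim k (fun _ => e (.J i)) (c (.J i)) := gen_limit_zero rfl
theorem galilean_limit_P0 : Lim k (fun _ => e .P0) (c .P0) := gen_limit_zero rfl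
theorem galilean_limit_C0 : Lim k (fun _ => e .C0) (c .C0) := gen_limit_zero rfl
theorem galilean_limit_D : Lim k (fun _ => e .D) (c .D) := gen_limit_zero rfl

/-- The space translation scales like `ε⁻¹` while `P₀` is fixed, so only the space part of the
null-plane momentum is left. -/
theorem galilean_limit_Tm : Lim k (fun ε => ε • Tm) (-(1 / 2 : ℝ) • c (.P 0)) := by
  have h := (galilean_limit_P0.vanish.sub (galilean_limit_P (k := k) 0)).const_smul (1 / 2)
  rw [zero_sub, smul_neg, ← neg_smul] at h
  exact h.congr fun ε _ => by rw [Tm, smul_comm, smul_sub]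

theorem galilean_limit_Tp : Lim k (fun ε => ε • Tp) ((1 / 2 : ℝ) • c (.P 0)) := by
  have h := (galilean_limit_P0.vanish.add (galilean_limit_P (k := k) 0)).const_smul (1 / 2)
  rw [zero_add] at h
  exact h.congr fun ε _ => by rw [Tp, smul_comm, smul_add]

theorem galilean_limit_T2 : Lim k (fun ε => ε • T2) ((1 / 2 : ℝ) • (c (.P 1) - c (.P 2))) :=
  (((galilean_limit_P 1).sub (galilean_limit_P 2)).const_smul (1 / 2)).congr fun ε _ => by
    rw [T2, smul_comm, smul_sub]

theorem galilean_limit_T3 : Lim k (fun ε => ε • T3) ((1 / 2 : ℝ) • (c (.P 1) + c (.P 2))) :=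
  (((galilean_limit_P 1).add (galilean_limit_P 2)).const_smul (1 / 2)).congr fun ε _ => by
    rw [T3, smul_comm, smul_add]

/-- The limit of `σ₋` when `z` is rescaled by `ε⁻¹` only. -/
def galileanSigmaM : (U 0 1)⟦X⟧ := plogOneSub ((2 : ℝ) • (z * (-(1 / 2 : ℝ) • c (.P 0))))

/-- The limit of `T` when `z` is rescaled by `ε⁻¹` only. -/
def galileanT : (U 0 1)⟦X⟧ := (1 / 2 : ℝ) • c (.P 0) +
  z * ((((1 / 2 : ℝ) • (c (.P 1) - c (.P 2))) ^ 2 + ((1 / 2 : ℝ) • (c (.P 1) + c (.P 2))) ^ 2) *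
    pexp (-galileanSigmaM))

/-- Uses the auxiliary rescaling of `z` by `ε⁻¹`, for which `z T₋` is already finite. The surplus
powers of `ε` in the true weight two are exploited afterwards. -/
theorem galilean_limit_sigmaM : Lim 1 (fun _ => sigmaM) galileanSigmaM := by
  refine SeriesLimit.plogOneSub (SeriesLimit.const_smul 2 (SeriesLimit.z_mul ?_))
  simpa only [pow_one] using galilean_limit_Tm

theorem galilean_limit_T : Lim 1 (fun ε => ε • T) galileanT := by
  have h := ((galilean_limit_T2 (k := 1)).pow 2).add (galilean_limit_T3.pow 2)
  have h2 := h.mul galilean_limit_sigmaM.neg.pexp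
  have h3 : Lim 1 (fun ε => z * (ε • ((T2 ^ 2 + T3 ^ 2) * pexp (-sigmaM)))) _ :=
    SeriesLimit.z_mul (h2.congr fun ε _ => by
      rw [pow_one, smul_smul, smul_pow, smul_pow, ← smul_add, smul_mul_assoc, ← pow_two])
  exact (galilean_limit_Tp.add h3).congr fun ε _ => by rw [T, smul_add, mul_smul_comm]

/-- The limit of `σ₊` when `z` is rescaled by `ε⁻¹` only. -/
def galileanSigmaP : (U 0 1)⟦X⟧ := plogOneSub ((2 : ℝ) • (z * galileanT))

theorem galilean_limit_sigmaP : Lim 1 (fun _ => sigmaP) galileanSigmaP := by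
  refine SeriesLimit.plogOneSub (SeriesLimit.const_smul 2 (SeriesLimit.z_mul ?_))
  simpa only [pow_one] using galilean_limit_T

theorem coeff_one_galileanSigmaM : PowerSeries.coeff 1 galileanSigmaM = gen 0 1 (.P 0) := by
  rw [galileanSigmaM, coeff_one_plogOneSub, coeff_real_smul, coeff_z_mul_succ 0, coeff_real_smul,
    coeff_zero_cl]
  module

theorem coeff_zero_galileanT : PowerSeries.coeff 0 galileanT = (1 / 2 : ℝ) • gen 0 1 (.P 0) := by
  rw [galileanT, map_add, coeff_z_mul_zero, add_zero, coeff_real_smul, coeff_zero_cl]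

theorem coeff_one_galileanSigmaP : PowerSeries.coeff 1 galileanSigmaP = -gen 0 1 (.P 0) := by
  rw [galileanSigmaP, coeff_one_plogOneSub, coeff_real_smul, coeff_z_mul_succ 0,
    coeff_zero_galileanT]
  module

theorem coeff_two_smul_z_sq {A : Type} [Ring A] [Algebra ℝ A] (r : ℝ) (f : A⟦X⟧) :
    PowerSeries.coeff 2 ((r • (z * f)) ^ 2) = (r ^ 2) • (PowerSeries.coeff 0 f) ^ 2 := by
  have : (r • (z * f)) ^ 2 = (r ^ 2) • (z * (z * (f * f))) := by
    rw [smul_pow, pow_two (z * f), mul_assoc, mul_z_mul']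
  rw [this, coeff_real_smul, coeff_z_mul_succ 1, coeff_z_mul_succ 0, pow_two (PowerSeries.coeff 0 f)]
  simp

/-- Each logarithm contributes half of `-P₁ ^ 2` through its quadratic term, and `T₂ ^ 2 + T₃ ^ 2`
supplies half of `P₂ ^ 2 + P₃ ^ 2`, doubled by the factor `2 z` in `σ₊`. -/
theorem coeff_two_galileanSigma : PowerSeries.coeff 2 (galileanSigmaP + galileanSigmaM) =
    -∑ i, gen 0 1 (.P i) ^ 2 := by
  have h : PowerSeries.coeff 1 galileanT =
      ((1 / 2 : ℝ) • (gen 0 1 (.P 1) - gen 0 1 (.P 2))) ^ 2 +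
        ((1 / 2 : ℝ) • (gen 0 1 (.P 1) + gen 0 1 (.P 2))) ^ 2 := by
    have h0 : PowerSeries.coeff 1 (c (.P 0)) = 0 := by
      rw [cl, PowerSeries.coeff_C, if_neg one_ne_zero]
    rw [galileanT, map_add, coeff_real_smul, h0, smul_zero, zero_add, coeff_z_mul_succ 0,
      PowerSeries.coeff_zero_eq_constantCoeff_apply, map_mul, constantCoeff_pexp, mul_one, map_add,
      map_pow, map_pow, ← PowerSeries.coeff_zero_eq_constantCoeff_apply,
      ← PowerSeries.coeff_zero_eq_constantCoeff_apply, coeff_real_smul, coeff_real_smul, map_add,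
      map_sub, coeff_zero_cl, coeff_zero_cl]
  have h0 : PowerSeries.coeff 1 (-(1 / 2 : ℝ) • c (.P 0)) = 0 := by
    rw [coeff_real_smul, cl, PowerSeries.coeff_C, if_neg one_ne_zero, smul_zero]
  rw [map_add, galileanSigmaP, galileanSigmaM, coeff_two_plogOneSub, coeff_two_plogOneSub,
    coeff_real_smul, coeff_real_smul, coeff_z_mul_succ 1, coeff_z_mul_succ 1, h, h0,
    coeff_two_smul_z_sq, coeff_two_smul_z_sq, coeff_zero_galileanT, coeff_real_smul, coeff_zero_cl,
    Fin.sum_univ_three]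
  simp only [pow_two, smul_mul_smul_comm, mul_add, add_mul, mul_sub, sub_mul]
  module

theorem galilean_limit_pexp_sigmaM (r : ℝ) : Lim 2 (fun _ => pexp (r • sigmaM)) 1 := by
  have h := (galilean_limit_sigmaM.const_smul r).pexp.weight_two
  rwa [coeff_zero_pexp, map_one] at h

theorem galilean_limit_inv_sigmaM : Lim 2 (fun ε => ε⁻¹ • sigmaM) (z * c (.P 0)) := by
  have h := galilean_limit_sigmaM.weight_two_inv fun _ => plogOneSub_small _
  rwa [coeff_one_galileanSigmaM] at h

theorem galilean_limit_inv_sigmaP : Lim 2 (fun ε => ε⁻¹ • sigmaP) (-(z * c (.P 0))) := by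
  have h := galilean_limit_sigmaP.weight_two_inv fun _ => plogOneSub_small _
  rwa [coeff_one_galileanSigmaP, map_neg, mul_neg] at h

/-- Dividing by `z` makes order `n` depend on order `n + 1` of `σ₊ + σ₋`. Order zero is exact, as
the `P₁` parts cancel and `-2 P₀` remains in first order. Order one is the auxiliary limit of the
second-order term; higher orders carry surplus powers of `ε`. -/
theorem galilean_limit_P0_qgen : Lim 2 (fun _ => qgen .P0) (galileanGen .P0) := by
  have hlin : PowerSeries.coeff 1 (sigmaP + sigmaM) = -(2 : ℝ) • gen 1 1 .P0 := by
    have h0 : ∀ g, PowerSeries.coeff 0 (e g) = gen 1 1 g := coeff_zero_cl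
    rw [map_add, sigmaP, sigmaM, coeff_one_plogOneSub, coeff_one_plogOneSub, coeff_real_smul,
      coeff_real_smul, coeff_z_mul_succ 0, coeff_z_mul_succ 0, T, Tm, map_add, coeff_z_mul_zero,
      add_zero, Tp, coeff_real_smul, coeff_real_smul, map_add, map_sub, h0, h0]
    module
  have hs := galilean_limit_sigmaP.add galilean_limit_sigmaM
  intro n
  have hq : ∀ n, PowerSeries.coeff n (qgen .P0) =
      -(1 / 2 : ℝ) • PowerSeries.coeff (n + 1) (sigmaP + sigmaM) := fun n => by
    rw [qgen, coeff_real_smul, divZ, PowerSeries.coeff_mk]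
  rcases n with _ | n
  · have h := galilean_limit_P0 (k := 2) 0
    rw [galileanGen, map_add, coeff_real_smul, coeff_z_mul_zero, smul_zero, add_zero]
    refine h.congr_ne fun ε _ => ?_
    rw [hq, hlin, show PowerSeries.coeff 0 (e .P0) = gen 1 1 .P0 from coeff_zero_cl .P0]
    module
  -- The weight available is `2 (n + 1)` and the auxiliary limit uses `n + 2`, so `ε ^ n` is left
  -- over: nonzero in the limit only for `n = 0`.
  · have hp : Tendsto (fun ε : ℝ => -(1 / 2) * ε ^ n) (𝓝[≠] 0) (𝓝 (-(1 / 2) * 0 ^ n)) :=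
      (((continuous_pow n).tendsto 0).mono_left nhdsWithin_le_nhds).const_mul _
    have h := (hs (n + 2)).smul hp
    have hy : (-(1 / 2) * 0 ^ n : ℝ) • PowerSeries.coeff (n + 2) (galileanSigmaP + galileanSigmaM) =
        PowerSeries.coeff (n + 1) (galileanGen .P0) := by
      have h0 : PowerSeries.coeff (n + 1) (c .P0) = 0 := by
        rw [cl, PowerSeries.coeff_C, if_neg n.succ_ne_zero]
      have hC : (∑ i, c (.P i) ^ 2 : (U 0 1)⟦X⟧) = PowerSeries.C (∑ i, gen 0 1 (.P i) ^ 2) := by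
        rw [map_sum]; exact Finset.sum_congr rfl fun i _ => (map_pow _ _ _).symm
      rw [galileanGen, (PowerSeries.coeff (n + 1)).map_add (c .P0), h0, zero_add, coeff_real_smul,
        coeff_z_mul_succ, hC,
        PowerSeries.coeff_C]
      rcases n with _ | n
      · rw [coeff_two_galileanSigma, if_pos rfl]
        module
      · rw [if_neg n.succ_ne_zero, zero_pow n.succ_ne_zero, mul_zero, zero_smul, smul_zero]
    rw [hy] at h
    refine h.congr_ne fun ε _ => ?_
    rw [hq, smul_smul, smul_smul]
    congr 1
    ring

theorem galilean_limit_generators (g : Gen) :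
    Lim 2 (fun ε => ε ^ speedSpace g • qgen g) (galileanGen g) := by
  rcases g with i | i | i | i | _ | _ | _
  · exact gen_limit (.J i)
  · exact gen_limit (.K i)
  · simp only [speedSpace, pow_one]
    have hE := galilean_limit_pexp_sigmaM (-1)
    fin_cases i
    · have h := ((galilean_limit_inv_sigmaP.sub galilean_limit_inv_sigmaM).divZ).const_smul
        (-(1 / 2))
      have hy : -(1 / 2 : ℝ) • divZ (-(z * c (.P 0)) - z * c (.P 0)) = galileanGen (.P 0) := by
        rw [← mul_neg, ← mul_sub, divZ_z_mul, galileanGen]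
        module
      rw [hy] at h
      refine h.congr fun ε hε => ?_
      change ε • (-(1 / 2 : ℝ) • divZ (sigmaP - sigmaM)) = _
      ext n
      simp only [coeff_real_smul, divZ, PowerSeries.coeff_mk, ← smul_sub]
      rw [smul_smul, smul_smul, smul_smul]
      congr 1
      field_simp
    · have h := (galilean_limit_T3.add galilean_limit_T2).mul hE
      have hy : ((1 / 2 : ℝ) • (c (.P 1) + c (.P 2)) + (1 / 2 : ℝ) • (c (.P 1) - c (.P 2))) * 1 =
          galileanGen (.P 1) := by
        rw [mul_one, galileanGen]; module
      rw [hy] at h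
      refine h.congr fun ε _ => ?_
      change ε • ((T3 + T2) * pexp (-sigmaM)) = _
      rw [neg_one_smul, ← smul_add, smul_mul_assoc]
    · have h := (galilean_limit_T3.sub galilean_limit_T2).mul hE
      have hy : ((1 / 2 : ℝ) • (c (.P 1) + c (.P 2)) - (1 / 2 : ℝ) • (c (.P 1) - c (.P 2))) * 1 =
          galileanGen (.P 2) := by
        rw [mul_one, galileanGen]; module
      rw [hy] at h
      refine h.congr fun ε _ => ?_
      change ε • ((T3 - T2) * pexp (-sigmaM)) = _
      rw [neg_one_smul, ← smul_sub, smul_mul_assoc]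
  -- The factor `z` supplies `ε ^ 2`, but `ε K_i D` needs only one power, already present; the
  -- remaining `ε ^ 2` kills the correction to `C_i`.
  · have h : Lim 2 (fun ε => z * (ε • (e (.K i) * e .D))) (z * 0) :=
      SeriesLimit.z_mul (((galilean_limit_K i).mul galilean_limit_D).vanish.vanish.congr
        fun ε _ => by rw [smul_mul_assoc, pow_two, ← smul_smul])
    have h2 := (galilean_limit_C i).sub h
    rw [mul_zero, sub_zero] at h2
    exact h2.congr fun ε _ => by
      simp only [speedSpace, pow_one, qgen, smul_sub, mul_smul_comm]
  · simpa only [speedSpace, pow_zero, one_smul] using galilean_limit_P0_qgen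
  -- Here the `ε ^ 2` supplied by `z` is exactly absorbed by the two boosts, so the correction to
  -- `C₀` survives.
  · have h : Lim 2 (fun ε => z * ∑ i, e (.K i) ^ 2) (z * ∑ i, c (.K i) ^ 2) :=
      SeriesLimit.z_mul ((SeriesLimit.sum Finset.univ fun i _ => (galilean_limit_K i).pow 2).congr
        fun ε _ => by simp only [smul_pow, Finset.smul_sum])
    exact (galilean_limit_C0.add (h.const_smul (1 / 2))).congr fun ε _ => one_smul ℝ _
  · exact gen_limit .D

theorem galilean_limit_Hm : Lim k (fun ε => ε • Hm) (-(1 / 2 : ℝ) • c (.K 0)) := by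
  have h := (galilean_limit_D.vanish.sub (galilean_limit_K (k := k) 0)).const_smul (1 / 2)
  rw [zero_sub, smul_neg, ← neg_smul] at h
  exact h.congr fun ε _ => by rw [Hm, smul_comm, smul_sub]

theorem galilean_limit_Hp : Lim k (fun ε => ε • Hp) ((1 / 2 : ℝ) • c (.K 0)) := by
  have h := (galilean_limit_D.vanish.add (galilean_limit_K (k := k) 0)).const_smul (1 / 2)
  rw [zero_add] at h
  exact h.congr fun ε _ => by rw [Hp, smul_comm, smul_add]

theorem galilean_limit_B2 : Lim k (fun ε => ε • B2) ((1 / 2 : ℝ) • (c (.K 1) - c (.K 2))) := by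
  have h := ((((galilean_limit_K (k := k) 1).add (galilean_limit_J 2).vanish).sub
    (galilean_limit_K 2)).add (galilean_limit_J 1).vanish).const_smul (1 / 2)
  rw [add_zero, add_zero] at h
  exact h.congr fun ε _ => by rw [B2]; module

theorem galilean_limit_B3 : Lim k (fun ε => ε • B3) ((1 / 2 : ℝ) • (c (.K 1) + c (.K 2))) := by
  have h := ((((galilean_limit_K (k := k) 1).add (galilean_limit_J 2).vanish).add
    (galilean_limit_K 2)).sub (galilean_limit_J 1).vanish).const_smul (1 / 2)
  rw [add_zero, sub_zero] at h
  exact h.congr fun ε _ => by rw [B3]; module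

/-- The exponent is balanced as `(ε H₋) ⊗ (ε⁻¹ σ₋)`, with limits `-K₁ / 2` and `z P₁`. -/
theorem galilean_limit_PhiJ : ContractsTo₂ speedSpace 2 (fun _ => PhiJ)
    (expTens (-(1 / 2)) (galileanGen (.K 0)) (galileanGen (.P 0))) := by
  have h := (galilean_limit_Hm.tens galilean_limit_inv_sigmaM).pexp
  rw [smul_tens, tens_z_mul] at h
  refine h.congr fun ε hε => ?_
  rw [PhiJ, smul_tens, tens_smul, smul_smul, mul_inv_cancel₀ hε, one_smul]

theorem galilean_limit_PhiA : ContractsTo₂ speedSpace 2 (fun _ => PhiA)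
    (expTens (-(1 / 2)) (galileanGen (.K 0)) (galileanGen (.P 0))) := by
  have h := (galilean_limit_Hp.tens galilean_limit_inv_sigmaP).pexp
  rw [smul_tens, tens_neg, tens_z_mul, smul_neg, ← neg_smul] at h
  refine h.congr fun ε hε => ?_
  rw [PhiA, smul_tens, tens_smul, smul_smul, mul_inv_cancel₀ hε, one_smul]

theorem galilean_pexp_mul {x y : (U 0 1 ⊗[ℝ] U 0 1)⟦X⟧}
    (hx : x ∈ tensSpan (fun i => c (.K i)) fun i => c (.P i))
    (hy : y ∈ tensSpan (fun i => c (.K i)) fun i => c (.P i)) : pexp x * pexp y = pexp (x + y) :=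
  pexp_mul_pexp_of_tensSpan
    (fun i j => br_eq_zero_iff.1 (by simp only [cl_KK, mul_one, neg_zero, zero_smul]))
    (fun i j => br_eq_zero_iff.1 (cl_PP ..)) hx hy

theorem galilean_mem_K (i : Fin 3) : c (.K i) ∈ Submodule.span ℝ (Set.range fun i => c (.K i)) :=
  Submodule.subset_span ⟨i, rfl⟩

theorem galilean_mem_P (i : Fin 3) : c (.P i) ∈ Submodule.span ℝ (Set.range fun i => c (.P i)) :=
  Submodule.subset_span ⟨i, rfl⟩

/-- The square-root factors tend to 1 and the rotation parts of `B₂, B₃` vanish. The polarisation `2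
(k₊ ⊗ p₊ + k₋ ⊗ p₋) = K₂ ⊗ P₂ + K₃ ⊗ P₃`, where `k₊, k₋` and `p₊, p₋` are half sums and half
differences, then separates the two directions. -/
theorem galilean_limit_PhiE : ContractsTo₂ speedSpace 2 (fun _ => PhiE)
    (expTens (-1) (galileanGen (.K 1)) (galileanGen (.P 1)) *
      expTens (-1) (galileanGen (.K 2)) (galileanGen (.P 2))) := by
  have hE := galilean_limit_pexp_sigmaM (-(1 / 2))
  have h : ∀ {B T : (U 1 1)⟦X⟧} {b t : (U 0 1)⟦X⟧}, Lim 2 (fun ε => ε • B) b →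
      Lim 2 (fun ε => ε • T) t → ContractsTo₂ speedSpace 2
        (fun _ => pexp (-(2 : ℝ) • (z * tens B (T * pexp (-(1 / 2 : ℝ) • sigmaM)))))
        (pexp (-(2 : ℝ) • (z * tens b t))) := fun hB hT => by
    have h1 := hB.tens (hT.mul hE)
    rw [mul_one] at h1
    exact ((SeriesLimit.z_mul (h1.congr fun ε _ => by
      rw [smul_mul_assoc, smul_tens, tens_smul, smul_smul, ← pow_two])).const_smul (-2)).pexp
  have h2 := (h galilean_limit_B3 galilean_limit_T3).mul (h galilean_limit_B2 galilean_limit_T2)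
  have hK := galilean_mem_K
  have hP := galilean_mem_P
  rw [galilean_pexp_mul
    (Submodule.smul_mem _ _ (mem_tensSpan (Submodule.smul_mem _ _ (add_mem (hK 1) (hK 2)))
      (Submodule.smul_mem _ _ (add_mem (hP 1) (hP 2)))))
    (Submodule.smul_mem _ _ (mem_tensSpan (Submodule.smul_mem _ _ (sub_mem (hK 1) (hK 2)))
      (Submodule.smul_mem _ _ (sub_mem (hP 1) (hP 2)))))] at h2
  change ContractsTo₂ speedSpace 2 (fun _ => PhiE)
    (pexp ((-1 : ℝ) • (z * tens (c (.K 1)) (c (.P 1)))) *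
      pexp ((-1 : ℝ) • (z * tens (c (.K 2)) (c (.P 2)))))
  rw [galilean_pexp_mul (Submodule.smul_mem _ _ (mem_tensSpan (hK 1) (hP 1)))
    (Submodule.smul_mem _ _ (mem_tensSpan (hK 2) (hP 2)))]
  have hs : (-1 : ℝ) • (z * tens (c (.K 1)) (c (.P 1))) +
      (-1 : ℝ) • (z * tens (c (.K 2)) (c (.P 2))) =
      -(2 : ℝ) • (z * tens ((1 / 2 : ℝ) • (c (.K 1) + c (.K 2))) ((1 / 2 : ℝ) • (c (.P 1) + c (.P 2))))
      + -(2 : ℝ) • (z * tens ((1 / 2 : ℝ) • (c (.K 1) - c (.K 2)))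
        ((1 / 2 : ℝ) • (c (.P 1) - c (.P 2)))) := by
    simp only [smul_tens, tens_smul, add_tens, sub_tens, tens_add, tens_sub, mul_smul_comm,
      mul_add, mul_sub]
    module
  rw [hs]
  exact h2

theorem galileanTwist_eq_mul : galileanTwist =
    expTens (-(1 / 2)) (galileanGen (.K 0)) (galileanGen (.P 0)) *
      (expTens (-1) (galileanGen (.K 1)) (galileanGen (.P 1)) *
        expTens (-1) (galileanGen (.K 2)) (galileanGen (.P 2))) *
      expTens (-(1 / 2)) (galileanGen (.K 0)) (galileanGen (.P 0)) := by
  have hm : ∀ (r : ℝ) i, r • (z * tens (c (.K i)) (c (.P i))) ∈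
      tensSpan (fun i => c (.K i)) fun i => c (.P i) := fun r i =>
    Submodule.smul_mem _ _ (mem_tensSpan (galilean_mem_K i) (galilean_mem_P i))
  have he : ∀ (r : ℝ) i, expTens r (galileanGen (.K i)) (galileanGen (.P i)) =
      pexp (r • (z * tens (c (.K i)) (c (.P i)))) := fun r i => rfl
  rw [he, he, he, galilean_pexp_mul (hm _ _) (hm _ _),
    galilean_pexp_mul (hm _ _) (add_mem (hm _ _) (hm _ _)),
    galilean_pexp_mul (add_mem (hm _ _) (add_mem (hm _ _) (hm _ _))) (hm _ _), galileanTwist,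
    galileanExponent_eq, Fin.sum_univ_three, mul_add, mul_add]
  congr 1
  module

theorem galilean_limit_F : ContractsTo₂ speedSpace 2 (fun _ => F) galileanTwist := by
  rw [galileanTwist_eq_mul]
  exact (galilean_limit_PhiA.mul galilean_limit_PhiE).mul galilean_limit_PhiJ

theorem galilean_limit_wedge_JP (i j : Fin 3) :
    Lim₂ 2 (fun ε => ε ^ 2 • wedge (e (.J i)) (e (.P j))) 0 :=
  ((galilean_limit_J i).wedge (galilean_limit_P j)).vanish.congr fun ε _ => by
    rw [wedge_smul, smul_smul, pow_two]

theorem galilean_limit_wedge_KP (i : Fin 3) :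
    Lim₂ 2 (fun ε => ε ^ 2 • wedge (e (.K i)) (e (.P i))) (wedge (c (.K i)) (c (.P i))) :=
  ((galilean_limit_K i).wedge (galilean_limit_P i)).congr fun ε _ => by
    rw [smul_wedge, wedge_smul, smul_smul, pow_two]

theorem galilean_limit_wedge_DP : Lim₂ 2 (fun ε => ε ^ 2 • wedge (e .D) (e .P0)) 0 :=
  (galilean_limit_D.wedge galilean_limit_P0).vanish.vanish.congr fun ε _ => by
    rw [pow_two, ← smul_smul]

theorem galilean_limit_r : ContractsTo₂ speedSpace 2 (fun _ => r)
    (z * ∑ i, wedge (galileanGen (.K i)) (galileanGen (.P i))) := by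
  have h1 : Lim₂ 2 (fun ε => ε ^ 2 • (wedge (e .D) (e .P0) + ∑ i, wedge (e (.K i)) (e (.P i))))
      (0 + ∑ i, wedge (c (.K i)) (c (.P i))) :=
    (galilean_limit_wedge_DP.add
      (SeriesLimit.sum Finset.univ fun i _ => galilean_limit_wedge_KP i)).congr fun ε _ => by
        rw [smul_add, Finset.smul_sum]
  have h2 : Lim₂ 2 (fun ε => ε ^ 2 • (wedge (e (.J 2)) (e (.P 1)) - wedge (e (.J 1)) (e (.P 2))))
      (0 - 0) :=
    ((galilean_limit_wedge_JP 2 1).sub (galilean_limit_wedge_JP 1 2)).congr fun ε _ => by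
        rw [smul_sub]
  have h3 := h1.z_mul.add h2.z_mul
  rw [sub_zero, mul_zero, add_zero, zero_add] at h3
  exact h3

theorem galileanGen_classical (g : Gen) :
    PowerSeries.constantCoeff (galileanGen g) = gen 0 1 g := by
  rw [← PowerSeries.coeff_zero_eq_constantCoeff_apply]
  rcases g with i | i | i | i | _ | _ | _
  all_goals try exact coeff_zero_cl _
  all_goals
    rw [galileanGen, map_add, coeff_real_smul, coeff_z_mul_zero, smul_zero, add_zero]
    exact coeff_zero_cl _

theorem galilean_isQuantumContraction :
    IsQuantumContraction speedSpace 2 galileanGen galileanTwist :=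
  .of_twist isLieContraction_speedSpace galilean_limit_generators galileanGen_classical
    galilean_limit_F isTwist_galileanTwist (coeff_zero_pexp _) coeff_zero_SO42_F

end GalileanLimit

/-! ### Rearrangement of the twist of `so(4,2)` that isolates the finite combination of `σ₊` and
`σ₋`. -/

section TwistFactorization

/-- Since `b u = (u + 1) b`, moving `exp (-u ⊗ s / 2)` across `b` multiplies the other leg by `exp
(-s / 2)`. This turns the exponential of `-s / 2` there into that of `-s`. -/
theorem pexp_mul_pexp_of_weight {A : Type} [Ring A] [Algebra ℝ A] {u b s t : A⟦X⟧}
    (hu : br u b = -b) (hs : Small s) (hst : Commute s t) :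
    pexp (-(2 : ℝ) • (z * tens b (t * pexp (-(1 / 2 : ℝ) • s)))) *
        pexp (-(1 / 2 : ℝ) • tens u s) =
      pexp (-(1 / 2 : ℝ) • tens u s) * pexp (-(2 : ℝ) • (z * tens b (t * pexp (-s)))) := by
  have hs2 : Small (-(1 / 2 : ℝ) • s) := hs.smul _
  have hse : Commute s (pexp (-(1 / 2 : ℝ) • s)) :=
    pexp_commute hs2 ((Commute.refl s).smul_right _)
  have hee : pexp (-(1 / 2 : ℝ) • s) * pexp (-(1 / 2 : ℝ) • s) = pexp (-s) := by
    rw [← pexp_add hs2 hs2 (Commute.refl _)]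
    congr 1
    module
  set q := pexp (-(1 / 2 : ℝ) • s) with hq
  set f := -(1 / 2 : ℝ) • tens u s with hf
  have hfs : Small f := (tens_small_right u hs).smul _
  have hgs : Small (tens (1 : A⟦X⟧) (-(1 / 2 : ℝ) • s)) := tens_small_right 1 hs2
  have h1 : SemiconjBy (tens b (t * q)) f (f + tens 1 (-(1 / 2 : ℝ) • s)) := by
    have hbu : b * u = u * b + b := by
      rw [← sub_eq_iff_eq_add']
      simpa [br] using congrArg Neg.neg hu
    rw [SemiconjBy, hf, add_mul, mul_smul_comm, smul_mul_assoc, tens_mul_tens, tens_mul_tens,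
      tens_mul_tens, hbu, add_tens, one_mul, smul_mul_assoc, tens_smul, smul_add,
      ((hst.mul_right hse).eq).symm]
  have h2 := pexp_semiconj hfs (hfs.add hgs) h1
  rw [pexp_add hfs hgs (((tens_commute (Commute.one_right u)
    ((Commute.refl s).smul_right _))).smul_left _), pexp_one_tens, ← hq] at h2
  have h3 : SemiconjBy (pexp f) (tens b (t * pexp (-s))) (tens b (t * q)) := by
    rw [SemiconjBy, h2.eq, mul_assoc (pexp f), tens_mul_tens, one_mul, ← hee, ← mul_assoc t,
      ← mul_assoc q, ((pexp_commute hs2 (hst.symm.smul_right (-(1 / 2 : ℝ)))).eq), ← hq]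
  have h4 : SemiconjBy (pexp f) (-(2 : ℝ) • (z * tens b (t * pexp (-s))))
      (-(2 : ℝ) • (z * tens b (t * q))) := by
    have := SemiconjBy.mul_right (z_commute (pexp f)).symm h3
    rw [SemiconjBy, mul_smul_comm, smul_mul_assoc, this.eq]
  exact (pexp_semiconj ((small_z_mul _).smul _) ((small_z_mul _).smul _) h4).eq.symm

namespace SO42

theorem commute_Tm {x : (U 1 1)⟦X⟧} (h0 : Commute x (e .P0)) (h : ∀ i, Commute x (e (.P i))) :
    Commute x Tm := (h0.sub_right (h 0)).smul_right _

theorem commute_T2 {x : (U 1 1)⟦X⟧} (h : ∀ i, Commute x (e (.P i))) :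
    Commute x T2 := ((h 1).sub_right (h 2)).smul_right _

theorem commute_T3 {x : (U 1 1)⟦X⟧} (h : ∀ i, Commute x (e (.P i))) :
    Commute x T3 := ((h 1).add_right (h 2)).smul_right _

theorem small_sigmaM : Small sigmaM := plogOneSub_small _

theorem small_sigmaP : Small sigmaP := plogOneSub_small _

theorem commute_z_smul {A : Type} [Ring A] [Algebra ℝ A] {x y : A⟦X⟧} (r : ℝ) (h : Commute x y) :
    Commute x (r • (z * y)) := ((z_commute x).symm.mul_right h).smul_right _

theorem commute_sigmaM {x : (U 1 1)⟦X⟧} (h0 : Commute x (e .P0))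
    (h : ∀ i, Commute x (e (.P i))) : Commute x sigmaM :=
  plogOneSub_commute ((small_z_mul _).smul _) (commute_z_smul 2 (commute_Tm h0 h))

theorem commute_T {x : (U 1 1)⟦X⟧} (h0 : Commute x (e .P0))
    (h : ∀ i, Commute x (e (.P i))) : Commute x T :=
  ((h0.add_right (h 0)).smul_right _).add_right ((z_commute x).symm.mul_right
    ((((commute_T2 h).pow_right 2).add_right ((commute_T3 h).pow_right 2)).mul_right
      (pexp_commute small_sigmaM.neg (commute_sigmaM h0 h).neg_right)))

theorem commute_sigmaP {x : (U 1 1)⟦X⟧} (h0 : Commute x (e .P0))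
    (h : ∀ i, Commute x (e (.P i))) : Commute x sigmaP :=
  plogOneSub_commute ((small_z_mul _).smul _) (commute_z_smul 2 (commute_T h0 h))

theorem commute_P_P (i j : Fin 3) : Commute (e (.P i)) (e (.P j)) := br_eq_zero_iff.1 (cl_PP ..)

theorem commute_P_P0 (i : Fin 3) : Commute (e (.P i)) (e .P0) := br_eq_zero_iff.1 (cl_PP0 ..)

theorem commute_P_sigmaM (i : Fin 3) : Commute (e (.P i)) sigmaM :=
  commute_sigmaM (commute_P_P0 i) (commute_P_P i)

theorem commute_P0_sigmaM : Commute (e .P0) sigmaM :=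
  commute_sigmaM (Commute.refl _) fun i => (commute_P_P0 i).symm

theorem commute_sigmaP_sigmaM : Commute sigmaP sigmaM :=
  (commute_sigmaP commute_P0_sigmaM.symm fun i => (commute_P_sigmaM i).symm).symm

theorem br_K_J2 : br (e (.K 0)) (e (.J 2)) = -e (.K 1) := by
  rw [br_swap]
  refine (congrArg _ (cl_JK 1 1 2 0)).trans ?_
  simp only [Fin.sum_univ_three, eps, e, cl]
  norm_num

theorem br_K_J1 : br (e (.K 0)) (e (.J 1)) = e (.K 2) := by
  rw [br_swap]
  refine (congrArg _ (cl_JK 1 1 1 0)).trans ?_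
  simp only [Fin.sum_univ_three, eps, e, cl]
  norm_num

theorem br_K_K1 : br (e (.K 0)) (e (.K 1)) = -e (.J 2) := by
  refine (cl_KK 1 1 0 1).trans ?_
  simp only [Fin.sum_univ_three, eps, e, cl]
  norm_num

theorem br_K_K2 : br (e (.K 0)) (e (.K 2)) = e (.J 1) := by
  refine (cl_KK 1 1 0 2).trans ?_
  simp only [Fin.sum_univ_three, eps, e, cl]
  norm_num

/-- `B₂` and `B₃` are combinations of boosts and rotations chosen to be eigenvectors of `K₁` with
weight `-1`, the weight required by `pexp_mul_pexp_of_weight`. -/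
theorem br_K_B2 : br (e (.K 0)) B2 = -B2 := by
  rw [B2, br_smul, br_add, br_sub, br_add, br_K_K1, br_K_K2, br_K_J2, br_K_J1]
  module

theorem br_K_B3 : br (e (.K 0)) B3 = -B3 := by
  rw [B3, br_smul, br_sub, br_add, br_add, br_K_K1, br_K_K2, br_K_J2, br_K_J1]
  module

/-- In the speed-time contraction the terms `K₁ ⊗ σ₊` and `K₁ ⊗ σ₋` are separately of order `ε⁻¹`.
Splitting `H₊` and `H₋` into dilation and boost and carrying the boost part of `Φ_J` leftwards
through `Φ_E` brings them together as `K₁ ⊗ (σ₊ - σ₋)`. -/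
theorem F_eq : F = pexp ((1 / 2 : ℝ) • tens (e .D) sigmaP) *
    (pexp ((1 / 2 : ℝ) • tens (e (.K 0)) (sigmaP - sigmaM)) *
      (pexp (-(2 : ℝ) • (z * tens B3 (T3 * pexp (-sigmaM)))) *
        pexp (-(2 : ℝ) • (z * tens B2 (T2 * pexp (-sigmaM)))))) *
    pexp ((1 / 2 : ℝ) • tens (e .D) sigmaM) := by
  have hKD : Commute (e (.K 0)) (e .D) := br_eq_zero_iff.1 (cl_KD 1 1 0)
  have hA : PhiA = pexp ((1 / 2 : ℝ) • tens (e .D) sigmaP) *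
      pexp ((1 / 2 : ℝ) • tens (e (.K 0)) sigmaP) := by
    rw [PhiA, Hp, smul_tens, add_tens, smul_add]
    exact pexp_add ((tens_small_right _ small_sigmaP).smul _)
      ((tens_small_right _ small_sigmaP).smul _)
      (((tens_commute hKD.symm (Commute.refl _)).smul_left _).smul_right _)
  have hJ : PhiJ = pexp (-(1 / 2 : ℝ) • tens (e (.K 0)) sigmaM) *
      pexp ((1 / 2 : ℝ) • tens (e .D) sigmaM) := by
    rw [← pexp_add ((tens_small_right _ small_sigmaM).smul _)
      ((tens_small_right _ small_sigmaM).smul _)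
      (((tens_commute hKD (Commute.refl _)).smul_left _).smul_right _), PhiJ, Hm, smul_tens,
      sub_tens]
    congr 1
    module
  have hK : pexp ((1 / 2 : ℝ) • tens (e (.K 0)) sigmaP) *
      pexp (-(1 / 2 : ℝ) • tens (e (.K 0)) sigmaM) =
      pexp ((1 / 2 : ℝ) • tens (e (.K 0)) (sigmaP - sigmaM)) := by
    rw [← pexp_add ((tens_small_right _ small_sigmaP).smul _)
      ((tens_small_right _ small_sigmaM).smul _)
      (((tens_commute (Commute.refl _) commute_sigmaP_sigmaM).smul_left _).smul_right _), tens_sub]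
    congr 1
    module
  have h3 := pexp_mul_pexp_of_weight br_K_B3 small_sigmaM
    (commute_T3 fun i => (commute_P_sigmaM i).symm)
  have h2 := pexp_mul_pexp_of_weight br_K_B2 small_sigmaM
    (commute_T2 fun i => (commute_P_sigmaM i).symm)
  rw [F, hA, hJ, PhiE, ← hK]
  simp only [mul_assoc]
  rw [← mul_assoc _ _ (pexp ((1 / 2 : ℝ) • tens (e .D) sigmaM)), h2]
  simp only [mul_assoc]
  rw [← mul_assoc _ _ (_ * pexp ((1 / 2 : ℝ) • tens (e .D) sigmaM)), h3]
  simp only [mul_assoc]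

end SO42

end TwistFactorization

/-! ### The speed-time contraction: generators, twist and classical `r`-matrix. -/

section CarrollLimit

local notation "c" => cl 1 0
local notation "E" => carrollE
local notation "Y" => carrollGen
local notation "Lim" => SeriesLimit (evalScaled speedTime) (evalLimit 1 0)
local notation "Lim₂" => SeriesLimit
  (fun ε => Algebra.TensorProduct.map (evalScaled speedTime ε) (evalScaled speedTime ε))
  (Algebra.TensorProduct.map (evalLimit 1 0) (evalLimit 1 0))

open SO42

theorem carroll_limit_P0 : Lim 1 (fun ε => ε • e .P0) (c .P0) := gen_limit_one rfl
theorem carroll_limit_K (i : Fin 3) : Lim 1 (fun ε => ε • e (.K i)) (c (.K i)) := gen_limit_one rfl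
theorem carroll_limit_C0 : Lim 1 (fun ε => ε • e .C0) (c .C0) := gen_limit_one rfl
theorem carroll_limit_P (i : Fin 3) : Lim 1 (fun _ => e (.P i)) (c (.P i)) := gen_limit_zero rfl
theorem carroll_limit_C (i : Fin 3) : Lim 1 (fun _ => e (.C i)) (c (.C i)) := gen_limit_zero rfl
theorem carroll_limit_J (i : Fin 3) : Lim 1 (fun _ => e (.J i)) (c (.J i)) := gen_limit_zero rfl
theorem carroll_limit_D : Lim 1 (fun _ => e .D) (c .D) := gen_limit_zero rfl

theorem SeriesLimit.z_mul_one {W V V₀ : Type} [Ring W] [Algebra ℝ W] [Ring V] [Algebra ℝ V]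
    [Ring V₀] [Algebra ℝ V₀] {φ : ℝ → W →ₐ[ℝ] V} {φ₀ : W →ₐ[ℝ] V₀} {x : ℝ → V⟦X⟧} {y : V₀⟦X⟧}
    (h : SeriesLimit φ φ₀ 1 (fun ε => ε • x ε) y) :
    SeriesLimit φ φ₀ 1 (fun ε => z * x ε) (z * y) :=
  SeriesLimit.z_mul (by simpa only [pow_one] using h)

theorem carroll_limit_Tm : Lim 1 (fun ε => ε • Tm) ((1 / 2 : ℝ) • c .P0) := by
  have h := (carroll_limit_P0.sub (carroll_limit_P 0).vanish).const_smul (1 / 2)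
  rw [sub_zero] at h
  exact h.congr fun ε _ => by rw [Tm, smul_comm, smul_sub]

theorem carroll_limit_Tp : Lim 1 (fun ε => ε • Tp) ((1 / 2 : ℝ) • c .P0) := by
  have h := (carroll_limit_P0.add (carroll_limit_P 0).vanish).const_smul (1 / 2)
  rw [add_zero] at h
  exact h.congr fun ε _ => by rw [Tp, smul_comm, smul_add]

theorem carroll_limit_T2 : Lim 1 (fun _ => T2) ((1 / 2 : ℝ) • (c (.P 1) - c (.P 2))) :=
  ((carroll_limit_P 1).sub (carroll_limit_P 2)).const_smul (1 / 2)

theorem carroll_limit_T3 : Lim 1 (fun _ => T3) ((1 / 2 : ℝ) • (c (.P 1) + c (.P 2))) :=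
  ((carroll_limit_P 1).add (carroll_limit_P 2)).const_smul (1 / 2)

theorem two_smul_z_mul_half {A : Type} [Ring A] [Algebra ℝ A] (x : A⟦X⟧) :
    (2 : ℝ) • (z * ((1 / 2 : ℝ) • x)) = z * x := by
  rw [mul_smul_comm, smul_smul]; norm_num

theorem carroll_limit_two_Tm : Lim 1 (fun _ => (2 : ℝ) • (z * Tm)) (z * c .P0) := by
  have h := carroll_limit_Tm.z_mul_one.const_smul 2
  rwa [two_smul_z_mul_half] at h

theorem carroll_limit_sigmaM : Lim 1 (fun _ => sigmaM) (-carrollLog) := by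
  have h := carroll_limit_two_Tm.plogOneSub
  rwa [← neg_neg (plogOneSub (z * c .P0))] at h

theorem carroll_limit_pexp_sigmaM : Lim 1 (fun _ => pexp (-sigmaM)) E := by
  have h := carroll_limit_sigmaM.neg.pexp
  rwa [neg_neg, pexp_carrollLog] at h

/-- Space translations are not rescaled here, so the factor `ε` supplied by `z` is left over and the
quadratic part of `T` disappears. -/
theorem carroll_limit_z_mul_sq :
    Lim 1 (fun _ => z * ((T2 ^ 2 + T3 ^ 2) * pexp (-sigmaM))) 0 := by
  have h := (((carroll_limit_T2.pow 2).add (carroll_limit_T3.pow 2)).mul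
    carroll_limit_pexp_sigmaM).vanish.z_mul_one
  rwa [mul_zero] at h

theorem carroll_limit_T : Lim 1 (fun ε => ε • T) ((1 / 2 : ℝ) • c .P0) := by
  have h := carroll_limit_Tp.add carroll_limit_z_mul_sq.vanish
  rw [add_zero] at h
  exact h.congr fun ε _ => by rw [T, smul_add]

theorem carroll_limit_two_T : Lim 1 (fun _ => (2 : ℝ) • (z * T)) (z * c .P0) := by
  have h := carroll_limit_T.z_mul_one.const_smul 2
  rwa [two_smul_z_mul_half] at h

theorem carroll_limit_sigmaP : Lim 1 (fun _ => sigmaP) (-carrollLog) := by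
  have h := carroll_limit_two_T.plogOneSub
  rwa [← neg_neg (plogOneSub (z * c .P0))] at h

/-- The arguments of the two logarithms have the common limit `z P₀` and differ by `2 z (T - T₋)`,
with `T - T₋` tending to `P₁`. Differentiating the logarithm gives `-2 z P₁ (1 - z P₀)⁻¹`, and the
inverse factor is the one in the deformed `P₁`. -/
theorem carroll_limit_sigma_sub :
    Lim 1 (fun ε => ε⁻¹ • (sigmaP - sigmaM)) (-(2 : ℝ) • (z * Y (.P 0))) := by
  have h1 : Lim 1 (fun _ => T - Tm) (c (.P 0)) := by
    have h := (carroll_limit_P 0).add carroll_limit_z_mul_sq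
    rw [add_zero] at h
    exact h.congr fun ε _ => by rw [T, Tp, Tm]; module
  have h2 : Lim 1 (fun ε => ε⁻¹ • ((2 : ℝ) • (z * T) - (2 : ℝ) • (z * Tm)))
      ((2 : ℝ) • (z * c (.P 0))) := by
    have h3 : Lim 1 (fun ε => z * (ε⁻¹ • (T - Tm))) (z * c (.P 0)) :=
      SeriesLimit.z_mul_one (h1.congr fun ε hε => by rw [smul_smul, mul_inv_cancel₀ hε, one_smul])
    exact (h3.const_smul 2).congr fun ε _ => by
      rw [← smul_sub, ← mul_sub, mul_smul_comm, smul_comm]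
  have h3 := carroll_limit_two_T.plogOneSub_sub carroll_limit_two_Tm h2
    (((z_commute _).mul_left ((z_commute _).symm.mul_right
      (br_eq_zero_iff.1 (cl_PP0 1 0 0)).symm)).smul_right _) ((small_z_mul _).smul _)
    (small_z_mul _)
  have h4 : -((2 : ℝ) • (z * c (.P 0)) * pgeom (z * c .P0)) = -(2 : ℝ) • (z * Y (.P 0)) := by
    rw [smul_mul_assoc, mul_assoc, ← neg_smul]; rfl
  rwa [h4] at h3

theorem carroll_limit_generators (g : Gen) :
    Lim 1 (fun ε => ε ^ speedTime g • qgen g) (Y g) := by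
  rcases g with i | i | i | i | _ | _ | _
  · exact gen_limit (.J i)
  · exact gen_limit (.K i)
  · simp only [speedTime, pow_zero, one_smul]
    fin_cases i
    · have h := carroll_limit_sigma_sub.divZ.const_smul (-(1 / 2))
      have hy : -(1 / 2 : ℝ) • divZ (-(2 : ℝ) • (z * Y (.P 0))) = Y (.P 0) := by
        rw [← mul_smul_comm, divZ_z_mul]
        module
      rw [hy] at h
      refine h.congr fun ε hε => ?_
      change -(1 / 2 : ℝ) • divZ (sigmaP - sigmaM) = _
      ext n
      simp only [coeff_real_smul, divZ, PowerSeries.coeff_mk, pow_one]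
      rw [smul_smul ε, mul_inv_cancel₀ hε, one_smul]
    · have h := (carroll_limit_T3.add carroll_limit_T2).mul carroll_limit_pexp_sigmaM
      have hy : ((1 / 2 : ℝ) • (c (.P 1) + c (.P 2)) + (1 / 2 : ℝ) • (c (.P 1) - c (.P 2))) * E =
          Y (.P 1) := by
        rw [carrollGen]; congr 1; module
      rwa [hy] at h
    · have h := (carroll_limit_T3.sub carroll_limit_T2).mul carroll_limit_pexp_sigmaM
      have hy : ((1 / 2 : ℝ) • (c (.P 1) + c (.P 2)) - (1 / 2 : ℝ) • (c (.P 1) - c (.P 2))) * E =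
          Y (.P 2) := by
        rw [carrollGen]; congr 1; module
      rwa [hy] at h
  · have h : Lim 1 (fun ε => z * (e (.K i) * e .D)) (z * (c (.K i) * c .D)) :=
      SeriesLimit.z_mul_one (((carroll_limit_K i).mul carroll_limit_D).congr
        fun ε _ => by rw [smul_mul_assoc])
    exact ((carroll_limit_C i).sub h).congr fun ε _ => one_smul ℝ _
  · have h := ((carroll_limit_sigmaP.add carroll_limit_sigmaM).divZ).const_smul (-(1 / 2))
    have hy : -(1 / 2 : ℝ) • divZ (-carrollLog + -carrollLog) = Y .P0 := by
      ext n
      simp only [carrollGen, coeff_real_smul, divZ, PowerSeries.coeff_mk, map_add, map_neg]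
      module
    rw [hy] at h
    refine h.congr fun ε _ => ?_
    rw [qgen, smul_comm]; rfl
  · have h : Lim 1 (fun ε => z * (ε • ∑ i, e (.K i) ^ 2)) (z * ∑ i, c (.K i) ^ 2) :=
      SeriesLimit.z_mul_one ((SeriesLimit.sum Finset.univ fun i _ =>
        (carroll_limit_K i).pow 2).congr fun ε _ => by
          simp only [smul_pow, Finset.smul_sum, smul_smul, ← pow_two])
    refine (carroll_limit_C0.add (h.const_smul (1 / 2))).congr fun ε _ => ?_
    simp only [speedTime, pow_one]
    rw [qgen, smul_add, mul_smul_comm, smul_comm ε (1 / 2 : ℝ)]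
  · exact gen_limit .D

theorem carroll_limit_B2 : Lim 1 (fun ε => ε • B2) ((1 / 2 : ℝ) • (c (.K 1) - c (.K 2))) := by
  have h := ((((carroll_limit_K 1).add (carroll_limit_J 2).vanish).sub
    (carroll_limit_K 2)).add (carroll_limit_J 1).vanish).const_smul (1 / 2)
  rw [add_zero, add_zero] at h
  exact h.congr fun ε _ => by rw [B2]; module

theorem carroll_limit_B3 : Lim 1 (fun ε => ε • B3) ((1 / 2 : ℝ) • (c (.K 1) + c (.K 2))) := by
  have h := ((((carroll_limit_K 1).add (carroll_limit_J 2).vanish).add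
    (carroll_limit_K 2)).sub (carroll_limit_J 1).vanish).const_smul (1 / 2)
  rw [add_zero, sub_zero] at h
  exact h.congr fun ε _ => by rw [B3]; module

theorem carroll_limit_pexp_D {s : (U 1 1)⟦X⟧} (h : Lim 1 (fun _ => s) (-carrollLog)) :
    Lim₂ 1 (fun _ => pexp ((1 / 2 : ℝ) • tens (e .D) s))
      (pexp (-(1 / 2 : ℝ) • (z * tens (Y .D) (Y .P0)))) := by
  have h1 := ((carroll_limit_D.tens h).const_smul (1 / 2)).pexp
  rwa [tens_neg, ← z_mul_carrollGen_P0, tens_z_mul, smul_neg, ← neg_smul] at h1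

/-- The `ε⁻¹` hidden in `K₁` is balanced by the first-order smallness of `σ₊ - σ₋`. -/
theorem carroll_limit_pexp_K :
    Lim₂ 1 (fun _ => pexp ((1 / 2 : ℝ) • tens (e (.K 0)) (sigmaP - sigmaM)))
      (pexp (-(1 : ℝ) • (z * tens (Y (.K 0)) (Y (.P 0))))) := by
  have h := (((carroll_limit_K 0).tens carroll_limit_sigma_sub).const_smul (1 / 2)).pexp
  have hy : (1 / 2 : ℝ) • tens (c (.K 0)) (-(2 : ℝ) • (z * Y (.P 0))) =
      -(1 : ℝ) • (z * tens (Y (.K 0)) (Y (.P 0))) := by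
    rw [tens_smul, tens_z_mul, smul_smul]
    norm_num
    rfl
  rw [hy] at h
  refine h.congr fun ε hε => ?_
  rw [smul_tens, tens_smul, smul_smul ε, mul_inv_cancel₀ hε, one_smul]

theorem carroll_limit_pexp_B {B S : (U 1 1)⟦X⟧} {b s : (U 1 0)⟦X⟧} (hB : Lim 1 (fun ε => ε • B) b)
    (hS : Lim 1 (fun _ => S) s) :
    Lim₂ 1 (fun _ => pexp (-(2 : ℝ) • (z * tens B (S * pexp (-sigmaM)))))
      (pexp (-(2 : ℝ) • (z * tens b (s * E)))) :=
  ((SeriesLimit.z_mul_one ((hB.tens (hS.mul carroll_limit_pexp_sigmaM)).congr fun ε _ => by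
    rw [smul_tens])).const_smul (-2)).pexp

/-- The left legs `D, K₁, K₂, K₃` of the Carroll twisting element. -/
def carrollLeft (o : Option (Fin 3)) : (U 1 0)⟦X⟧ := o.elim (Y .D) fun i => Y (.K i)

/-- The right legs `P₀, P₁, P₂, P₃` of the Carroll twisting element. -/
def carrollRight (o : Option (Fin 3)) : (U 1 0)⟦X⟧ := o.elim (Y .P0) fun i => Y (.P i)

theorem carroll_pexp_mul {x y : (U 1 0 ⊗[ℝ] U 1 0)⟦X⟧} (hx : x ∈ tensSpan carrollLeft carrollRight)
    (hy : y ∈ tensSpan carrollLeft carrollRight) : pexp x * pexp y = pexp (x + y) := by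
  refine pexp_mul_pexp_of_tensSpan ?_ ?_ hx hy
  · rintro (_ | i) (_ | j)
    · exact Commute.refl _
    · exact (br_eq_zero_iff.1 (carrollGen_relations.KD j)).symm
    · exact br_eq_zero_iff.1 (carrollGen_relations.KD i)
    · exact br_eq_zero_iff.1 (carrollGen_relations.KK i j)
  · rintro (_ | i) (_ | j)
    · exact Commute.refl _
    · exact (br_eq_zero_iff.1 (carrollGen_relations.PP0 j)).symm
    · exact br_eq_zero_iff.1 (carrollGen_relations.PP0 i)
    · exact br_eq_zero_iff.1 (carrollGen_relations.PP i j)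

theorem carroll_mem_left (o : Option (Fin 3)) :
    carrollLeft o ∈ Submodule.span ℝ (Set.range carrollLeft) := Submodule.subset_span ⟨o, rfl⟩

theorem carroll_mem_right (o : Option (Fin 3)) :
    carrollRight o ∈ Submodule.span ℝ (Set.range carrollRight) := Submodule.subset_span ⟨o, rfl⟩

/-- All exponents lie in one commuting span, so the two dilation halves recombine and the sums and
differences of directions two and three polarise to the diagonal form. -/
theorem carrollTwist_eq_mul : carrollTwist =
    pexp (-(1 / 2 : ℝ) • (z * tens (Y .D) (Y .P0))) *
      (pexp (-(1 : ℝ) • (z * tens (Y (.K 0)) (Y (.P 0)))) *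
        (pexp (-(2 : ℝ) • (z * tens ((1 / 2 : ℝ) • (c (.K 1) + c (.K 2)))
            ((1 / 2 : ℝ) • (c (.P 1) + c (.P 2)) * E))) *
          pexp (-(2 : ℝ) • (z * tens ((1 / 2 : ℝ) • (c (.K 1) - c (.K 2)))
            ((1 / 2 : ℝ) • (c (.P 1) - c (.P 2)) * E))))) *
      pexp (-(1 / 2 : ℝ) • (z * tens (Y .D) (Y .P0))) := by
  have hK : ∀ i, Y (.K i) ∈ Submodule.span ℝ (Set.range carrollLeft) :=
    fun i => carroll_mem_left (some i)
  have hP : ∀ i, Y (.P i) ∈ Submodule.span ℝ (Set.range carrollRight) :=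
    fun i => carroll_mem_right (some i)
  have h : ∀ (r : ℝ) {u v : (U 1 0)⟦X⟧}, u ∈ Submodule.span ℝ (Set.range carrollLeft) →
      v ∈ Submodule.span ℝ (Set.range carrollRight) →
      r • (z * tens u v) ∈ tensSpan carrollLeft carrollRight := fun r u v hu hv =>
    Submodule.smul_mem _ _ (mem_tensSpan hu hv)
  have hD : -(1 / 2 : ℝ) • (z * tens (Y .D) (Y .P0)) ∈ tensSpan carrollLeft carrollRight :=
    h _ (carroll_mem_left none) (carroll_mem_right none)
  have h0 : -(1 : ℝ) • (z * tens (Y (.K 0)) (Y (.P 0))) ∈ tensSpan carrollLeft carrollRight :=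
    h _ (hK 0) (hP 0)
  have e3 : (1 / 2 : ℝ) • (c (.P 1) + c (.P 2)) * E = (1 / 2 : ℝ) • (Y (.P 1) + Y (.P 2)) := by
    rw [smul_mul_assoc, add_mul]; rfl
  have e2 : (1 / 2 : ℝ) • (c (.P 1) - c (.P 2)) * E = (1 / 2 : ℝ) • (Y (.P 1) - Y (.P 2)) := by
    rw [smul_mul_assoc, sub_mul]; rfl
  have h3 : -(2 : ℝ) • (z * tens ((1 / 2 : ℝ) • (c (.K 1) + c (.K 2)))
      ((1 / 2 : ℝ) • (Y (.P 1) + Y (.P 2)))) ∈ tensSpan carrollLeft carrollRight :=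
    h _ (Submodule.smul_mem _ _ (add_mem (hK 1) (hK 2)))
      (Submodule.smul_mem _ _ (add_mem (hP 1) (hP 2)))
  have h2 : -(2 : ℝ) • (z * tens ((1 / 2 : ℝ) • (c (.K 1) - c (.K 2)))
      ((1 / 2 : ℝ) • (Y (.P 1) - Y (.P 2)))) ∈ tensSpan carrollLeft carrollRight :=
    h _ (Submodule.smul_mem _ _ (sub_mem (hK 1) (hK 2)))
      (Submodule.smul_mem _ _ (sub_mem (hP 1) (hP 2)))
  have hk : carrollExponentK ∈ tensSpan carrollLeft carrollRight := by
    rw [carrollExponentK, Finset.mul_sum]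
    exact neg_mem (sum_mem fun i _ => mem_tensSpan (hK i) (hP i))
  have hd' : carrollExponentD = -(1 : ℝ) • (z * tens (Y .D) (Y .P0)) := by
    rw [carrollExponentD, ← z_mul_carrollGen_P0, tens_z_mul, neg_one_smul]; rfl
  have hd : carrollExponentD ∈ tensSpan carrollLeft carrollRight :=
    hd' ▸ h _ (carroll_mem_left none) (carroll_mem_right none)
  rw [e3, e2, carroll_pexp_mul h3 h2, carroll_pexp_mul h0 (add_mem h3 h2),
    carroll_pexp_mul hD (add_mem h0 (add_mem h3 h2)),
    carroll_pexp_mul (add_mem hD (add_mem h0 (add_mem h3 h2))) hD, carrollTwist,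
    carroll_pexp_mul hk hd, hd', carrollExponentK, Fin.sum_univ_three]
  congr 1
  simp only [smul_tens, tens_smul, add_tens, sub_tens, tens_add, tens_sub, mul_smul_comm,
    mul_add, mul_sub]
  change -(z * tens (c (.K 0)) (Y (.P 0)) + z * tens (c (.K 1)) (Y (.P 1)) +
    z * tens (c (.K 2)) (Y (.P 2))) + _ = _ + (-(1 : ℝ) • (z * tens (c (.K 0)) (Y (.P 0))) + _) + _
  module

theorem carroll_limit_F : ContractsTo₂ speedTime 1 (fun _ => F) carrollTwist := by
  rw [carrollTwist_eq_mul, F_eq]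
  exact ((carroll_limit_pexp_D carroll_limit_sigmaP).mul (carroll_limit_pexp_K.mul
    ((carroll_limit_pexp_B carroll_limit_B3 carroll_limit_T3).mul
      (carroll_limit_pexp_B carroll_limit_B2 carroll_limit_T2)))).mul
    (carroll_limit_pexp_D carroll_limit_sigmaM)

theorem carroll_limit_r : ContractsTo₂ speedTime 1 (fun _ => r)
    (z * (wedge (c .D) (c .P0) + ∑ i, wedge (c (.K i)) (c (.P i)))) := by
  have hKP : ∀ i, Lim₂ 1 (fun ε => ε • wedge (e (.K i)) (e (.P i)))
      (wedge (c (.K i)) (c (.P i))) := fun i =>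
    ((carroll_limit_K i).wedge (carroll_limit_P i)).congr fun ε _ => by rw [smul_wedge]
  have hDP : Lim₂ 1 (fun ε => ε • wedge (e .D) (e .P0)) (wedge (c .D) (c .P0)) :=
    (carroll_limit_D.wedge carroll_limit_P0).congr fun ε _ => by rw [wedge_smul]
  have hJP : ∀ i j, Lim₂ 1 (fun ε => ε • wedge (e (.J i)) (e (.P j))) 0 := fun i j =>
    ((carroll_limit_J i).wedge (carroll_limit_P j)).vanish
  have h1 : Lim₂ 1 (fun ε => ε • (wedge (e .D) (e .P0) + ∑ i, wedge (e (.K i)) (e (.P i))))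
      (wedge (c .D) (c .P0) + ∑ i, wedge (c (.K i)) (c (.P i))) :=
    (hDP.add (SeriesLimit.sum Finset.univ fun i _ => hKP i)).congr fun ε _ => by
      rw [smul_add, Finset.smul_sum]
  have h2 : Lim₂ 1 (fun ε => ε • (wedge (e (.J 2)) (e (.P 1)) - wedge (e (.J 1)) (e (.P 2))))
      (0 - 0) := ((hJP 2 1).sub (hJP 1 2)).congr fun ε _ => by rw [smul_sub]
  have h3 := h1.z_mul_one.add h2.z_mul_one
  rw [sub_zero, mul_zero, add_zero] at h3
  exact h3

theorem carroll_isQuantumContraction :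
    IsQuantumContraction speedTime 1 carrollGen carrollTwist :=
  .of_twist isLieContraction_speedTime carroll_limit_generators carrollGen_classical
    carroll_limit_F isTwist_carrollTwist coeff_zero_carrollTwist coeff_zero_SO42_F

end CarrollLimit

end TwistedConformal

end

open TwistedConformal in
theorem mainTheorem3 :
    (∃ (Y : Gen → (U 0 1)⟦X⟧) (F₀ : (U 0 1 ⊗[ℝ] U 0 1)⟦X⟧),
      IsQuantumContraction speedSpace 2 Y F₀ ∧
      GalileanRelations Y ∧
      GalileanCoproduct (twComul F₀) Y ∧
      ContractsTo₂ speedSpace 2 (fun _ => SO42.r)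
        (z * ∑ i, wedge (Y (.K i)) (Y (.P i))) ∧
      ContractsTo₂ speedSpace 2 (fun _ => SO42.PhiJ) (expTens (-(1 / 2)) (Y (.K 0)) (Y (.P 0))) ∧
      ContractsTo₂ speedSpace 2 (fun _ => SO42.PhiA) (expTens (-(1 / 2)) (Y (.K 0)) (Y (.P 0))) ∧
      ContractsTo₂ speedSpace 2 (fun _ => SO42.PhiE)
        (expTens (-1) (Y (.K 1)) (Y (.P 1)) * expTens (-1) (Y (.K 2)) (Y (.P 2))) ∧
      F₀ = expTens (-1) (Y (.K 2)) (Y (.P 2)) * expTens (-1) (Y (.K 1)) (Y (.P 1)) *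
        expTens (-1) (Y (.K 0)) (Y (.P 0)) ∧
      rMatrix F₀ = pexp (z * ∑ i, wedge (Y (.K i)) (Y (.P i))) ∧
      rMatrix F₀ = pexp (z * wedge (Y (.K 0)) (Y (.P 0))) *
        pexp (z * wedge (Y (.K 1)) (Y (.P 1))) * pexp (z * wedge (Y (.K 2)) (Y (.P 2))) ∧
      IsHopfSubalgebra (twComul F₀) (twAntipode F₀) (Y '' kinematical) ∧
      IsHopfSubalgebra (twComul F₀) (twAntipode F₀) (Y '' weyl)) ∧
    (∃ (Y : Gen → (U 1 0)⟦X⟧) (F₀ : (U 1 0 ⊗[ℝ] U 1 0)⟦X⟧),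
      IsQuantumContraction speedTime 1 Y F₀ ∧
      CarrollRelations Y (pexp (z * Y .P0)) ∧
      CarrollCoproduct (twComul F₀) Y (pexp (z * Y .P0)) ∧
      ContractsTo₂ speedTime 1 (fun _ => SO42.r)
        (z * (wedge (PowerSeries.C (gen 1 0 .D)) (PowerSeries.C (gen 1 0 .P0)) +
          ∑ i, wedge (PowerSeries.C (gen 1 0 (.K i))) (PowerSeries.C (gen 1 0 (.P i))))) ∧
      PowerSeries.coeff 1 (rMatrix F₀) = PowerSeries.coeff 1
        (z * (wedge (PowerSeries.C (gen 1 0 .D)) (PowerSeries.C (gen 1 0 .P0)) +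
          ∑ i, wedge (PowerSeries.C (gen 1 0 (.K i))) (PowerSeries.C (gen 1 0 (.P i)))) :
          (U 1 0 ⊗[ℝ] U 1 0)⟦X⟧) ∧
      F₀ = expTens (-1) (Y (.K 2)) (Y (.P 2)) * expTens (-1) (Y (.K 1)) (Y (.P 1)) *
        expTens (-1) (Y (.K 0)) (Y (.P 0)) * expTens (-1) (Y .D) (Y .P0) ∧
      rMatrix F₀ = expTens (-1) (Y (.P 2)) (Y (.K 2)) * expTens (-1) (Y (.P 1)) (Y (.K 1)) *
        expTens (-1) (Y (.P 0)) (Y (.K 0)) * expTens (-1) (Y .P0) (Y .D) *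
        expTens 1 (Y .D) (Y .P0) * expTens 1 (Y (.K 0)) (Y (.P 0)) *
        expTens 1 (Y (.K 1)) (Y (.P 1)) * expTens 1 (Y (.K 2)) (Y (.P 2)) ∧
      IsHopfSubalgebra (twComul F₀) (twAntipode F₀) (Y '' weyl)) := by
  refine ⟨⟨galileanGen, galileanTwist, galilean_isQuantumContraction, galileanGen_relations,
    galileanGen_coproduct, galilean_limit_r, galilean_limit_PhiJ, galilean_limit_PhiA,
    galilean_limit_PhiE, galileanTwist_eq, rMatrix_galileanTwist, rMatrix_galileanTwist_eq_mul,
    galilean_isHopfSubalgebra subset_rfl (Set.subset_insert _ _),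
    galilean_isHopfSubalgebra (Set.subset_insert _ _) subset_rfl⟩,
    ⟨carrollGen, carrollTwist, carroll_isQuantumContraction, ?_, ?_, carroll_limit_r,
      coeff_one_rMatrix_carrollTwist, carrollTwist_eq, rMatrix_carrollTwist,
      carroll_isHopfSubalgebra⟩⟩
  -- The exponential `exp (z P₀)` of the deformed time translation is `(1 - z P₀)⁻¹` in the
  -- classical one, the form in which the relations were proved.
  · rw [pexp_z_mul_carrollGen_P0]
    exact carrollGen_relations
  · rw [pexp_z_mul_carrollGen_P0]
    exact carrollGen_coproduct
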